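/- Let $\Omega\subset\mathbb R^2$ be a bounded open set with Lipschitz boundary. Let $A:\mathbb R^2\to\mathbb R^{2\times 2}$ be measurable, $1$-periodic, symmetric and uniformly elliptic, i.e. $A_{ij}=A_{ji}$ and $\kappa_1|\xi|^2\le A_{ij}(y)\xi_i\xi_j\le\kappa_2|\xi|^2$ for a.e. $y$ and all $\xi\in\mathbb R^2$, where $\kappa_1>0$ and repeated indices are summed; put $A^\epsilon(x)=A(x/\epsilon)$ for $\epsilon>0$. With $Q=(-\tfrac12,\tfrac12)^2$ and $H^1_\sharp(Q)$ the closure of the smooth $1$-periodic functions in $H^1(Q)$, let the corrector $N_l\in H^1_\sharp(Q)$, $l=1,2$, be the mean-zero weak solution of $-\operatorname{div}(A\nabla N_l)=\operatorname{div}(Ae_l)$ with periodic boundary conditions, and let $\hat A_{il}=\int_Q (A_{il}+A_{ij}\partial_jN_l)\,dy$ be the homogenized coefficients. Assume that $N_1,N_2\in W^{1,\infty}(Q)$ with norms at most $M$. Let $\mathcal T_h$ be a conforming partition of $\Omega$ into finitely many triangles which is regular with mesh size $h>0$: for constants $\rho,\sigma>0$, every triangle $T$, with circumradius $h_T$ and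 inradius $r_T$, satisfies $\sigma h\le h_T\le h$ and $r_T/h_T\ge\rho$. For each node $j$ let $\psi_j$ be the continuous piecewise affine nodal basis function, let the multiscale basis function $\Phi_j\in H^1(\Omega)$ be given in each $T\in\mathcal T_h$ by $-\operatorname{div}(A^\epsilon\nabla\Phi_j)=0$ in $T$ and $\Phi_j=\psi_j$ on $\partial T$, and let $V_{\mathrm{ms}}=\operatorname{span}\{\Phi_j\}$. Let $f\in L^2(\Omega)$. (a) Mixed Dirichlet–Neumann problem. Let $\partial\Omega=\Gamma_D\cup\Gamma_N$ be a disjoint splitting such that the interior of every boundary edge of $\mathcal T_h$ lies in $\Gamma_D$ or in $\Gamma_N$, let $g\in L^2(\Gamma_N)$, and let $V=H^1_{0,\Gamma_D}(\Omega)$ be the space of functions in $H^1(\Omega)$ with zero trace on $\Gamma_D$. Let $u_\epsilon\in V$ satisfy $$\int_\Omega A^\epsilon\nabla u_\epsilon\cdot\nabla v=\int_\Omega fv+\int_{\Gamma_N}gv\qquad\text{for all }v\in V,$$ let the homogenized solution $u_0\in V$ satisfy the same with $\hat A$ in place of $A^\epsilon$, and let the MsFEM solution $u_{\epsilon,\mathrm{ms}}\in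 V_{\mathrm{ms}}\cap V$ satisfy the equation of $u_\epsilon$ for all $v\in V_{\mathrm{ms}}\cap V$. If $u_0\in H^2(\Omega)$, then $$|u_\epsilon-u_{\epsilon,\mathrm{ms}}|_{1,\Omega}\le C\Bigl(\epsilon^{1/2}+h+\sqrt{\epsilon/h}\Bigr)\|u_0\|_{2,\Omega},$$ where $C$ depends only on $\Omega,\kappa_1,\kappa_2,M,\rho,\sigma$. (b) Robin problem. Let $\alpha$ be measurable on $\partial\Omega$ with $0<\alpha_1\le\alpha\le\alpha_2$, let $g\in L^2(\partial\Omega)$, and let $u_\epsilon\in H^1(\Omega)$ satisfy $$\int_\Omega A^\epsilon\nabla u_\epsilon\cdot\nabla v+\int_{\partial\Omega}\alpha u_\epsilon v=\int_\Omega fv+\int_{\partial\Omega}gv\qquad\text{for all }v\in H^1(\Omega),$$ let $u_0\in H^1(\Omega)$ satisfy the same with $\hat A$ in place of $A^\epsilon$, and let $u_{\epsilon,\mathrm{ms}}\in V_{\mathrm{ms}}$ satisfy the equation of $u_\epsilon$ for all $v\in V_{\mathrm{ms}}$. If $u_0\in H^2(\Omega)$, then, with the energy norm $|||v|||^2=\int_\Omega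 A^\epsilon\nabla v\cdot\nabla v+\int_{\partial\Omega}\alpha v^2$, $$|||u_\epsilon-u_{\epsilon,\mathrm{ms}}|||\le C\Bigl(\epsilon^{1/2}+h+\sqrt{\epsilon/h}\Bigr)\|u_0\|_{2,\Omega},$$ where $C$ depends only on $\Omega,\kappa_1,\kappa_2,\alpha_1,\alpha_2,M,\rho,\sigma$. -/

import Mathlib

open MeasureTheory Filter Topology
open scoped ENNReal NNReal ContDiff Gradient

namespace MsFEM

noncomputable section

/-- The Euclidean plane. -/
abbrev Plane : Type := EuclideanSpace ℝ (Fin 2)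

/-! ### Domains and boundary measure -/

/-- A bounded open set which, near each boundary point and after an orthogonal change of
coordinates, is the region above the graph of a Lipschitz function. -/
def IsLipschitzDomain (Ω : Set Plane) : Prop :=
  Bornology.IsBounded Ω ∧ IsOpen Ω ∧
    ∀ x ∈ frontier Ω, ∃ (e : Plane ≃ₗᵢ[ℝ] Plane) (L : ℝ≥0) (θ : ℝ → ℝ), LipschitzWith L θ ∧
      ∀ᶠ y in 𝓝 x, (y ∈ Ω ↔ θ (e y 0) < e y 1)

/-- Arc length on a set `Γ`: the one-dimensional Hausdorff measure restricted to `Γ`. -/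
def arc (Γ : Set Plane) : Measure Plane := (Measure.hausdorffMeasure 1).restrict Γ

/-! ### Sobolev spaces -/

/-- `φ ∈ C_c^∞(U)`. -/
def IsTestFun (U : Set Plane) (φ : Plane → ℝ) : Prop :=
  ContDiff ℝ ∞ φ ∧ HasCompactSupport φ ∧ tsupport φ ⊆ U

lemma IsTestFun.memLp {U : Set Plane} {φ : Plane → ℝ} (h : IsTestFun U φ) (μ : Measure Plane)
    [IsFiniteMeasureOnCompacts μ] : MemLp φ 2 μ :=
  h.1.continuous.memLp_of_hasCompactSupport h.2.1

lemma gradient_apply (φ : Plane → ℝ) (x : Plane) (i : Fin 2) :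
    ∇ φ x i = fderiv ℝ φ x (EuclideanSpace.single i 1) := by
  rw [← inner_gradient_left, EuclideanSpace.inner_single_right]
  simp

lemma IsTestFun.memLp_partial {U : Set Plane} {φ : Plane → ℝ} (h : IsTestFun U φ)
    (μ : Measure Plane) [IsFiniteMeasureOnCompacts μ] (i : Fin 2) :
    MemLp (fun x => ∇ φ x i) 2 μ := by
  simp only [gradient_apply]
  refine Continuous.memLp_of_hasCompactSupport ?_ ?_
  · exact (h.1.continuous_fderiv (by simp)).clm_apply continuous_const
  · exact (h.2.1.fderiv (𝕜 := ℝ)).comp_left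
      (g := fun l : Plane →L[ℝ] ℝ => l (EuclideanSpace.single i 1)) rfl

lemma memLp_coord {μ : Measure Plane} (G : Lp Plane 2 μ) (i : Fin 2) :
    MemLp (fun x => G x i) 2 μ :=
  (EuclideanSpace.proj (𝕜 := ℝ) i).comp_memLp' (Lp.memLp G)

/-- The Sobolev space `H¹(Ω)`: pairs `(u, G)` of square integrable classes on `Ω` such that `G` is
the weak gradient of `u`. Its norm is `(‖u‖² + ‖G‖²)^(1/2)`. -/
def h1Submodule (Ω : Set Plane) :
    Submodule ℝ (WithLp 2
      (Lp ℝ 2 (volume.restrict Ω : Measure Plane) × Lp Plane 2 (volume.restrict Ω : Measure Plane)))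
    where
  carrier := {p | ∀ φ, IsTestFun Ω φ → ∀ i : Fin 2,
    ∫ x in Ω, p.fst x * ∇ φ x i = - ∫ x in Ω, p.snd x i * φ x}
  zero_mem' := by
    intro φ hφ i
    have h1 : ∫ x in Ω, (0 : Lp ℝ 2 (volume.restrict Ω : Measure Plane)) x * ∇ φ x i = 0 := by
      refine integral_eq_zero_of_ae ?_
      filter_upwards [Lp.coeFn_zero ℝ 2 (volume.restrict Ω : Measure Plane)] with x hx
      rw [hx]
      simp
    have h2 : ∫ x in Ω, (0 : Lp Plane 2 (volume.restrict Ω : Measure Plane)) x i * φ x = 0 := by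
      refine integral_eq_zero_of_ae ?_
      filter_upwards [Lp.coeFn_zero Plane 2 (volume.restrict Ω : Measure Plane)] with x hx
      rw [hx]
      simp
    rw [WithLp.zero_fst, WithLp.zero_snd, h1, h2, neg_zero]
  add_mem' := by
    intro p q hp hq φ hφ i
    have hp' := hp φ hφ i
    have hq' := hq φ hφ i
    have e1 : ∫ x in Ω, (p.fst + q.fst : Lp ℝ 2 (volume.restrict Ω : Measure Plane)) x * ∇ φ x i
        = (∫ x in Ω, p.fst x * ∇ φ x i) + ∫ x in Ω, q.fst x * ∇ φ x i := by
      refine Eq.trans (integral_congr_ae ?_)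
        (integral_add ((Lp.memLp p.fst).integrable_mul (hφ.memLp_partial _ i))
          ((Lp.memLp q.fst).integrable_mul (hφ.memLp_partial _ i)))
      filter_upwards [Lp.coeFn_add p.fst q.fst] with x hx
      beta_reduce
      rw [hx]
      simp [add_mul]
    have e2 : ∫ x in Ω, (p.snd + q.snd : Lp Plane 2 (volume.restrict Ω : Measure Plane)) x i * φ x
        = (∫ x in Ω, p.snd x i * φ x) + ∫ x in Ω, q.snd x i * φ x := by
      refine Eq.trans (integral_congr_ae ?_)
        (integral_add ((memLp_coord p.snd i).integrable_mul (hφ.memLp _))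
          ((memLp_coord q.snd i).integrable_mul (hφ.memLp _)))
      filter_upwards [Lp.coeFn_add p.snd q.snd] with x hx
      beta_reduce
      rw [hx]
      simp [add_mul]
    rw [WithLp.add_fst, WithLp.add_snd, e1, e2, hp', hq', neg_add]
  smul_mem' := by
    intro c p hp φ hφ i
    have hp' := hp φ hφ i
    have e1 : ∫ x in Ω, (c • p.fst : Lp ℝ 2 (volume.restrict Ω : Measure Plane)) x * ∇ φ x i
        = c * ∫ x in Ω, p.fst x * ∇ φ x i := by
      rw [← integral_const_mul]
      refine integral_congr_ae ?_
      filter_upwards [Lp.coeFn_smul c p.fst] with x hx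
      simp [hx, mul_assoc]
    have e2 : ∫ x in Ω, (c • p.snd : Lp Plane 2 (volume.restrict Ω : Measure Plane)) x i * φ x
        = c * ∫ x in Ω, p.snd x i * φ x := by
      rw [← integral_const_mul]
      refine integral_congr_ae ?_
      filter_upwards [Lp.coeFn_smul c p.snd] with x hx
      simp [hx, mul_assoc]
    rw [WithLp.smul_fst, WithLp.smul_snd, e1, e2, hp', mul_neg]

/-- The Sobolev space `H¹(Ω)` as a type. -/
abbrev H1 (Ω : Set Plane) : Type := h1Submodule Ω

variable {Ω : Set Plane}

/-- The function underlying an element of `H¹(Ω)` (relevant on `Ω`, up to null sets). -/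
def H1.fn (u : H1 Ω) : Plane → ℝ := u.1.fst

/-- The weak gradient of an element of `H¹(Ω)` (relevant on `Ω`, up to null sets). -/
def H1.grad (u : H1 Ω) : Plane → Plane := u.1.snd

/-- The seminorm `|u|_{1,Ω}`, the `L²(Ω)` norm of the weak gradient. -/
def H1.seminorm (u : H1 Ω) : ℝ := ‖u.1.snd‖

/-- The Sobolev space `H²(Ω)`: functions of `H¹(Ω)` whose first weak derivatives
are in `H¹(Ω)`. -/
structure H2 (Ω : Set Plane) where
  toH1 : H1 Ω
  /-- the first weak derivatives `∂_l u` -/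
  deriv : Fin 2 → H1 Ω
  deriv_eq : ∀ l, (deriv l).fn =ᵐ[volume.restrict Ω] fun x => toH1.grad x l

/-- The norm `‖u‖_{2,Ω}`. -/
def H2.norm (u : H2 Ω) : ℝ := √(‖u.toH1‖ ^ 2 + ∑ l, (u.deriv l).seminorm ^ 2)

/-- Convergence in `H¹(U)` of a sequence of smooth functions `φ n` to a function `u` with weak
gradient `G`. -/
def TendstoH1 (U : Set Plane) (φ : ℕ → Plane → ℝ) (u : Plane → ℝ) (G : Plane → Plane) : Prop :=
  Tendsto (fun n => eLpNorm (fun x => φ n x - u x) 2 (volume.restrict U)) atTop (𝓝 0) ∧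
  Tendsto (fun n => eLpNorm (fun x => ∇ (φ n) x - G x) 2 (volume.restrict U)) atTop (𝓝 0)

/-- `u`, with weak gradient `G`, belongs to `H¹₀(U)`, the closure of `C_c^∞(U)` in `H¹(U)`. -/
def MemH10 (U : Set Plane) (u : Plane → ℝ) (G : Plane → Plane) : Prop :=
  ∃ φ : ℕ → Plane → ℝ, (∀ n, IsTestFun U (φ n)) ∧ TendstoH1 U φ u G

/-- `γ ∈ L²(∂Ω)` is the trace of `u`: some smooth functions on the plane converge to `u` in
`H¹(Ω)` and to `γ` in `L²(∂Ω)`. -/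
def IsTrace (u : H1 Ω) (γ : Plane → ℝ) : Prop :=
  MemLp γ 2 (arc (frontier Ω)) ∧
  ∃ φ : ℕ → Plane → ℝ, (∀ n, ContDiff ℝ ∞ (φ n)) ∧ TendstoH1 Ω φ u.fn u.grad ∧
    Tendsto (fun n => eLpNorm (fun x => φ n x - γ x) 2 (arc (frontier Ω))) atTop (𝓝 0)

open Classical in
/-- The trace of `u` on `∂Ω`. On a Lipschitz domain it exists and is unique up to null sets. -/
def H1.trace (u : H1 Ω) : Plane → ℝ :=
  if h : ∃ γ, IsTrace u γ then h.choose else 0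

/-- `u ∈ H¹_{0,Γ}(Ω)`: the trace of `u` vanishes almost everywhere on `Γ`. -/
def VanishesOn (Γ : Set Plane) (u : H1 Ω) : Prop := u.trace =ᵐ[arc Γ] 0

/-! ### Periodic coefficients, correctors and homogenized coefficients -/

/-- `f` is 1-periodic in each coordinate. -/
def IsPeriodic {X : Type*} (f : Plane → X) : Prop :=
  ∀ (x : Plane) (z : Fin 2 → ℤ), f (x + WithLp.toLp 2 (fun i => (z i : ℝ))) = f x

/-- The coefficient matrix is measurable, 1-periodic, symmetric and uniformly elliptic. -/
structure IsCoeff (κ₁ κ₂ : ℝ) (A : Plane → Matrix (Fin 2) (Fin 2) ℝ) : Prop where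
  meas : ∀ i j, AEMeasurable (fun y => A y i j) volume
  periodic : IsPeriodic A
  symm : ∀ᵐ y, ∀ i j, A y i j = A y j i
  elliptic : ∀ᵐ y, ∀ ξ : Plane, κ₁ * ‖ξ‖ ^ 2 ≤ ∑ i, ∑ j, A y i j * ξ i * ξ j ∧
    ∑ i, ∑ j, A y i j * ξ i * ξ j ≤ κ₂ * ‖ξ‖ ^ 2

/-- The rescaled coefficient `A^ε(x) = A(x/ε)`. -/
def scaled (A : Plane → Matrix (Fin 2) (Fin 2) ℝ) (ε : ℝ) : Plane → Matrix (Fin 2) (Fin 2) ℝ :=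
  fun x => A (ε⁻¹ • x)

/-- `∫_U B F · G` for a matrix field `B` and vector fields `F`, `G`. -/
def form (B : Plane → Matrix (Fin 2) (Fin 2) ℝ) (U : Set Plane) (F G : Plane → Plane) : ℝ :=
  ∫ x in U, ∑ i, ∑ j, B x i j * F x j * G x i

/-- The periodicity cell `Q = (-1/2, 1/2)²`. -/
def cell : Set Plane := {y | ∀ i, y i ∈ Set.Ioo (-(1 / 2) : ℝ) (1 / 2)}

/-- `N ∈ H¹_♯(Q)`, the closure in `H¹(Q)` of the smooth 1-periodic functions. -/
def MemH1Per (N : H1 cell) : Prop :=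
  ∃ φ : ℕ → Plane → ℝ, (∀ n, ContDiff ℝ ∞ (φ n) ∧ IsPeriodic (φ n)) ∧
    TendstoH1 cell φ N.fn N.grad

/-- `N` is the `l`-th corrector: `N ∈ H¹_♯(Q)` has mean zero and solves
`-div (A ∇N) = div (A e_l)` with periodic boundary conditions, in weak form. -/
structure IsCorrector (A : Plane → Matrix (Fin 2) (Fin 2) ℝ) (l : Fin 2) (N : H1 cell) : Prop where
  periodic : MemH1Per N
  mean_zero : ∫ y in cell, N.fn y = 0
  weak : ∀ φ : H1 cell, MemH1Per φ →
    form A cell (fun y => N.grad y + EuclideanSpace.single l 1) φ.grad = 0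

/-- The norm of `W^{1,∞}(Q)`, infinite if `N` or its weak gradient is not essentially bounded. -/
def w1infNorm (N : H1 cell) : ℝ≥0∞ :=
  max (eLpNorm N.fn ∞ (volume.restrict cell)) (eLpNorm N.grad ∞ (volume.restrict cell))

/-- The homogenized coefficients `Â_il = ∫_Q (A_il + A_ij ∂_j N_l)` (the cell has area one). -/
def homogenized (A : Plane → Matrix (Fin 2) (Fin 2) ℝ) (N : Fin 2 → H1 cell) :
    Matrix (Fin 2) (Fin 2) ℝ :=
  Matrix.of fun i l => ∫ y in cell, (A y i l + ∑ j, A y i j * (N l).grad y j)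

/-! ### The boundary value problems, in variational form -/

/-- `u` solves the mixed Dirichlet–Neumann problem with coefficient `B` on the space
`V ∩ H¹_{0,Γ_D}(Ω)`. The exact problem is `V = ⊤`, its Galerkin version has `V` finite
dimensional. -/
def SolvesMixed (B : Plane → Matrix (Fin 2) (Fin 2) ℝ) (ΓD ΓN : Set Plane) (f g : Plane → ℝ)
    (V : Submodule ℝ (H1 Ω)) (u : H1 Ω) : Prop :=
  u ∈ V ∧ VanishesOn ΓD u ∧ ∀ v ∈ V, VanishesOn ΓD v →
    form B Ω u.grad v.grad = (∫ x in Ω, f x * v.fn x) + ∫ x, g x * v.trace x ∂arc ΓN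

/-- `u` solves the Robin problem with coefficients `B`, `α` on the space `V ⊆ H¹(Ω)`. -/
def SolvesRobin (B : Plane → Matrix (Fin 2) (Fin 2) ℝ) (α : Plane → ℝ) (f g : Plane → ℝ)
    (V : Submodule ℝ (H1 Ω)) (u : H1 Ω) : Prop :=
  u ∈ V ∧ ∀ v ∈ V,
    form B Ω u.grad v.grad + ∫ x, α x * u.trace x * v.trace x ∂arc (frontier Ω) =
      (∫ x in Ω, f x * v.fn x) + ∫ x, g x * v.trace x ∂arc (frontier Ω)

/-- The energy norm of the Robin problem. -/
def energyNorm (B : Plane → Matrix (Fin 2) (Fin 2) ℝ) (α : Plane → ℝ) (u : H1 Ω) : ℝ :=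
  √(form B Ω u.grad u.grad + ∫ x, α x * u.trace x ^ 2 ∂arc (frontier Ω))

/-! ### Triangulations and the multiscale finite element space -/

/-- A conforming partition of `Ω` into finitely many triangles. -/
structure Triangulation (Ω : Set Plane) where
  elems : Set (Affine.Simplex ℝ Plane 2)
  finite : elems.Finite
  cover : ⋃ T ∈ elems, T.closedInterior = closure Ω
  disjoint : ∀ T ∈ elems, ∀ T' ∈ elems, T ≠ T' → Disjoint T.interior T'.interior
  conforming : ∀ T ∈ elems, ∀ T' ∈ elems,
    T.closedInterior ∩ T'.closedInterior = convexHull ℝ (Set.range T.points ∩ Set.range T'.points)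

/-- The nodes, i.e. the vertices of the triangles. -/
def Triangulation.nodes (𝒯 : Triangulation Ω) : Set Plane :=
  {p | ∃ T ∈ 𝒯.elems, p ∈ Set.range T.points}

/-- All triangles are of size `h` and of nondegenerate shape: circumradius between `σ h` and `h`,
and inradius at least `ρ` times the circumradius. -/
def Triangulation.IsRegular (𝒯 : Triangulation Ω) (ρ σ h : ℝ) : Prop :=
  ∀ T ∈ 𝒯.elems, T.circumradius ≤ h ∧ σ * h ≤ T.circumradius ∧ ρ ≤ T.inradius / T.circumradius

/-- Every edge on the boundary lies, apart from its end points, entirely in one of the two parts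
of the boundary. -/
def Triangulation.Resolves (𝒯 : Triangulation Ω) (ΓD ΓN : Set Plane) : Prop :=
  ∀ T ∈ 𝒯.elems, ∀ i j, i ≠ j → openSegment ℝ (T.points i) (T.points j) ⊆ frontier Ω →
    openSegment ℝ (T.points i) (T.points j) ⊆ ΓD ∨ openSegment ℝ (T.points i) (T.points j) ⊆ ΓN

/-- `ψ` belongs to the Lagrange space: continuous on `closure Ω` and affine on each triangle. -/
def Triangulation.IsLagrange (𝒯 : Triangulation Ω) (ψ : Plane → ℝ) : Prop :=
  ContinuousOn ψ (closure Ω) ∧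
    ∀ T ∈ 𝒯.elems, ∃ a : Plane →ᵃ[ℝ] ℝ, Set.EqOn ψ a T.closedInterior

/-- `ψ` is the nodal basis function of the node `p`. -/
def Triangulation.IsNodal (𝒯 : Triangulation Ω) (p : Plane) (ψ : Plane → ℝ) : Prop :=
  𝒯.IsLagrange ψ ∧ ψ p = 1 ∧ ∀ q ∈ 𝒯.nodes, q ≠ p → ψ q = 0

/-- `Φ` is the multiscale basis function of the node `p`: in each triangle `T` it solves
`-div (B ∇Φ) = 0` weakly, with `Φ = ψ` on `∂T` (that is, `Φ - ψ ∈ H¹₀(T)`) for the nodal basis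
function `ψ` of `p`. -/
def Triangulation.IsMsBasis (𝒯 : Triangulation Ω) (B : Plane → Matrix (Fin 2) (Fin 2) ℝ)
    (p : Plane) (Φ : H1 Ω) : Prop :=
  ∃ ψ, 𝒯.IsNodal p ψ ∧ ∀ T ∈ 𝒯.elems,
    MemH10 T.interior (fun x => Φ.fn x - ψ x) (fun x => Φ.grad x - ∇ ψ x) ∧
    ∀ φ, IsTestFun T.interior φ → form B T.interior Φ.grad (∇ φ) = 0

/-- The multiscale finite element space `V_ms`, spanned by the multiscale basis functions. -/
def Triangulation.msSpace (𝒯 : Triangulation Ω) (B : Plane → Matrix (Fin 2) (Fin 2) ℝ) :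
    Submodule ℝ (H1 Ω) :=
  Submodule.span ℝ {Φ | ∃ p ∈ 𝒯.nodes, 𝒯.IsMsBasis B p Φ}

end

end MsFEM

open MeasureTheory Filter Topology
open scoped ENNReal NNReal ContDiff Gradient

namespace MsFEM

noncomputable section

/-! By Céa's lemma (`mixed_quasi_optimal`, `robin_quasi_optimal`) the Galerkin error is bounded by
the distance from `u_ε` to one well-chosen element of the multiscale space: the function `v` with
the nodal values of `u₀`. Homogenization says that both have the same microstructure. With `G_l` the
gradient of the `l`-th corrector at scale `ε`, `∇u_ε` is close to `p + ∑ p_l G_l` for `p = ∇u₀`, and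
`∇v` is close to `q + ∑ q_l G_l` for `q` the piecewise constant gradient of the affine interpolant
of `u₀`. Since `G` is bounded, what remains is the interpolation error `‖p - q‖ = O(h)`
(`l2_sub_le_of_expansions`).

Both expansions are instances of `two_scale_estimate`, for a field `p` on an open set `U`. The
corrected gradient is `p + Z` with `Z = ∇(∑ η P_l p_l)`, where `P_l` is a smoothed corrector of size
`ε` and `η` is a cut-off equal to one outside a boundary layer of width `ε`. Its flux must be weakly
close to the homogenized flux `Â p`. The columns `Â e_l - B (e_l + G_l)` are divergence free,
periodic and of mean zero, hence in the plane they are rotated gradients of stream functions `s_l`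
of size `ε` (`exists_stream`). Up to small terms, `p_l` times such a column is the rotated gradient
of `η s_l p_l`, and this is orthogonal to all gradients (`MemH10.integral_rot`). The error is the
mass of `p` in the layer plus `ε` times the norm of the derivative of `p`. Correctors and stream
functions are mollified first, so that all products are with smooth functions; gradients then
converge almost everywhere with uniform bounds, which is what `CorrectorApprox` records.

For `U = Ω` and `p = ∇u₀ ∈ H¹`, a layer of width `ε` carries mass `O(√ε ‖p‖)` by a one-dimensional
Sobolev inequality in Lipschitz charts (`layer_estimate`). For `U` the union of the open triangles,
`p` is locally constant, so its derivative vanishes, and the layers occupy a fraction `O(ε/h)` of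
each triangle (`Tri.volume_layer_le`). This gives the resonance term `√(ε/h)`.

The boundary conditions enter through `FluxIdentity`. For mixed data the fluxes of `u_ε` and `u₀`
agree weakly. For Robin data they differ by `-∫ α (u_ε - u₀)²`, whose sign is favourable, so the
same estimate also controls the trace of `u_ε - u₀`. The competitor `v` has the trace of the affine
interpolant. For mixed data this vanishes on the Dirichlet part because the continuous
representative of `u₀` vanishes on every closed Dirichlet edge. If `ε > 1` or `h > 1`, the rate is
at least one and `v = 0` suffices.

The supporting analysis is proved along the way: density of smooth functions on Lipschitz domains by
mollification shifted into a cone (`exists_smooth_approx`), traces, interpolation of `H²` functions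
from Taylor remainders, and the Dirichlet problem defining the basis functions. -/

variable {Ω U : Set Plane}

/-! ### Square integrable functions -/

/-- The `L²(μ)` norm of a function, as a real number. -/
def l2 {E : Type*} [NormedAddCommGroup E] (μ : Measure Plane) (F : Plane → E) : ℝ :=
  (eLpNorm F 2 μ).toReal

section L2

variable {E : Type*} [NormedAddCommGroup E] {μ : Measure Plane} {F G H : Plane → E}

lemma l2_nonneg : 0 ≤ l2 μ F := ENNReal.toReal_nonneg

lemma l2_add_le (hF : MemLp F 2 μ) (hG : MemLp G 2 μ) :
    l2 μ (fun x => F x + G x) ≤ l2 μ F + l2 μ G := by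
  unfold l2
  rw [← ENNReal.toReal_add hF.eLpNorm_ne_top hG.eLpNorm_ne_top]
  exact ENNReal.toReal_mono (ENNReal.add_ne_top.2 ⟨hF.eLpNorm_ne_top, hG.eLpNorm_ne_top⟩)
    (eLpNorm_add_le hF.1 hG.1 (by norm_num))

lemma l2_sub_le (hF : MemLp F 2 μ) (hG : MemLp G 2 μ) :
    l2 μ (fun x => F x - G x) ≤ l2 μ F + l2 μ G := by
  unfold l2
  rw [← ENNReal.toReal_add hF.eLpNorm_ne_top hG.eLpNorm_ne_top]
  exact ENNReal.toReal_mono (ENNReal.add_ne_top.2 ⟨hF.eLpNorm_ne_top, hG.eLpNorm_ne_top⟩)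
    (eLpNorm_sub_le hF.1 hG.1 (by norm_num))

lemma l2_congr (h : F =ᵐ[μ] G) : l2 μ F = l2 μ G := by
  unfold l2; rw [eLpNorm_congr_ae h]

lemma l2_sub_comm : l2 μ (fun x => F x - G x) = l2 μ (fun x => G x - F x) := by
  unfold l2
  congr 1
  exact eLpNorm_congr_norm_ae (ae_of_all _ fun x => norm_sub_rev _ _)

lemma l2_triangle (hF : MemLp F 2 μ) (hG : MemLp G 2 μ) (hH : MemLp H 2 μ) :
    l2 μ (fun x => F x - H x) ≤ l2 μ (fun x => F x - G x) + l2 μ (fun x => G x - H x) := by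
  refine le_trans (le_of_eq ?_) (l2_add_le (hF.sub hG) (hG.sub hH))
  simp

lemma l2_le_of_ae {E' : Type*} [NormedAddCommGroup E'] {F' : Plane → E'} {K : ℝ} (hK : 0 ≤ K)
    (hF : MemLp F 2 μ) (h : ∀ᵐ x ∂μ, ‖F' x‖ ≤ K * ‖F x‖) : l2 μ F' ≤ K * l2 μ F := by
  unfold l2
  have h1 := eLpNorm_le_mul_eLpNorm_of_ae_le_mul h 2
  have h2 := ENNReal.toReal_mono (ENNReal.mul_ne_top ENNReal.ofReal_ne_top hF.eLpNorm_ne_top) h1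
  rwa [ENNReal.toReal_mul, ENNReal.toReal_ofReal hK] at h2

lemma l2_mono_ae {E' : Type*} [NormedAddCommGroup E'] {F' : Plane → E'}
    (hF : MemLp F 2 μ) (h : ∀ᵐ x ∂μ, ‖F' x‖ ≤ ‖F x‖) : l2 μ F' ≤ l2 μ F := by
  have := l2_le_of_ae (K := 1) zero_le_one hF (F' := F') (by simpa using h)
  simpa using this

lemma l2_sq (hF : AEStronglyMeasurable F μ) : l2 μ F ^ 2 = ∫ x, ‖F x‖ ^ 2 ∂μ := by
  rw [integral_eq_lintegral_of_nonneg_ae (ae_of_all _ fun x => by positivity)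
    (by fun_prop)]
  unfold l2
  rw [← ENNReal.toReal_pow]
  congr 1
  have h := eLpNorm_nnreal_pow_eq_lintegral (f := F) (μ := μ) (p := 2) (by norm_num)
  have h2 : eLpNorm F 2 μ ^ 2 = eLpNorm F ((2 : ℝ≥0) : ℝ≥0∞) μ ^ ((2 : ℝ≥0) : ℝ) := by
    norm_num
  rw [h2, h]
  refine lintegral_congr fun x => ?_
  rw [ENNReal.ofReal_pow (norm_nonneg _), ofReal_norm]
  norm_num

lemma l2_Lp (f : Lp E 2 μ) : l2 μ f = ‖f‖ := rfl

lemma l2_toLp (hF : MemLp F 2 μ) : ‖hF.toLp F‖ = l2 μ F := by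
  rw [Lp.norm_toLp]; rfl

lemma l2_mono_measure {ν : Measure Plane} (h : ν ≤ μ) (hF : MemLp F 2 μ) : l2 ν F ≤ l2 μ F :=
  ENNReal.toReal_mono hF.eLpNorm_ne_top (eLpNorm_mono_measure _ h)

lemma tendsto_l2_iff {ι : Type*} {l : Filter ι} {f : ι → Plane → E} (hf : ∀ n, MemLp (f n) 2 μ) :
    Tendsto (fun n => eLpNorm (f n) 2 μ) l (𝓝 0) ↔ Tendsto (fun n => l2 μ (f n)) l (𝓝 0) := by
  rw [← ENNReal.tendsto_toReal_iff (fun n => (hf n).eLpNorm_ne_top) ENNReal.zero_ne_top]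
  rfl

lemma l2_sum_le {ι : Type*} (s : Finset ι) {f : ι → Plane → E} (hf : ∀ i ∈ s, MemLp (f i) 2 μ) :
    l2 μ (fun x => ∑ i ∈ s, f i x) ≤ ∑ i ∈ s, l2 μ (f i) := by
  classical
  induction s using Finset.induction_on with
  | empty =>
    simp [l2]
  | insert a s ha ih =>
    simp only [Finset.sum_insert ha]
    refine (l2_add_le (hf a (by simp)) (memLp_finsetSum s fun i hi => hf i (by simp [hi]))).trans ?_
    gcongr
    exact ih fun i hi => hf i (by simp [hi])

end L2

lemma abs_coord_le (v : Plane) (i : Fin 2) : |v i| ≤ ‖v‖ := by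
  simpa using PiLp.norm_apply_le v i

lemma norm_le_sum_coord (v : Plane) : ‖v‖ ≤ |v 0| + |v 1| := by
  rw [EuclideanSpace.norm_eq, Fin.sum_univ_two]
  refine Real.sqrt_le_iff.2 ⟨by positivity, ?_⟩
  have h0 := abs_nonneg (v 0)
  have h1 := abs_nonneg (v 1)
  simp only [Real.norm_eq_abs]
  nlinarith

lemma plane_ext {v w : Plane} (h0 : v 0 = w 0) (h1 : v 1 = w 1) : v = w := by
  ext i
  fin_cases i <;> assumption

lemma eq_coord_sum (v : Plane) :
    v = v 0 • EuclideanSpace.single 0 (1 : ℝ) + v 1 • EuclideanSpace.single 1 (1 : ℝ) := by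
  apply plane_ext <;> simp

lemma memLp_coord' {μ : Measure Plane} {G : Plane → Plane} (hG : MemLp G 2 μ) (i : Fin 2) :
    MemLp (fun x => G x i) 2 μ :=
  (EuclideanSpace.proj (𝕜 := ℝ) i).comp_memLp' hG

lemma memLp_of_coord {μ : Measure Plane} {G : Plane → Plane}
    (hG : ∀ i : Fin 2, MemLp (fun x => G x i) 2 μ) : MemLp G 2 μ := by
  have h := ((ContinuousLinearMap.toSpanSingleton ℝ
    (EuclideanSpace.single (0 : Fin 2) (1 : ℝ))).comp_memLp' (hG 0)).add
    ((ContinuousLinearMap.toSpanSingleton ℝ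
    (EuclideanSpace.single (1 : Fin 2) (1 : ℝ))).comp_memLp' (hG 1))
  refine h.ae_eq (ae_of_all _ fun x => ?_)
  simpa using (eq_coord_sum (G x)).symm

lemma l2_coord_le {μ : Measure Plane} {G : Plane → Plane} (hG : MemLp G 2 μ) (i : Fin 2) :
    l2 μ (fun x => G x i) ≤ l2 μ G :=
  l2_mono_ae hG (ae_of_all _ fun _ => abs_coord_le _ _)

/-! ### Pairings -/

lemma abs_integral_inner_le {E : Type*} [NormedAddCommGroup E] [InnerProductSpace ℝ E]
    {μ : Measure Plane} {F G : Plane → E} (hF : MemLp F 2 μ) (hG : MemLp G 2 μ) :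
    |∫ x, inner ℝ (F x) (G x) ∂μ| ≤ l2 μ F * l2 μ G := by
  have h := abs_real_inner_le_norm (hF.toLp F) (hG.toLp G)
  rw [L2.inner_def, l2_toLp, l2_toLp] at h
  rwa [integral_congr_ae (g := fun x => inner ℝ (F x) (G x))] at h
  filter_upwards [hF.coeFn_toLp, hG.coeFn_toLp] with x h1 h2
  rw [h1, h2]

lemma integrable_inner {E : Type*} [NormedAddCommGroup E] [InnerProductSpace ℝ E]
    {μ : Measure Plane} {F G : Plane → E} (hF : MemLp F 2 μ) (hG : MemLp G 2 μ) :
    Integrable (fun x => inner ℝ (F x) (G x)) μ := by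
  have h := L2.integrable_inner (𝕜 := ℝ) (hF.toLp F) (hG.toLp G)
  refine h.congr ?_
  filter_upwards [hF.coeFn_toLp, hG.coeFn_toLp] with x h1 h2
  rw [h1, h2]

lemma abs_integral_mul_le {μ : Measure Plane} {F G : Plane → ℝ} (hF : MemLp F 2 μ)
    (hG : MemLp G 2 μ) : |∫ x, F x * G x ∂μ| ≤ l2 μ F * l2 μ G := by
  have := abs_integral_inner_le hG hF
  simpa [mul_comm] using this

lemma integrable_mul' {μ : Measure Plane} {F G : Plane → ℝ} (hF : MemLp F 2 μ)
    (hG : MemLp G 2 μ) : Integrable (fun x => F x * G x) μ := hF.integrable_mul hG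

lemma tendsto_integral_mul {μ : Measure Plane} {ι : Type*} {l : Filter ι} {f : ι → Plane → ℝ}
    {u g : Plane → ℝ} (hf : ∀ n, MemLp (f n) 2 μ) (hu : MemLp u 2 μ) (hg : MemLp g 2 μ)
    (h : Tendsto (fun n => eLpNorm (fun x => f n x - u x) 2 μ) l (𝓝 0)) :
    Tendsto (fun n => ∫ x, f n x * g x ∂μ) l (𝓝 (∫ x, u x * g x ∂μ)) := by
  rw [tendsto_iff_norm_sub_tendsto_zero]
  have h' := ((tendsto_l2_iff fun n => (hf n).sub hu).1 h).mul_const (l2 μ g)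
  rw [zero_mul] at h'
  refine squeeze_zero (fun _ => norm_nonneg _) (fun n => ?_) h'
  rw [← integral_sub (integrable_mul' (hf n) hg) (integrable_mul' hu hg), Real.norm_eq_abs]
  have := abs_integral_mul_le ((hf n).sub hu) hg
  simpa [sub_mul] using this

/-- The matrix-vector product on the plane. -/
def mv (B : Matrix (Fin 2) (Fin 2) ℝ) (v : Plane) : Plane := WithLp.toLp 2 (fun i => ∑ j, B i j * v j)

@[simp] lemma mv_apply (B : Matrix (Fin 2) (Fin 2) ℝ) (v : Plane) (i : Fin 2) :
    mv B v i = ∑ j, B i j * v j := rfl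

lemma inner_mv (B : Matrix (Fin 2) (Fin 2) ℝ) (v w : Plane) :
    inner ℝ (mv B v) w = ∑ i, ∑ j, B i j * v j * w i := by
  simp [PiLp.inner_apply, Fin.sum_univ_two]
  ring

lemma mv_add (B : Matrix (Fin 2) (Fin 2) ℝ) (v w : Plane) : mv B (v + w) = mv B v + mv B w := by
  apply plane_ext <;> simp [Fin.sum_univ_two] <;> ring

lemma mv_sub (B : Matrix (Fin 2) (Fin 2) ℝ) (v w : Plane) : mv B (v - w) = mv B v - mv B w := by
  apply plane_ext <;> simp [Fin.sum_univ_two] <;> ring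

lemma mv_smul (B : Matrix (Fin 2) (Fin 2) ℝ) (c : ℝ) (v : Plane) : mv B (c • v) = c • mv B v := by
  apply plane_ext <;> simp [Fin.sum_univ_two] <;> ring

lemma norm_mv_le {B : Matrix (Fin 2) (Fin 2) ℝ} {K : ℝ} (hB : ∀ i j, |B i j| ≤ K) (v : Plane) :
    ‖mv B v‖ ≤ 4 * K * ‖v‖ := by
  have key : ∀ i, |mv B v i| ≤ 2 * K * ‖v‖ := by
    intro i
    rw [mv_apply, Fin.sum_univ_two]
    refine (abs_add_le _ _).trans ?_
    rw [abs_mul, abs_mul]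
    have h0 := mul_le_mul (hB i 0) (abs_coord_le v 0) (abs_nonneg _) ((abs_nonneg _).trans (hB i 0))
    have h1 := mul_le_mul (hB i 1) (abs_coord_le v 1) (abs_nonneg _) ((abs_nonneg _).trans (hB i 1))
    linarith
  have := norm_le_sum_coord (mv B v)
  linarith [key 0, key 1]

/-- A measurable matrix field with entries bounded by `K` almost everywhere. -/
structure BddCoeff (K : ℝ) (B : Plane → Matrix (Fin 2) (Fin 2) ℝ) : Prop where
  meas : ∀ i j, AEMeasurable (fun y => B y i j) volume
  bdd : ∀ᵐ y, ∀ i j, |B y i j| ≤ K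

lemma BddCoeff.memLp {K : ℝ} {B : Plane → Matrix (Fin 2) (Fin 2) ℝ} (hB : BddCoeff K B) {U : Set Plane}
    {F : Plane → Plane} (hF : MemLp F 2 (volume.restrict U)) :
    MemLp (fun x => mv (B x) (F x)) 2 (volume.restrict U) := by
  refine hF.of_le_mul (c := 4 * K) ?_ ?_
  · have : (fun x => mv (B x) (F x)) = fun x => WithLp.toLp 2 (fun i => ∑ j, B x i j * F x j) := rfl
    rw [this]
    refine (PiLp.continuous_toLp 2 _).comp_aestronglyMeasurable ?_
    refine (aemeasurable_pi_iff.2 fun i => ?_).aestronglyMeasurable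
    refine Finset.aemeasurable_fun_sum _ fun j _ => ?_
    exact ((hB.meas i j).mono_measure Measure.restrict_le_self).mul
      (memLp_coord' hF j).1.aemeasurable
  · filter_upwards [ae_restrict_of_ae hB.bdd] with x hx
    exact norm_mv_le hx _

lemma BddCoeff.l2_le {K : ℝ} {B : Plane → Matrix (Fin 2) (Fin 2) ℝ} (hB : BddCoeff K B)
    (hK : 0 ≤ K) {U : Set Plane} {F : Plane → Plane} (hF : MemLp F 2 (volume.restrict U)) :
    l2 (volume.restrict U) (fun x => mv (B x) (F x)) ≤ 4 * K * l2 (volume.restrict U) F := by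
  refine l2_le_of_ae (by positivity) hF ?_
  filter_upwards [ae_restrict_of_ae hB.bdd] with x hx
  exact norm_mv_le hx _

lemma form_eq (B : Plane → Matrix (Fin 2) (Fin 2) ℝ) (U : Set Plane) (F G : Plane → Plane) :
    form B U F G = ∫ x in U, inner ℝ (mv (B x) (F x)) (G x) := by
  simp only [form, inner_mv]

section Form

variable {K : ℝ} {B : Plane → Matrix (Fin 2) (Fin 2) ℝ} {U : Set Plane} {F F' G : Plane → Plane}

lemma form_congr (hF : F =ᵐ[volume.restrict U] F') {G' : Plane → Plane}
    (hG : G =ᵐ[volume.restrict U] G') : form B U F G = form B U F' G' := by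
  refine integral_congr_ae ?_
  filter_upwards [hF, hG] with x h1 h2
  rw [h1, h2]

lemma BddCoeff.form_sub_left (hB : BddCoeff K B) (hF : MemLp F 2 (volume.restrict U))
    (hF' : MemLp F' 2 (volume.restrict U)) (hG : MemLp G 2 (volume.restrict U)) :
    form B U (fun x => F x - F' x) G = form B U F G - form B U F' G := by
  rw [form_eq, form_eq, form_eq, ← integral_sub (integrable_inner (hB.memLp hF) hG)
    (integrable_inner (hB.memLp hF') hG)]
  simp only [mv_sub, inner_sub_left]

lemma BddCoeff.form_sub_right (hB : BddCoeff K B) (hF : MemLp F 2 (volume.restrict U))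
    {G' : Plane → Plane}
    (hG : MemLp G 2 (volume.restrict U)) (hG' : MemLp G' 2 (volume.restrict U)) :
    form B U F (fun x => G x - G' x) = form B U F G - form B U F G' := by
  rw [form_eq, form_eq, form_eq, ← integral_sub (integrable_inner (hB.memLp hF) hG)
    (integrable_inner (hB.memLp hF) hG')]
  simp only [inner_sub_right]

lemma BddCoeff.abs_form_le (hB : BddCoeff K B) (hK : 0 ≤ K) (hF : MemLp F 2 (volume.restrict U))
    (hG : MemLp G 2 (volume.restrict U)) :
    |form B U F G| ≤ 4 * K * l2 (volume.restrict U) F * l2 (volume.restrict U) G := by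
  rw [form_eq]
  exact (abs_integral_inner_le (hB.memLp hF) hG).trans
    (mul_le_mul_of_nonneg_right (hB.l2_le hK hF) l2_nonneg)

end Form

/-! ### Weak gradients -/

lemma IsTestFun.eq_zero {U : Set Plane} {φ : Plane → ℝ} (hφ : IsTestFun U φ) {x : Plane}
    (hx : x ∉ U) : φ x = 0 := by
  by_contra hne
  exact hx (hφ.2.2 (subset_tsupport _ hne))

lemma IsTestFun.gradient_eq_zero {U : Set Plane} {φ : Plane → ℝ} (hφ : IsTestFun U φ) {x : Plane}
    (hx : x ∉ U) : ∇ φ x = 0 := by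
  by_contra hne
  refine hx (hφ.2.2 (tsupport_fderiv_subset ℝ (f := φ) (subset_tsupport _ ?_)))
  intro h0
  exact hne (by simp [gradient, h0])

/-- `u` and `G` are square integrable on `U`, and `G` is the weak gradient of `u` on `U`. -/
structure WG (U : Set Plane) (u : Plane → ℝ) (G : Plane → Plane) : Prop where
  fn : MemLp u 2 (volume.restrict U)
  grad : MemLp G 2 (volume.restrict U)
  weak : ∀ φ, IsTestFun U φ → ∀ i : Fin 2,
    ∫ x in U, u x * ∇ φ x i = - ∫ x in U, G x i * φ x

lemma H1.wg (u : H1 Ω) : WG Ω u.fn u.grad := ⟨Lp.memLp _, Lp.memLp _, u.2⟩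

lemma WG.congr {u u' : Plane → ℝ} {G G' : Plane → Plane} (h : WG U u G)
    (hu : u =ᵐ[volume.restrict U] u') (hG : G =ᵐ[volume.restrict U] G') : WG U u' G' := by
  refine ⟨h.fn.ae_eq hu, h.grad.ae_eq hG, fun φ hφ i => ?_⟩
  have := h.weak φ hφ i
  rw [integral_congr_ae (g := fun x => u' x * ∇ φ x i),
    integral_congr_ae (f := fun x => G x i * φ x) (g := fun x => G' x i * φ x)] at this
  · exact this
  · filter_upwards [hG] with x hx
    rw [hx]
  · filter_upwards [hu] with x hx
    rw [hx]

/-- The element of `H¹(Ω)` given by a function and its weak gradient. -/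
def WG.toH1 {u : Plane → ℝ} {G : Plane → Plane} (h : WG Ω u G) : H1 Ω :=
  ⟨WithLp.toLp 2 (h.fn.toLp u, h.grad.toLp G),
    (h.congr h.fn.coeFn_toLp.symm h.grad.coeFn_toLp.symm).weak⟩

lemma WG.fn_toH1 {u : Plane → ℝ} {G : Plane → Plane} (h : WG Ω u G) :
    h.toH1.fn =ᵐ[volume.restrict Ω] u := h.fn.coeFn_toLp

lemma WG.grad_toH1 {u : Plane → ℝ} {G : Plane → Plane} (h : WG Ω u G) :
    h.toH1.grad =ᵐ[volume.restrict Ω] G := h.grad.coeFn_toLp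

lemma H1.fn_sub (u v : H1 Ω) : (u - v).fn =ᵐ[volume.restrict Ω] fun x => u.fn x - v.fn x :=
  Lp.coeFn_sub u.1.fst v.1.fst

lemma H1.grad_sub (u v : H1 Ω) : (u - v).grad =ᵐ[volume.restrict Ω] fun x => u.grad x - v.grad x :=
  Lp.coeFn_sub u.1.snd v.1.snd

lemma H1.fn_add (u v : H1 Ω) : (u + v).fn =ᵐ[volume.restrict Ω] fun x => u.fn x + v.fn x :=
  Lp.coeFn_add u.1.fst v.1.fst

lemma H1.grad_add (u v : H1 Ω) : (u + v).grad =ᵐ[volume.restrict Ω] fun x => u.grad x + v.grad x :=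
  Lp.coeFn_add u.1.snd v.1.snd

lemma H1.fn_smul (c : ℝ) (v : H1 Ω) : (c • v).fn =ᵐ[volume.restrict Ω] fun x => c * v.fn x :=
  Lp.coeFn_smul c v.1.fst

lemma H1.grad_smul (c : ℝ) (v : H1 Ω) : (c • v).grad =ᵐ[volume.restrict Ω] fun x => c • v.grad x :=
  Lp.coeFn_smul c v.1.snd

lemma H1.seminorm_eq (u : H1 Ω) : u.seminorm = l2 (volume.restrict Ω) u.grad := rfl

lemma H1.norm_sq (u : H1 Ω) : ‖u‖ ^ 2 = l2 (volume.restrict Ω) u.fn ^ 2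
    + l2 (volume.restrict Ω) u.grad ^ 2 := by
  have h : ‖u‖ = ‖u.1‖ := rfl
  rw [h, WithLp.prod_norm_sq_eq_of_L2]
  rfl

lemma H1.l2_fn_le (u : H1 Ω) : l2 (volume.restrict Ω) u.fn ≤ ‖u‖ := by
  have := u.norm_sq
  exact abs_le_of_sq_le_sq' (by nlinarith [sq_nonneg (l2 (volume.restrict Ω) u.grad)])
    (norm_nonneg _) |>.2

lemma H1.l2_grad_le (u : H1 Ω) : l2 (volume.restrict Ω) u.grad ≤ ‖u‖ := by
  have := u.norm_sq
  exact abs_le_of_sq_le_sq' (by nlinarith [sq_nonneg (l2 (volume.restrict Ω) u.fn)])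
    (norm_nonneg _) |>.2

lemma H1.norm_le (u : H1 Ω) : ‖u‖ ≤ l2 (volume.restrict Ω) u.fn + l2 (volume.restrict Ω) u.grad := by
  have := u.norm_sq
  refine abs_le_of_sq_le_sq' ?_ (add_nonneg l2_nonneg l2_nonneg) |>.2
  nlinarith [l2_nonneg (μ := volume.restrict Ω) (F := u.fn),
    l2_nonneg (μ := volume.restrict Ω) (F := u.grad)]

lemma WG.add {u v : Plane → ℝ} {G H : Plane → Plane} (h : WG U u G) (h' : WG U v H) :
    WG U (fun x => u x + v x) (fun x => G x + H x) := by
  refine ⟨h.fn.add h'.fn, h.grad.add h'.grad, fun φ hφ i => ?_⟩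
  simp only [PiLp.add_apply, add_mul]
  rw [integral_add (integrable_mul' h.fn (hφ.memLp_partial _ i))
    (integrable_mul' h'.fn (hφ.memLp_partial _ i)),
    integral_add (integrable_mul' (memLp_coord' h.grad i) (hφ.memLp _))
    (integrable_mul' (memLp_coord' h'.grad i) (hφ.memLp _)), h.weak φ hφ, h'.weak φ hφ]
  ring

lemma continuous_gradient {φ : Plane → ℝ} (h : ContDiff ℝ ∞ φ) : Continuous (∇ φ) := by
  have := (h.continuous_fderiv (by simp))
  exact (InnerProductSpace.toDual ℝ Plane).symm.continuous.comp this

lemma norm_gradient (φ : Plane → ℝ) (x : Plane) : ‖∇ φ x‖ = ‖fderiv ℝ φ x‖ := by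
  simp [gradient]

lemma contDiff_partial {φ : Plane → ℝ} (h : ContDiff ℝ ∞ φ) (i : Fin 2) :
    ContDiff ℝ ∞ (fun x => ∇ φ x i) := by
  simp only [gradient_apply]
  exact (h.fderiv_right (m := ∞) (by simp)).clm_apply contDiff_const

lemma memLp_of_continuous {E : Type*} [NormedAddCommGroup E] [SecondCountableTopology E]
    (hU : Bornology.IsBounded U) {f : Plane → E} (hf : Continuous f) (p : ℝ≥0∞) :
    MemLp f p (volume.restrict U) := by
  have hc : IsCompact (closure U) := hU.isCompact_closure
  have : IsFiniteMeasure ((volume : Measure Plane).restrict (closure U)) :=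
    ⟨by simpa using hc.measure_lt_top⟩
  obtain ⟨C, hC⟩ := hc.exists_bound_of_continuousOn hf.continuousOn
  have : MemLp f p (volume.restrict (closure U)) := by
    refine MemLp.of_bound hf.aestronglyMeasurable C ?_
    exact (ae_restrict_iff' isClosed_closure.measurableSet).2 (ae_of_all _ hC)
  exact this.mono_measure (Measure.restrict_mono_set _ subset_closure)

/-- The test function is supported in `U`, so both integrals extend to the whole plane, where
integration by parts has no boundary term. No regularity of `U` is needed. -/
lemma WG.of_contDiff (hU : Bornology.IsBounded U) {f : Plane → ℝ} (hf : ContDiff ℝ ∞ f) :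
    WG U f (∇ f) := by
  refine ⟨memLp_of_continuous hU hf.continuous 2,
    memLp_of_continuous hU (continuous_gradient hf) 2, fun φ hφ i => ?_⟩
  have z1 := fun x => hφ.eq_zero (x := x)
  have z2 := fun x hx => congrArg (fun v : Plane => v i) (hφ.gradient_eq_zero (x := x) hx)
  simp only [PiLp.zero_apply] at z2
  rw [setIntegral_eq_integral_of_forall_compl_eq_zero, setIntegral_eq_integral_of_forall_compl_eq_zero]
  · simp only [gradient_apply]
    have c1 : Continuous fun x => fderiv ℝ f x (EuclideanSpace.single i 1) :=
      (hf.continuous_fderiv (by simp)).clm_apply continuous_const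
    have c2 : Continuous fun x => fderiv ℝ φ x (EuclideanSpace.single i 1) :=
      (hφ.1.continuous_fderiv (by simp)).clm_apply continuous_const
    refine integral_mul_fderiv_eq_neg_fderiv_mul_of_integrable ?_ ?_ ?_
      (fun x _ => hf.differentiable (by simp) x) (fun x _ => hφ.1.differentiable (by simp) x)
    · exact (c1.mul hφ.1.continuous).integrable_of_hasCompactSupport hφ.2.1.mul_left
    · refine (hf.continuous.mul c2).integrable_of_hasCompactSupport (HasCompactSupport.mul_left ?_)
      exact (hφ.2.1.fderiv (𝕜 := ℝ)).comp_left
        (g := fun l : Plane →L[ℝ] ℝ => l (EuclideanSpace.single i 1)) rfl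
    · exact (hf.continuous.mul hφ.1.continuous).integrable_of_hasCompactSupport hφ.2.1.mul_left
  · exact fun x hx => by rw [z1 x hx, mul_zero]
  · exact fun x hx => by rw [z2 x hx, mul_zero]

lemma gradient_mul {f g : Plane → ℝ} (hf : ContDiff ℝ ∞ f) (hg : ContDiff ℝ ∞ g) (x : Plane) :
    ∇ (fun y => f y * g y) x = f x • ∇ g x + g x • ∇ f x := by
  ext i
  rw [gradient_apply, fderiv_fun_mul (hf.differentiable (by simp) x) (hg.differentiable (by simp) x)]
  simp [gradient_apply]

lemma gradient_add' {f g : Plane → ℝ} (hf : ContDiff ℝ ∞ f) (hg : ContDiff ℝ ∞ g) (x : Plane) :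
    ∇ (fun y => f y + g y) x = ∇ f x + ∇ g x := by
  ext i
  rw [gradient_apply, fderiv_fun_add (hf.differentiable (by simp) x) (hg.differentiable (by simp) x)]
  simp [gradient_apply]

lemma gradient_const_mul' {f : Plane → ℝ} (hf : ContDiff ℝ ∞ f) (c : ℝ) (x : Plane) :
    ∇ (fun y => c * f y) x = c • ∇ f x := by
  ext i
  rw [gradient_apply, fderiv_const_mul (hf.differentiable (by simp) x)]
  simp [gradient_apply]

lemma exists_bound_on (hU : Bornology.IsBounded U) {E : Type*} [NormedAddCommGroup E]
    {f : Plane → E} (hf : Continuous f) : ∃ C, 0 ≤ C ∧ ∀ x ∈ U, ‖f x‖ ≤ C := by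
  obtain ⟨C, hC⟩ := hU.isCompact_closure.exists_bound_of_continuousOn hf.continuousOn
  exact ⟨|C|, abs_nonneg _, fun x hx => (hC x (subset_closure hx)).trans (le_abs_self _)⟩

lemma memLp_mul_of_bound {E : Type*} [NormedAddCommGroup E] [NormedSpace ℝ E]
    {μ : Measure Plane} {c : Plane → ℝ} {F : Plane → E} {K : ℝ} (hc : AEStronglyMeasurable c μ)
    (hK : ∀ᵐ x ∂μ, |c x| ≤ K) (hF : MemLp F 2 μ) : MemLp (fun x => c x • F x) 2 μ := by
  refine hF.of_le_mul (c := K) (hc.smul hF.1) ?_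
  filter_upwards [hK] with x hx
  rw [norm_smul]
  exact mul_le_mul_of_nonneg_right hx (norm_nonneg _)

lemma memLp_mul_of_bound' {E : Type*} [NormedAddCommGroup E] [NormedSpace ℝ E]
    {μ : Measure Plane} {c : Plane → ℝ} {F : Plane → E} {K : ℝ} (hc : MemLp c 2 μ)
    (hF : AEStronglyMeasurable F μ) (hK : ∀ᵐ x ∂μ, ‖F x‖ ≤ K) : MemLp (fun x => c x • F x) 2 μ := by
  refine hc.of_le_mul (c := K) (hc.1.smul hF) ?_
  filter_upwards [hK] with x hx
  rw [norm_smul, mul_comm]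
  exact mul_le_mul_of_nonneg_right hx (norm_nonneg _)

/-- Product rule for a smooth function and a function with a weak gradient. -/
lemma WG.mul (hU : Bornology.IsBounded U) (hUo : IsOpen U) {χ : Plane → ℝ} (hχ : ContDiff ℝ ∞ χ)
    {u : Plane → ℝ} {G : Plane → Plane} (h : WG U u G) :
    WG U (fun x => χ x * u x) (fun x => χ x • G x + u x • ∇ χ x) := by
  obtain ⟨C, hC0, hC⟩ := exists_bound_on hU hχ.continuous
  obtain ⟨D, hD0, hD⟩ := exists_bound_on hU (continuous_gradient hχ)
  have aeC : ∀ᵐ x ∂(volume.restrict U), |χ x| ≤ C :=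
    (ae_restrict_iff' hUo.measurableSet).2 (ae_of_all _ hC)
  have aeD : ∀ᵐ x ∂(volume.restrict U), ‖∇ χ x‖ ≤ D :=
    (ae_restrict_iff' hUo.measurableSet).2 (ae_of_all _ hD)
  have m1 := memLp_mul_of_bound hχ.continuous.aestronglyMeasurable aeC h.fn
  have m2 := memLp_mul_of_bound hχ.continuous.aestronglyMeasurable aeC h.grad
  have m3 := memLp_mul_of_bound' h.fn (continuous_gradient hχ).aestronglyMeasurable aeD
  refine ⟨m1, m2.add m3, fun φ hφ i => ?_⟩
  have hχφ : IsTestFun U (fun x => χ x * φ x) :=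
    ⟨hχ.mul hφ.1, hφ.2.1.mul_left, (tsupport_mul_subset_right).trans hφ.2.2⟩
  have key := h.weak _ hχφ i
  simp only [gradient_mul hχ hφ.1] at key
  have i1 : Integrable (fun x => χ x * u x * ∇ φ x i) (volume.restrict U) :=
    m1.integrable_mul (hφ.memLp_partial _ i)
  have i2 : Integrable (fun x => (u x • ∇ χ x) i * φ x) (volume.restrict U) :=
    (memLp_coord' m3 i).integrable_mul (hφ.memLp _)
  have i3 : Integrable (fun x => (χ x • G x) i * φ x) (volume.restrict U) :=
    (memLp_coord' m2 i).integrable_mul (hφ.memLp _)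
  have e1 : ∫ x in U, u x * (χ x • ∇ φ x + φ x • ∇ χ x) i =
      (∫ x in U, χ x * u x * ∇ φ x i) + ∫ x in U, (u x • ∇ χ x) i * φ x := by
    rw [← integral_add i1 i2]
    refine integral_congr_ae (ae_of_all _ fun x => ?_)
    simp
    ring
  have e2 : ∫ x in U, (χ x • G x + u x • ∇ χ x) i * φ x =
      (∫ x in U, (χ x • G x) i * φ x) + ∫ x in U, (u x • ∇ χ x) i * φ x := by
    rw [← integral_add i3 i2]
    refine integral_congr_ae (ae_of_all _ fun x => ?_)
    simp
    ring
  have e3 : ∫ x in U, G x i * (χ x * φ x) = ∫ x in U, (χ x • G x) i * φ x := by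
    refine integral_congr_ae (ae_of_all _ fun x => ?_)
    simp
    ring
  rw [e1, e3] at key
  rw [e2]
  linarith

/-- Weak gradients pass to the limit. -/
lemma WG.of_tendsto {φ : ℕ → Plane → ℝ} {Φ : ℕ → Plane → Plane} {u : Plane → ℝ} {G : Plane → Plane}
    (hφ : ∀ n, WG U (φ n) (Φ n)) (hu : MemLp u 2 (volume.restrict U))
    (hG : MemLp G 2 (volume.restrict U))
    (h1 : Tendsto (fun n => eLpNorm (fun x => φ n x - u x) 2 (volume.restrict U)) atTop (𝓝 0))
    (h2 : Tendsto (fun n => eLpNorm (fun x => Φ n x - G x) 2 (volume.restrict U)) atTop (𝓝 0)) :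
    WG U u G := by
  refine ⟨hu, hG, fun ψ hψ i => ?_⟩
  have t1 := tendsto_integral_mul (fun n => (hφ n).fn) hu (hψ.memLp_partial _ i) h1
  have t2 := tendsto_integral_mul (f := fun n x => Φ n x i) (u := fun x => G x i)
    (fun n => memLp_coord' (hφ n).grad i) (memLp_coord' hG i) (hψ.memLp _) (by
      refine tendsto_of_tendsto_of_tendsto_of_le_of_le tendsto_const_nhds h2 (fun _ => zero_le)
        fun n => ?_
      refine eLpNorm_mono fun x => ?_
      simpa using abs_coord_le (Φ n x - G x) i)
  refine tendsto_nhds_unique t1 ?_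
  simp only [(hφ _).weak ψ hψ i]
  exact t2.neg

/-! ### Mollification -/

lemma eLpNorm_two_sq {E : Type*} [NormedAddCommGroup E] (f : Plane → E) (μ : Measure Plane) :
    eLpNorm f 2 μ ^ 2 = ∫⁻ x, ‖f x‖ₑ ^ 2 ∂μ := by
  have h := eLpNorm_nnreal_pow_eq_lintegral (f := f) (μ := μ) (p := 2) (by norm_num)
  simpa using h

/-- The translation action on `L²` is continuous because the exponent is finite. -/
lemma tendsto_translate {w : Plane → ℝ} (hw : MemLp w 2 volume) :
    Tendsto (fun z => eLpNorm (fun x => w (x - z) - w x) 2 volume) (𝓝 0) (𝓝 0) := by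
  have : Fact ((2 : ℝ≥0∞) ≠ ⊤) := ⟨by norm_num⟩
  have hc : Continuous fun z : Plane => (DomAddAct.mk (-z) +ᵥ hw.toLp w : Lp ℝ 2 volume) := by
    have h1 : Continuous fun z : Plane => DomAddAct.mk (-z) :=
      DomAddAct.continuous_mk.comp continuous_neg
    exact h1.vadd continuous_const
  have h2 := (tendsto_iff_edist_tendsto_0.1 (hc.tendsto 0))
  refine h2.congr fun z => ?_
  have e0 : (DomAddAct.mk (-(0 : Plane)) +ᵥ hw.toLp w : Lp ℝ 2 volume) = hw.toLp w := by
    rw [neg_zero, DomAddAct.mk_zero, zero_vadd]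
  rw [e0, DomAddAct.mk_vadd_toLp, Lp.edist_toLp_toLp]
  refine eLpNorm_congr_ae (ae_of_all _ fun x => ?_)
  simp [sub_eq_add_neg, add_comm]

/-- A smooth probability density supported in the ball of radius `r` around `a`. -/
structure IsKernel (k : Plane → ℝ) (a : Plane) (r : ℝ) : Prop where
  smooth : ContDiff ℝ ∞ k
  nonneg : ∀ z, 0 ≤ k z
  integral_one : ∫ z, k z = 1
  supp : ∀ z, k z ≠ 0 → ‖z - a‖ < r

lemma exists_kernel (a : Plane) {r : ℝ} (hr : 0 < r) : ∃ k, IsKernel k a r := by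
  let b : ContDiffBump (0 : Plane) := ⟨r / 2, r, by positivity, by linarith⟩
  refine ⟨fun z => b.normed volume (z - a), b.contDiff_normed.comp (contDiff_id.sub contDiff_const),
    fun z => b.nonneg_normed _, ?_, fun z hz => ?_⟩
  · rw [integral_sub_right_eq_self (fun z => b.normed volume z)]
    exact b.integral_normed
  · have : z - a ∈ Function.support (b.normed volume) := hz
    rw [b.support_normed_eq] at this
    simpa [b] using this

namespace IsKernel

variable {k : Plane → ℝ} {a : Plane} {r : ℝ}

lemma tsupport_subset (hk : IsKernel k a r) : tsupport k ⊆ Metric.closedBall a r :=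
  closure_minimal (fun z hz => by
    rw [mem_closedBall_iff_norm]
    exact (hk.supp z hz).le) Metric.isClosed_closedBall

lemma hasCompactSupport (hk : IsKernel k a r) : HasCompactSupport k :=
  (isCompact_closedBall a r).of_isClosed_subset (isClosed_tsupport k) hk.tsupport_subset

lemma integrable (hk : IsKernel k a r) : Integrable k volume :=
  hk.smooth.continuous.integrable_of_hasCompactSupport hk.hasCompactSupport

lemma integrable_mul (hk : IsKernel k a r) {w : Plane → ℝ} (hw : LocallyIntegrable w volume)
    (x : Plane) : Integrable (fun y => k (x - y) * w y) volume := by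
  have hc : HasCompactSupport fun y => k (x - y) :=
    hk.hasCompactSupport.comp_homeomorph (Homeomorph.subLeft x)
  have := hw.integrable_smul_left_of_hasCompactSupport
    (hk.smooth.continuous.comp (continuous_const.sub continuous_id)) hc
  simpa using this

end IsKernel

/-- The mollification of `w` with the kernel `k`. -/
def mol (k w : Plane → ℝ) (x : Plane) : ℝ := ∫ y, k (x - y) * w y

lemma mol_eq_convolution (k w : Plane → ℝ) :
    mol k w = (convolution k w (ContinuousLinearMap.lsmul ℝ ℝ) volume) := by
  funext x
  rw [convolution_eq_swap]
  simp [mol]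

lemma contDiff_mol {k w : Plane → ℝ} (hk : ContDiff ℝ ∞ k) (hc : HasCompactSupport k)
    (hw : LocallyIntegrable w volume) : ContDiff ℝ ∞ (mol k w) := by
  rw [mol_eq_convolution]
  exact hc.contDiff_convolution_left _ hk hw

lemma gradient_mol {k w : Plane → ℝ} (hk : ContDiff ℝ ∞ k) (hc : HasCompactSupport k)
    (hw : LocallyIntegrable w volume) (x : Plane) (i : Fin 2) :
    ∇ (mol k w) x i = mol (fun z => ∇ k z i) w x := by
  rw [gradient_apply, mol_eq_convolution,
    (hc.hasFDerivAt_convolution_left (ContinuousLinearMap.lsmul ℝ ℝ) (hk.of_le (by simp)) hw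
      x).fderiv, convolution_eq_swap, mol]
  rw [ContinuousLinearMap.integral_apply]
  · simp [gradient_apply]
  · have hcx : HasCompactSupport fun y => fderiv ℝ k (x - y) :=
      (hc.fderiv (𝕜 := ℝ)).comp_homeomorph (Homeomorph.subLeft x)
    have hcont : Continuous fun y => fderiv ℝ k (x - y) :=
      (hk.continuous_fderiv (by simp)).comp (continuous_const.sub continuous_id)
    have := hw.integrable_smul_right_of_hasCompactSupport hcont hcx
    refine this.congr (ae_of_all _ fun y => ?_)
    ext v
    simp [mul_comm]

lemma mol_sub_eq {k : Plane → ℝ} {a : Plane} {r : ℝ} (hk : IsKernel k a r) {w : Plane → ℝ}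
    (hw : LocallyIntegrable w volume) (x : Plane) (c : ℝ) :
    mol k w x - c = ∫ y, k (x - y) * (w y - c) := by
  have h1 : ∫ y, k (x - y) * c = c := by
    rw [integral_mul_const, integral_sub_left_eq_self (fun y => k y) volume x, hk.integral_one,
      one_mul]
  have hi : Integrable (fun y => k (x - y) * c) volume :=
    (hk.integrable.comp_sub_left x).mul_const c
  conv_lhs => rw [← h1]
  rw [mol, ← integral_sub (hk.integrable_mul hw x) hi]
  simp only [mul_sub]

/-- A mollification is an average, so it stays within `δ` of `c` if `w` does on the support of the
kernel. The case `δ = 0` identifies values of cut-off functions exactly. -/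
lemma abs_mol_sub_le {k : Plane → ℝ} {a : Plane} {r : ℝ} (hk : IsKernel k a r) {w : Plane → ℝ}
    (hw : LocallyIntegrable w volume) {x : Plane} {c δ : ℝ}
    (h : ∀ᵐ y, k (x - y) ≠ 0 → |w y - c| ≤ δ) : |mol k w x - c| ≤ δ := by
  rw [mol_sub_eq hk hw]
  have hi : Integrable (fun y => k (x - y) * δ) volume :=
    (hk.integrable.comp_sub_left x).mul_const δ
  have h1 : ∫ y, k (x - y) * δ = δ := by
    rw [integral_mul_const, integral_sub_left_eq_self (fun y => k y) volume x, hk.integral_one,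
      one_mul]
  rw [← Real.norm_eq_abs, ← h1]
  refine norm_integral_le_of_norm_le hi ?_
  filter_upwards [h] with y hy
  rw [norm_mul, Real.norm_of_nonneg (hk.nonneg _)]
  by_cases h0 : k (x - y) = 0
  · simp [h0]
  · exact mul_le_mul_of_nonneg_left (hy h0) (hk.nonneg _)

/-- Jensen's inequality for the probability measure with density `k`, in the form that the `L¹` norm
is at most the `L²` norm. -/
lemma enorm_mol_sub_sq_le {k : Plane → ℝ} {a : Plane} {r : ℝ} (hk : IsKernel k a r) {w : Plane → ℝ}
    (hw : LocallyIntegrable w volume) (hwm : Measurable w) (x : Plane) :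
    ‖mol k w x - w x‖ₑ ^ 2 ≤ ∫⁻ z, ENNReal.ofReal (k z) * ‖w (x - z) - w x‖ₑ ^ 2 := by
  have hkm : Measurable fun z => ENNReal.ofReal (k z) :=
    hk.smooth.continuous.measurable.ennreal_ofReal
  set ν := (volume : Measure Plane).withDensity fun z => ENNReal.ofReal (k z) with hν
  have hp : IsProbabilityMeasure ν := by
    constructor
    rw [hν, withDensity_apply _ MeasurableSet.univ, Measure.restrict_univ,
      ← ofReal_integral_eq_lintegral_ofReal hk.integrable (ae_of_all _ hk.nonneg), hk.integral_one,
      ENNReal.ofReal_one]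
  have hfm : Measurable fun z => w (x - z) - w x :=
    (hwm.comp (measurable_const.sub measurable_id)).sub measurable_const
  have h1 : ‖mol k w x - w x‖ₑ ≤ ∫⁻ z, ‖w (x - z) - w x‖ₑ ∂ν := by
    rw [mol_sub_eq hk hw]
    refine (enorm_integral_le_lintegral_enorm _).trans (le_of_eq ?_)
    rw [hν, lintegral_withDensity_eq_lintegral_mul _ hkm hfm.enorm,
      ← lintegral_sub_left_eq_self _ x]
    refine lintegral_congr fun z => ?_
    simp only [sub_sub_cancel, Pi.mul_apply, enorm_mul]
    rw [Real.enorm_of_nonneg (hk.nonneg _)]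
  have h2 := eLpNorm_le_eLpNorm_of_exponent_le (μ := ν) (p := 1) (q := 2) (by norm_num)
    hfm.aestronglyMeasurable
  rw [eLpNorm_one_eq_lintegral_enorm] at h2
  calc ‖mol k w x - w x‖ₑ ^ 2 ≤ (eLpNorm (fun z => w (x - z) - w x) 2 ν) ^ 2 := by
        gcongr
        exact h1.trans h2
    _ = ∫⁻ z, ‖w (x - z) - w x‖ₑ ^ 2 ∂ν := by
        rw [eLpNorm_two_sq]
    _ = _ := by
        rw [hν, lintegral_withDensity_eq_lintegral_mul _ hkm (hfm.enorm.pow_const 2)]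
        rfl

/-- Jensen and Fubini bound the error by an average of translation errors over the support of the
kernel. The centres `a n` need not be zero; it is enough that they and the radii tend to zero, which
allows kernels shifted into the domain. -/
lemma tendsto_mol {k : ℕ → Plane → ℝ} {a : ℕ → Plane} {r : ℕ → ℝ}
    (hk : ∀ n, IsKernel (k n) (a n) (r n)) (ha : Tendsto a atTop (𝓝 0))
    (hr : Tendsto r atTop (𝓝 0)) {w : Plane → ℝ} (hw : MemLp w 2 volume) (hwm : Measurable w) :
    Tendsto (fun n => eLpNorm (fun x => mol (k n) w x - w x) 2 volume) atTop (𝓝 0) := by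
  have hloc : LocallyIntegrable w volume := hw.locallyIntegrable (by norm_num)
  rw [ENNReal.tendsto_nhds_zero]
  intro δ hδ
  have ht := (ENNReal.tendsto_nhds_zero.1 (tendsto_translate hw)) δ hδ
  rw [Metric.eventually_nhds_iff] at ht
  obtain ⟨η, hη, ht⟩ := ht
  have e1 : ∀ᶠ n in atTop, ‖a n‖ < η / 2 := by
    have := ha.norm
    rw [norm_zero] at this
    exact this.eventually_lt_const (by positivity)
  have e2 : ∀ᶠ n in atTop, r n < η / 2 := hr.eventually_lt_const (by positivity)
  filter_upwards [e1, e2] with n h1 h2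
  have hsq : (eLpNorm (fun x => mol (k n) w x - w x) 2 volume) ^ 2 ≤ δ ^ 2 := by
    rw [eLpNorm_two_sq]
    have hm : Measurable (Function.uncurry fun x z : Plane =>
        ENNReal.ofReal (k n z) * ‖w (x - z) - w x‖ₑ ^ 2) := by
      refine Measurable.mul (f := fun p : Plane × Plane => ENNReal.ofReal (k n p.2))
        (g := fun p : Plane × Plane => ‖w (p.1 - p.2) - w p.1‖ₑ ^ 2) ?_ ?_
      · exact ((hk n).smooth.continuous.measurable.comp measurable_snd).ennreal_ofReal
      · exact (((hwm.comp (measurable_fst.sub measurable_snd)).sub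
          (hwm.comp measurable_fst)).enorm).pow_const 2
    calc ∫⁻ x, ‖mol (k n) w x - w x‖ₑ ^ 2
        ≤ ∫⁻ x, ∫⁻ z, ENNReal.ofReal (k n z) * ‖w (x - z) - w x‖ₑ ^ 2 :=
          lintegral_mono fun x => enorm_mol_sub_sq_le (hk n) hloc hwm x
      _ = ∫⁻ z, ∫⁻ x, ENNReal.ofReal (k n z) * ‖w (x - z) - w x‖ₑ ^ 2 :=
          lintegral_lintegral_swap hm.aemeasurable
      _ ≤ ∫⁻ z, ENNReal.ofReal (k n z) * δ ^ 2 := by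
          refine lintegral_mono fun z => ?_
          simp only
          have hmz : Measurable fun x => ‖w (x - z) - w x‖ₑ ^ 2 :=
            ((hwm.comp (measurable_id.sub measurable_const)).sub hwm).enorm.pow_const 2
          rw [lintegral_const_mul _ hmz]
          by_cases h0 : k n z = 0
          · simp [h0]
          · gcongr
            have hz : dist z 0 < η := by
              rw [dist_zero_right]
              have := (hk n).supp z h0
              calc ‖z‖ = ‖(z - a n) + a n‖ := by simp
                _ ≤ ‖z - a n‖ + ‖a n‖ := norm_add_le _ _
                _ < η := by linarith
            have h5 := ht hz
            rw [← eLpNorm_two_sq]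
            gcongr
      _ = δ ^ 2 := by
          rw [lintegral_mul_const _ (hk n).smooth.continuous.measurable.ennreal_ofReal,
            ← ofReal_integral_eq_lintegral_ofReal (hk n).integrable (ae_of_all _ (hk n).nonneg),
            (hk n).integral_one, ENNReal.ofReal_one, one_mul]
  exact (ENNReal.pow_le_pow_left_iff (by norm_num)).1 hsq

/-! ### Lipschitz domains: local cones -/

/-- The unit vector pointing upwards in the coordinates given by `e`. -/
def up (e : Plane ≃ₗᵢ[ℝ] Plane) : Plane := e.symm (EuclideanSpace.single 1 1)

lemma map_add_up (e : Plane ≃ₗᵢ[ℝ] Plane) (y : Plane) (t : ℝ) :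
    e (y + t • up e) = e y + t • EuclideanSpace.single 1 1 := by
  simp [up]

lemma norm_up (e : Plane ≃ₗᵢ[ℝ] Plane) : ‖up e‖ = 1 := by
  simp [up]

/-- Moving a point above a Lipschitz graph upwards by `t` leaves room for a ball of radius
proportional to `t` above the graph. Near interior points `τ = 0` works. -/
lemma IsLipschitzDomain.cone (hΩ : IsLipschitzDomain Ω) {x : Plane} (hx : x ∈ closure Ω) :
    ∃ (W : Set Plane) (τ : Plane) (c t₀ : ℝ), IsOpen W ∧ x ∈ W ∧ Bornology.IsBounded W ∧ 0 < c ∧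
      0 < t₀ ∧ ∀ y ∈ W ∩ Ω, ∀ t ∈ Set.Ioo 0 t₀, Metric.ball (y + t • τ) (c * t) ⊆ Ω := by
  by_cases hxΩ : x ∈ Ω
  · obtain ⟨r, hr, hrΩ⟩ := Metric.isOpen_iff.1 hΩ.2.1 x hxΩ
    refine ⟨Metric.ball x (r / 2), 0, 1, r / 2, Metric.isOpen_ball, Metric.mem_ball_self (by positivity),
      Metric.isBounded_ball, one_pos, by positivity, fun y hy t ht z hz => hrΩ ?_⟩
    have h1 := Metric.mem_ball.1 hy.1
    have h2 := Metric.mem_ball.1 hz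
    simp only [smul_zero, add_zero, one_mul] at h2
    exact Metric.mem_ball.2 ((dist_triangle z y x).trans_lt (by linarith [ht.2]))
  · have hfr : x ∈ frontier Ω := by
      rw [hΩ.2.1.frontier_eq]; exact ⟨hx, hxΩ⟩
    obtain ⟨e, L, θ, hθ, hev⟩ := hΩ.2.2 x hfr
    obtain ⟨δ, hδ, hball⟩ := Metric.eventually_nhds_iff.1 hev
    have hL : (0 : ℝ) < L + 1 := by positivity
    refine ⟨Metric.ball x (δ / 2), up e, (L + 1 : ℝ)⁻¹, δ / 4, Metric.isOpen_ball,
      Metric.mem_ball_self (by positivity), Metric.isBounded_ball, by positivity, by positivity,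
      fun y hy t ht z hz => ?_⟩
    have h1 := Metric.mem_ball.1 hy.1
    have h2 := Metric.mem_ball.1 hz
    have ht0 : 0 < t := ht.1
    have ht1 := ht.2
    have hct : (L + 1 : ℝ)⁻¹ * t ≤ t := by
      have : (L + 1 : ℝ)⁻¹ ≤ 1 := inv_le_one_of_one_le₀ (by simp)
      nlinarith
    have hdyt : dist (y + t • up e) y = t := by
      simp [norm_smul, norm_up, abs_of_pos ht0]
    have hzy : dist z y < 2 * t := by
      calc dist z y ≤ dist z (y + t • up e) + dist (y + t • up e) y := dist_triangle _ _ _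
        _ < 2 * t := by rw [hdyt]; linarith
    have hyΩ := (hball (y := y) (by linarith)).1 hy.2
    refine (hball (y := z) ?_).2 ?_
    · linarith [dist_triangle z y x]
    · have hd : ‖e z - (e y + t • EuclideanSpace.single 1 1)‖ < (L + 1 : ℝ)⁻¹ * t := by
        rw [← map_add_up, ← map_sub, LinearIsometryEquiv.norm_map, ← dist_eq_norm]
        exact h2
      have c0 := (abs_coord_le _ 0).trans_lt hd
      have c1 := (abs_coord_le _ 1).trans_lt hd
      simp only [PiLp.sub_apply, PiLp.add_apply, PiLp.smul_apply, smul_eq_mul] at c0 c1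
      simp at c0 c1
      have hlip := hθ.dist_le_mul (e z 0) (e y 0)
      rw [Real.dist_eq, Real.dist_eq] at hlip
      have hlip2 : θ (e z 0) - θ (e y 0) ≤ L * ((L + 1 : ℝ)⁻¹ * t) :=
        (le_abs_self _).trans (hlip.trans (by gcongr))
      have c1' := (abs_lt.1 c1).1
      -- The rise of the graph, at most `L * (c * t)`, and the vertical loss, less than `c * t`, use
      -- up exactly the upward shift `t`. This dictates `c = 1 / (L + 1)`.
      have hsum : L * ((L + 1 : ℝ)⁻¹ * t) + (L + 1 : ℝ)⁻¹ * t = t := by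
        field_simp
      linarith

/-- A boundary point has points strictly below the graph arbitrarily near it, and these have
neighbourhoods free of `Ω`. Hence the domain has no slits, and sets filled by closed triangles can
be compared with `Ω` itself. -/
lemma IsLipschitzDomain.interior_closure (hΩ : IsLipschitzDomain Ω) : interior (closure Ω) = Ω := by
  refine Set.Subset.antisymm (fun x hx => ?_) (interior_maximal subset_closure hΩ.2.1)
  by_contra hxΩ
  have hxc := interior_subset hx
  have hfr : x ∈ frontier Ω := by
    rw [hΩ.2.1.frontier_eq]; exact ⟨hxc, hxΩ⟩
  obtain ⟨e, L, θ, hθ, hev⟩ := hΩ.2.2 x hfr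
  have hev2 := hev.and (isOpen_interior.mem_nhds hx)
  obtain ⟨δ, hδ, hball⟩ := Metric.eventually_nhds_iff.1 hev2
  have hle : e x 1 ≤ θ (e x 0) := by
    by_contra! hlt
    exact hxΩ ((hball (y := x) (by simpa using hδ)).1.2 hlt)
  set z : Plane := x + (-(δ / 2)) • up e with hz
  have hzx : dist z x < δ := by
    simp only [hz, dist_eq_norm, add_sub_cancel_left, norm_smul, norm_up, norm_neg, mul_one,
      Real.norm_eq_abs]
    rw [abs_of_pos (by positivity)]
    linarith
  have hzc := interior_subset (hball hzx).2
  have hopen : IsOpen {y : Plane | e y 1 < θ (e y 0)} := by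
    refine isOpen_lt ?_ ?_
    · exact (EuclideanSpace.proj (𝕜 := ℝ) 1).continuous.comp e.continuous
    · exact hθ.continuous.comp ((EuclideanSpace.proj (𝕜 := ℝ) 0).continuous.comp e.continuous)
  have hzm : z ∈ {y : Plane | e y 1 < θ (e y 0)} ∩ Metric.ball x δ := by
    refine ⟨?_, hzx⟩
    simp only [Set.mem_ofPred_eq, hz, map_add_up]
    simp
    linarith
  obtain ⟨y, hy, hyΩ⟩ := mem_closure_iff.1 hzc _ (hopen.inter Metric.isOpen_ball) hzm
  have := ((hball (y := y) hy.2).1).1 hyΩ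
  exact absurd this (not_lt.2 (le_of_lt hy.1))

/-! ### Approximation by smooth functions, locally -/

lemma gradient_finset_sum {ι : Type*} (s : Finset ι) {f : ι → Plane → ℝ}
    (hf : ∀ i ∈ s, ContDiff ℝ ∞ (f i)) (x : Plane) :
    ∇ (fun y => ∑ i ∈ s, f i y) x = ∑ i ∈ s, ∇ (f i) x := by
  ext l
  rw [gradient_apply, fderiv_fun_sum fun i hi => (hf i hi).differentiable (by simp) x]
  simp [gradient_apply, WithLp.ofLp_sum]

lemma gradient_congr_of_eqOn (hU : IsOpen U) {f g : Plane → ℝ} (h : Set.EqOn f g U) {x : Plane}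
    (hx : x ∈ U) : ∇ f x = ∇ g x :=
  Filter.EventuallyEq.gradient_eq (h.eventuallyEq_of_mem (hU.mem_nhds hx))

/-- The kernels are centred at `-t τ`, so mollification at `x` averages over a ball around `x + t
τ`, which the cone condition places inside `Ω`. The alternative `x = y` gives the same conclusion at
points of `K ∩ closure Ω` for which the kernel does not reach `K`; pointwise convergence up to the
boundary needs it. -/
lemma exists_kernels {W : Set Plane} {τ : Plane} {c t₀ : ℝ} (hW : IsOpen W)
    (hc : 0 < c)
    (ht₀ : 0 < t₀) (hcone : ∀ y ∈ W ∩ Ω, ∀ t ∈ Set.Ioo 0 t₀, Metric.ball (y + t • τ) (c * t) ⊆ Ω)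
    {K : Set Plane} (hK : IsCompact K) (hKW : K ⊆ W) :
    ∃ (k : ℕ → Plane → ℝ) (a : ℕ → Plane) (r : ℕ → ℝ), (∀ n, IsKernel (k n) (a n) (r n)) ∧
      Tendsto a atTop (𝓝 0) ∧ Tendsto r atTop (𝓝 0) ∧
      (∀ n, ∀ x ∈ closure Ω, ∀ y ∈ K, k n (x - y) ≠ 0 ∨ x = y →
        Metric.closedBall (x - a n) (r n) ⊆ Ω) := by
  obtain ⟨d, hd, hdW⟩ := hK.exists_thickening_subset_open hW hKW
  -- The first bound keeps the shift below `t₀`. The second keeps every `x` whose kernel reaches `K`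
  -- within distance `d` of `K`, hence in `W`.
  set t₁ : ℝ := min (t₀ / 2) (d / (2 * (‖τ‖ + c))) with ht₁
  have ht₁pos : 0 < t₁ := by positivity
  let t : ℕ → ℝ := fun n => t₁ * (1 / ((n : ℝ) + 1))
  have htpos : ∀ n, 0 < t n := fun n => by positivity
  have htle : ∀ n, t n ≤ t₁ := fun n => by
    have : (1 : ℝ) / ((n : ℝ) + 1) ≤ 1 := by
      rw [div_le_one (by positivity)]; simp
    simp only [t]
    nlinarith
  have htt : Tendsto t atTop (𝓝 0) := by
    have := (tendsto_one_div_add_atTop_nhds_zero_nat (𝕜 := ℝ)).const_mul t₁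
    simpa [t] using this
  choose k hk using fun n => exists_kernel (-(t n • τ)) (r := c * t n / 2)
    (by have := htpos n; positivity)
  refine ⟨k, fun n => -(t n • τ), fun n => c * t n / 2, hk, ?_, ?_, ?_⟩
  · simpa using (htt.smul_const τ).neg
  · simpa using (htt.const_mul c).div_const 2
  · intro n x hx y hy hne z hz
    have hxW : x ∈ W := by
      rcases hne with hne | rfl
      swap
      · exact hKW hy
      have h1 := (hk n).supp _ hne
      refine hdW (Metric.mem_thickening_iff.2 ⟨y, hy, ?_⟩)
      rw [dist_eq_norm]
      calc ‖x - y‖ = ‖(x - y - -(t n • τ)) - t n • τ‖ := by congr 1; abel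
        _ ≤ ‖x - y - -(t n • τ)‖ + ‖t n • τ‖ := norm_sub_le _ _
        _ < c * t n + t n * ‖τ‖ := by
            rw [norm_smul, Real.norm_of_nonneg (htpos n).le]
            have := htpos n
            nlinarith
        _ = (‖τ‖ + c) * t n := by ring
        _ ≤ (‖τ‖ + c) * (d / (2 * (‖τ‖ + c))) := by
            gcongr
            exact (htle n).trans (min_le_right _ _)
        _ = d / 2 := by field_simp
        _ < d := by linarith
    have hz' : z ∈ Metric.ball (x + t n • τ) (c * t n) := by
      rw [sub_neg_eq_add] at hz
      refine Metric.closedBall_subset_ball ?_ hz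
      have := htpos n
      nlinarith [mul_pos hc (htpos n)]
    -- The cone condition holds only at points of `Ω`. Membership of `z` in the ball is an open
    -- condition on its base point, so `x ∈ closure Ω` may be replaced by a nearby point of `Ω`.
    have hopen : IsOpen {x' | x' ∈ W ∧ z ∈ Metric.ball (x' + t n • τ) (c * t n)} := by
      refine hW.inter ?_
      exact isOpen_lt (f := fun x' => dist z (x' + t n • τ)) (by fun_prop) continuous_const
    obtain ⟨x', hx', hx'Ω⟩ := mem_closure_iff.1 hx _ hopen ⟨hxW, hz'⟩
    refine hcone x' ⟨hx'.1, hx'Ω⟩ (t n) ⟨htpos n, ?_⟩ hx'.2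
    have := (htle n).trans (min_le_left _ _)
    linarith

lemma locallyIntegrable_indicator (hΩo : IsOpen Ω) {w : Plane → ℝ}
    (hw : MemLp w 2 (volume.restrict Ω)) : LocallyIntegrable (Ω.indicator w) volume :=
  ((memLp_indicator_iff_restrict hΩo.measurableSet).2 hw).locallyIntegrable (by norm_num)

/-- If the kernel at `x` reaches `K`, its whole support lies in `Ω`, so `k (x - ·)` is a test
function and the weak gradient applies. Otherwise both sides vanish. -/
lemma gradient_mol_indicator (hΩo : IsOpen Ω) {k : Plane → ℝ} {a : Plane} {r : ℝ}
    (hk : IsKernel k a r) {K : Set Plane}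
    (hgeo : ∀ x ∈ closure Ω, ∀ y ∈ K, k (x - y) ≠ 0 ∨ x = y → Metric.closedBall (x - a) r ⊆ Ω)
    {w : Plane → ℝ} {G : Plane → Plane} (h : WG Ω w G) (hw : ∀ x ∉ K, w x = 0)
    (hG : ∀ x ∉ K, G x = 0) {x : Plane} (hx : x ∈ Ω) (i : Fin 2) :
    ∇ (mol k (Ω.indicator w)) x i = mol k (Ω.indicator fun y => G y i) x := by
  rw [gradient_mol hk.smooth hk.hasCompactSupport (locallyIntegrable_indicator hΩo h.fn)]
  by_cases hex : ∃ y ∈ K, k (x - y) ≠ 0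
  · obtain ⟨y, hy, hne⟩ := hex
    have hsub := hgeo x (subset_closure hx) y hy (Or.inl hne)
    have htest : IsTestFun Ω (fun y => k (x - y)) := by
      refine ⟨hk.smooth.comp (contDiff_const.sub contDiff_id),
        hk.hasCompactSupport.comp_homeomorph (Homeomorph.subLeft x), ?_⟩
      refine (closure_minimal (fun z hz => ?_) Metric.isClosed_closedBall).trans hsub
      have := hk.supp (x - z) hz
      rw [mem_closedBall_iff_norm]
      calc ‖z - (x - a)‖ = ‖x - z - a‖ := by rw [← norm_neg]; congr 1; abel
        _ ≤ r := this.le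
    have hgr : ∀ y, ∇ (fun y => k (x - y)) y i = - ∇ k (x - y) i := by
      intro y
      rw [gradient_apply, gradient_apply]
      have hd : HasFDerivAt (fun y => k (x - y)) ((fderiv ℝ k (x - y)).comp
          (-ContinuousLinearMap.id ℝ Plane)) y := by
        refine HasFDerivAt.comp y (hk.smooth.differentiable (by simp) (x - y)).hasFDerivAt ?_
        exact (hasFDerivAt_id y).const_sub x
      rw [hd.fderiv]
      simp
    have := h.weak _ htest i
    simp only [hgr] at this
    have e1 : mol (fun z => ∇ k z i) (Ω.indicator w) x = ∫ y in Ω, w y * ∇ k (x - y) i := by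
      rw [mol, ← integral_indicator hΩo.measurableSet]
      refine integral_congr_ae (ae_of_all _ fun y => ?_)
      by_cases hy : y ∈ Ω <;> simp [hy, mul_comm]
    have e2 : mol k (Ω.indicator fun y => G y i) x = ∫ y in Ω, G y i * k (x - y) := by
      rw [mol, ← integral_indicator hΩo.measurableSet]
      refine integral_congr_ae (ae_of_all _ fun y => ?_)
      by_cases hy : y ∈ Ω <;> simp [hy, mul_comm]
    rw [e1, e2]
    simp only [mul_neg, integral_neg] at this
    linarith
  · push Not at hex
    have z1 : ∀ y ∈ K, ∇ k (x - y) = 0 := by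
      intro y hy
      -- The kernel is nonnegative, so its zeros are minima and its gradient vanishes there too.
      have hmin : IsLocalMin k (x - y) :=
        Filter.Eventually.of_forall fun z => by rw [hex y hy]; exact hk.nonneg z
      simp [gradient, hmin.fderiv_eq_zero]
    have e1 : ∀ y, ∇ k (x - y) i * Ω.indicator w y = 0 := by
      intro y
      by_cases hy : y ∈ K
      · simp [z1 y hy]
      · simp [Set.indicator, hw y hy]
    have e2 : ∀ y, k (x - y) * Ω.indicator (fun y => G y i) y = 0 := by
      intro y
      by_cases hy : y ∈ K
      · simp [hex y hy]
      · simp [Set.indicator, hG y hy]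
    simp [mol, e1, e2]

lemma tendsto_mol_indicator (hΩo : IsOpen Ω) {k : ℕ → Plane → ℝ} {a : ℕ → Plane} {r : ℕ → ℝ}
    (hk : ∀ n, IsKernel (k n) (a n) (r n)) (ha : Tendsto a atTop (𝓝 0))
    (hr : Tendsto r atTop (𝓝 0)) {w : Plane → ℝ} (hw : MemLp w 2 (volume.restrict Ω))
    (hwm : Measurable w) :
    Tendsto (fun n => eLpNorm (fun x => mol (k n) (Ω.indicator w) x - w x) 2 (volume.restrict Ω))
      atTop (𝓝 0) := by
  have h := tendsto_mol hk ha hr ((memLp_indicator_iff_restrict hΩo.measurableSet).2 hw)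
    (hwm.indicator hΩo.measurableSet)
  refine tendsto_of_tendsto_of_tendsto_of_le_of_le tendsto_const_nhds h (fun _ => zero_le)
    fun n => ?_
  refine le_trans (le_of_eq ?_) (eLpNorm_mono_measure _ (Measure.restrict_le_self (s := Ω)))
  refine eLpNorm_congr_ae ((ae_restrict_iff' hΩo.measurableSet).2 (ae_of_all _ fun x hx => ?_))
  simp [hx]

lemma tendsto_eLpNorm_of_coord {μ : Measure Plane} {F : ℕ → Plane → Plane}
    (hm : ∀ n, AEStronglyMeasurable (F n) μ)
    (h : ∀ i : Fin 2, Tendsto (fun n => eLpNorm (fun x => F n x i) 2 μ) atTop (𝓝 0)) :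
    Tendsto (fun n => eLpNorm (F n) 2 μ) atTop (𝓝 0) := by
  have h2 := (h 0).add (h 1)
  rw [add_zero] at h2
  refine tendsto_of_tendsto_of_tendsto_of_le_of_le tendsto_const_nhds h2 (fun _ => zero_le)
    fun n => ?_
  have hmi : ∀ i : Fin 2, AEStronglyMeasurable (fun x => F n x i) μ := fun i =>
    (EuclideanSpace.proj (𝕜 := ℝ) i).continuous.comp_aestronglyMeasurable (hm n)
  calc eLpNorm (F n) 2 μ ≤ eLpNorm (fun x => |F n x 0| + |F n x 1|) 2 μ := by
        refine eLpNorm_mono_real fun x => norm_le_sum_coord _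
    _ ≤ eLpNorm (fun x => |F n x 0|) 2 μ + eLpNorm (fun x => |F n x 1|) 2 μ :=
        eLpNorm_add_le (hmi 0).norm (hmi 1).norm (by norm_num)
    _ = _ := by
        congr 1 <;> exact eLpNorm_norm (F := ℝ) _

lemma tendstoH1_mol (hΩo : IsOpen Ω) {k : ℕ → Plane → ℝ} {a : ℕ → Plane} {r : ℕ → ℝ}
    (hk : ∀ n, IsKernel (k n) (a n) (r n)) (ha : Tendsto a atTop (𝓝 0))
    (hr : Tendsto r atTop (𝓝 0)) {K : Set Plane}
    (hgeo : ∀ n, ∀ x ∈ closure Ω, ∀ y ∈ K, k n (x - y) ≠ 0 ∨ x = y →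
      Metric.closedBall (x - a n) (r n) ⊆ Ω)
    {w : Plane → ℝ} {G : Plane → Plane} (h : WG Ω w G) (hwm : Measurable w) (hGm : Measurable G)
    (hw : ∀ x ∉ K, w x = 0) (hG : ∀ x ∉ K, G x = 0) :
    TendstoH1 Ω (fun n => mol (k n) (Ω.indicator w)) w G := by
  refine ⟨tendsto_mol_indicator hΩo hk ha hr h.fn hwm, tendsto_eLpNorm_of_coord (fun n => ?_) ?_⟩
  · exact ((continuous_gradient (contDiff_mol (hk n).smooth (hk n).hasCompactSupport
      (locallyIntegrable_indicator hΩo h.fn))).aestronglyMeasurable).sub h.grad.1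
  · intro i
    have hGi : Measurable fun x => G x i :=
      (EuclideanSpace.proj (𝕜 := ℝ) i).continuous.measurable.comp hGm
    refine (tendsto_mol_indicator hΩo hk ha hr (memLp_coord' h.grad i) hGi).congr fun n => ?_
    refine eLpNorm_congr_ae ((ae_restrict_iff' hΩo.measurableSet).2 (ae_of_all _ fun x hx => ?_))
    simp only [PiLp.sub_apply]
    rw [gradient_mol_indicator hΩo (hk n) (hgeo n) h hw hG hx]

lemma TendstoH1.congr {φ ψ : ℕ → Plane → ℝ} {u v : Plane → ℝ} {G H : Plane → Plane}
    (h : TendstoH1 Ω φ u G) (hΩo : IsOpen Ω) (hφ : ∀ n, Set.EqOn (φ n) (ψ n) Ω)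
    (hu : u =ᵐ[volume.restrict Ω] v) (hG : G =ᵐ[volume.restrict Ω] H) : TendstoH1 Ω ψ v H := by
  refine ⟨h.1.congr fun n => eLpNorm_congr_ae ?_, h.2.congr fun n => eLpNorm_congr_ae ?_⟩
  · filter_upwards [hu, ae_restrict_mem hΩo.measurableSet] with x hx hxΩ
    rw [hx, hφ n hxΩ]
  · filter_upwards [hG, ae_restrict_mem hΩo.measurableSet] with x hx hxΩ
    rw [hx, gradient_congr_of_eqOn hΩo (hφ n) hxΩ]

lemma tendsto_eLpNorm_sum {E : Type*} [NormedAddCommGroup E] {μ : Measure Plane} {ι : Type*}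
    (s : Finset ι) {f : ι → ℕ → Plane → E} (hm : ∀ i ∈ s, ∀ n, AEStronglyMeasurable (f i n) μ)
    (h : ∀ i ∈ s, Tendsto (fun n => eLpNorm (f i n) 2 μ) atTop (𝓝 0)) :
    Tendsto (fun n => eLpNorm (fun x => ∑ i ∈ s, f i n x) 2 μ) atTop (𝓝 0) := by
  have h2 := tendsto_finsetSum s h
  rw [Finset.sum_const_zero] at h2
  refine tendsto_of_tendsto_of_tendsto_of_le_of_le tendsto_const_nhds h2 (fun _ => zero_le)
    fun n => ?_
  have := eLpNorm_sum_le (μ := μ) (p := 2) (f := fun i => f i n) (s := s) (fun i hi => hm i hi n)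
    (by norm_num)
  refine le_trans (le_of_eq ?_) this
  congr 1
  funext x
  simp

lemma TendstoH1.sum {ι : Type*} (s : Finset ι) {φ : ι → ℕ → Plane → ℝ} {u : ι → Plane → ℝ}
    {G : ι → Plane → Plane} (hφ : ∀ i ∈ s, ∀ n, ContDiff ℝ ∞ (φ i n))
    (hu : ∀ i ∈ s, AEStronglyMeasurable (u i) (volume.restrict Ω))
    (hG : ∀ i ∈ s, AEStronglyMeasurable (G i) (volume.restrict Ω))
    (h : ∀ i ∈ s, TendstoH1 Ω (φ i) (u i) (G i)) :
    TendstoH1 Ω (fun n x => ∑ i ∈ s, φ i n x) (fun x => ∑ i ∈ s, u i x)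
      (fun x => ∑ i ∈ s, G i x) := by
  constructor
  · simp only [← Finset.sum_sub_distrib]
    exact tendsto_eLpNorm_sum s (fun i hi n =>
      (hφ i hi n).continuous.aestronglyMeasurable.sub (hu i hi)) fun i hi => (h i hi).1
  · simp only [gradient_finset_sum s fun i hi => hφ i hi _, ← Finset.sum_sub_distrib]
    exact tendsto_eLpNorm_sum s (fun i hi n =>
      (continuous_gradient (hφ i hi n)).aestronglyMeasurable.sub (hG i hi)) fun i hi => (h i hi).2

/-! ### Approximation by smooth functions, globally -/

lemma IsLipschitzDomain.exists_partition (hΩ : IsLipschitzDomain Ω) :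
    ∃ (ι : Type) (_ : Fintype ι) (W : ι → Set Plane) (τ : ι → Plane) (c t₀ : ι → ℝ)
      (ζ : ι → Plane → ℝ), (∀ i, IsOpen (W i) ∧ 0 < c i ∧ 0 < t₀ i ∧
        ∀ y ∈ W i ∩ Ω, ∀ t ∈ Set.Ioo 0 (t₀ i), Metric.ball (y + t • τ i) (c i * t) ⊆ Ω) ∧
      (∀ i, ContDiff ℝ ∞ (ζ i) ∧ tsupport (ζ i) ⊆ W i ∧ IsCompact (tsupport (ζ i))) ∧
      ∀ x ∈ closure Ω, ∑ i, ζ i x = 1 := by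
  have hcone := fun x : closure Ω => hΩ.cone x.2
  choose W τ c t₀ hWo hxW hWb hc ht₀ hW using hcone
  obtain ⟨s, hs⟩ := hΩ.1.isCompact_closure.elim_finite_subcover W hWo
    (fun x hx => Set.mem_iUnion.2 ⟨⟨x, hx⟩, hxW ⟨x, hx⟩⟩)
  obtain ⟨f, hf⟩ := SmoothPartitionOfUnity.exists_isSubordinate
    (modelWithCornersSelf ℝ Plane) (isClosed_closure (s := Ω)) (fun i : s => W i) (fun i => hWo i)
    (by
      intro x hx
      obtain ⟨i, hi, hxi⟩ := Set.mem_iUnion₂.1 (hs hx)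
      exact Set.mem_iUnion.2 ⟨⟨i, hi⟩, hxi⟩)
  refine ⟨s, inferInstance, fun i => W i, fun i => τ i, fun i => c i, fun i => t₀ i,
    fun i => f i, fun i => ⟨hWo i, hc i, ht₀ i, hW i⟩, fun i => ⟨(f i).contMDiff.contDiff, hf i, ?_⟩,
    fun x hx => ?_⟩
  · exact (hWb i).isCompact_closure.of_isClosed_subset (isClosed_tsupport _)
      ((hf i).trans subset_closure)
  · rw [← finsum_eq_sum_of_fintype]
    exact f.sum_eq_one hx

lemma measurable_coord {G : Plane → Plane} (hG : Measurable G) (i : Fin 2) :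
    Measurable fun x => G x i :=
  (EuclideanSpace.proj (𝕜 := ℝ) i).continuous.measurable.comp hG

/-- Functions in `H¹(Ω)` are limits of smooth functions on the plane, which converge pointwise on
`closure Ω` if the function is continuous there, and in `H²(Ω)` if the function is in `H²(Ω)`. -/
theorem IsLipschitzDomain.exists_smooth_approx (hΩ : IsLipschitzDomain Ω) {u : Plane → ℝ}
    {G : Plane → Plane} (h : WG Ω u G) (hum : Measurable u) (hGm : Measurable G) :
    ∃ φ : ℕ → Plane → ℝ, (∀ n, ContDiff ℝ ∞ (φ n)) ∧ TendstoH1 Ω φ u G ∧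
      (ContinuousOn u (closure Ω) → ∀ x ∈ closure Ω, Tendsto (fun n => φ n x) atTop (𝓝 (u x))) ∧
      ∀ H : Fin 2 → Plane → Plane, (∀ l, Measurable (H l)) →
        (∀ l, WG Ω (fun x => G x l) (H l)) →
        ∀ l, TendstoH1 Ω (fun n x => ∇ (φ n) x l) (fun x => G x l) (H l) := by
  obtain ⟨ι, _, W, τ, c, t₀, ζ, hW, hζ, hsum⟩ := hΩ.exists_partition
  have hΩo := hΩ.2.1
  have hker := fun i => exists_kernels (hW i).1 (hW i).2.1 (hW i).2.2.1 (hW i).2.2.2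
    (hζ i).2.2 (hζ i).2.1
  choose k a r hk ha hr hgeo using hker
  have hzs : ∀ i, ∀ x ∉ tsupport (ζ i), ζ i x = 0 := fun i x hx => image_eq_zero_of_notMem_tsupport hx
  have hzg : ∀ i, ∀ x ∉ tsupport (ζ i), ∇ (ζ i) x = 0 := fun i x hx => by
    have : fderiv ℝ (ζ i) x = 0 := by
      by_contra hne
      exact hx (tsupport_fderiv_subset ℝ (f := ζ i) (subset_tsupport _ hne))
    simp [gradient, this]
  have hζm : ∀ i, Measurable (ζ i) := fun i => (hζ i).1.continuous.measurable
  have hζgm : ∀ i, Measurable (∇ (ζ i)) := fun i => (continuous_gradient (hζ i).1).measurable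
  let w : ι → Plane → ℝ := fun i x => ζ i x * u x
  let Gw : ι → Plane → Plane := fun i x => ζ i x • G x + u x • ∇ (ζ i) x
  have hw : ∀ i, WG Ω (w i) (Gw i) := fun i => h.mul hΩ.1 hΩo (hζ i).1
  have hwm : ∀ i, Measurable (w i) := fun i => (hζm i).mul hum
  have hGwm : ∀ i, Measurable (Gw i) := fun i => ((hζm i).smul hGm).add (hum.smul (hζgm i))
  have hw0 : ∀ i, ∀ x ∉ tsupport (ζ i), w i x = 0 := fun i x hx => by simp [w, hzs i x hx]
  have hGw0 : ∀ i, ∀ x ∉ tsupport (ζ i), Gw i x = 0 := fun i x hx => by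
    simp [Gw, hzs i x hx, hzg i x hx]
  let f : ι → ℕ → Plane → ℝ := fun i n => mol (k i n) (Ω.indicator (w i))
  have hfs : ∀ i n, ContDiff ℝ ∞ (f i n) := fun i n => contDiff_mol (hk i n).smooth
    (hk i n).hasCompactSupport (locallyIntegrable_indicator hΩo (hw i).fn)
  have hft : ∀ i, TendstoH1 Ω (f i) (w i) (Gw i) := fun i => tendstoH1_mol hΩo (hk i) (ha i) (hr i)
    (hgeo i) (hw i) (hwm i) (hGwm i) (hw0 i) (hGw0 i)
  -- The partition functions sum to one on `Ω`, so their gradients sum to zero and the localized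
  -- gradients recombine to `G`.
  have hsum1 : Set.EqOn (fun y => ∑ i, ζ i y) (fun _ => 1) Ω := fun x hx => hsum x (subset_closure hx)
  have hsg : ∀ x ∈ Ω, ∑ i, ∇ (ζ i) x = 0 := by
    intro x hx
    rw [← gradient_finset_sum _ fun i _ => (hζ i).1, gradient_congr_of_eqOn hΩo hsum1 hx]
    simp [gradient]
  refine ⟨fun n x => ∑ i, f i n x, fun n => ContDiff.sum fun i _ => hfs i n, ?_, ?_, ?_⟩
  · refine (TendstoH1.sum Finset.univ (fun i _ => hfs i) (fun i _ => (hw i).fn.1)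
      (fun i _ => (hw i).grad.1) fun i _ => hft i).congr hΩo (fun n x _ => rfl) ?_ ?_
    · filter_upwards [ae_restrict_mem hΩo.measurableSet] with x hx
      simp only [w]
      rw [← Finset.sum_mul, hsum x (subset_closure hx), one_mul]
    · filter_upwards [ae_restrict_mem hΩo.measurableSet] with x hx
      simp only [Gw]
      rw [Finset.sum_add_distrib, ← Finset.sum_smul, ← Finset.smul_sum, hsg x hx,
        hsum x (subset_closure hx), one_smul, smul_zero, add_zero]
  · intro hcont x hx
    have hlim : u x = ∑ i, w i x := by
      simp only [w]
      rw [← Finset.sum_mul, hsum x hx, one_mul]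
    rw [hlim]
    refine tendsto_finsetSum _ fun i _ => ?_
    have hwc : ContinuousOn (w i) (closure Ω) := (hζ i).1.continuous.continuousOn.mul hcont
    rw [Metric.tendsto_nhds]
    intro δ hδ
    obtain ⟨η, hη, hηw⟩ := Metric.continuousOn_iff.1 hwc x hx (δ / 2) (by positivity)
    have e1 : ∀ᶠ n in atTop, ‖a i n‖ < η / 2 := by
      have := (ha i).norm
      rw [norm_zero] at this
      exact this.eventually_lt_const (by positivity)
    have e2 : ∀ᶠ n in atTop, r i n < η / 2 := (hr i).eventually_lt_const (by positivity)
    have e3 : ∀ᶠ n in atTop, ‖a i n‖ + r i n < η := by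
      filter_upwards [e1, e2] with n h1 h2
      linarith
    filter_upwards [e3] with n hn
    rw [Real.dist_eq]
    refine (abs_mol_sub_le (hk i n) (locallyIntegrable_indicator hΩo (hw i).fn) (δ := δ / 2)
      (ae_of_all _ fun y hy => ?_)).trans_lt (by linarith)
    by_cases hex : ∃ y' ∈ tsupport (ζ i), k i n (x - y') ≠ 0 ∨ x = y'
    · obtain ⟨y', hy', hne⟩ := hex
      have hsub := hgeo i n x hx y' hy' hne
      have hyb := (hk i n).supp _ hy
      have hyΩ : y ∈ Ω := hsub (by
        rw [mem_closedBall_iff_norm]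
        calc ‖y - (x - a i n)‖ = ‖x - y - a i n‖ := by rw [← norm_neg]; congr 1; abel
          _ ≤ r i n := hyb.le)
      have hyx : dist y x < η := by
        rw [dist_eq_norm]
        calc ‖y - x‖ = ‖x - y‖ := norm_sub_rev _ _
          _ = ‖(x - y - a i n) + a i n‖ := by simp
          _ ≤ ‖x - y - a i n‖ + ‖a i n‖ := norm_add_le _ _
          _ < η := by linarith
      have := hηw y (subset_closure hyΩ) hyx
      rw [Real.dist_eq] at this
      simpa [hyΩ] using this.le
    -- Neither `x` nor any point seen by the kernel lies in the support of `ζ i`, so the localized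
    -- function and its mollification both vanish.
    · push Not at hex
      have hy1 : y ∉ tsupport (ζ i) := fun hmem => hy (hex y hmem).1
      have hwy : Ω.indicator (w i) y = 0 := by simp [Set.indicator, hw0 i y hy1]
      have hwx : w i x = 0 := hw0 i x fun hmem => (hex x hmem).2 rfl
      rw [hwy, hwx]
      simpa using (half_pos hδ).le
  · intro H hHm hH l
    have hζl : ∀ i, ContDiff ℝ ∞ (fun x => ∇ (ζ i) x l) := fun i => contDiff_partial (hζ i).1 l
    have h1 : ∀ i, WG Ω (fun x => Gw i x l) (fun x => (ζ i x • H l x + G x l • ∇ (ζ i) x)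
        + (∇ (ζ i) x l • G x + u x • ∇ (fun y => ∇ (ζ i) y l) x)) := by
      intro i
      have := ((hH l).mul hΩ.1 hΩo (hζ i).1).add (h.mul hΩ.1 hΩo (hζl i))
      refine this.congr (ae_of_all _ fun x => ?_) (ae_of_all _ fun x => rfl)
      simp [Gw, mul_comm]
    have hzg2 : ∀ i, ∀ x ∉ tsupport (ζ i), ∇ (fun y => ∇ (ζ i) y l) x = 0 := by
      intro i x hx
      have hev : (fun y => ∇ (ζ i) y l) =ᶠ[𝓝 x] fun _ => 0 := by
        filter_upwards [(isClosed_tsupport (ζ i)).isOpen_compl.mem_nhds hx] with y hy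
        simp [hzg i y hy]
      rw [Filter.EventuallyEq.gradient_eq hev]
      simp [gradient]
    have hm2 : ∀ i, Measurable (∇ fun y => ∇ (ζ i) y l) := fun i =>
      (continuous_gradient (hζl i)).measurable
    have h2 : ∀ i, TendstoH1 Ω (fun n x => ∇ (f i n) x l) (fun x => Gw i x l)
        (fun x => (ζ i x • H l x + G x l • ∇ (ζ i) x)
        + (∇ (ζ i) x l • G x + u x • ∇ (fun y => ∇ (ζ i) y l) x)) := by
      intro i
      refine (tendstoH1_mol hΩo (hk i) (ha i) (hr i) (hgeo i) (h1 i) (measurable_coord (hGwm i) l)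
        ?_ ?_ ?_).congr hΩo (fun n x hx => ?_) (ae_of_all _ fun x => rfl) (ae_of_all _ fun x => rfl)
      · exact (((hζm i).smul (hHm l)).add ((measurable_coord hGm l).smul (hζgm i))).add
          (((measurable_coord (hζgm i) l).smul hGm).add (hum.smul (hm2 i)))
      · intro x hx
        simp [hGw0 i x hx]
      · intro x hx
        simp [hzs i x hx, hzg i x hx, hzg2 i x hx]
      · exact (gradient_mol_indicator hΩo (hk i n) (hgeo i n) (hw i) (hw0 i) (hGw0 i) hx l).symm
    have hsl : Set.EqOn (fun y => ∑ i, ∇ (ζ i) y l) (fun _ => 0) Ω := by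
      intro x hx
      have := congrArg (fun v : Plane => v l) (hsg x hx)
      simpa [WithLp.ofLp_sum] using this
    have hsg2 : ∀ x ∈ Ω, ∑ i, ∇ (fun y => ∇ (ζ i) y l) x = 0 := by
      intro x hx
      rw [← gradient_finset_sum _ fun i _ => hζl i, gradient_congr_of_eqOn hΩo hsl hx]
      simp [gradient]
    refine (TendstoH1.sum Finset.univ (fun i _ n => contDiff_partial (hfs i n) l)
      (fun i _ => (h1 i).fn.1) (fun i _ => (h1 i).grad.1) fun i _ => h2 i).congr hΩo
      (fun n x _ => ?_) ?_ ?_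
    · simp only
      rw [gradient_finset_sum _ fun i _ => hfs i n]
      simp [WithLp.ofLp_sum]
    · filter_upwards [ae_restrict_mem hΩo.measurableSet] with x hx
      have e := congrArg (fun v : Plane => v l) (show ∑ i, Gw i x = G x by
        simp only [Gw]
        rw [Finset.sum_add_distrib, ← Finset.sum_smul, ← Finset.smul_sum, hsg x hx,
          hsum x (subset_closure hx), one_smul, smul_zero, add_zero])
      simpa [WithLp.ofLp_sum] using e
    · filter_upwards [ae_restrict_mem hΩo.measurableSet] with x hx
      have e4 : ∑ i, ∇ (ζ i) x l = 0 := hsl hx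
      rw [Finset.sum_add_distrib, Finset.sum_add_distrib, Finset.sum_add_distrib,
        ← Finset.sum_smul, ← Finset.smul_sum, ← Finset.sum_smul, ← Finset.smul_sum, hsg x hx,
        hsg2 x hx, e4, hsum x (subset_closure hx), one_smul, smul_zero, smul_zero, zero_smul]
      simp

/-! ### Estimates near the boundary, in a chart -/

/-- One-dimensional Sobolev inequality: `(f²)' = 2 f f'` is bounded by `f² + f'²`, so values of `f²`
at two points differ by at most the integral, and one of the points is averaged out. -/
lemma sq_le_mul_integral {f f' : ℝ → ℝ} {δ : ℝ} (hδ : 0 < δ) (hf : ∀ t, HasDerivAt f (f' t) t)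
    (hf' : Continuous f') {t : ℝ} (ht : t ∈ Set.Icc 0 δ) :
    f t ^ 2 ≤ (1 / δ + 1) * ∫ t' in (0 : ℝ)..δ, (f t' ^ 2 + f' t' ^ 2) := by
  have hfc : Continuous f := continuous_iff_continuousAt.2 fun t => (hf t).continuousAt
  set J := ∫ t' in (0 : ℝ)..δ, (f t' ^ 2 + f' t' ^ 2) with hJ
  have hcJ : Continuous fun t' => f t' ^ 2 + f' t' ^ 2 := by fun_prop
  have key : ∀ t' ∈ Set.Icc 0 δ, f t ^ 2 - J ≤ f t' ^ 2 := by
    intro t' ht'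
    have hder : ∀ τ ∈ Set.uIcc t' t, HasDerivAt (fun τ => f τ ^ 2) (2 * f τ * f' τ) τ := by
      intro τ _
      simpa using (hf τ).fun_pow 2
    have hc2 : Continuous fun τ => 2 * f τ * f' τ := by fun_prop
    have hftc := intervalIntegral.integral_eq_sub_of_hasDerivAt hder (hc2.intervalIntegrable _ _)
    have hb : |∫ τ in t'..t, 2 * f τ * f' τ| ≤ J := by
      rw [← Real.norm_eq_abs, hJ, intervalIntegral.integral_of_le hδ.le]
      refine intervalIntegral.norm_integral_le_integral_norm_uIoc.trans ?_
      calc ∫ τ in Set.uIoc t' t, ‖2 * f τ * f' τ‖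
          ≤ ∫ τ in Set.uIoc t' t, (f τ ^ 2 + f' τ ^ 2) := by
            refine integral_mono (hc2.norm.integrableOn_uIoc) (hcJ.integrableOn_uIoc) fun τ => ?_
            simp only [Real.norm_eq_abs, abs_le]
            constructor <;> nlinarith [sq_nonneg (f τ - f' τ), sq_nonneg (f τ + f' τ)]
        _ ≤ ∫ τ in Set.Ioc 0 δ, (f τ ^ 2 + f' τ ^ 2) := by
            refine setIntegral_mono_set hcJ.integrableOn_Ioc (ae_of_all _ fun τ => by positivity)
              (LE.le.eventuallyLE ?_)
            rw [Set.uIoc]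
            exact Set.Ioc_subset_Ioc (le_min ht'.1 ht.1) (max_le ht'.2 ht.2)
    rw [hftc] at hb
    linarith [(abs_le.1 hb).2]
  -- Averaging `key` over `t' ∈ [0, δ]` produces the term `1 / δ`.
  have hintg : ∫ _ in (0 : ℝ)..δ, (f t ^ 2 - J) ≤ J := by
    refine (intervalIntegral.integral_mono_on hδ.le (by simp) (hcJ.intervalIntegrable _ _)
      fun t' ht' => ?_)
    have := key t' ht'
    nlinarith [sq_nonneg (f' t')]
  simp only [intervalIntegral.integral_const, sub_zero, smul_eq_mul] at hintg
  have : f t ^ 2 - J ≤ 1 / δ * J := by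
    rw [one_div, ← div_eq_inv_mul, le_div_iff₀ hδ]
    linarith
  linarith

/-- The point with coordinates `(s, θ s + t)` in the frame given by `e`. -/
def strip (e : Plane ≃ₗᵢ[ℝ] Plane) (θ : ℝ → ℝ) (p : ℝ × ℝ) : Plane :=
  e.symm (WithLp.toLp 2 ![p.1, θ p.1 + p.2])

lemma map_strip_zero (e : Plane ≃ₗᵢ[ℝ] Plane) (θ : ℝ → ℝ) (p : ℝ × ℝ) :
    e (strip e θ p) 0 = p.1 := by simp [strip]

lemma map_strip_one (e : Plane ≃ₗᵢ[ℝ] Plane) (θ : ℝ → ℝ) (p : ℝ × ℝ) :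
    e (strip e θ p) 1 = θ p.1 + p.2 := by simp [strip]

lemma strip_eq_add (e : Plane ≃ₗᵢ[ℝ] Plane) (θ : ℝ → ℝ) (s t : ℝ) :
    strip e θ (s, t) = strip e θ (s, 0) + t • up e := by
  apply e.injective
  rw [map_add_up]
  apply plane_ext <;> simp [map_strip_zero, map_strip_one]

lemma strip_coord (e : Plane ≃ₗᵢ[ℝ] Plane) (θ : ℝ → ℝ) (y : Plane) :
    strip e θ (e y 0, e y 1 - θ (e y 0)) = y := by
  apply e.injective
  apply plane_ext <;> simp [map_strip_zero, map_strip_one]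

/-- The map is a shear, which preserves area by Fubini for any measurable `θ`, followed by an
isometry. Thus no Jacobian of a Lipschitz function is needed. -/
lemma measurePreserving_strip (e : Plane ≃ₗᵢ[ℝ] Plane) {θ : ℝ → ℝ} (hθ : Measurable θ) :
    MeasurePreserving (strip e θ) volume volume := by
  have h1 : MeasurePreserving (fun p : ℝ × ℝ => (p.1, θ p.1 + p.2)) volume volume := by
    refine MeasurePreserving.skew_product (g := fun s t => θ s + t) (MeasurePreserving.id volume)
      ?_ ?_
    · exact (hθ.comp measurable_fst).add measurable_snd
    · exact ae_of_all _ fun s => (measurePreserving_add_left volume (θ s)).map_eq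
  have h2 := (volume_preserving_finTwoArrow ℝ).symm
  have h3 := PiLp.volume_preserving_toLp (Fin 2)
  have h4 := e.symm.measurePreserving
  exact h4.comp (h3.comp (h2.comp h1))

lemma lipschitz_strip (e : Plane ≃ₗᵢ[ℝ] Plane) {θ : ℝ → ℝ} {L : ℝ≥0} (hθ : LipschitzWith L θ) :
    LipschitzWith (1 + L) fun s => strip e θ (s, 0) := by
  refine LipschitzWith.of_dist_le_mul fun s s' => ?_
  rw [← e.dist_map, dist_eq_norm]
  refine (norm_le_sum_coord _).trans ?_
  simp only [PiLp.sub_apply, map_strip_zero, map_strip_one, add_zero]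
  have := hθ.dist_le_mul s s'
  rw [Real.dist_eq, Real.dist_eq] at this
  rw [Real.dist_eq]
  push_cast
  linarith

/-- Lipschitz maps increase one-dimensional Hausdorff measure by at most the factor `K`, so the
measure on the curve is dominated by the push-forward of Lebesgue measure. -/
lemma lintegral_hausdorff_graph_le {K : ℝ≥0} {γ : ℝ → Plane} (hγ : LipschitzWith K γ)
    {I : Set ℝ} {S : Set Plane} (hS : S ⊆ γ '' I) {F : Plane → ℝ≥0∞}
    (hF : Measurable F) :
    ∫⁻ y in S, F y ∂(Measure.hausdorffMeasure 1) ≤ K * ∫⁻ s in I, F (γ s) := by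
  have hle : (Measure.hausdorffMeasure 1 : Measure Plane).restrict S ≤
      (K : ℝ≥0∞) • Measure.map γ (volume.restrict I) := by
    refine Measure.le_iff.2 fun B hB => ?_
    rw [Measure.restrict_apply hB, Measure.smul_apply, Measure.map_apply hγ.continuous.measurable hB,
      Measure.restrict_apply (hγ.continuous.measurable hB)]
    have hsub : B ∩ S ⊆ γ '' (γ ⁻¹' B ∩ I) := by
      rintro y ⟨hyB, hyS⟩
      obtain ⟨s, hs, rfl⟩ := hS hyS
      exact ⟨s, ⟨hyB, hs⟩, rfl⟩
    refine (measure_mono hsub).trans ((hγ.hausdorffMeasure_image_le zero_le_one _).trans ?_)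
    simp [hausdorffMeasure_real]
  refine (lintegral_mono' hle le_rfl).trans (le_of_eq ?_)
  rw [lintegral_smul_measure, lintegral_map hF hγ.continuous.measurable, smul_eq_mul]

/-- The integrand of the squared norm of `H¹`. -/
def dens (φ : Plane → ℝ) (y : Plane) : ℝ := φ y ^ 2 + ‖∇ φ y‖ ^ 2

lemma continuous_dens {φ : Plane → ℝ} (hφ : ContDiff ℝ ∞ φ) : Continuous (dens φ) :=
  (hφ.continuous.pow 2).add ((continuous_gradient hφ).norm.pow 2)

lemma ofReal_sq_strip_le {φ : Plane → ℝ} (hφ : ContDiff ℝ ∞ φ) (e : Plane ≃ₗᵢ[ℝ] Plane) (θ : ℝ → ℝ)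
    {δ : ℝ} (hδ : 0 < δ) (s : ℝ) {t : ℝ} (ht : t ∈ Set.Icc 0 δ) :
    ENNReal.ofReal (φ (strip e θ (s, t)) ^ 2) ≤ ENNReal.ofReal (1 / δ + 1) *
      ∫⁻ t' in Set.Ioc 0 δ, ENNReal.ofReal (dens φ (strip e θ (s, t'))) := by
  have hder : ∀ t, HasDerivAt (fun t => φ (strip e θ (s, t)))
      (fderiv ℝ φ (strip e θ (s, t)) (up e)) t := by
    intro t
    have h1 : HasDerivAt (fun t => strip e θ (s, t)) (up e) t := by
      rw [funext (strip_eq_add e θ s)]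
      simpa using ((hasDerivAt_id t).smul_const (up e)).const_add (strip e θ (s, 0))
    exact ((hφ.differentiable (by simp) _).hasFDerivAt).comp_hasDerivAt t h1
  have hsc : Continuous fun t => strip e θ (s, t) := by
    rw [funext (strip_eq_add e θ s)]
    fun_prop
  have hc : Continuous fun t => fderiv ℝ φ (strip e θ (s, t)) (up e) :=
    ((hφ.continuous_fderiv (by simp)).comp hsc).clm_apply continuous_const
  have h := sq_le_mul_integral hδ hder hc ht
  have hcd : Continuous fun t => dens φ (strip e θ (s, t)) := (continuous_dens hφ).comp hsc
  rw [← ofReal_integral_eq_lintegral_ofReal hcd.integrableOn_Ioc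
    (ae_of_all _ fun t => by simp only [dens]; positivity), ← ENNReal.ofReal_mul (by positivity),
    ← intervalIntegral.integral_of_le hδ.le]
  refine ENNReal.ofReal_le_ofReal (h.trans ?_)
  refine mul_le_mul_of_nonneg_left ?_ (by positivity)
  refine intervalIntegral.integral_mono_on hδ.le ?_ (hcd.intervalIntegrable _ _) fun t' _ => ?_
  · refine Continuous.intervalIntegrable ?_ _ _
    exact ((hφ.continuous.comp hsc).pow 2).add (hc.pow 2)
  · simp only [dens]
    refine add_le_add le_rfl ?_
    have hop := (fderiv ℝ φ (strip e θ (s, t'))).le_opNorm (up e)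
    rw [norm_up, mul_one, ← norm_gradient] at hop
    exact sq_le_sq.2 (hop.trans (le_abs_self _))

lemma dist_strip_le (e : Plane ≃ₗᵢ[ℝ] Plane) {θ : ℝ → ℝ} {L : ℝ≥0} (hθ : LipschitzWith L θ)
    {x : Plane} (hx : e x 1 = θ (e x 0)) (s t : ℝ) :
    dist (strip e θ (s, t)) x ≤ (1 + L) * |s - e x 0| + |t| := by
  rw [← e.dist_map, dist_eq_norm]
  refine (norm_le_sum_coord _).trans ?_
  simp only [PiLp.sub_apply, map_strip_zero, map_strip_one]
  have := hθ.dist_le_mul s (e x 0)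
  rw [Real.dist_eq, Real.dist_eq] at this
  rw [hx]
  have h2 : |θ s + t - θ (e x 0)| ≤ |θ s - θ (e x 0)| + |t| := by
    rw [show θ s + t - θ (e x 0) = (θ s - θ (e x 0)) + t by ring]
    exact abs_add_le _ _
  linarith

/-- In a neighbourhood of a boundary point, traces and boundary layers are controlled. -/
lemma IsLipschitzDomain.chart_estimate (hΩ : IsLipschitzDomain Ω) {x : Plane}
    (hx : x ∈ frontier Ω) : ∃ r > 0, ∃ C : ℝ≥0, ∀ φ : Plane → ℝ, ContDiff ℝ ∞ φ →
      (∫⁻ y in frontier Ω ∩ Metric.ball x r, ENNReal.ofReal (φ y ^ 2)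
        ∂(Measure.hausdorffMeasure 1) ≤ C * ∫⁻ y in Ω, ENNReal.ofReal (dens φ y)) ∧
      ∀ d > 0, ∫⁻ y in Ω ∩ Metric.ball x r ∩ {y | ∃ z ∉ Ω, dist y z < d}, ENNReal.ofReal (φ y ^ 2)
        ≤ C * ENNReal.ofReal d * ∫⁻ y in Ω, ENNReal.ofReal (dens φ y) := by
  obtain ⟨e, L, θ, hθ, hev⟩ := hΩ.2.2 x hx
  obtain ⟨δ₀, hδ₀, hball⟩ := Metric.eventually_nhds_iff.1 hev
  have hgraph : ∀ y, dist y x < δ₀ → y ∈ frontier Ω → e y 1 = θ (e y 0) := by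
    intro y hyx hy
    rw [hΩ.2.1.frontier_eq] at hy
    refine le_antisymm (not_lt.1 fun hlt => hy.2 ((hball hyx).2 hlt)) ?_
    have hcl : y ∈ closure (Ω ∩ Metric.ball x δ₀) :=
      by
      refine mem_closure_iff_nhds.2 fun V hV => ?_
      · obtain ⟨z, hz, hzΩ⟩ := mem_closure_iff_nhds.1 hy.1 _
          (Filter.inter_mem hV (Metric.isOpen_ball.mem_nhds hyx))
        exact ⟨z, hz.1, hzΩ, hz.2⟩
    have hclosed : IsClosed {y : Plane | θ (e y 0) ≤ e y 1} := by
      refine isClosed_le ?_ ?_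
      · exact hθ.continuous.comp ((EuclideanSpace.proj (𝕜 := ℝ) 0).continuous.comp e.continuous)
      · exact (EuclideanSpace.proj (𝕜 := ℝ) 1).continuous.comp e.continuous
    exact closure_minimal (fun z hz => ((hball hz.2).1 hz.1).le) hclosed hcl
  have hx1 := hgraph x (by simpa using hδ₀) hx
  -- The box of half-width `δ` and height `δ` over the graph then stays within `(1 + L) δ + δ = δ₀ /
  -- 2` of `x`, inside the chart.
  set δ : ℝ := δ₀ / (2 * (2 + L)) with hδ
  have hδpos : 0 < δ := by positivity
  set r : ℝ := δ / (2 * (1 + L)) with hr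
  have hrpos : 0 < r := by positivity
  have hLr : (1 + L) * r = δ / 2 := by rw [hr]; field_simp
  have hLδ : (2 + L) * δ = δ₀ / 2 := by rw [hδ]; field_simp
  have hL0 : (0 : ℝ) ≤ L := L.2
  have hrδ : r ≤ δ / 2 := by nlinarith
  set I : Set ℝ := Set.Ioo (e x 0 - δ) (e x 0 + δ) with hI
  have hin : ∀ s ∈ I, ∀ t ∈ Set.Ioc 0 δ, strip e θ (s, t) ∈ Ω := by
    intro s hs t ht
    refine (hball ?_).2 ?_
    · refine (dist_strip_le e hθ hx1 s t).trans_lt ?_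
      have h1 : |s - e x 0| ≤ δ := abs_le.2 ⟨by linarith [hs.1], by linarith [hs.2]⟩
      rw [abs_of_pos ht.1]
      nlinarith [ht.2]
    · rw [map_strip_zero, map_strip_one]
      linarith [ht.1]
  have hmp := measurePreserving_strip e hθ.continuous.measurable
  have hcoord : ∀ y ∈ Metric.ball x r, |e y 0 - e x 0| < r ∧ |e y 1 - e x 1| < r := by
    intro y hy
    rw [Metric.mem_ball, ← e.dist_map, dist_eq_norm] at hy
    exact ⟨(abs_coord_le _ 0).trans_lt hy, (abs_coord_le _ 1).trans_lt hy⟩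
  have hcoordI : ∀ y ∈ Metric.ball x r, e y 0 ∈ I := by
    intro y hy
    have := abs_lt.1 (hcoord y hy).1
    exact ⟨by linarith, by linarith⟩
  have hbox : ∀ φ : Plane → ℝ, ContDiff ℝ ∞ φ →
      ∫⁻ s in I, ∫⁻ t in Set.Ioc 0 δ, ENNReal.ofReal (dens φ (strip e θ (s, t)))
        ≤ ∫⁻ y in Ω, ENNReal.ofReal (dens φ y) := by
    intro φ hφ
    have hm : Measurable fun y => ENNReal.ofReal (dens φ y) :=
      (continuous_dens hφ).measurable.ennreal_ofReal
    rw [← hmp.setLIntegral_comp_preimage hΩ.2.1.measurableSet hm,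
      ← setLIntegral_prod (fun p => ENNReal.ofReal (dens φ (strip e θ p)))
        (hm.comp hmp.measurable).aemeasurable]
    exact lintegral_mono_set fun p hp => hin p.1 hp.1 p.2 hp.2
  let C₁ : ℝ := 1 / δ + 1
  have hC₁ : 0 ≤ C₁ := by positivity
  -- The first summand combines the Lipschitz constant of the graph with the constant of the
  -- one-dimensional estimate. The second settles layers wider than `r`, where `r⁻¹ * d ≥ 1` and the
  -- bound is trivial.
  refine ⟨r, hrpos, (1 + L) * C₁.toNNReal + r.toNNReal⁻¹, fun φ hφ => ⟨?_, fun d hd => ?_⟩⟩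
  · have hm : Measurable fun y => ENNReal.ofReal (φ y ^ 2) :=
      (hφ.continuous.pow 2).measurable.ennreal_ofReal
    refine (lintegral_hausdorff_graph_le (lipschitz_strip e hθ) (I := I) ?_ hm).trans ?_
    · rintro y ⟨hyf, hyb⟩
      refine ⟨e y 0, hcoordI y hyb, ?_⟩
      have := hgraph y ((Metric.mem_ball.1 hyb).trans_le (by nlinarith)) hyf
      have h2 := strip_coord e θ y
      rwa [this, sub_self] at h2
    · calc ((1 + L : ℝ≥0) : ℝ≥0∞) * ∫⁻ s in I, ENNReal.ofReal (φ (strip e θ (s, 0)) ^ 2)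
          ≤ ((1 + L : ℝ≥0) : ℝ≥0∞) * ∫⁻ s in I, ENNReal.ofReal C₁ *
            ∫⁻ t in Set.Ioc 0 δ, ENNReal.ofReal (dens φ (strip e θ (s, t))) := by
            gcongr with s
            exact ofReal_sq_strip_le hφ e θ hδpos s ⟨le_rfl, hδpos.le⟩
        _ = ((1 + L : ℝ≥0) : ℝ≥0∞) * (ENNReal.ofReal C₁ *
            ∫⁻ s in I, ∫⁻ t in Set.Ioc 0 δ, ENNReal.ofReal (dens φ (strip e θ (s, t)))) := by
            rw [lintegral_const_mul' _ _ ENNReal.ofReal_ne_top]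
        _ ≤ ((1 + L : ℝ≥0) : ℝ≥0∞) * (ENNReal.ofReal C₁ *
            ∫⁻ y in Ω, ENNReal.ofReal (dens φ y)) := by
            gcongr
            exact hbox φ hφ
        _ ≤ _ := by
            rw [← mul_assoc]
            gcongr
            push_cast
            rw [ENNReal.ofReal]
            exact le_self_add
  · have hm : Measurable fun y => ENNReal.ofReal (φ y ^ 2) :=
      (hφ.continuous.pow 2).measurable.ennreal_ofReal
    rcases lt_or_ge r d with hrd | hdr
    · calc ∫⁻ y in Ω ∩ Metric.ball x r ∩ {y | ∃ z ∉ Ω, dist y z < d}, ENNReal.ofReal (φ y ^ 2)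
          ≤ ∫⁻ y in Ω, ENNReal.ofReal (φ y ^ 2) :=
            lintegral_mono_set fun y hy => hy.1.1
        _ ≤ 1 * ∫⁻ y in Ω, ENNReal.ofReal (dens φ y) := by
            rw [one_mul]
            refine lintegral_mono fun y => ENNReal.ofReal_le_ofReal ?_
            simp only [dens]
            nlinarith [sq_nonneg ‖∇ φ y‖]
        _ ≤ _ := by
            gcongr
            calc (1 : ℝ≥0∞) = ((r.toNNReal⁻¹ * r.toNNReal : ℝ≥0) : ℝ≥0∞) := by
                  rw [inv_mul_cancel₀ (by simpa using hrpos)]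
                  simp
              _ ≤ _ := by
                  push_cast
                  rw [ENNReal.ofReal]
                  gcongr
                  exact le_add_self
    -- A point within `d` of the complement has height at most `d + L d` above the graph. For `d ≤
    -- r` this is at most `δ / 2`, so the vertical estimate applies.
    · set d' : ℝ := (1 + L) * d with hd'
      have hopen : IsOpen {y | ∃ z ∉ Ω, dist y z < d} := by
        have : {y | ∃ z ∉ Ω, dist y z < d} = Metric.thickening d Ωᶜ := by
          ext y
          simp [Metric.mem_thickening_iff]
        rw [this]
        exact Metric.isOpen_thickening
      rw [← hmp.setLIntegral_comp_preimage
        ((hΩ.2.1.inter Metric.isOpen_ball).inter hopen).measurableSet hm]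
      calc ∫⁻ p in strip e θ ⁻¹' (Ω ∩ Metric.ball x r ∩ {y | ∃ z ∉ Ω, dist y z < d}),
            ENNReal.ofReal (φ (strip e θ p) ^ 2)
          ≤ ∫⁻ p in I ×ˢ Set.Ioc 0 d', ENNReal.ofReal (φ (strip e θ p) ^ 2) := by
            refine lintegral_mono_set ?_
            rintro ⟨s, t⟩ ⟨⟨hpΩ, hpb⟩, z, hz, hdz⟩
            have h1 := hcoordI _ hpb
            rw [map_strip_zero] at h1
            have hpx := Metric.mem_ball.1 hpb
            have h2 := (hball (hpx.trans_le (by nlinarith))).1 hpΩ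
            have hzx : dist z x < δ₀ := by
              have := dist_triangle_left z x (strip e θ (s, t))
              nlinarith
            have h3 : e z 1 ≤ θ (e z 0) := not_lt.1 fun hlt => hz ((hball hzx).2 hlt)
            rw [map_strip_zero, map_strip_one] at h2
            rw [← e.dist_map, dist_eq_norm] at hdz
            have c0 := (abs_coord_le _ 0).trans_lt hdz
            have c1 := (abs_coord_le _ 1).trans_lt hdz
            simp only [PiLp.sub_apply, map_strip_zero, map_strip_one] at c0 c1
            have hlip := hθ.dist_le_mul (e z 0) s
            rw [Real.dist_eq, Real.dist_eq, abs_sub_comm (e z 0)] at hlip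
            have hlip2 : θ (e z 0) - θ s ≤ L * d :=
              (le_abs_self _).trans (hlip.trans (by gcongr))
            refine ⟨h1, by simpa using h2, ?_⟩
            simp only [hd']
            linarith [(abs_lt.1 c1).2]
        _ = ∫⁻ s in I, ∫⁻ t in Set.Ioc 0 d', ENNReal.ofReal (φ (strip e θ (s, t)) ^ 2) :=
            setLIntegral_prod (fun p => ENNReal.ofReal (φ (strip e θ p) ^ 2))
              (hm.comp hmp.measurable).aemeasurable
        _ ≤ ∫⁻ s in I, ∫⁻ t in Set.Ioc 0 d', ENNReal.ofReal C₁ *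
            ∫⁻ t in Set.Ioc 0 δ, ENNReal.ofReal (dens φ (strip e θ (s, t))) := by
            refine lintegral_mono fun s => setLIntegral_mono' measurableSet_Ioc fun t ht => ?_
            refine ofReal_sq_strip_le hφ e θ hδpos s ⟨ht.1.le, ht.2.trans ?_⟩
            nlinarith
        _ = ∫⁻ s in I, (ENNReal.ofReal C₁ * ENNReal.ofReal d') *
            ∫⁻ t in Set.Ioc 0 δ, ENNReal.ofReal (dens φ (strip e θ (s, t))) := by
            refine lintegral_congr fun s => ?_
            rw [setLIntegral_const, Real.volume_Ioc, sub_zero]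
            ring
        _ = (ENNReal.ofReal C₁ * ENNReal.ofReal d') *
            ∫⁻ s in I, ∫⁻ t in Set.Ioc 0 δ, ENNReal.ofReal (dens φ (strip e θ (s, t))) :=
            lintegral_const_mul' _ _ (ENNReal.mul_ne_top ENNReal.ofReal_ne_top ENNReal.ofReal_ne_top)
        _ ≤ (ENNReal.ofReal C₁ * ENNReal.ofReal d') * ∫⁻ y in Ω, ENNReal.ofReal (dens φ y) := by
            gcongr
            exact hbox φ hφ
        _ ≤ _ := by
            refine mul_le_mul_left ?_ _
            rw [hd', ENNReal.ofReal_mul (by positivity)]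
            have : ENNReal.ofReal (1 + (L : ℝ)) = ((1 + L : ℝ≥0) : ℝ≥0∞) := by
              rw [show (1 + (L : ℝ)) = ((1 + L : ℝ≥0) : ℝ) by push_cast; rfl,
                ENNReal.ofReal_coe_nnreal]
            rw [this, ← mul_assoc]
            gcongr
            rw [ENNReal.ofReal, mul_comm, ← ENNReal.coe_mul]
            exact ENNReal.coe_le_coe.2 le_self_add

/-! ### Boundary estimates -/

/-- The segment from `y` to `z` is connected, hence it crosses the frontier. -/
lemma exists_mem_frontier_of_dist_lt {y z : Plane} {d : ℝ} (hy : y ∈ Ω) (hz : z ∉ Ω)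
    (h : dist y z < d) : ∃ p ∈ frontier Ω, dist y p < d := by
  have hconn : IsPreconnected (segment ℝ y z) := (convex_segment y z).isPreconnected
  have hne : (segment ℝ y z ∩ frontier Ω).Nonempty := by
    by_contra hempty
    rw [Set.not_nonempty_iff_eq_empty] at hempty
    have hcov : segment ℝ y z ⊆ interior Ω ∪ (closure Ω)ᶜ := by
      intro p hp
      by_contra hnot
      simp only [Set.mem_union, Set.mem_compl_iff, not_or, not_not] at hnot
      have : p ∈ segment ℝ y z ∩ frontier Ω := ⟨hp, hnot.2, hnot.1⟩
      rw [hempty] at this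
      exact this
    obtain ⟨p, _, hp1, hp2⟩ := hconn _ _ isOpen_interior isClosed_closure.isOpen_compl hcov
      ⟨y, left_mem_segment ℝ y z, (hcov (left_mem_segment ℝ y z)).resolve_right
        fun h => h (subset_closure hy)⟩
      ⟨z, right_mem_segment ℝ y z, (hcov (right_mem_segment ℝ y z)).resolve_left
        fun h => hz (interior_subset h)⟩
    exact hp2 (subset_closure (interior_subset hp1))
  obtain ⟨p, hp, hpf⟩ := hne
  exact ⟨p, hpf, (by
    have := dist_add_dist_of_mem_segment hp
    linarith [dist_nonneg (x := p) (y := z)])⟩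

/-- Finitely many charts cover the compact frontier, together with a neighbourhood of some width
`d₀`. Layers thinner than `d₀` lie in the charts; for wider ones `d₀⁻¹ * d ≥ 1` makes the bound
trivial. -/
lemma IsLipschitzDomain.lintegral_estimate (hΩ : IsLipschitzDomain Ω) :
    ∃ C : ℝ≥0, ∀ φ : Plane → ℝ, ContDiff ℝ ∞ φ →
      (∫⁻ y, ENNReal.ofReal (φ y ^ 2) ∂(arc (frontier Ω))
        ≤ C * ∫⁻ y in Ω, ENNReal.ofReal (dens φ y)) ∧
      ∀ d > 0, ∫⁻ y in Ω ∩ {y | ∃ z ∉ Ω, dist y z < d}, ENNReal.ofReal (φ y ^ 2)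
        ≤ C * ENNReal.ofReal d * ∫⁻ y in Ω, ENNReal.ofReal (dens φ y) := by
  have hch := fun x : frontier Ω => hΩ.chart_estimate x.2
  choose r hr C hC using hch
  have hcomp : IsCompact (frontier Ω) :=
    hΩ.1.isCompact_closure.of_isClosed_subset isClosed_frontier frontier_subset_closure
  obtain ⟨s, hs⟩ := hcomp.elim_finite_subcover (fun x : frontier Ω => Metric.ball (x : Plane) (r x))
    (fun _ => Metric.isOpen_ball)
    (fun x hx => Set.mem_iUnion.2 ⟨⟨x, hx⟩, Metric.mem_ball_self (hr _)⟩)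
  obtain ⟨d₀, hd₀, hthick⟩ := hcomp.exists_thickening_subset_open
    (isOpen_biUnion fun x (_ : x ∈ s) => Metric.isOpen_ball (x := (x : Plane)) (ε := r x)) hs
  refine ⟨∑ i ∈ s, C i + d₀.toNNReal⁻¹, fun φ hφ => ⟨?_, fun d hd => ?_⟩⟩
  · calc ∫⁻ y, ENNReal.ofReal (φ y ^ 2) ∂(arc (frontier Ω))
        ≤ ∫⁻ y in ⋃ i : s, frontier Ω ∩ Metric.ball (i : Plane) (r i), ENNReal.ofReal (φ y ^ 2)
          ∂(Measure.hausdorffMeasure 1) := by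
          refine lintegral_mono_set fun y hy => ?_
          obtain ⟨i, hi, hyi⟩ := Set.mem_iUnion₂.1 (hs hy)
          exact Set.mem_iUnion.2 ⟨⟨i, hi⟩, hy, hyi⟩
      _ ≤ ∑' i : s, ∫⁻ y in frontier Ω ∩ Metric.ball (i : Plane) (r i), ENNReal.ofReal (φ y ^ 2)
          ∂(Measure.hausdorffMeasure 1) := lintegral_iUnion_le _ _
      _ ≤ ∑' i : s, (C i : ℝ≥0∞) * ∫⁻ y in Ω, ENNReal.ofReal (dens φ y) :=
          ENNReal.tsum_le_tsum fun i => (hC i φ hφ).1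
      _ = (∑ i ∈ s, C i : ℝ≥0) * ∫⁻ y in Ω, ENNReal.ofReal (dens φ y) := by
          rw [ENNReal.tsum_mul_right, tsum_fintype, Finset.sum_coe_sort s fun i => (C i : ℝ≥0∞)]
          push_cast
          rfl
      _ ≤ _ := by
          gcongr
          exact le_self_add
  · rcases lt_or_ge d d₀ with hdd | hdd
    · calc ∫⁻ y in Ω ∩ {y | ∃ z ∉ Ω, dist y z < d}, ENNReal.ofReal (φ y ^ 2)
          ≤ ∫⁻ y in ⋃ i : s, Ω ∩ Metric.ball (i : Plane) (r i) ∩ {y | ∃ z ∉ Ω, dist y z < d},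
            ENNReal.ofReal (φ y ^ 2) := by
            refine lintegral_mono_set ?_
            rintro y ⟨hy, z, hz, hdz⟩
            obtain ⟨p, hp, hpd⟩ := exists_mem_frontier_of_dist_lt hy hz hdz
            obtain ⟨i, hi, hyi⟩ := Set.mem_iUnion₂.1
              (hthick (Metric.mem_thickening_iff.2 ⟨p, hp, hpd.trans hdd⟩))
            exact Set.mem_iUnion.2 ⟨⟨i, hi⟩, ⟨hy, hyi⟩, z, hz, hdz⟩
        _ ≤ ∑' i : s, ∫⁻ y in Ω ∩ Metric.ball (i : Plane) (r i) ∩ {y | ∃ z ∉ Ω, dist y z < d},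
            ENNReal.ofReal (φ y ^ 2) := lintegral_iUnion_le _ _
        _ ≤ ∑' i : s, (C i : ℝ≥0∞) * (ENNReal.ofReal d * ∫⁻ y in Ω, ENNReal.ofReal (dens φ y)) :=
            ENNReal.tsum_le_tsum fun i => by
              rw [← mul_assoc]
              exact (hC i φ hφ).2 d hd
        _ = (∑ i ∈ s, C i : ℝ≥0) * ENNReal.ofReal d * ∫⁻ y in Ω, ENNReal.ofReal (dens φ y) := by
            rw [ENNReal.tsum_mul_right, tsum_fintype,
              Finset.sum_coe_sort s fun i => (C i : ℝ≥0∞), mul_assoc]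
            push_cast
            rfl
        _ ≤ _ := by
            gcongr
            exact le_self_add
    · calc ∫⁻ y in Ω ∩ {y | ∃ z ∉ Ω, dist y z < d}, ENNReal.ofReal (φ y ^ 2)
          ≤ ∫⁻ y in Ω, ENNReal.ofReal (φ y ^ 2) :=
            lintegral_mono_set fun y hy => hy.1
        _ ≤ 1 * ∫⁻ y in Ω, ENNReal.ofReal (dens φ y) := by
            rw [one_mul]
            refine lintegral_mono fun y => ENNReal.ofReal_le_ofReal ?_
            simp only [dens]
            nlinarith [sq_nonneg ‖∇ φ y‖]
        _ ≤ _ := by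
            gcongr
            calc (1 : ℝ≥0∞) = ((d₀.toNNReal⁻¹ * d₀.toNNReal : ℝ≥0) : ℝ≥0∞) := by
                  rw [inv_mul_cancel₀ (by simpa using hd₀)]
                  simp
              _ ≤ _ := by
                  push_cast
                  rw [ENNReal.ofReal]
                  gcongr
                  exact le_add_self

lemma lintegral_dens_le {φ : Plane → ℝ} (hφ : ContDiff ℝ ∞ φ) (μ : Measure Plane) :
    ∫⁻ y, ENNReal.ofReal (dens φ y) ∂μ ≤ (eLpNorm φ 2 μ + eLpNorm (∇ φ) 2 μ) ^ 2 := by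
  have e : ∀ y, ENNReal.ofReal (dens φ y) = ‖φ y‖ₑ ^ 2 + ‖∇ φ y‖ₑ ^ 2 := by
    intro y
    rw [dens, ENNReal.ofReal_add (by positivity) (by positivity),
      ENNReal.ofReal_pow (norm_nonneg _), ofReal_norm, ← sq_abs, ENNReal.ofReal_pow (abs_nonneg _),
      ← Real.norm_eq_abs, ofReal_norm]
  simp only [e]
  rw [lintegral_add_left (hφ.continuous.enorm.measurable.pow_const 2), ← eLpNorm_two_sq,
    ← eLpNorm_two_sq, add_sq]
  gcongr
  exact le_self_add

lemma eLpNorm_le_of_lintegral {φ : Plane → ℝ} {μ : Measure Plane} {c : ℝ} (hc : 0 ≤ c) {a : ℝ≥0∞}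
    (h : ∫⁻ y, ENNReal.ofReal (φ y ^ 2) ∂μ ≤ ENNReal.ofReal c * a ^ 2) :
    eLpNorm φ 2 μ ≤ ENNReal.ofReal √c * a := by
  have e : ∀ y, ENNReal.ofReal (φ y ^ 2) = ‖φ y‖ₑ ^ 2 := by
    intro y
    rw [← sq_abs, ENNReal.ofReal_pow (abs_nonneg _), ← Real.norm_eq_abs, ofReal_norm]
  simp only [e] at h
  rw [← eLpNorm_two_sq] at h
  refine (ENNReal.pow_le_pow_left_iff (n := 2) (by norm_num)).1 (h.trans (le_of_eq ?_))
  rw [mul_pow, ← ENNReal.ofReal_pow (Real.sqrt_nonneg _), Real.sq_sqrt hc]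

/-- The part of `Ω` at distance less than `d` from the complement. -/
def layer (Ω : Set Plane) (d : ℝ) : Set Plane := Ω ∩ {y | ∃ z ∉ Ω, dist y z < d}

theorem IsLipschitzDomain.boundary_estimate (hΩ : IsLipschitzDomain Ω) :
    ∃ C : ℝ, 0 ≤ C ∧ ∀ φ : Plane → ℝ, ContDiff ℝ ∞ φ →
      (eLpNorm φ 2 (arc (frontier Ω)) ≤ ENNReal.ofReal C *
        (eLpNorm φ 2 (volume.restrict Ω) + eLpNorm (∇ φ) 2 (volume.restrict Ω))) ∧
      ∀ d > 0, eLpNorm φ 2 (volume.restrict (layer Ω d)) ≤ ENNReal.ofReal (C * √d) *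
        (eLpNorm φ 2 (volume.restrict Ω) + eLpNorm (∇ φ) 2 (volume.restrict Ω)) := by
  obtain ⟨C, hC⟩ := hΩ.lintegral_estimate
  refine ⟨√C, Real.sqrt_nonneg _, fun φ hφ => ⟨?_, fun d hd => ?_⟩⟩
  · refine eLpNorm_le_of_lintegral C.2 (((hC φ hφ).1).trans ?_)
    rw [NNReal.val_eq_coe, ENNReal.ofReal_coe_nnreal]
    gcongr
    exact lintegral_dens_le hφ _
  · rw [← Real.sqrt_mul (NNReal.coe_nonneg C)]
    refine eLpNorm_le_of_lintegral (by positivity) (((hC φ hφ).2 d hd).trans ?_)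
    rw [ENNReal.ofReal_mul (NNReal.coe_nonneg C), ENNReal.ofReal_coe_nnreal]
    gcongr
    exact lintegral_dens_le hφ _

/-! ### Convergence in `H¹` -/

lemma H1.measurable_fn (u : H1 Ω) : Measurable u.fn := (Lp.stronglyMeasurable u.1.fst).measurable

lemma H1.measurable_grad (u : H1 Ω) : Measurable u.grad :=
  (Lp.stronglyMeasurable u.1.snd).measurable

lemma tendsto_l2_of_tendsto {E : Type*} [NormedAddCommGroup E] {μ : Measure Plane}
    {f : ℕ → Plane → E} {u : Plane → E} (hf : ∀ n, MemLp (f n) 2 μ) (hu : MemLp u 2 μ)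
    (h : Tendsto (fun n => eLpNorm (fun x => f n x - u x) 2 μ) atTop (𝓝 0)) :
    Tendsto (fun n => l2 μ (f n)) atTop (𝓝 (l2 μ u)) := by
  have h' := (tendsto_l2_iff fun n => (hf n).sub hu).1 h
  rw [tendsto_iff_dist_tendsto_zero]
  refine squeeze_zero (fun _ => dist_nonneg) (fun n => ?_) h'
  rw [Real.dist_eq, abs_sub_le_iff]
  constructor
  · have := l2_add_le ((hf n).sub hu) hu
    simp only [Pi.sub_apply, sub_add_cancel] at this
    linarith
  · have := l2_add_le (hu.sub (hf n)) (hf n)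
    simp only [Pi.sub_apply, sub_add_cancel] at this
    have h2 := l2_sub_comm (μ := μ) (F := u) (G := f n)
    change l2 μ (u - f n) = l2 μ (f n - u) at h2
    have e : l2 μ (fun x => u x) = l2 μ u := rfl
    linarith

/-- The boundary layer estimate in `H¹(Ω)`. -/
theorem IsLipschitzDomain.layer_estimate (hΩ : IsLipschitzDomain Ω) :
    ∃ C : ℝ, 0 ≤ C ∧ ∀ (u : H1 Ω) (d : ℝ), 0 < d →
      l2 (volume.restrict (layer Ω d)) u.fn ≤ C * √d * ‖u‖ := by
  obtain ⟨C, hC0, hC⟩ := hΩ.boundary_estimate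
  refine ⟨2 * C, by positivity, fun u d hd => ?_⟩
  obtain ⟨φ, hφs, hφt, -⟩ := hΩ.exists_smooth_approx u.wg u.measurable_fn u.measurable_grad
  have hsub : volume.restrict (layer Ω d) ≤ volume.restrict Ω :=
    Measure.restrict_mono_set _ Set.inter_subset_left
  have m1 : ∀ n, MemLp (φ n) 2 (volume.restrict Ω) := fun n =>
    memLp_of_continuous hΩ.1 (hφs n).continuous 2
  have m2 : ∀ n, MemLp (∇ (φ n)) 2 (volume.restrict Ω) := fun n =>
    memLp_of_continuous hΩ.1 (continuous_gradient (hφs n)) 2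
  have t1 := tendsto_l2_of_tendsto m1 u.wg.fn hφt.1
  have t2 := tendsto_l2_of_tendsto m2 u.wg.grad hφt.2
  have t3 : Tendsto (fun n => l2 (volume.restrict (layer Ω d)) (φ n)) atTop
      (𝓝 (l2 (volume.restrict (layer Ω d)) u.fn)) := by
    refine tendsto_l2_of_tendsto (fun n => (m1 n).mono_measure hsub) (u.wg.fn.mono_measure hsub) ?_
    exact tendsto_of_tendsto_of_tendsto_of_le_of_le tendsto_const_nhds hφt.1 (fun _ => zero_le)
      fun n => eLpNorm_mono_measure _ hsub
  have key : l2 (volume.restrict (layer Ω d)) u.fn ≤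
      C * √d * (l2 (volume.restrict Ω) u.fn + l2 (volume.restrict Ω) u.grad) := by
    refine le_of_tendsto_of_tendsto' t3 ((t1.add t2).const_mul (C * √d)) fun n => ?_
    have := (hC (φ n) (hφs n)).2 d hd
    have h2 := ENNReal.toReal_mono (ENNReal.mul_ne_top ENNReal.ofReal_ne_top
      (ENNReal.add_ne_top.2 ⟨(m1 n).eLpNorm_ne_top, (m2 n).eLpNorm_ne_top⟩)) this
    rwa [ENNReal.toReal_mul, ENNReal.toReal_ofReal (by positivity),
      ENNReal.toReal_add (m1 n).eLpNorm_ne_top (m2 n).eLpNorm_ne_top] at h2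
  have h3 := u.l2_fn_le
  have h4 := u.l2_grad_le
  calc _ ≤ _ := key
    _ ≤ C * √d * (‖u‖ + ‖u‖) := by gcongr
    _ = _ := by ring

/-! ### Traces -/

/-- `C` is a constant of the trace inequality of `Ω`. -/
def TraceConst (Ω : Set Plane) (C : ℝ) : Prop :=
  ∀ φ : Plane → ℝ, ContDiff ℝ ∞ φ → eLpNorm φ 2 (arc (frontier Ω)) ≤ ENNReal.ofReal C *
    (eLpNorm φ 2 (volume.restrict Ω) + eLpNorm (∇ φ) 2 (volume.restrict Ω))

lemma IsLipschitzDomain.exists_traceConst (hΩ : IsLipschitzDomain Ω) :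
    ∃ C : ℝ, 0 ≤ C ∧ TraceConst Ω C := by
  obtain ⟨C, hC0, hC⟩ := hΩ.boundary_estimate
  exact ⟨C, hC0, fun φ hφ => (hC φ hφ).1⟩

lemma gradient_sub' {f g : Plane → ℝ} (hf : ContDiff ℝ ∞ f) (hg : ContDiff ℝ ∞ g) (x : Plane) :
    ∇ (fun y => f y - g y) x = ∇ f x - ∇ g x := by
  ext i
  rw [gradient_apply, fderiv_fun_sub (hf.differentiable (by simp) x) (hg.differentiable (by simp) x)]
  simp [gradient_apply]

lemma TraceConst.memLp {C : ℝ} (hC : TraceConst Ω C) (hΩ : Bornology.IsBounded Ω) {φ : Plane → ℝ}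
    (hφ : ContDiff ℝ ∞ φ) : MemLp φ 2 (arc (frontier Ω)) :=
  ⟨hφ.continuous.aestronglyMeasurable, (hC φ hφ).trans_lt
    (ENNReal.mul_lt_top ENNReal.ofReal_lt_top
      (ENNReal.add_lt_top.2 ⟨(memLp_of_continuous hΩ hφ.continuous 2).2,
        (memLp_of_continuous hΩ (continuous_gradient hφ) 2).2⟩))⟩

/-- The trace inequality for `φ - ψ`, with the right-hand side split through `u`. Both the existence
of traces and their independence of the approximation rest on it. -/
lemma TraceConst.sub_le {C : ℝ} (hC : TraceConst Ω C) (hΩ : Bornology.IsBounded Ω) (u : H1 Ω)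
    {φ ψ : Plane → ℝ} (hφ : ContDiff ℝ ∞ φ) (hψ : ContDiff ℝ ∞ ψ) :
    eLpNorm (fun x => φ x - ψ x) 2 (arc (frontier Ω)) ≤ ENNReal.ofReal C *
      ((eLpNorm (fun x => φ x - u.fn x) 2 (volume.restrict Ω) +
        eLpNorm (fun x => ψ x - u.fn x) 2 (volume.restrict Ω)) +
      (eLpNorm (fun x => ∇ φ x - u.grad x) 2 (volume.restrict Ω) +
        eLpNorm (fun x => ∇ ψ x - u.grad x) 2 (volume.restrict Ω))) := by
  have m1 := fun (f : Plane → ℝ) (hf : ContDiff ℝ ∞ f) =>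
    memLp_of_continuous hΩ hf.continuous 2
  have m2 := fun (f : Plane → ℝ) (hf : ContDiff ℝ ∞ f) =>
    memLp_of_continuous hΩ (continuous_gradient hf) 2
  refine (hC _ (hφ.sub hψ)).trans ?_
  gcongr
  · have := eLpNorm_sub_le ((m1 φ hφ).sub u.wg.fn).1 ((m1 ψ hψ).sub u.wg.fn).1 (p := 2) (by norm_num)
    refine le_trans (le_of_eq ?_) this
    congr 1
    funext x
    simp
  · have := eLpNorm_sub_le ((m2 φ hφ).sub u.wg.grad).1 ((m2 ψ hψ).sub u.wg.grad).1 (p := 2)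
      (by norm_num)
    refine le_trans (le_of_eq ?_) this
    congr 1
    funext x
    rw [gradient_sub' hφ hψ]
    simp

theorem IsLipschitzDomain.exists_isTrace (hΩ : IsLipschitzDomain Ω) (u : H1 Ω) :
    ∃ γ, IsTrace u γ := by
  obtain ⟨C, hC0, hC⟩ := hΩ.exists_traceConst
  obtain ⟨φ, hφs, hφt, -⟩ := hΩ.exists_smooth_approx u.wg u.measurable_fn u.measurable_grad
  have m3 : ∀ n, MemLp (φ n) 2 (arc (frontier Ω)) := fun n => hC.memLp hΩ.1 (hφs n)
  have hb := fun n m => hC.sub_le hΩ.1 u (hφs n) (hφs m)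
  have hcau : CauchySeq fun n => (m3 n).toLp (φ n) := by
    rw [EMetric.cauchySeq_iff']
    intro δ hδ
    have ht : Tendsto (fun n => eLpNorm (fun x => φ n x - u.fn x) 2 (volume.restrict Ω) +
        eLpNorm (fun x => ∇ (φ n) x - u.grad x) 2 (volume.restrict Ω)) atTop (𝓝 0) := by
      simpa using hφt.1.add hφt.2
    have hpos : 0 < δ / (2 * (ENNReal.ofReal C + 1)) :=
      ENNReal.div_pos hδ.ne' (ENNReal.mul_ne_top (by norm_num)
        (ENNReal.add_ne_top.2 ⟨ENNReal.ofReal_ne_top, ENNReal.one_ne_top⟩))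
    obtain ⟨n₀, hn₀⟩ := eventually_atTop.1 (ht.eventually_lt_const hpos)
    refine ⟨n₀, fun n hn => ?_⟩
    rw [Lp.edist_toLp_toLp]
    refine (hb n n₀).trans_lt ?_
    have h1 := hn₀ n hn
    have h2 := hn₀ n₀ le_rfl
    set q := δ / (2 * (ENNReal.ofReal C + 1)) with hq
    calc _ ≤ (ENNReal.ofReal C + 1) * ((eLpNorm (fun x => φ n x - u.fn x) 2 (volume.restrict Ω) +
        eLpNorm (fun x => ∇ (φ n) x - u.grad x) 2 (volume.restrict Ω)) +
        (eLpNorm (fun x => φ n₀ x - u.fn x) 2 (volume.restrict Ω) +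
        eLpNorm (fun x => ∇ (φ n₀) x - u.grad x) 2 (volume.restrict Ω))) := by
          gcongr ?_ * ?_
          · exact le_self_add
          · rw [add_add_add_comm]
      _ < (ENNReal.ofReal C + 1) * (q + q) := by
          refine ENNReal.mul_lt_mul_right (by simp) (by simp) (ENNReal.add_lt_add h1 h2)
      _ ≤ δ := by
          rw [hq, ← two_mul, ← mul_assoc, mul_comm _ (2 : ℝ≥0∞)]
          exact ENNReal.mul_div_le
  obtain ⟨g, hg⟩ := cauchySeq_tendsto_of_complete hcau
  refine ⟨g, Lp.memLp g, φ, hφs, hφt, ?_⟩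
  have := (tendsto_iff_edist_tendsto_0.1 hg)
  refine this.congr fun n => ?_
  rw [Lp.edist_def]
  refine eLpNorm_congr_ae ?_
  filter_upwards [(m3 n).coeFn_toLp] with x hx
  simp [hx]

lemma H1.isTrace_trace (hΩ : IsLipschitzDomain Ω) (u : H1 Ω) : IsTrace u u.trace := by
  have h := hΩ.exists_isTrace u
  rw [H1.trace, dif_pos h]
  exact h.choose_spec

/-- The traces of any smooth approximation converge to the trace. -/
lemma IsTrace.tendsto (hΩ : IsLipschitzDomain Ω) {u : H1 Ω} {γ : Plane → ℝ} (hγ : IsTrace u γ)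
    {φ : ℕ → Plane → ℝ} (hφ : ∀ n, ContDiff ℝ ∞ (φ n)) (h : TendstoH1 Ω φ u.fn u.grad) :
    Tendsto (fun n => eLpNorm (fun x => φ n x - γ x) 2 (arc (frontier Ω))) atTop (𝓝 0) := by
  obtain ⟨hγm, ψ, hψ, hψt, hψγ⟩ := hγ
  obtain ⟨C, hC0, hC⟩ := hΩ.exists_traceConst
  have ht := (ENNReal.Tendsto.const_mul (a := ENNReal.ofReal C)
    ((h.1.add hψt.1).add (h.2.add hψt.2)) (Or.inr ENNReal.ofReal_ne_top)).add hψγ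
  simp only [add_zero, mul_zero] at ht
  refine tendsto_of_tendsto_of_tendsto_of_le_of_le tendsto_const_nhds ht (fun _ => zero_le)
    fun n => ?_
  calc eLpNorm (fun x => φ n x - γ x) 2 (arc (frontier Ω))
      = eLpNorm (fun x => (φ n x - ψ n x) + (ψ n x - γ x)) 2 (arc (frontier Ω)) := by simp
    _ ≤ eLpNorm (fun x => φ n x - ψ n x) 2 (arc (frontier Ω)) +
        eLpNorm (fun x => ψ n x - γ x) 2 (arc (frontier Ω)) :=
        eLpNorm_add_le ((hφ n).sub (hψ n)).continuous.aestronglyMeasurable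
          ((hψ n).continuous.aestronglyMeasurable.sub hγm.1) (by norm_num)
    _ ≤ _ := by
        gcongr
        exact hC.sub_le hΩ.1 u (hφ n) (hψ n)

lemma ae_eq_of_tendsto_eLpNorm {μ : Measure Plane} {φ : ℕ → Plane → ℝ} {γ γ' : Plane → ℝ}
    (hφ : ∀ n, AEStronglyMeasurable (φ n) μ) (hγ : AEStronglyMeasurable γ μ)
    (hγ' : AEStronglyMeasurable γ' μ)
    (h : Tendsto (fun n => eLpNorm (fun x => φ n x - γ x) 2 μ) atTop (𝓝 0))
    (h' : Tendsto (fun n => eLpNorm (fun x => φ n x - γ' x) 2 μ) atTop (𝓝 0)) : γ =ᵐ[μ] γ' := by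
  have ht := h.add h'
  rw [add_zero] at ht
  have h0 : eLpNorm (fun x => γ' x - γ x) 2 μ = 0 := by
    refine le_antisymm (ge_of_tendsto' ht fun n => ?_) zero_le
    have := eLpNorm_sub_le ((hφ n).sub hγ) ((hφ n).sub hγ') (p := 2) (by norm_num)
    refine le_trans (le_of_eq ?_) this
    congr 1
    funext x
    simp
  have h1 := (eLpNorm_eq_zero_iff (hγ'.sub hγ) (by norm_num)).1 h0
  filter_upwards [h1] with x hx
  simp only [Pi.zero_apply, Pi.sub_apply] at hx
  linarith

lemma IsTrace.ae_eq (hΩ : IsLipschitzDomain Ω) {u : H1 Ω} {γ γ' : Plane → ℝ} (h : IsTrace u γ)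
    (h' : IsTrace u γ') : γ =ᵐ[arc (frontier Ω)] γ' := by
  obtain ⟨hγm, ψ, hψ, hψt, hψγ⟩ := h
  exact ae_eq_of_tendsto_eLpNorm (fun n => (hψ n).continuous.aestronglyMeasurable) hγm.1 h'.1.1
    hψγ (h'.tendsto hΩ hψ hψt)

/-- Convergence in `L²` of the boundary values yields an almost everywhere convergent subsequence,
so the trace must be the pointwise limit. -/
lemma H1.trace_eq_of_tendsto (hΩ : IsLipschitzDomain Ω) (u : H1 Ω) {φ : ℕ → Plane → ℝ}
    (hφ : ∀ n, ContDiff ℝ ∞ (φ n)) (h : TendstoH1 Ω φ u.fn u.grad) {f : Plane → ℝ}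
    (hf : ∀ x ∈ frontier Ω, Tendsto (fun n => φ n x) atTop (𝓝 (f x))) :
    u.trace =ᵐ[arc (frontier Ω)] f := by
  have hu := u.isTrace_trace hΩ
  have ht := hu.tendsto hΩ hφ h
  have hm := tendstoInMeasure_of_tendsto_eLpNorm (μ := arc (frontier Ω)) (p := 2) (by norm_num)
    (fun n => (hφ n).continuous.aestronglyMeasurable) hu.1.1 ht
  obtain ⟨ns, hns, hae⟩ := hm.exists_seq_tendsto_ae
  filter_upwards [hae, ae_restrict_mem isClosed_frontier.measurableSet] with x hx hxf
  exact tendsto_nhds_unique hx ((hf x hxf).comp hns.tendsto_atTop)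

lemma H1.trace_sub (hΩ : IsLipschitzDomain Ω) (u v : H1 Ω) :
    (u - v).trace =ᵐ[arc (frontier Ω)] fun x => u.trace x - v.trace x := by
  refine ((u - v).isTrace_trace hΩ).ae_eq hΩ ?_
  obtain ⟨hγ, φ, hφ, hφt, hφγ⟩ := u.isTrace_trace hΩ
  obtain ⟨hγ', ψ, hψ, hψt, hψγ⟩ := v.isTrace_trace hΩ
  have aux : ∀ {E : Type} [NormedAddCommGroup E] {μ : Measure Plane} {f g : ℕ → Plane → E}
      {a b : Plane → E}, (∀ n, AEStronglyMeasurable (f n) μ) → (∀ n, AEStronglyMeasurable (g n) μ) →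
      AEStronglyMeasurable a μ → AEStronglyMeasurable b μ →
      Tendsto (fun n => eLpNorm (fun x => f n x - a x) 2 μ) atTop (𝓝 0) →
      Tendsto (fun n => eLpNorm (fun x => g n x - b x) 2 μ) atTop (𝓝 0) →
      Tendsto (fun n => eLpNorm (fun x => (f n x - g n x) - (a x - b x)) 2 μ) atTop (𝓝 0) := by
    intro E _ μ f g a b hf hg ha hb h1 h2
    have ht := h1.add h2
    rw [add_zero] at ht
    refine tendsto_of_tendsto_of_tendsto_of_le_of_le tendsto_const_nhds ht (fun _ => zero_le)
      fun n => ?_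
    refine le_trans (le_of_eq ?_) (eLpNorm_sub_le ((hf n).sub ha) ((hg n).sub hb) (by norm_num))
    congr 1
    funext x
    simp only [Pi.sub_apply]
    abel
  refine ⟨hγ.sub hγ', fun n x => φ n x - ψ n x, fun n => (hφ n).sub (hψ n), ⟨?_, ?_⟩, ?_⟩
  · refine (aux (fun n => (hφ n).continuous.aestronglyMeasurable)
      (fun n => (hψ n).continuous.aestronglyMeasurable) u.wg.fn.1 v.wg.fn.1 hφt.1 hψt.1).congr
      fun n => eLpNorm_congr_ae ?_
    filter_upwards [H1.fn_sub u v] with x hx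
    rw [hx]
  · refine (aux (fun n => (continuous_gradient (hφ n)).aestronglyMeasurable)
      (fun n => (continuous_gradient (hψ n)).aestronglyMeasurable) u.wg.grad.1 v.wg.grad.1 hφt.2
      hψt.2).congr fun n => eLpNorm_congr_ae ?_
    filter_upwards [H1.grad_sub u v] with x hx
    rw [hx, gradient_sub' (hφ n) (hψ n)]
  · exact aux (fun n => (hφ n).continuous.aestronglyMeasurable)
      (fun n => (hψ n).continuous.aestronglyMeasurable) hγ.1 hγ'.1 hφγ hψγ

lemma H1.memLp_trace (hΩ : IsLipschitzDomain Ω) (u : H1 Ω) :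
    MemLp u.trace 2 (arc (frontier Ω)) := (u.isTrace_trace hΩ).1

theorem IsLipschitzDomain.trace_estimate (hΩ : IsLipschitzDomain Ω) :
    ∃ C : ℝ, 0 ≤ C ∧ ∀ u : H1 Ω, l2 (arc (frontier Ω)) u.trace ≤ C * ‖u‖ := by
  obtain ⟨C, hC0, hC⟩ := hΩ.exists_traceConst
  refine ⟨2 * C, by positivity, fun u => ?_⟩
  obtain ⟨hγ, φ, hφs, hφt, hφγ⟩ := u.isTrace_trace hΩ
  have m1 : ∀ n, MemLp (φ n) 2 (volume.restrict Ω) := fun n =>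
    memLp_of_continuous hΩ.1 (hφs n).continuous 2
  have m2 : ∀ n, MemLp (∇ (φ n)) 2 (volume.restrict Ω) := fun n =>
    memLp_of_continuous hΩ.1 (continuous_gradient (hφs n)) 2
  have t1 := tendsto_l2_of_tendsto m1 u.wg.fn hφt.1
  have t2 := tendsto_l2_of_tendsto m2 u.wg.grad hφt.2
  have t3 := tendsto_l2_of_tendsto (fun n => hC.memLp hΩ.1 (hφs n)) hγ hφγ
  have key : l2 (arc (frontier Ω)) u.trace ≤
      C * (l2 (volume.restrict Ω) u.fn + l2 (volume.restrict Ω) u.grad) := by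
    refine le_of_tendsto_of_tendsto' t3 ((t1.add t2).const_mul C) fun n => ?_
    have h2 := ENNReal.toReal_mono (ENNReal.mul_ne_top ENNReal.ofReal_ne_top
      (ENNReal.add_ne_top.2 ⟨(m1 n).eLpNorm_ne_top, (m2 n).eLpNorm_ne_top⟩)) (hC (φ n) (hφs n))
    rwa [ENNReal.toReal_mul, ENNReal.toReal_ofReal (by positivity),
      ENNReal.toReal_add (m1 n).eLpNorm_ne_top (m2 n).eLpNorm_ne_top] at h2
  have h3 := u.l2_fn_le
  have h4 := u.l2_grad_le
  calc _ ≤ _ := key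
    _ ≤ C * (‖u‖ + ‖u‖) := by gcongr
    _ = _ := by ring

lemma H1.trace_of_continuousOn (hΩ : IsLipschitzDomain Ω) (u : H1 Ω) {ψ : Plane → ℝ}
    (hψm : Measurable ψ) (hψ : ContinuousOn ψ (closure Ω)) (hu : u.fn =ᵐ[volume.restrict Ω] ψ) :
    u.trace =ᵐ[arc (frontier Ω)] ψ := by
  obtain ⟨φ, hφs, hφt, hφp, -⟩ := hΩ.exists_smooth_approx
    (u.wg.congr hu (ae_eq_refl _)) hψm u.measurable_grad
  refine u.trace_eq_of_tendsto hΩ hφs (hφt.congr hΩ.2.1 (fun n x _ => rfl) hu.symm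
    (ae_eq_refl _)) fun x hx => hφp hψ x (frontier_subset_closure hx)

lemma H1.trace_of_memH10 (hΩ : IsLipschitzDomain Ω) (u : H1 Ω) (h : MemH10 Ω u.fn u.grad) :
    u.trace =ᵐ[arc (frontier Ω)] 0 := by
  obtain ⟨φ, hφ, ht⟩ := h
  refine u.trace_eq_of_tendsto hΩ (fun n => (hφ n).1) ht (f := 0) fun x hx => ?_
  rw [hΩ.2.1.frontier_eq] at hx
  simp only [(hφ _).eq_zero hx.2]
  exact tendsto_const_nhds

/-! ### Periodic functions -/

/-- The lattice vector with integer coordinates `z`. -/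
def latVec : (Fin 2 → ℤ) →+ Plane where
  toFun z := WithLp.toLp 2 (fun i => (z i : ℝ))
  map_zero' := by ext i; simp
  map_add' z w := by ext i; simp

lemma latVec_apply (z : Fin 2 → ℤ) (i : Fin 2) : latVec z i = z i := rfl

lemma IsPeriodic.add_latVec {X : Type*} {f : Plane → X} (hf : IsPeriodic f) (x : Plane)
    (z : Fin 2 → ℤ) : f (x + latVec z) = f x := hf x z

lemma IsPeriodic.sub_latVec {X : Type*} {f : Plane → X} (hf : IsPeriodic f) (x : Plane)
    (z : Fin 2 → ℤ) : f (x - latVec z) = f x := by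
  rw [sub_eq_add_neg, ← map_neg, hf.add_latVec]

/-- The representative of `y` modulo the lattice in the closed periodicity cell. -/
def wrap (y : Plane) : Plane := y - latVec (fun i => round (y i))

lemma wrap_apply (y : Plane) (i : Fin 2) : wrap y i = y i - round (y i) := rfl

lemma IsPeriodic.wrap {X : Type*} {f : Plane → X} (hf : IsPeriodic f) (y : Plane) :
    f (wrap y) = f y := hf.sub_latVec _ _

lemma isPeriodic_comp_wrap {X : Type*} (f : Plane → X) : IsPeriodic (fun y => f (wrap y)) := by
  intro x z
  have : wrap (x + WithLp.toLp 2 (fun i => (z i : ℝ))) = wrap x := by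
    ext i
    simp [wrap_apply, round_add_intCast]
  simp only [this]

lemma wrap_eq_self {y : Plane} (hy : y ∈ cell) : wrap y = y := by
  ext i
  have h : round (y i) = 0 := by
    rw [round_eq_zero_iff]
    exact ⟨(hy i).1.le, (hy i).2⟩
  simp [wrap_apply, h]

lemma measurable_wrap : Measurable wrap := by
  have h : Measurable fun y : Plane => fun i => y i - (round (y i) : ℝ) := by
    refine measurable_pi_iff.2 fun i => ?_
    have hi : Measurable fun y : Plane => y i := measurable_coord measurable_id i
    refine hi.sub ?_
    simp only [round_eq]
    exact measurable_from_top.comp (Int.measurable_floor.comp (hi.add_const _))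
  exact (PiLp.continuous_toLp 2 _).measurable.comp h

lemma volume_coord_eq (i : Fin 2) (c : ℝ) : volume {y : Plane | y i = c} = 0 := by
  have h := Measure.pi_hyperplane (fun _ : Fin 2 => (volume : Measure ℝ)) i c
  rw [← volume_pi] at h
  have hm : MeasurableSet {y : Plane | y i = c} :=
    measurableSet_eq_fun (measurable_coord measurable_id i) measurable_const
  rw [← (PiLp.volume_preserving_toLp (Fin 2)).measure_preimage hm.nullMeasurableSet]
  exact h

lemma ae_wrap_mem_cell : ∀ᵐ y : Plane, wrap y ∈ cell := by
  have h : ∀ᵐ y : Plane, ∀ i : Fin 2, ∀ m : ℤ, y i ≠ m - 1 / 2 := by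
    rw [ae_all_iff]; intro i
    rw [ae_all_iff]; intro m
    rw [ae_iff]
    simpa using volume_coord_eq i (m - 1 / 2)
  filter_upwards [h] with y hy i
  have h1 := round_eq (y i)
  have h2 := Int.floor_le (y i + 1 / 2)
  have h3 := Int.lt_floor_add_one (y i + 1 / 2)
  rw [wrap_apply, h1]
  have h4 := hy i ⌊y i + 1 / 2⌋
  refine ⟨?_, by linarith⟩
  rcases h2.lt_or_eq with h | h
  · linarith
  · exact absurd (by linarith) h4

/-- The exceptional set is covered by countably many translates of a null set, up to the null set of
points on cell boundaries. -/
lemma ae_wrap {P : Plane → Prop} (h : ∀ᵐ y ∂volume.restrict cell, P y)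
    (hc : MeasurableSet cell) : ∀ᵐ y : Plane, P (wrap y) := by
  rw [ae_restrict_iff' hc] at h
  have h' : ∀ᵐ y : Plane, ∀ z : Fin 2 → ℤ, y - latVec z ∈ cell → P (y - latVec z) := by
    rw [ae_all_iff]; intro z
    exact (measurePreserving_sub_right volume (latVec z)).quasiMeasurePreserving.ae h
  filter_upwards [h', ae_wrap_mem_cell] with y hy hc
  exact hy _ hc

lemma isOpen_cell : IsOpen cell := by
  have : cell = ⋂ i : Fin 2, (fun y : Plane => y i) ⁻¹' Set.Ioo (-(1 / 2) : ℝ) (1 / 2) := by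
    ext y; simp [cell]
  rw [this]
  exact isOpen_iInter_of_finite fun i => isOpen_Ioo.preimage (by fun_prop)

lemma norm_le_one_of_mem_cell {y : Plane} (hy : y ∈ cell) : ‖y‖ ≤ 1 := by
  refine (norm_le_sum_coord y).trans ?_
  have := abs_le.2 ⟨(hy 0).1.le, (hy 0).2.le⟩
  have := abs_le.2 ⟨(hy 1).1.le, (hy 1).2.le⟩
  linarith

lemma norm_wrap_le (y : Plane) : ‖wrap y‖ ≤ 1 := by
  refine (norm_le_sum_coord _).trans ?_
  rw [wrap_apply, wrap_apply]
  have := abs_sub_round (y 0)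
  have := abs_sub_round (y 1)
  linarith

lemma isBounded_cell : Bornology.IsBounded cell :=
  (Metric.isBounded_closedBall (x := (0 : Plane)) (r := 1)).subset fun y hy => by
    simpa using norm_le_one_of_mem_cell hy

lemma volume_cell : volume cell = 1 := by
  have h : (WithLp.toLp 2 : (Fin 2 → ℝ) → Plane) ⁻¹' cell =
      Set.univ.pi fun _ => Set.Ioo (-(1 / 2) : ℝ) (1 / 2) := by
    ext y
    simp [cell]
  rw [← (PiLp.volume_preserving_toLp (Fin 2)).measure_preimage
    isOpen_cell.measurableSet.nullMeasurableSet, h, volume_pi_pi]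
  simp
  norm_num

/-! ### Integration over the periodicity cell -/

/-- The integer lattice. -/
abbrev lattice : AddSubgroup Plane := latVec.range

instance : Countable lattice := Set.countable_range latVec

lemma mem_cell_unique {x : Plane} {z w : Fin 2 → ℤ} (hz : x - latVec z ∈ cell)
    (hw : x - latVec w ∈ cell) : z = w := by
  funext i
  have h1 := hz i
  have h2 := hw i
  simp only [PiLp.sub_apply, latVec_apply] at h1 h2
  have h3 : ((z i - w i : ℤ) : ℝ) < 1 := by push_cast; linarith [h1.1, h2.2]
  have h4 : (-1 : ℝ) < ((z i - w i : ℤ) : ℝ) := by push_cast; linarith [h1.2, h2.1]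
  have h5 : z i - w i < 1 := by exact_mod_cast h3
  have h6 : -1 < z i - w i := by exact_mod_cast h4
  omega

/-- Integrals of lattice-invariant functions are the same over all fundamental domains; this is how
cells are translated below. -/
lemma isAddFundamentalDomain_cell : IsAddFundamentalDomain lattice cell volume where
  nullMeasurableSet := isOpen_cell.measurableSet.nullMeasurableSet
  ae_covers := by
    filter_upwards [ae_wrap_mem_cell] with y hy
    refine ⟨-⟨latVec fun i => round (y i), _, rfl⟩, ?_⟩
    convert hy using 1
    simp [wrap, AddSubgroup.vadd_def, sub_eq_add_neg, add_comm]
  aedisjoint := by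
    rintro ⟨_, z, rfl⟩ ⟨_, w, rfl⟩ hne
    refine Disjoint.aedisjoint ?_
    rw [Set.disjoint_left]
    rintro x ⟨y, hy, rfl⟩ ⟨y', hy', hyy⟩
    apply hne
    simp only [AddSubgroup.vadd_def, vadd_eq_add] at hyy
    have h := mem_cell_unique (x := latVec z + y) (z := z) (w := w) (by simpa using hy)
      (by rw [← hyy]; simpa using hy')
    rw [h]

open Pointwise in
/-- The integral of a periodic function over a translate of the cell. -/
lemma IsPeriodic.setIntegral_translate {f : Plane → ℝ} (hf : IsPeriodic f) (a : Plane) :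
    ∫ y in {y | y - a ∈ cell}, f y = ∫ y in cell, f y := by
  have h1 : IsAddFundamentalDomain lattice (a +ᵥ cell) volume :=
    isAddFundamentalDomain_cell.vadd_of_comm a
  have h2 : a +ᵥ cell = {y | y - a ∈ cell} := by
    ext y
    simp [Set.mem_vadd_set_iff_neg_vadd_mem, sub_eq_add_neg, add_comm]
  rw [← h2]
  refine h1.setIntegral_eq isAddFundamentalDomain_cell ?_
  rintro ⟨_, z, rfl⟩ x
  simp only [AddSubgroup.vadd_def, vadd_eq_add]
  rw [add_comm, hf.add_latVec]

lemma IsPeriodic.setIntegral_comp_sub {f : Plane → ℝ} (hf : IsPeriodic f) (a : Plane) :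
    ∫ y in cell, f (y - a) = ∫ y in cell, f y := by
  rw [← hf.setIntegral_translate (-a)]
  have h := (measurePreserving_sub_right (volume : Measure Plane) a).setIntegral_preimage_emb
    (measurableEmbedding_subRight a) f {y | y - -a ∈ cell}
  rw [← h]
  congr 2
  ext y
  simp

/-! ### Mollification of periodic functions -/

/-- `f` is measurable, periodic and essentially bounded by `K`. -/
structure PerBdd (K : ℝ) (f : Plane → ℝ) : Prop where
  meas : AEStronglyMeasurable f volume
  per : IsPeriodic f
  bdd : ∀ᵐ y, |f y| ≤ K

lemma PerBdd.locallyIntegrable {K : ℝ} {f : Plane → ℝ} (hf : PerBdd K f) :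
    LocallyIntegrable f volume :=
  (MemLp.locallyIntegrable (memLp_top_of_bound hf.meas K hf.bdd) le_top)

lemma PerBdd.abs_mol_le {K : ℝ} {f : Plane → ℝ} (hf : PerBdd K f) {k : Plane → ℝ} {a : Plane}
    {r : ℝ} (hk : IsKernel k a r) (x : Plane) : |mol k f x| ≤ K := by
  have := abs_mol_sub_le hk hf.locallyIntegrable (x := x) (c := 0) (δ := K)
    (by filter_upwards [hf.bdd] with y hy _; simpa using hy)
  simpa using this

lemma IsPeriodic.mol {f : Plane → ℝ} (hf : IsPeriodic f) (k : Plane → ℝ) :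
    IsPeriodic (mol k f) := by
  intro x z
  change MsFEM.mol k f (x + latVec z) = _
  unfold MsFEM.mol
  rw [← integral_add_right_eq_self _ (latVec z)]
  refine integral_congr_ae (ae_of_all _ fun y => ?_)
  simp only [hf.add_latVec]
  congr 2
  abel

lemma neg_mem_cell {y : Plane} (hy : y ∈ cell) : -y ∈ cell := fun i => by
  have := hy i
  simp only [PiLp.neg_apply]
  exact ⟨by linarith [this.2], by linarith [this.1]⟩

lemma mem_cell_of_norm_lt {y : Plane} (hy : ‖y‖ < 1 / 2) : y ∈ cell := fun i => by
  have := abs_lt.1 ((abs_coord_le y i).trans_lt hy)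
  exact ⟨by linarith [this.1], this.2⟩

lemma measurableSet_translate_cell (x : Plane) : MeasurableSet {y | y - x ∈ cell} :=
  (measurable_id.sub_const x) isOpen_cell.measurableSet

/-- Mollification of a periodic function is an integral over the cell. -/
lemma mol_eq_cell {k f : Plane → ℝ} (hk : ∀ z, k z ≠ 0 → z ∈ cell) (hf : IsPeriodic f)
    (x : Plane) : mol k f x = ∫ y in cell, k (wrap (x - y)) * f y := by
  have hper : IsPeriodic fun y => k (wrap (x - y)) * f y := by
    intro y z
    have h1 := (isPeriodic_comp_wrap k).sub_latVec (x - y) z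
    change k (wrap (x - (y + latVec z))) * f (y + latVec z) = _
    rw [hf.add_latVec, ← sub_sub, h1]
  rw [← hper.setIntegral_translate x, mol, ← setIntegral_eq_integral_of_forall_compl_eq_zero
    (s := {y | y - x ∈ cell})]
  · refine setIntegral_congr_fun (measurableSet_translate_cell x) fun y hy => ?_
    have : x - y ∈ cell := by
      have := neg_mem_cell hy
      rwa [neg_sub] at this
    simp only [wrap_eq_self this]
  · intro y hy
    have : k (x - y) = 0 := by
      by_contra h
      refine hy ?_
      have := neg_mem_cell (hk _ h)
      rwa [neg_sub] at this
    rw [this, zero_mul]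

lemma wrap_eq_of_mem_cell {y : Plane} {z : Fin 2 → ℤ} (h : y - latVec z ∈ cell) :
    wrap y = y - latVec z := by
  have := (isPeriodic_comp_wrap (fun y => y)).sub_latVec y z
  rw [← wrap_eq_self h]
  exact this.symm

lemma comp_wrap_eventuallyEq (k : Plane → ℝ) {y : Plane} (hy : wrap y ∈ cell) :
    (fun y' => k (wrap y')) =ᶠ[𝓝 y] fun y' => k (y' - latVec (fun i => round (y i))) := by
  have hc : Continuous fun y' : Plane => y' - latVec (fun i => round (y i)) := by fun_prop
  filter_upwards [hc.continuousAt.preimage_mem_nhds (isOpen_cell.mem_nhds hy)] with y' hy'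
  rw [wrap_eq_of_mem_cell hy']

/-- The rounding in `wrap` jumps only at the boundary of the cell, where the kernel already
vanishes. The margins fit together: within `1 / 8` of a point with some `|wrap y i| ≥ 3 / 8`, that
coordinate stays at least `1 / 4` in absolute value. -/
lemma contDiff_comp_wrap {k : Plane → ℝ} (hk : ContDiff ℝ ∞ k) (hs : ∀ z, k z ≠ 0 → ‖z‖ < 1 / 4) :
    ContDiff ℝ ∞ fun y => k (wrap y) := by
  rw [contDiff_iff_contDiffAt]
  intro y
  by_cases hy : ∀ i, |wrap y i| < 3 / 8
  · have hyc : wrap y ∈ cell := fun i => by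
      have := abs_lt.1 (hy i)
      exact ⟨by linarith [this.1], by linarith [this.2]⟩
    refine ContDiffAt.congr_of_eventuallyEq ?_ (comp_wrap_eventuallyEq k hyc)
    exact (hk.comp (contDiff_id.sub contDiff_const)).contDiffAt
  · push Not at hy
    obtain ⟨i, hi⟩ := hy
    refine ContDiffAt.congr_of_eventuallyEq (f := fun _ => (0 : ℝ)) contDiffAt_const ?_
    filter_upwards [Metric.ball_mem_nhds y (show (0 : ℝ) < 1 / 8 by norm_num)] with y' hy'
    by_contra h
    have h1 := (abs_coord_le _ i).trans_lt (hs _ h)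
    have h2 : |y i - y' i| < 1 / 8 := by
      have := (abs_coord_le (y' - y) i).trans_lt (mem_ball_iff_norm.1 hy')
      rwa [PiLp.sub_apply, abs_sub_comm] at this
    have h3 := round_le (y i) (round (y' i))
    have h4 := abs_sub_le (y i) (y' i) (round (y' i))
    rw [wrap_apply] at h1 hi
    linarith

lemma gradient_comp_sub_left {k : Plane → ℝ} (hk : ContDiff ℝ ∞ k) (x y : Plane) :
    ∇ (fun y => k (x - y)) y = - ∇ k (x - y) := by
  ext i
  rw [PiLp.neg_apply, gradient_apply, gradient_apply]
  have hd : HasFDerivAt (fun y => k (x - y)) ((fderiv ℝ k (x - y)).comp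
      (-ContinuousLinearMap.id ℝ Plane)) y := by
    refine HasFDerivAt.comp y (hk.differentiable (by simp) (x - y)).hasFDerivAt ?_
    exact (hasFDerivAt_id y).const_sub x
  rw [hd.fderiv]
  simp

lemma gradient_comp_wrap {k : Plane → ℝ} (hk : ContDiff ℝ ∞ k) (x : Plane) :
    ∀ᵐ y, ∇ (fun y => k (wrap (x - y))) y = - ∇ k (wrap (x - y)) := by
  have h : ∀ᵐ y : Plane, wrap (x - y) ∈ cell :=
    (Measure.measurePreserving_sub_left volume x).quasiMeasurePreserving.ae ae_wrap_mem_cell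
  filter_upwards [h] with y hy
  have h1 := comp_wrap_eventuallyEq k hy
  have h2 : (fun y' => k (wrap (x - y'))) =ᶠ[𝓝 y]
      fun y' => k (x - latVec (fun i => round ((x - y) i)) - y') := by
    have hc : Continuous fun y' : Plane => x - y' := by fun_prop
    filter_upwards [hc.continuousAt.eventually h1] with y' hy'
    rw [hy']
    congr 1
    abel
  have h3 : ∇ (fun y => k (wrap (x - y))) y
      = ∇ (fun y' => k (x - latVec (fun i => round ((x - y) i)) - y')) y := by
    simp only [gradient, h2.fderiv_eq]
  rw [h3, gradient_comp_sub_left hk]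
  congr 2
  rw [wrap]
  abel

lemma isPeriodic_comp_wrap_sub (k : Plane → ℝ) (x : Plane) :
    IsPeriodic fun y => k (wrap (x - y)) := by
  intro y z
  have h1 := (isPeriodic_comp_wrap k).sub_latVec (x - y) z
  rw [sub_sub] at h1
  exact h1

/-- The mean over the cell of a partial derivative which is periodic. -/
lemma setIntegral_cell_partial {s : Plane → ℝ} (hs : ContDiff ℝ ∞ s) (i : Fin 2)
    (hp : IsPeriodic fun x => ∇ s x i) :
    ∫ x in cell, (s (x + EuclideanSpace.single i 1) - s x) = ∫ x in cell, ∇ s x i := by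
  set e : Plane := EuclideanSpace.single i 1 with he
  have h1 : ∀ x, s (x + e) - s x = ∫ t in (0 : ℝ)..1, ∇ s (x + t • e) i := by
    intro x
    have hd : ∀ t : ℝ, HasDerivAt (fun t : ℝ => s (x + t • e)) (∇ s (x + t • e) i) t := by
      intro t
      rw [gradient_apply]
      have h := (hs.differentiable (by simp) (x + t • e)).hasFDerivAt
      have h2 : HasDerivAt (fun t : ℝ => x + t • e) e t := by
        simpa using ((hasDerivAt_id t).smul_const e).const_add x
      exact h.comp_hasDerivAt t h2
    rw [intervalIntegral.integral_eq_sub_of_hasDerivAt (fun t _ => hd t)]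
    · simp
    · refine Continuous.intervalIntegrable ?_ _ _
      exact (contDiff_partial hs i).continuous.comp (by fun_prop)
  have hcont : Continuous fun p : ℝ × Plane => ∇ s (p.2 + p.1 • e) i :=
    (contDiff_partial hs i).continuous.comp (by fun_prop)
  have hintg : Integrable (Function.uncurry fun (t : ℝ) (x : Plane) => ∇ s (x + t • e) i)
      ((volume.restrict (Set.uIoc (0 : ℝ) 1)).prod (volume.restrict cell)) := by
    rw [Measure.prod_restrict]
    have hK : IsCompact (Set.Icc (0 : ℝ) 1 ×ˢ closure cell) :=
      isCompact_Icc.prod isBounded_cell.isCompact_closure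
    refine (ContinuousOn.integrableOn_compact hK hcont.continuousOn).mono_set ?_
    refine Set.prod_mono ?_ subset_closure
    rw [Set.uIoc_of_le zero_le_one]
    exact Set.Ioc_subset_Icc_self
  simp only [h1]
  rw [← intervalIntegral_integral_swap hintg]
  have h2 : ∀ t : ℝ, ∫ x in cell, ∇ s (x + t • e) i = ∫ x in cell, ∇ s x i := by
    intro t
    have := hp.setIntegral_comp_sub (-(t • e))
    simpa [sub_neg_eq_add] using this
  simp only [h2]
  simp

lemma IsPeriodic.gradient {q : Plane → ℝ} (hq : IsPeriodic q) : IsPeriodic (∇ q) := by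
  intro x z
  have h : (fun y => q (y + latVec z)) = q := funext fun y => hq.add_latVec y z
  have h2 : fderiv ℝ q (x + latVec z) = fderiv ℝ q x := by
    conv_rhs => rw [← h]
    rw [fderiv_comp_add_right]
  change ∇ q (x + latVec z) = _
  simp only [_root_.gradient, h2]

lemma setIntegral_cell_gradient {q : Plane → ℝ} (hq : ContDiff ℝ ∞ q) (hp : IsPeriodic q)
    (i : Fin 2) : ∫ x in cell, ∇ q x i = 0 := by
  rw [← setIntegral_cell_partial hq i (fun x z => congrArg (fun v : Plane => v i) (hp.gradient x z))]
  have h : ∀ x, q (x + EuclideanSpace.single i 1) = q x := by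
    intro x
    have := hp.add_latVec x (Pi.single i 1)
    convert this using 3
    ext j
    simp [latVec_apply, Pi.single_apply]
  simp [h]

lemma IsKernel.norm_lt_of_gradient_ne {k : Plane → ℝ} {a : Plane} {r : ℝ} (hk : IsKernel k a r)
    {z : Plane} {i : Fin 2} (hz : ∇ k z i ≠ 0) : ‖z - a‖ < r := by
  refine hk.supp z fun h0 => hz ?_
  have hmin : IsLocalMin k z :=
    Filter.Eventually.of_forall fun z => by rw [h0]; exact hk.nonneg z
  simp [_root_.gradient, hmin.fderiv_eq_zero]

/-- The gradient of the mollified corrector. -/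
lemma gradient_mol_of_memH1Per {N : H1 cell} (hN : MemH1Per N) {K : ℝ}
    (hb : PerBdd K fun y => N.fn (wrap y)) {k : Plane → ℝ} (hk : IsKernel k 0 (1 / 4))
    (x : Plane) (i : Fin 2) :
    ∇ (mol k fun y => N.fn (wrap y)) x i = mol k (fun y => N.grad (wrap y) i) x := by
  have hs : ∀ z, k z ≠ 0 → ‖z‖ < 1 / 4 := fun z hz => by simpa using hk.supp z hz
  have hs' : ∀ z, ∇ k z i ≠ 0 → z ∈ cell := fun z hz => by
    have := hk.norm_lt_of_gradient_ne hz
    rw [sub_zero] at this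
    exact mem_cell_of_norm_lt (by linarith)
  rw [gradient_mol hk.smooth hk.hasCompactSupport hb.locallyIntegrable,
    mol_eq_cell hs' (isPeriodic_comp_wrap _),
    mol_eq_cell (fun z hz => mem_cell_of_norm_lt ((hs z hz).trans (by norm_num)))
      (isPeriodic_comp_wrap fun y => N.grad y i)]
  set P : Plane → ℝ := fun y => k (wrap (x - y)) with hP
  have hPs : ContDiff ℝ ∞ P := (contDiff_comp_wrap hk.smooth hs).comp
    (contDiff_const.sub contDiff_id)
  have hPp : IsPeriodic P := isPeriodic_comp_wrap_sub k x
  obtain ⟨φ, hφ, hlim1, hlim2⟩ := hN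
  have hfin : IsFiniteMeasure ((volume : Measure Plane).restrict cell) :=
    ⟨by simp [volume_cell]⟩
  have hcm := isOpen_cell.measurableSet
  have e1 : ∫ y in cell, ∇ k (wrap (x - y)) i * N.fn (wrap y) = - ∫ y in cell, N.fn y * ∇ P y i := by
    rw [← integral_neg]
    refine integral_congr_ae ?_
    filter_upwards [ae_restrict_mem hcm, ae_restrict_of_ae (gradient_comp_wrap hk.smooth x)]
      with y hy h
    rw [h, wrap_eq_self hy]
    simp [mul_comm]
  have e2 : ∫ y in cell, k (wrap (x - y)) * N.grad (wrap y) i = ∫ y in cell, N.grad y i * P y := by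
    refine setIntegral_congr_fun hcm fun y hy => ?_
    simp only [wrap_eq_self hy, hP, mul_comm]
  rw [e1, e2]
  have l1 := tendsto_integral_mul (fun n => memLp_of_continuous isBounded_cell (hφ n).1.continuous 2)
    N.wg.fn (memLp_of_continuous isBounded_cell (contDiff_partial hPs i).continuous 2) hlim1
  have l2 := tendsto_integral_mul (f := fun n x => ∇ (φ n) x i) (fun n => memLp_of_continuous
    isBounded_cell (contDiff_partial (hφ n).1 i).continuous 2)
    (memLp_coord' N.wg.grad i) (memLp_of_continuous isBounded_cell hPs.continuous 2) (by
      refine tendsto_of_tendsto_of_tendsto_of_le_of_le tendsto_const_nhds hlim2 (fun _ => zero_le)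
        fun n => eLpNorm_mono fun x => ?_
      exact abs_coord_le (∇ (φ n) x - N.grad x) i)
  refine tendsto_nhds_unique l1.neg (l2.congr fun n => ?_)
  -- The gradient of the periodic function `φ n * P` has mean zero over the cell. This is
  -- integration by parts without boundary terms, and it is available because `N` is a limit of
  -- periodic functions.
  have hm := setIntegral_cell_gradient ((hφ n).1.mul hPs) (fun x z => by
    change φ n _ * P _ = _
    rw [(hφ n).2, hPp]) i
  have hm' : ∫ y in cell, (∇ (φ n) y i * P y + φ n y * ∇ P y i) = 0 := by
    rw [← hm]
    refine integral_congr_ae (ae_of_all _ fun y => ?_)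
    have := congrArg (fun v : Plane => v i) (gradient_mul (hφ n).1 hPs y)
    simp only [PiLp.add_apply, PiLp.smul_apply, smul_eq_mul] at this
    change _ = ∇ (fun y => φ n y * P y) y i
    simp only [this]
    ring
  rw [integral_add] at hm'
  · linarith
  · exact (memLp_of_continuous isBounded_cell ((contDiff_partial (hφ n).1 i).continuous.mul
      hPs.continuous) 1).integrable le_rfl
  · exact (memLp_of_continuous isBounded_cell ((hφ n).1.continuous.mul
      (contDiff_partial hPs i).continuous) 1).integrable le_rfl

/-- The mean of a mollified periodic function. -/
lemma PerBdd.setIntegral_mol {K : ℝ} {f : Plane → ℝ} (hf : PerBdd K f) {k : Plane → ℝ}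
    (hk : IsKernel k 0 (1 / 4)) : ∫ x in cell, mol k f x = ∫ x in cell, f x := by
  have hs : ∀ z, k z ≠ 0 → ‖z‖ < 1 / 4 := fun z hz => by simpa using hk.supp z hz
  have hs' : ∀ z, k z ≠ 0 → z ∈ cell :=
    fun z hz => mem_cell_of_norm_lt ((hs z hz).trans (by norm_num))
  have hw := (contDiff_comp_wrap hk.smooth hs).continuous
  have hfin : IsFiniteMeasure ((volume : Measure Plane).restrict cell) :=
    ⟨by simp [volume_cell]⟩
  obtain ⟨C, hC⟩ : ∃ C, ∀ z, |k z| ≤ C := by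
    obtain ⟨C, hC⟩ := hk.hasCompactSupport.exists_bound_of_continuous hk.smooth.continuous
    exact ⟨C, hC⟩
  have hintg : Integrable (Function.uncurry fun x y => k (wrap (x - y)) * f y)
      ((volume.restrict cell).prod (volume.restrict cell)) := by
    refine Integrable.of_bound (C := C * K) ?_ ?_
    · refine AEStronglyMeasurable.mul ?_ ?_
      · exact (hw.comp (continuous_fst.sub continuous_snd)).aestronglyMeasurable
      · exact hf.meas.restrict.comp_snd
    · have := Measure.quasiMeasurePreserving_snd (μ := volume.restrict cell)
        (ν := volume.restrict cell) |>.ae (ae_restrict_of_ae hf.bdd)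
      filter_upwards [this] with p hp
      simp only [Function.uncurry, norm_mul, Real.norm_eq_abs]
      exact mul_le_mul (hC _) hp (abs_nonneg _) ((abs_nonneg _).trans (hC 0))
  simp only [mol_eq_cell hs' hf.per]
  rw [integral_integral_swap hintg]
  refine integral_congr_ae (ae_of_all _ fun y => ?_)
  simp only [integral_mul_const]
  rw [(isPeriodic_comp_wrap k).setIntegral_comp_sub y]
  have : ∫ x in cell, k (wrap x) = 1 := by
    have h1 : ∫ z in cell, k z = ∫ z, k z :=
      setIntegral_eq_integral_of_forall_compl_eq_zero fun z hz => by
        by_contra h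
        exact hz (hs' z h)
    rw [← hk.integral_one, ← h1]
    exact setIntegral_congr_fun isOpen_cell.measurableSet fun y hy => by
        simp only [wrap_eq_self hy]
  rw [this, one_mul]

/-! ### Stream functions -/

/-- Rotation by a right angle. -/
def rot (v : Plane) : Plane := !₂[v 1, -v 0]

@[simp] lemma rot_zero (v : Plane) : rot v 0 = v 1 := rfl

@[simp] lemma rot_one (v : Plane) : rot v 1 = -v 0 := rfl

/-- A periodic smooth divergence free field of mean zero is a rotated gradient of a periodic
function. -/
lemma exists_stream {b : Fin 2 → Plane → ℝ} (hb : ∀ i, ContDiff ℝ ∞ (b i))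
    (hp : ∀ i, IsPeriodic (b i)) (hdiv : ∀ x, ∇ (b 0) x 0 + ∇ (b 1) x 1 = 0)
    (hmean : ∀ i, ∫ x in cell, b i x = 0) {K : ℝ} (hK : ∀ i x, |b i x| ≤ K) :
    ∃ s : Plane → ℝ, ContDiff ℝ ∞ s ∧ (∀ x, ∇ s x 0 = - b 1 x) ∧ (∀ x, ∇ s x 1 = b 0 x) ∧
      ∀ x, |s x| ≤ 2 * K := by
  let p : Fin 2 → Plane →L[ℝ] ℝ := fun i => EuclideanSpace.proj i
  have hpe : ∀ i v, p i v = v i := fun i v => rfl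
  -- As a one-form `β = -b₁ dx₀ + b₀ dx₁` is closed precisely because `b` is divergence free, so the
  -- Poincaré lemma gives a primitive `s`.
  let β : Plane → Plane →L[ℝ] ℝ := fun x => (-b 1 x) • p 0 + b 0 x • p 1
  have hβ : ContDiff ℝ ∞ β := ((hb 1).neg.smul contDiff_const).add ((hb 0).smul contDiff_const)
  have hd : ∀ i x, HasFDerivAt (b i) (fderiv ℝ (b i) x) x :=
    fun i x => ((hb i).differentiable (by simp) x).hasFDerivAt
  have hexp : ∀ i x v, fderiv ℝ (b i) x v = v 0 * ∇ (b i) x 0 + v 1 * ∇ (b i) x 1 := by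
    intro i x v
    conv_lhs => rw [eq_coord_sum v]
    rw [map_add, map_smul, map_smul, gradient_apply, gradient_apply]
    rfl
  obtain ⟨s, hs⟩ := convex_univ.exists_forall_hasFDerivAt_of_fderiv_symmetric isOpen_univ
    (hβ.differentiable (by simp)).differentiableOn (fun a _ v w => by
      have h1 : HasFDerivAt β ((-fderiv ℝ (b 1) a).smulRight (p 0)
          + (fderiv ℝ (b 0) a).smulRight (p 1)) a :=
        ((hd 1 a).neg.smul_const (p 0)).add ((hd 0 a).smul_const (p 1))
      rw [h1.fderiv]
      simp only [_root_.add_apply, ContinuousLinearMap.smulRight_apply,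
        _root_.neg_apply, _root_.smul_apply, hexp, hpe, smul_eq_mul]
      linear_combination (v 0 * w 1 - v 1 * w 0) * hdiv a)
  replace hs : ∀ a, HasFDerivAt s (β a) a := fun a => hs a (Set.mem_univ a)
  have hfd : fderiv ℝ s = β := funext fun a => (hs a).fderiv
  have hsm : ContDiff ℝ ∞ s := by
    rw [contDiff_infty_iff_fderiv, hfd]
    exact ⟨fun a => (hs a).differentiableAt, hβ⟩
  have g0 : ∀ x, ∇ s x 0 = - b 1 x := fun x => by
    rw [gradient_apply, hfd]
    simp [β, p]
  have g1 : ∀ x, ∇ s x 1 = b 0 x := fun x => by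
    rw [gradient_apply, hfd]
    simp [β, p]
  have hgper : ∀ i, IsPeriodic fun x => ∇ s x i := by
    intro i x z
    fin_cases i
    · simp only [Fin.zero_eta, g0, hp 1 x z]
    · simp only [Fin.mk_one, g1, hp 0 x z]
  have hgmean : ∀ i, ∫ x in cell, ∇ s x i = 0 := by
    intro i
    fin_cases i
    · simp only [Fin.zero_eta, g0, integral_neg, hmean, neg_zero]
    · simp only [Fin.mk_one, g1, hmean]
  have hβper : ∀ (x : Plane) (z : Fin 2 → ℤ), β (x + latVec z) = β x := by
    intro x z
    simp only [β, (hp _).add_latVec]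
  -- The increment of `s` over one period has derivative zero because `β` is periodic, so it is
  -- constant. The constant equals the mean of `∂_i s` over the cell, which vanishes.
  have hper1 : ∀ i : Fin 2, Function.Periodic s (EuclideanSpace.single i (1 : ℝ)) := by
    intro i x
    set e : Plane := EuclideanSpace.single i 1 with he
    have hel : e = latVec (Pi.single i 1) := by
      ext j
      simp [latVec_apply, Pi.single_apply, he]
    have hder : ∀ y, HasFDerivAt (fun y => s (y + e) - s y) (0 : Plane →L[ℝ] ℝ) y := by
      intro y
      have h1 : HasFDerivAt (fun y => s (y + e)) (β (y + e)) y := by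
        exact (hs (y + e)).comp y ((hasFDerivAt_id y).add_const e)
      have := h1.sub (hs y)
      rwa [hel, hβper, sub_self, ← hel] at this
    have hconst : ∀ y, s (y + e) - s y = s (x + e) - s x := fun y =>
      is_const_of_fderiv_eq_zero (fun y => (hder y).differentiableAt) (fun y => (hder y).fderiv) y x
    have hm := setIntegral_cell_partial hsm i (hgper i)
    rw [hgmean i] at hm
    simp only [← he, hconst] at hm
    have hv : (volume : Measure Plane).real cell = 1 := by simp [Measure.real, volume_cell]
    simp [hv] at hm
    linarith
  have hper : IsPeriodic s := by
    intro x z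
    have e : WithLp.toLp 2 (fun i => (z i : ℝ)) = z 0 • (EuclideanSpace.single 0 (1 : ℝ) : Plane)
        + z 1 • EuclideanSpace.single 1 (1 : ℝ) := by
      apply plane_ext <;> simp
    rw [e, ← add_assoc, ((hper1 1).zsmul (z 1)) _, ((hper1 0).zsmul (z 0)) _]
  have hgb : ∀ x, ‖fderiv ℝ s x‖ ≤ 2 * K := by
    intro x
    rw [← norm_gradient]
    refine (norm_le_sum_coord _).trans ?_
    rw [g0, g1, abs_neg]
    linarith [hK 1 x, hK 0 x]
  have hK0 : 0 ≤ K := (abs_nonneg _).trans (hK 0 0)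
  -- Normalized at the origin, `s` is bounded by its gradient bound `2 K` times `‖wrap x‖ ≤ 1`,
  -- using periodicity.
  refine ⟨fun x => s x - s 0, hsm.sub contDiff_const, fun x => ?_, fun x => ?_, fun x => ?_⟩
  · rw [← g0, gradient_apply, gradient_apply, fderiv_sub_const]
  · rw [← g1, gradient_apply, gradient_apply, fderiv_sub_const]
  · beta_reduce
    rw [← hper.wrap x]
    have := convex_univ.norm_image_sub_le_of_norm_fderiv_le (𝕜 := ℝ) (f := s)
      (fun y _ => (hs y).differentiableAt) (fun y _ => hgb y) (Set.mem_univ 0)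
      (Set.mem_univ (wrap x))
    rw [Real.norm_eq_abs] at this
    refine this.trans ?_
    rw [sub_zero]
    nlinarith [norm_wrap_le x, norm_nonneg (wrap x)]

/-! ### Correctors, their fluxes and smooth approximations -/

lemma w1infNorm_bound {N : H1 cell} {M : ℝ≥0} (h : w1infNorm N ≤ M) :
    ∀ᵐ y ∂volume.restrict cell, |N.fn y| ≤ M ∧ ‖N.grad y‖ ≤ M := by
  have h1 := (le_max_left _ _).trans h
  have h2 := (le_max_right _ _).trans h
  rw [eLpNorm_exponent_top] at h1 h2
  filter_upwards [enorm_ae_le_eLpNormEssSup N.fn (volume.restrict cell),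
    enorm_ae_le_eLpNormEssSup N.grad (volume.restrict cell)] with y e1 e2
  have e1' := e1.trans h1
  have e2' := e2.trans h2
  rw [enorm_le_coe] at e1' e2'
  exact ⟨by exact_mod_cast e1', by exact_mod_cast e2'⟩

/-- Testing ellipticity with the coordinate vectors bounds the diagonal; with their sum and
difference it bounds the off-diagonal entry by polarization, where symmetry is used. -/
lemma IsCoeff.abs_le {κ₁ κ₂ : ℝ} {A : Plane → Matrix (Fin 2) (Fin 2) ℝ} (hA : IsCoeff κ₁ κ₂ A)
    (hκ : 0 ≤ κ₁) : ∀ᵐ y, ∀ i j, |A y i j| ≤ κ₂ := by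
  filter_upwards [hA.symm, hA.elliptic] with y hs he
  have h0 := he (EuclideanSpace.single 0 1)
  have h1 := he (EuclideanSpace.single 1 1)
  have h2 := he (EuclideanSpace.single 0 1 + EuclideanSpace.single 1 1)
  have h3 := he (EuclideanSpace.single 0 1 - EuclideanSpace.single 1 1)
  have hn : ‖(EuclideanSpace.single 0 1 + EuclideanSpace.single 1 1 : Plane)‖ ^ 2 = 2 := by
    rw [EuclideanSpace.norm_sq_eq]; simp; norm_num
  have hn' : ‖(EuclideanSpace.single 0 1 - EuclideanSpace.single 1 1 : Plane)‖ ^ 2 = 2 := by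
    rw [EuclideanSpace.norm_sq_eq]; simp; norm_num
  rw [hn] at h2
  rw [hn'] at h3
  simp [Fin.sum_univ_two] at h0 h1 h2 h3
  have hs' := hs 1 0
  rw [hs'] at h2 h3
  intro i j
  rw [_root_.abs_le]
  fin_cases i <;> fin_cases j <;> simp only [Fin.zero_eta, Fin.mk_one, hs'] <;>
    constructor <;> linarith

/-- The flux of the `l`-th corrector, extended periodically. -/
def flux (A : Plane → Matrix (Fin 2) (Fin 2) ℝ) (N : H1 cell) (l i : Fin 2) (y : Plane) : ℝ :=
  ∑ j, A y i j * (N.grad (wrap y) j + (EuclideanSpace.single l 1 : Plane) j)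

section Corrector

variable {κ₁ κ₂ : ℝ} {A : Plane → Matrix (Fin 2) (Fin 2) ℝ} {N : H1 cell} {M : ℝ≥0} {l : Fin 2}

lemma perBdd_fn (h : w1infNorm N ≤ M) : PerBdd M fun y => N.fn (wrap y) where
  meas := (N.measurable_fn.comp measurable_wrap).aestronglyMeasurable
  per := isPeriodic_comp_wrap _
  bdd := ae_wrap ((w1infNorm_bound h).mono fun _ hy => hy.1) isOpen_cell.measurableSet

lemma perBdd_grad (h : w1infNorm N ≤ M) (i : Fin 2) : PerBdd M fun y => N.grad (wrap y) i where
  meas := ((measurable_coord N.measurable_grad i).comp measurable_wrap).aestronglyMeasurable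
  per := isPeriodic_comp_wrap fun y => N.grad y i
  bdd := ae_wrap (P := fun y => |N.grad y i| ≤ M) ((w1infNorm_bound h).mono fun _ hy =>
    (abs_coord_le _ i).trans hy.2) isOpen_cell.measurableSet

lemma perBdd_flux (hA : IsCoeff κ₁ κ₂ A) (hκ : 0 ≤ κ₁) (h : w1infNorm N ≤ M) (i : Fin 2) :
    PerBdd (2 * (κ₂ * (M + 1))) (flux A N l i) where
  meas := by
    refine (AEMeasurable.aestronglyMeasurable ?_)
    unfold flux
    refine Finset.aemeasurable_fun_sum _ fun j _ => (hA.meas i j).mul ?_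
    exact (perBdd_grad h j).meas.aemeasurable.add_const _
  per := by
    intro x z
    have h1 := fun j => (perBdd_grad h j).per x z
    have h2 := hA.periodic x z
    simp only at h1
    simp only [flux, h1, h2]
  bdd := by
    filter_upwards [hA.abs_le hκ, (perBdd_grad h 0).bdd, (perBdd_grad h 1).bdd] with y h1 h2 h3
    have key : ∀ j, |A y i j * (N.grad (wrap y) j + (EuclideanSpace.single l 1 : Plane) j)|
        ≤ κ₂ * (M + 1) := by
      intro j
      rw [abs_mul]
      refine mul_le_mul (h1 i j) ((abs_add_le _ _).trans (add_le_add ?_ ?_)) (abs_nonneg _)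
        ((abs_nonneg _).trans (h1 i j))
      · fin_cases j <;> assumption
      · fin_cases j <;> fin_cases l <;> simp
    rw [flux, Fin.sum_univ_two, two_mul]
    exact (abs_add_le _ _).trans (add_le_add (key 0) (key 1))

lemma flux_eq_mv (y : Plane) (i : Fin 2) : flux A N l i y =
    mv (A y) (EuclideanSpace.single l 1 + N.grad (wrap y)) i := by
  simp [flux, add_comm]

/-- The mollified flux is divergence free. -/
lemma IsCorrector.div_mol (hA : IsCoeff κ₁ κ₂ A) (hκ : 0 ≤ κ₁) (hN : IsCorrector A l N)
    (h : w1infNorm N ≤ M) {k : Plane → ℝ} (hk : IsKernel k 0 (1 / 4)) (x : Plane) :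
    ∇ (mol k (flux A N l 0)) x 0 + ∇ (mol k (flux A N l 1)) x 1 = 0 := by
  have hs : ∀ z, k z ≠ 0 → ‖z‖ < 1 / 4 := fun z hz => by simpa using hk.supp z hz
  have hs' : ∀ i z, ∇ k z i ≠ 0 → z ∈ cell := fun i z hz => by
    have := hk.norm_lt_of_gradient_ne hz
    rw [sub_zero] at this
    exact mem_cell_of_norm_lt (by linarith)
  have hF := fun i => perBdd_flux (l := l) hA hκ h i
  set P : Plane → ℝ := fun y => k (wrap (x - y)) with hP
  have hPs : ContDiff ℝ ∞ P := (contDiff_comp_wrap hk.smooth hs).comp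
    (contDiff_const.sub contDiff_id)
  have hPp : IsPeriodic P := isPeriodic_comp_wrap_sub k x
  have hPw := WG.of_contDiff isBounded_cell hPs
  -- The periodized kernel `P` is itself smooth and periodic, hence admissible in the corrector
  -- equation.
  have hper : MemH1Per hPw.toH1 := by
    refine ⟨fun _ => P, fun _ => ⟨hPs, hPp⟩, ?_, ?_⟩
    · refine tendsto_const_nhds.congr fun n => ?_
      rw [eLpNorm_congr_ae (g := fun _ => (0 : ℝ)) ?_, eLpNorm_zero']
      filter_upwards [hPw.fn_toH1] with y hy
      simp [hy]
    · refine tendsto_const_nhds.congr fun n => ?_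
      rw [eLpNorm_congr_ae (g := fun _ => (0 : Plane)) ?_, eLpNorm_zero']
      filter_upwards [hPw.grad_toH1] with y hy
      simp [hy]
  have hweak := hN.weak _ hper
  have hfin : IsFiniteMeasure ((volume : Measure Plane).restrict cell) :=
    ⟨by simp [volume_cell]⟩
  have hintg : ∀ i, Integrable (fun y => ∇ P y i * flux A N l i y) (volume.restrict cell) := by
    intro i
    refine integrable_mul' (memLp_of_continuous isBounded_cell (contDiff_partial hPs i).continuous 2)
      ?_
    exact (memLp_top_of_bound (hF i).meas.restrict _ (ae_restrict_of_ae (hF i).bdd)).mono_exponent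
      le_top
  have e : ∀ i, ∇ (mol k (flux A N l i)) x i = - ∫ y in cell, ∇ P y i * flux A N l i y := by
    intro i
    rw [gradient_mol hk.smooth hk.hasCompactSupport (hF i).locallyIntegrable,
      mol_eq_cell (hs' i) (hF i).per, ← integral_neg]
    refine integral_congr_ae ?_
    filter_upwards [ae_restrict_of_ae (gradient_comp_wrap hk.smooth x)] with y hy
    rw [hy]
    simp
  have hsum : ∫ y in cell, (∇ P y 0 * flux A N l 0 y + ∇ P y 1 * flux A N l 1 y) = 0 := by
    rw [← hweak, form_eq]
    refine integral_congr_ae ?_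
    filter_upwards [hPw.grad_toH1, ae_restrict_mem isOpen_cell.measurableSet] with y hy hc
    rw [hy, flux_eq_mv, flux_eq_mv, wrap_eq_self hc, add_comm (N.grad y), PiLp.inner_apply,
      Fin.sum_univ_two]
    simp
  rw [e, e, ← neg_add, ← integral_add (hintg 0) (hintg 1), hsum, neg_zero]

lemma homogenized_eq (N : Fin 2 → H1 cell) (i l : Fin 2) :
    homogenized A N i l = ∫ y in cell, flux A (N l) l i y := by
  refine setIntegral_congr_fun isOpen_cell.measurableSet fun y hy => ?_
  simp only [flux, wrap_eq_self hy, mul_add, Finset.sum_add_distrib]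
  rw [add_comm]
  congr 1
  simp

lemma abs_homogenized_le {N : Fin 2 → H1 cell} (hA : IsCoeff κ₁ κ₂ A) (hκ : 0 ≤ κ₁)
    (h : ∀ l, w1infNorm (N l) ≤ M) (i l : Fin 2) :
    |homogenized A N i l| ≤ 2 * (κ₂ * (M + 1)) := by
  rw [homogenized_eq]
  have hv : (volume : Measure Plane).real cell = 1 := by simp [Measure.real, volume_cell]
  have := norm_setIntegral_le_of_norm_le_const_ae (μ := volume) (s := cell)
    (f := flux A (N l) l i) (by simp [volume_cell])
    (ae_restrict_of_ae (perBdd_flux (l := l) hA hκ (h l) i).bdd)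
  rwa [hv, mul_one] at this

end Corrector

/-- Smooth approximations `P n l` of the correctors, with gradients converging to `G l`, and
stream functions `s n l` of the correction of the flux, at the scale `ε`. -/
structure CorrectorApprox (B : Plane → Matrix (Fin 2) (Fin 2) ℝ) (Â : Matrix (Fin 2) (Fin 2) ℝ)
    (K ε : ℝ) (G : Fin 2 → Plane → Plane) (P s : ℕ → Fin 2 → Plane → ℝ) : Prop where
  smooth_corr : ∀ n l, ContDiff ℝ ∞ (P n l)
  smooth_stream : ∀ n l, ContDiff ℝ ∞ (s n l)
  corr_le : ∀ n l x, |P n l x| ≤ K * ε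
  stream_le : ∀ n l x, |s n l x| ≤ K * ε
  grad_corr_le : ∀ n l x, ‖∇ (P n l) x‖ ≤ K
  grad_stream_le : ∀ n l x, ‖∇ (s n l) x‖ ≤ K
  tendsto_corr : ∀ l, ∀ᵐ x, Tendsto (fun n => ∇ (P n l) x) atTop (𝓝 (G l x))
  tendsto_stream : ∀ l, ∀ᵐ x, Tendsto (fun n => rot (∇ (s n l) x)) atTop
    (𝓝 (mv Â (EuclideanSpace.single l 1) - mv (B x) (EuclideanSpace.single l 1 + G l x)))

lemma tendsto_plane {ι : Type*} {f : Filter ι} {v : ι → Plane} {w : Plane}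
    (h0 : Tendsto (fun n => v n 0) f (𝓝 (w 0))) (h1 : Tendsto (fun n => v n 1) f (𝓝 (w 1))) :
    Tendsto v f (𝓝 w) := by
  have := (h0.smul_const (EuclideanSpace.single 0 (1 : ℝ) : Plane)).add
    (h1.smul_const (EuclideanSpace.single 1 (1 : ℝ) : Plane))
  rw [← eq_coord_sum] at this
  exact this.congr fun n => (eq_coord_sum (v n)).symm

/-- Mollification keeps periodicity, bounds and means, and commutes with the gradient of the
correctors and with the vanishing divergence of their fluxes; Lebesgue differentiation gives
convergence almost everywhere. The constant arises as follows: the flux is at most `2 κ₂ (M + 1)`,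
its deviation from `Â e_l` at most twice that, and `exists_stream` doubles once more. The two
components of the corrector gradient contribute `2 M`. -/
lemma exists_correctorApprox {κ₁ κ₂ : ℝ} {A : Plane → Matrix (Fin 2) (Fin 2) ℝ}
    {N : Fin 2 → H1 cell} {M : ℝ≥0} (hA : IsCoeff κ₁ κ₂ A) (hκ : 0 ≤ κ₁)
    (hN : ∀ l, IsCorrector A l (N l)) (h : ∀ l, w1infNorm (N l) ≤ M) :
    ∃ G P s, CorrectorApprox A (homogenized A N) (2 * M + 8 * (κ₂ * (M + 1))) 1 G P s := by
  -- The outer radius is at most `1 / 4`, as the cell lemmas require. The ratio of the radii is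
  -- always `2`, which the Lebesgue differentiation theorem for bump functions needs to be bounded.
  let bump : ℕ → ContDiffBump (0 : Plane) := fun n =>
    ⟨1 / (8 * ((n : ℝ) + 1)), 1 / (4 * ((n : ℝ) + 1)), by positivity, by
      apply one_div_lt_one_div_of_lt <;> [positivity; linarith [(n.cast_nonneg : (0 : ℝ) ≤ n)]]⟩
  let k : ℕ → Plane → ℝ := fun n => (bump n).normed volume
  have hk : ∀ n, IsKernel (k n) 0 (1 / 4) := by
    intro n
    refine ⟨(bump n).contDiff_normed, fun z => (bump n).nonneg_normed _, (bump n).integral_normed,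
      fun z hz => ?_⟩
    have : z ∈ Function.support (k n) := hz
    rw [(bump n).support_normed_eq, mem_ball_iff_norm] at this
    refine this.trans_le ?_
    apply one_div_le_one_div_of_le (by norm_num)
    linarith [(n.cast_nonneg : (0 : ℝ) ≤ n)]
  have hlim : ∀ {K : ℝ} {f : Plane → ℝ}, PerBdd K f →
      ∀ᵐ x, Tendsto (fun n => mol (k n) f x) atTop (𝓝 (f x)) := by
    intro K f hf
    have := ContDiffBump.ae_convolution_tendsto_right_of_locallyIntegrable (φ := bump) (l := atTop)
      (K := 2) (g := f) (μ := volume) ?_ ?_ hf.locallyIntegrable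
    · filter_upwards [this] with x hx
      refine hx.congr fun n => ?_
      rw [mol_eq_convolution]
    · have := (tendsto_one_div_add_atTop_nhds_zero_nat (𝕜 := ℝ)).const_mul (1 / 4)
      rw [mul_zero] at this
      refine this.congr fun n => ?_
      simp only [bump]
      field_simp
    · refine Eventually.of_forall fun n => le_of_eq ?_
      simp only [bump]
      field_simp
      norm_num
  have hκ₂ : 0 ≤ κ₂ := by
    obtain ⟨y, hy⟩ := (hA.abs_le hκ).exists
    exact (abs_nonneg _).trans (hy 0 0)
  have hM : (0 : ℝ) ≤ M := M.2
  have hKn : 0 ≤ κ₂ * (M + 1) := by positivity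
  have hF := fun l i => perBdd_flux (l := l) hA hκ (h l) i
  have hex : ∀ n l, ∃ s : Plane → ℝ, ContDiff ℝ ∞ s ∧
      (∀ x, ∇ s x 0 = - (homogenized A N 1 l - mol (k n) (flux A (N l) l 1) x)) ∧
      (∀ x, ∇ s x 1 = homogenized A N 0 l - mol (k n) (flux A (N l) l 0) x) ∧
      ∀ x, |s x| ≤ 2 * (4 * (κ₂ * (M + 1))) := by
    intro n l
    have hsm : ∀ i, ContDiff ℝ ∞ (mol (k n) (flux A (N l) l i)) := fun i =>
      contDiff_mol (hk n).smooth (hk n).hasCompactSupport (hF l i).locallyIntegrable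
    refine exists_stream (b := fun i x => homogenized A N i l - mol (k n) (flux A (N l) l i) x)
      (fun i => contDiff_const.sub (hsm i)) (fun i x z => ?_) (fun x => ?_) (fun i => ?_)
      (fun i x => ?_)
    · simp only [(hF l i).per.mol (k n) x z]
    · have hd := (hN l).div_mol hA hκ (h l) (hk n) x
      rw [gradient_apply, gradient_apply, fderiv_const_sub, fderiv_const_sub,
        _root_.neg_apply, _root_.neg_apply, ← gradient_apply,
        ← gradient_apply]
      linarith
    · have hfin : IsFiniteMeasure ((volume : Measure Plane).restrict cell) :=
        ⟨by simp [volume_cell]⟩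
      have hv : (volume : Measure Plane).real cell = 1 := by simp [Measure.real, volume_cell]
      rw [integral_sub (integrable_const _)
        ((memLp_of_continuous isBounded_cell (hsm i).continuous 1).integrable le_rfl),
        (hF l i).setIntegral_mol (hk n), homogenized_eq]
      simp [hv]
    · have := abs_homogenized_le hA hκ h i l
      have := (hF l i).abs_mol_le (hk n) x
      exact (abs_sub _ _).trans (by linarith)
  choose s hs1 hs2 hs3 hs4 using hex
  have hgP := fun n l x i => gradient_mol_of_memH1Per (hN l).periodic (perBdd_fn (h l)) (hk n) x i
  refine ⟨fun l y => (N l).grad (wrap y), fun n l => mol (k n) fun y => (N l).fn (wrap y), s,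
    fun n l => contDiff_mol (hk n).smooth (hk n).hasCompactSupport
      (perBdd_fn (h l)).locallyIntegrable, hs1, fun n l x => ?_, fun n l x => ?_, fun n l x => ?_,
    fun n l x => ?_, fun l => ?_, fun l => ?_⟩
  · have := (perBdd_fn (h l)).abs_mol_le (hk n) x
    linarith
  · have := hs4 n l x
    linarith
  · refine (norm_le_sum_coord _).trans ?_
    rw [hgP, hgP]
    have := (perBdd_grad (h l) 0).abs_mol_le (hk n) x
    have := (perBdd_grad (h l) 1).abs_mol_le (hk n) x
    linarith
  · refine (norm_le_sum_coord _).trans ?_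
    rw [hs2, hs3, abs_neg]
    have h0 := abs_homogenized_le hA hκ h 0 l
    have h1 := abs_homogenized_le hA hκ h 1 l
    have h2 := (hF l 0).abs_mol_le (hk n) x
    have h3 := (hF l 1).abs_mol_le (hk n) x
    have h4 := abs_sub (homogenized A N 1 l) (mol (k n) (flux A (N l) l 1) x)
    have h5 := abs_sub (homogenized A N 0 l) (mol (k n) (flux A (N l) l 0) x)
    linarith
  · filter_upwards [hlim (perBdd_grad (h l) 0), hlim (perBdd_grad (h l) 1)] with x h0 h1
    refine tendsto_plane (h0.congr fun n => (hgP n l x 0).symm) (h1.congr fun n => (hgP n l x 1).symm)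
  · filter_upwards [hlim (hF l 0), hlim (hF l 1)] with x h0 h1
    refine tendsto_plane ?_ ?_
    · simp only [rot_zero, hs3, PiLp.sub_apply, ← flux_eq_mv]
      have : mv (homogenized A N) (EuclideanSpace.single l 1) 0 = homogenized A N 0 l := by simp
      rw [this]
      exact tendsto_const_nhds.sub h0
    · simp only [rot_one, hs2, PiLp.sub_apply, ← flux_eq_mv, neg_neg]
      have : mv (homogenized A N) (EuclideanSpace.single l 1) 1 = homogenized A N 1 l := by simp
      rw [this]
      exact tendsto_const_nhds.sub h1

/-! ### Rescaling to period `ε` -/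

lemma gradient_comp_smul {f : Plane → ℝ} (hf : ContDiff ℝ ∞ f) (c : ℝ) (x : Plane) :
    ∇ (fun y => f (c • y)) x = c • ∇ f (c • x) := by
  ext i
  have hd : HasFDerivAt (fun y => f (c • y)) ((fderiv ℝ f (c • x)).comp
      (c • ContinuousLinearMap.id ℝ Plane)) x :=
    HasFDerivAt.comp x (hf.differentiable (by simp) (c • x)).hasFDerivAt
      ((hasFDerivAt_id x).const_smul c)
  rw [gradient_apply, hd.fderiv, PiLp.smul_apply, gradient_apply]
  simp

lemma ae_comp_smul {P : Plane → Prop} (h : ∀ᵐ x, P x) {c : ℝ} (hc : c ≠ 0) : ∀ᵐ x, P (c • x) := by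
  rw [ae_iff] at h ⊢
  have := Measure.addHaar_preimage_smul (volume : Measure Plane) hc {x | ¬ P x}
  rw [h, mul_zero] at this
  exact this

/-- Passing from `f` to `ε f(x / ε)` multiplies sizes by `ε` and leaves gradient bounds unchanged.
-/
lemma CorrectorApprox.scale {A : Plane → Matrix (Fin 2) (Fin 2) ℝ} {Â : Matrix (Fin 2) (Fin 2) ℝ}
    {K ε : ℝ} (hε : 0 < ε) {G : Fin 2 → Plane → Plane} {P s : ℕ → Fin 2 → Plane → ℝ}
    (h : CorrectorApprox A Â K 1 G P s) :
    CorrectorApprox (scaled A ε) Â K ε (fun l x => G l (ε⁻¹ • x))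
      (fun n l x => ε * P n l (ε⁻¹ • x)) (fun n l x => ε * s n l (ε⁻¹ • x)) := by
  have hc : ContDiff ℝ ∞ fun x : Plane => ε⁻¹ • x := contDiff_const_smul _
  have hg : ∀ {f : Plane → ℝ}, ContDiff ℝ ∞ f → ∀ x, ∇ (fun x => ε * f (ε⁻¹ • x)) x
      = ∇ f (ε⁻¹ • x) := by
    intro f hf x
    rw [gradient_const_mul' (f := fun x => f (ε⁻¹ • x)) (hf.comp hc), gradient_comp_smul hf, smul_smul,
      mul_inv_cancel₀ hε.ne', one_smul]
  have hb : ∀ {t : ℝ}, |t| ≤ K * 1 → |ε * t| ≤ K * ε := by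
    intro t ht
    rw [abs_mul, abs_of_pos hε]
    nlinarith
  refine ⟨fun n l => contDiff_const.mul ((h.smooth_corr n l).comp hc),
    fun n l => contDiff_const.mul ((h.smooth_stream n l).comp hc),
    fun n l x => hb (h.corr_le n l _), fun n l x => hb (h.stream_le n l _),
    fun n l x => ?_, fun n l x => ?_, fun l => ?_, fun l => ?_⟩
  · rw [hg (h.smooth_corr n l)]
    exact h.grad_corr_le n l _
  · rw [hg (h.smooth_stream n l)]
    exact h.grad_stream_le n l _
  · simp only [hg (h.smooth_corr _ l)]
    exact ae_comp_smul (h.tendsto_corr l) (inv_ne_zero hε.ne')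
  · simp only [hg (h.smooth_stream _ l)]
    exact ae_comp_smul (h.tendsto_stream l) (inv_ne_zero hε.ne')

lemma IsCoeff.bddCoeff_scaled {κ₁ κ₂ : ℝ} {A : Plane → Matrix (Fin 2) (Fin 2) ℝ}
    (hA : IsCoeff κ₁ κ₂ A) (hκ : 0 ≤ κ₁) {ε : ℝ} (hε : 0 < ε) : BddCoeff κ₂ (scaled A ε) where
  meas i j := by
    refine (hA.meas i j).comp_quasiMeasurePreserving ⟨measurable_const_smul _, ?_⟩
    refine Measure.AbsolutelyContinuous.mk fun t ht h0 => ?_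
    rw [Measure.map_apply (measurable_const_smul _) ht,
      Measure.addHaar_preimage_smul _ (inv_ne_zero hε.ne'), h0, mul_zero]
  bdd := ae_comp_smul (hA.abs_le hκ) (inv_ne_zero hε.ne')

lemma IsCoeff.elliptic_scaled {κ₁ κ₂ : ℝ} {A : Plane → Matrix (Fin 2) (Fin 2) ℝ}
    (hA : IsCoeff κ₁ κ₂ A) {ε : ℝ} (hε : 0 < ε) :
    ∀ᵐ y, ∀ ξ : Plane, κ₁ * ‖ξ‖ ^ 2 ≤ inner ℝ (mv (scaled A ε y) ξ) ξ := by
  filter_upwards [ae_comp_smul hA.elliptic (inv_ne_zero hε.ne')] with y hy ξ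
  rw [inner_mv]
  exact (hy ξ).1.trans (le_of_eq (Finset.sum_congr rfl fun i _ => Finset.sum_congr rfl fun j _ => by
    rw [scaled]; ring))

/-! ### Cut-off functions -/

lemma isOpen_layer (hU : IsOpen U) (d : ℝ) : IsOpen (layer U d) := by
  refine hU.inter ?_
  have : {y : Plane | ∃ z ∉ U, dist y z < d} = ⋃ z ∈ Uᶜ, Metric.ball z d := by
    ext y; simp
  rw [this]
  exact isOpen_biUnion fun z _ => Metric.isOpen_ball

lemma lipschitz_mol {k : Plane → ℝ} {a : Plane} {r : ℝ} (hk : IsKernel k a r) {q : Plane → ℝ}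
    {C : ℝ≥0} (hq : LipschitzWith C q) : LipschitzWith C (mol k q) := by
  have hli : LocallyIntegrable q volume := hq.continuous.locallyIntegrable
  refine LipschitzWith.of_dist_le_mul fun x y => ?_
  have e : ∀ x, mol k q x = ∫ z, k z * q (x - z) := by
    intro x
    rw [mol, ← integral_sub_left_eq_self (fun z => k z * q (x - z)) volume x]
    simp
  have hi : ∀ x, Integrable (fun z => k z * q (x - z)) volume := by
    intro x
    have := (hk.integrable_mul hli x).comp_sub_left x
    simpa using this
  rw [Real.dist_eq, e, e, ← integral_sub (hi x) (hi y), ← Real.norm_eq_abs]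
  have h1 : ∫ z, k z * (C * dist x y) = C * dist x y := by
    rw [integral_mul_const, hk.integral_one, one_mul]
  rw [← h1]
  refine norm_integral_le_of_norm_le (hk.integrable.mul_const _) (ae_of_all _ fun z => ?_)
  rw [← mul_sub, norm_mul, Real.norm_of_nonneg (hk.nonneg _)]
  refine mul_le_mul_of_nonneg_left ?_ (hk.nonneg _)
  have := hq.dist_le_mul (x - z) (y - z)
  rwa [dist_sub_right, Real.dist_eq] at this

/-- A cut-off function which equals one off the layer of width `d` at the boundary. -/
lemma exists_cutoff (hU : IsOpen U) (hb : Bornology.IsBounded U) {d : ℝ} (hd : 0 < d) :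
    ∃ η : Plane → ℝ, IsTestFun U η ∧ (∀ x, 0 ≤ η x ∧ η x ≤ 1) ∧ (∀ x, ‖∇ η x‖ ≤ 4 / d) ∧
      ∀ x ∈ U, x ∉ layer U d → η x = 1 ∧ ∇ η x = 0 := by
  have hne : (Uᶜ).Nonempty := by
    rw [Set.nonempty_compl]
    rintro rfl
    exact NormedSpace.unbounded_univ ℝ Plane hb
  set δ : Plane → ℝ := fun x => Metric.infDist x Uᶜ with hδ
  have hδl : LipschitzWith 1 δ := Metric.lipschitz_infDist_pt _
  -- A ramp in the distance to the complement, rising from `0` at `d / 4` to `1` at `d / 2` with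
  -- slope `4 / d`. Mollification at scale `d / 8` preserves the Lipschitz constant and moves the
  -- thresholds to `d / 8` and `5 d / 8`, leaving margin on both sides.
  set q : Plane → ℝ := fun x => max 0 (min 1 (4 / d * δ x - 1)) with hq
  have hql : LipschitzWith (4 / d).toNNReal q := by
    have h1 : LipschitzWith (4 / d).toNNReal fun x => 4 / d * δ x - 1 := by
      refine LipschitzWith.of_dist_le_mul fun x y => ?_
      have := hδl.dist_le_mul x y
      rw [Real.dist_eq] at this ⊢
      have e : 4 / d * δ x - 1 - (4 / d * δ y - 1) = 4 / d * (δ x - δ y) := by ring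
      rw [e, abs_mul, abs_of_pos (by positivity), Real.coe_toNNReal _ (by positivity)]
      simp only [NNReal.coe_one, one_mul] at this
      exact mul_le_mul_of_nonneg_left this (by positivity)
    exact (h1.const_min 1).const_max 0
  have hq01 : ∀ x, 0 ≤ q x ∧ q x ≤ 1 := fun x =>
    ⟨le_max_left _ _, max_le zero_le_one (min_le_left _ _)⟩
  obtain ⟨k, hk⟩ := exists_kernel 0 (show 0 < d / 8 by positivity)
  have hli : LocallyIntegrable q volume := hql.continuous.locallyIntegrable
  have hsm := contDiff_mol hk.smooth hk.hasCompactSupport hli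
  have hloc : ∀ x y, k (x - y) ≠ 0 → |δ x - δ y| < d / 8 := by
    intro x y hxy
    have h1 := hk.supp _ hxy
    have h2 := hδl.dist_le_mul x y
    rw [Real.dist_eq, dist_eq_norm] at h2
    simp only [NNReal.coe_one, one_mul] at h2
    rw [sub_zero] at h1
    linarith
  have hone : ∀ x, 5 / 8 * d ≤ δ x → mol k q x = 1 := by
    intro x hx
    have := abs_mol_sub_le hk hli (x := x) (c := 1) (δ := 0) (ae_of_all _ fun y hy => ?_)
    · linarith [abs_nonpos_iff.1 this]
    · have h1 := abs_lt.1 (hloc x y hy)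
      have h2 : 1 ≤ 4 / d * δ y - 1 := by
        have : 1 / 2 * d ≤ δ y := by linarith [h1.2]
        have := mul_le_mul_of_nonneg_left this (show 0 ≤ 4 / d by positivity)
        have e : 4 / d * (1 / 2 * d) = 2 := by field_simp; norm_num
        linarith
      simp [hq, h2]
  have hzero : ∀ x, δ x ≤ d / 8 → mol k q x = 0 := by
    intro x hx
    have := abs_mol_sub_le hk hli (x := x) (c := 0) (δ := 0) (ae_of_all _ fun y hy => ?_)
    · linarith [abs_nonpos_iff.1 this]
    · have h1 := abs_lt.1 (hloc x y hy)
      have h2 : 4 / d * δ y - 1 ≤ 0 := by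
        have : δ y ≤ 1 / 4 * d := by linarith [h1.1]
        have := mul_le_mul_of_nonneg_left this (show 0 ≤ 4 / d by positivity)
        have e : 4 / d * (1 / 4 * d) = 1 := by field_simp
        linarith
      have h3 : q y = 0 := by
        simp only [hq]
        exact max_eq_left ((min_le_right _ _).trans h2)
      simp [h3]
  have hts : tsupport (mol k q) ⊆ U := by
    have h1 : tsupport (mol k q) ⊆ {x | d / 8 ≤ δ x} := by
      refine closure_minimal (fun x hx => ?_) (isClosed_le continuous_const hδl.continuous)
      by_contra hlt
      exact hx (hzero x (not_le.1 hlt).le)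
    refine h1.trans fun x hx => ?_
    by_contra hxU
    have : δ x = 0 := Metric.infDist_zero_of_mem hxU
    have hx' : d / 8 ≤ δ x := hx
    linarith
  refine ⟨mol k q, ⟨hsm, ?_, hts⟩, fun x => ?_, fun x => ?_, fun x hx hxl => ?_⟩
  · exact Metric.isCompact_of_isClosed_isBounded (isClosed_tsupport _) (hb.subset hts)
  · have := abs_mol_sub_le hk hli (x := x) (c := 1 / 2) (δ := 1 / 2) (ae_of_all _ fun y _ => by
      rw [abs_le]
      constructor <;> linarith [(hq01 y).1, (hq01 y).2])
    rw [abs_le] at this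
    constructor <;> linarith [this.1, this.2]
  · rw [norm_gradient]
    have := norm_fderiv_le_of_lipschitz ℝ (lipschitz_mol hk hql) (x₀ := x)
    rwa [Real.coe_toNNReal _ (by positivity)] at this
  · have hdx : d ≤ δ x := by
      by_contra hlt
      obtain ⟨z, hz, hdz⟩ := (Metric.infDist_lt_iff hne).1 (not_le.1 hlt)
      exact hxl ⟨hx, z, hz, hdz⟩
    refine ⟨hone x (by linarith), ?_⟩
    have hev : mol k q =ᶠ[𝓝 x] fun _ => (1 : ℝ) := by
      have : ∀ᶠ y in 𝓝 x, 5 / 8 * d < δ y :=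
        hδl.continuous.continuousAt.eventually (lt_mem_nhds (by linarith))
      filter_upwards [this] with y hy
      exact hone y hy.le
    simp [gradient, hev.fderiv_eq]

/-! ### The two-scale expansion -/

lemma rot_sub (v w : Plane) : rot (v - w) = rot v - rot w := by
  apply plane_ext <;> simp [sub_eq_add_neg, add_comm]

lemma rot_smul (c : ℝ) (v : Plane) : rot (c • v) = c • rot v := by
  apply plane_ext <;> simp

lemma norm_rot (v : Plane) : ‖rot v‖ = ‖v‖ := by
  simp [EuclideanSpace.norm_eq, Fin.sum_univ_two, add_comm]

lemma continuous_rot : Continuous rot := by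
  have : rot = fun v : Plane => (WithLp.toLp 2 ![v 1, -v 0] : Plane) := rfl
  rw [this]
  refine (PiLp.continuous_toLp 2 _).comp (continuous_pi fun i => ?_)
  fin_cases i
  · exact (EuclideanSpace.proj (𝕜 := ℝ) (1 : Fin 2)).continuous
  · exact (EuclideanSpace.proj (𝕜 := ℝ) (0 : Fin 2)).continuous.neg

lemma memLp_rot {μ : Measure Plane} {W : Plane → Plane} (hW : MemLp W 2 μ) :
    MemLp (fun x => rot (W x)) 2 μ :=
  hW.of_le (continuous_rot.comp_aestronglyMeasurable hW.1) (ae_of_all _ fun _ => (norm_rot _).le)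

lemma l2_rot {μ : Measure Plane} (W : Plane → Plane) : l2 μ (fun x => rot (W x)) = l2 μ W := by
  unfold l2
  congr 1
  exact eLpNorm_congr_norm_ae (ae_of_all _ fun x => norm_rot _)

lemma MemH10.wg (hb : Bornology.IsBounded U) {u : Plane → ℝ} {G : Plane → Plane}
    (h : MemH10 U u G) (hu : MemLp u 2 (volume.restrict U)) (hG : MemLp G 2 (volume.restrict U)) :
    WG U u G := by
  obtain ⟨φ, hφ, h1, h2⟩ := h
  exact WG.of_tendsto (fun n => WG.of_contDiff hb (hφ n).1) hu hG h1 h2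

/-- Rotated gradients of functions vanishing on the boundary are orthogonal to gradients. -/
lemma MemH10.integral_rot (hb : Bornology.IsBounded U) {u : Plane → ℝ} {W : Plane → Plane}
    (h : MemH10 U u W) (hW : MemLp W 2 (volume.restrict U)) {v : Plane → ℝ} {g : Plane → Plane}
    (hv : WG U v g) : ∫ x in U, inner ℝ (rot (W x)) (g x) = 0 := by
  obtain ⟨φ, hφ, h1, h2⟩ := h
  have hm : ∀ n, MemLp (∇ (φ n)) 2 (volume.restrict U) := fun n =>
    memLp_of_continuous hb (continuous_gradient (hφ n).1) 2
  have hz : ∀ n, ∫ x in U, inner ℝ (rot (∇ (φ n) x)) (g x) = 0 := by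
    intro n
    have ht : ∀ i, IsTestFun U fun x => ∇ (φ n) x i := fun i => by
      refine ⟨contDiff_partial (hφ n).1 i, ?_, ?_⟩
      · simp only [gradient_apply]
        exact ((hφ n).2.1.fderiv (𝕜 := ℝ)).comp_left
          (g := fun l : Plane →L[ℝ] ℝ => l (EuclideanSpace.single i 1)) rfl
      · refine (closure_mono ?_).trans (((tsupport_fderiv_subset ℝ (f := φ n))).trans (hφ n).2.2)
        intro x hx h0
        exact hx (by simp [gradient_apply, h0])
    have e : ∀ x, inner ℝ (rot (∇ (φ n) x)) (g x)
        = g x 0 * ∇ (φ n) x 1 - g x 1 * ∇ (φ n) x 0 := by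
      intro x
      simp [PiLp.inner_apply, Fin.sum_univ_two]
      ring
    simp only [e]
    rw [integral_sub (integrable_mul' (memLp_coord' hv.grad 0) ((ht 1).memLp _))
      (integrable_mul' (memLp_coord' hv.grad 1) ((ht 0).memLp _))]
    -- The partial derivatives of `φ n` serve as test functions for the weak gradient of `v`. The
    -- two resulting terms cancel by symmetry of the second derivatives.
    have w0 := hv.weak _ (ht 1) 0
    have w1 := hv.weak _ (ht 0) 1
    have hsymm : ∀ x, ∇ (fun x => ∇ (φ n) x 1) x 0 = ∇ (fun x => ∇ (φ n) x 0) x 1 := by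
      intro x
      have hs : IsSymmSndFDerivAt ℝ (φ n) x :=
        (hφ n).1.contDiffAt.isSymmSndFDerivAt
          (by
            rw [minSmoothness_of_isRCLikeNormedField]
            exact WithTop.coe_le_coe.2 (le_top : (2 : ℕ∞) ≤ ⊤))
      have hd : DifferentiableAt ℝ (fderiv ℝ (φ n)) x :=
        ((hφ n).1.fderiv_right (m := ∞) (by simp)).differentiable (by simp) x
      rw [gradient_apply, gradient_apply]
      simp only [gradient_apply]
      rw [fderiv_clm_apply hd (differentiableAt_const _), fderiv_clm_apply hd (differentiableAt_const _)]
      simp [hs.eq (EuclideanSpace.single 0 1) (EuclideanSpace.single 1 1)]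
    simp only [hsymm] at w0
    linarith
  have hb' : ∀ n, |∫ x in U, inner ℝ (rot (W x)) (g x)|
      ≤ l2 (volume.restrict U) (fun x => ∇ (φ n) x - W x) * l2 (volume.restrict U) g := by
    intro n
    have := abs_integral_inner_le (memLp_rot ((hm n).sub hW)) hv.grad
    rw [l2_rot] at this
    refine le_trans (le_of_eq ?_) this
    simp only [Pi.sub_apply, rot_sub, inner_sub_left]
    rw [integral_sub (integrable_inner (memLp_rot (hm n)) hv.grad)
      (integrable_inner (memLp_rot hW) hv.grad), hz, zero_sub, abs_neg]
  have hl := ((tendsto_l2_iff fun n => (hm n).sub hW).1 h2).mul_const (l2 (volume.restrict U) g)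
  rw [zero_mul] at hl
  have := ge_of_tendsto' hl hb'
  exact abs_nonpos_iff.1 this

/-- Dominated convergence with majorant `(2 K)² |p|²`. This is why bounded gradients converging
almost everywhere are a sufficient approximation of the correctors. -/
lemma tendsto_l2_smul_of_ae {μ : Measure Plane} {p : Plane → ℝ} (hp : MemLp p 2 μ)
    {F : ℕ → Plane → Plane} {H : Plane → Plane} {K : ℝ} (hFm : ∀ n, AEStronglyMeasurable (F n) μ)
    (hF : ∀ n x, ‖F n x‖ ≤ K) (hlim : ∀ᵐ x ∂μ, Tendsto (fun n => F n x) atTop (𝓝 (H x))) :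
    Tendsto (fun n => l2 μ fun x => p x • (F n x - H x)) atTop (𝓝 0) := by
  have hHm : AEStronglyMeasurable H μ := aestronglyMeasurable_of_tendsto_ae _ hFm hlim
  have hHb : ∀ᵐ x ∂μ, ‖H x‖ ≤ K := by
    filter_upwards [hlim] with x hx
    exact le_of_tendsto' hx.norm fun n => hF n x
  have hsq : Tendsto (fun n => l2 μ (fun x => p x • (F n x - H x)) ^ 2) atTop (𝓝 0) := by
    have e : ∀ n, l2 μ (fun x => p x • (F n x - H x)) ^ 2 = ∫ x, ‖p x • (F n x - H x)‖ ^ 2 ∂μ :=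
      fun n => l2_sq (hp.1.smul ((hFm n).sub hHm))
    simp only [e]
    have := tendsto_integral_of_dominated_convergence (F := fun n x => ‖p x • (F n x - H x)‖ ^ 2)
      (f := fun _ => (0 : ℝ)) (μ := μ) (fun x => (2 * K) ^ 2 * ‖p x‖ ^ 2)
      (fun n => ((hp.1.smul ((hFm n).sub hHm)).norm.pow 2))
      ((hp.integrable_norm_pow (by norm_num)).const_mul _) (fun n => ?_) ?_
    · simpa using this
    · filter_upwards [hHb] with x hx
      rw [Real.norm_of_nonneg (by positivity), norm_smul, mul_pow, mul_comm]
      refine mul_le_mul_of_nonneg_right ?_ (by positivity)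
      refine pow_le_pow_left₀ (norm_nonneg _) ?_ 2
      exact (norm_sub_le _ _).trans (by linarith [hF n x])
    · filter_upwards [hlim] with x hx
      have h1 : Tendsto (fun n => F n x - H x) atTop (𝓝 0) := by
        simpa using hx.sub_const (H x)
      have h2 := ((h1.const_smul (p x)).norm).pow 2
      simpa using h2
  have := hsq.sqrt
  simpa [Real.sqrt_sq l2_nonneg] using this

lemma memLp_fun_sub {E : Type*} [NormedAddCommGroup E] {μ : Measure Plane} {F G : Plane → E}
    (hF : MemLp F 2 μ) (hG : MemLp G 2 μ) : MemLp (fun x => F x - G x) 2 μ := hF.sub hG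

lemma memLp_fun_add {E : Type*} [NormedAddCommGroup E] {μ : Measure Plane} {F G : Plane → E}
    (hF : MemLp F 2 μ) (hG : MemLp G 2 μ) : MemLp (fun x => F x + G x) 2 μ := hF.add hG

lemma l2_le_of_vanish {E E' : Type*} [NormedAddCommGroup E] [NormedAddCommGroup E']
    {L : Set Plane} (hL : MeasurableSet L) (hLU : L ⊆ U) (hU : MeasurableSet U) {F : Plane → E}
    {p : Plane → E'} (hp : MemLp p 2 (volume.restrict U)) {K : ℝ} (hK : 0 ≤ K)
    (h0 : ∀ x ∈ U, x ∉ L → F x = 0) (hF : ∀ x ∈ U, ‖F x‖ ≤ K * ‖p x‖) :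
    l2 (volume.restrict U) F ≤ K * l2 (volume.restrict L) p := by
  have e : l2 (volume.restrict U) F = l2 (volume.restrict L) F := by
    have h1 : eLpNorm F 2 (volume.restrict U) = eLpNorm (L.indicator F) 2 (volume.restrict U) := by
      refine eLpNorm_congr_ae ?_
      filter_upwards [ae_restrict_mem hU] with x hx
      by_cases hxL : x ∈ L
      · rw [Set.indicator_of_mem hxL]
      · rw [Set.indicator_of_notMem hxL, h0 x hx hxL]
    unfold l2
    rw [h1, eLpNorm_indicator_eq_eLpNorm_restrict hL, Measure.restrict_restrict hL,
      Set.inter_eq_left.2 hLU]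
  rw [e]
  refine l2_le_of_ae hK (hp.mono_measure (Measure.restrict_mono_set _ hLU)) ?_
  filter_upwards [ae_restrict_mem hL] with x hx
  exact hF x (hLU hx)

/-- A cut-off function adapted to the layer `L` of `U`, with gradients of size `c / ε`. -/
structure IsCutoff (U L : Set Plane) (c ε : ℝ) (η : Plane → ℝ) : Prop where
  test : IsTestFun U η
  nonneg : ∀ x, 0 ≤ η x
  le_one : ∀ x, η x ≤ 1
  grad_le : ∀ x, ‖∇ η x‖ ≤ c / ε
  eq_one : ∀ x ∈ U, x ∉ L → η x = 1
  grad_eq_zero : ∀ x ∈ U, x ∉ L → ∇ η x = 0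

/-! ### Products with cut-off functions -/

/-- The gradient of `η f p` where `D` is the gradient of `p`. -/
def prodGrad (η f p : Plane → ℝ) (D : Plane → Plane) (x : Plane) : Plane :=
  p x • (η x • ∇ f x + f x • ∇ η x) + (η x * f x) • D x

section Product

variable {L : Set Plane} {c ε K : ℝ} {η f p : Plane → ℝ} {D : Plane → Plane}

lemma memLp_prodGrad (hU : Bornology.IsBounded U) (hη : ContDiff ℝ ∞ η) (hf : ContDiff ℝ ∞ f)
    (hp : MemLp p 2 (volume.restrict U)) (hD : MemLp D 2 (volume.restrict U))
    (hUm : MeasurableSet U) : MemLp (prodGrad η f p D) 2 (volume.restrict U) := by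
  have c1 : Continuous fun x => η x • ∇ f x + f x • ∇ η x :=
    (hη.continuous.smul (continuous_gradient hf)).add (hf.continuous.smul (continuous_gradient hη))
  have c2 : Continuous fun x => η x * f x := hη.continuous.mul hf.continuous
  obtain ⟨C1, -, hC1⟩ := exists_bound_on hU c1
  obtain ⟨C2, -, hC2⟩ := exists_bound_on hU c2
  refine (memLp_mul_of_bound' hp c1.aestronglyMeasurable (K := C1) ?_).add
    (memLp_mul_of_bound c2.aestronglyMeasurable (K := C2) ?_ hD)
  · filter_upwards [ae_restrict_mem hUm] with x hx using hC1 x hx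
  · filter_upwards [ae_restrict_mem hUm] with x hx using hC2 x hx

/-- The difference is `p ((1 - η) ∇f - f ∇η) - η f D`. The bracket vanishes off `L` and is at most
`K + K c`, since `f` of size `K ε` compensates `∇η` of size `c / ε`; the last factor is at most `K
ε`. -/
lemma IsCutoff.l2_prodGrad_le (hη : IsCutoff U L c ε η)
    (hUm : MeasurableSet U) (hL : MeasurableSet L) (hLU : L ⊆ U) (hε : 0 < ε) (hc : 0 ≤ c)
    (hK : 0 ≤ K) (hf : ContDiff ℝ ∞ f) (hfb : ∀ x, |f x| ≤ K * ε) (hfg : ∀ x, ‖∇ f x‖ ≤ K)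
    (hp : MemLp p 2 (volume.restrict U)) (hD : MemLp D 2 (volume.restrict U)) :
    l2 (volume.restrict U) (fun x => p x • ∇ f x - prodGrad η f p D x)
      ≤ (K + K * c) * l2 (volume.restrict L) p + K * ε * l2 (volume.restrict U) D := by
  have hηs := hη.test.1
  have c1 : Continuous fun x => (1 - η x) • ∇ f x - f x • ∇ η x :=
    ((continuous_const.sub hηs.continuous).smul (continuous_gradient hf)).sub
      (hf.continuous.smul (continuous_gradient hηs))
  have c2 : Continuous fun x => η x * f x := hηs.continuous.mul hf.continuous
  have b1 : ∀ x, ‖(1 - η x) • ∇ f x - f x • ∇ η x‖ ≤ K + K * c := by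
    intro x
    refine (norm_sub_le _ _).trans (add_le_add ?_ ?_)
    · rw [norm_smul, Real.norm_eq_abs, abs_of_nonneg (by linarith [hη.le_one x])]
      nlinarith [hη.nonneg x, hfg x, norm_nonneg (∇ f x), hη.le_one x]
    · rw [norm_smul, Real.norm_eq_abs]
      calc |f x| * ‖∇ η x‖ ≤ (K * ε) * (c / ε) :=
            mul_le_mul (hfb x) (hη.grad_le x) (norm_nonneg _) (by positivity)
        _ = K * c := by field_simp
  have b2 : ∀ x, |η x * f x| ≤ K * ε := by
    intro x
    rw [abs_mul, abs_of_nonneg (hη.nonneg x)]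
    nlinarith [hη.nonneg x, hfb x, abs_nonneg (f x), hη.le_one x]
  have e : (fun x => p x • ∇ f x - prodGrad η f p D x) =
      fun x => p x • ((1 - η x) • ∇ f x - f x • ∇ η x) - (η x * f x) • D x := by
    funext x
    simp only [prodGrad]
    module
  rw [e]
  have m1 := memLp_mul_of_bound' hp c1.aestronglyMeasurable (K := K + K * c) (ae_of_all _ b1)
  have m2 := memLp_mul_of_bound c2.aestronglyMeasurable (K := K * ε) (ae_of_all _ b2) hD
  refine (l2_sub_le m1 m2).trans (add_le_add ?_ ?_)
  · refine l2_le_of_vanish hL hLU hUm hp (by positivity) (fun x hx hxL => ?_) fun x _ => ?_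
    · rw [hη.eq_one x hx hxL, hη.grad_eq_zero x hx hxL]
      simp
    · rw [norm_smul, mul_comm]
      exact mul_le_mul_of_nonneg_right (b1 x) (norm_nonneg _)
  · refine l2_le_of_ae (by positivity) hD (ae_of_all _ fun x => ?_)
    rw [norm_smul]
    exact mul_le_mul_of_nonneg_right (b2 x) (norm_nonneg _)

lemma memH10_prod (hη : IsTestFun U η) (hf : ContDiff ℝ ∞ f)
    (hprod : ∀ χ, IsTestFun U χ → MemH10 U (fun x => χ x * p x) (fun x => p x • ∇ χ x + χ x • D x)) :
    MemH10 U (fun x => (η x * f x) * p x) (prodGrad η f p D) := by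
  have h := hprod (fun x => η x * f x)
    ⟨hη.1.mul hf, hη.2.1.mul_right, tsupport_mul_subset_left.trans hη.2.2⟩
  simp only [gradient_mul hη.1 hf] at h
  exact h

end Product

lemma MemH10.add (hb : Bornology.IsBounded U) {u v : Plane → ℝ} {F G : Plane → Plane}
    (hu : MemH10 U u F) (hv : MemH10 U v G)
    (mu : MemLp u 2 (volume.restrict U)) (mv : MemLp v 2 (volume.restrict U))
    (mF : MemLp F 2 (volume.restrict U)) (mG : MemLp G 2 (volume.restrict U)) :
    MemH10 U (fun x => u x + v x) (fun x => F x + G x) := by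
  obtain ⟨φ, hφ, h1, h2⟩ := hu
  obtain ⟨ψ, hψ, h3, h4⟩ := hv
  refine ⟨fun n x => φ n x + ψ n x, fun n => ⟨(hφ n).1.add (hψ n).1, (hφ n).2.1.add (hψ n).2.1,
    (tsupport_add _ _).trans (Set.union_subset (hφ n).2.2 (hψ n).2.2)⟩, ?_, ?_⟩
  · have := h1.add h3
    rw [add_zero] at this
    refine tendsto_of_tendsto_of_tendsto_of_le_of_le tendsto_const_nhds this (fun _ => zero_le)
      fun n => ?_
    refine le_trans (le_of_eq ?_) (eLpNorm_add_le
      ((memLp_of_continuous hb (hφ n).1.continuous 2).sub mu).1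
      ((memLp_of_continuous hb (hψ n).1.continuous 2).sub mv).1 (by norm_num))
    congr 1
    funext x
    simp only [Pi.add_apply]
    ring
  · have := h2.add h4
    rw [add_zero] at this
    refine tendsto_of_tendsto_of_tendsto_of_le_of_le tendsto_const_nhds this (fun _ => zero_le)
      fun n => ?_
    refine le_trans (le_of_eq ?_) (eLpNorm_add_le
      ((memLp_of_continuous hb (continuous_gradient (hφ n).1) 2).sub mF).1
      ((memLp_of_continuous hb (continuous_gradient (hψ n).1) 2).sub mG).1 (by norm_num))
    congr 1
    funext x
    simp only [Pi.add_apply, gradient_add' (hφ n).1 (hψ n).1]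
    abel

/-- The consistency error of the two-scale expansion. -/
def expansionError (U L : Set Plane) (K c ε : ℝ) (p : Plane → Plane) (D : Fin 2 → Plane → Plane) :
    ℝ :=
  ∑ l, ((K + K * c) * l2 (volume.restrict L) (fun x => p x l) +
    K * ε * l2 (volume.restrict U) (D l))

section TwoScale

variable {L : Set Plane} {c ε K : ℝ} {η : Plane → ℝ} {B : Plane → Matrix (Fin 2) (Fin 2) ℝ}
  {Â : Matrix (Fin 2) (Fin 2) ℝ} {G : Fin 2 → Plane → Plane} {P s : ℕ → Fin 2 → Plane → ℝ}
  {p : Plane → Plane} {D : Fin 2 → Plane → Plane}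

lemma CorrectorApprox.memLp (hG : CorrectorApprox B Â K ε G P s)
    (hp : MemLp p 2 (volume.restrict U)) (l : Fin 2) :
    MemLp (fun x => p x l • G l x) 2 (volume.restrict U) := by
  have hm : AEStronglyMeasurable (G l) volume :=
    aestronglyMeasurable_of_tendsto_ae _
      (fun n => (continuous_gradient (hG.smooth_corr n l)).aestronglyMeasurable) (hG.tendsto_corr l)
  refine memLp_mul_of_bound' (K := K) (memLp_coord' hp l) hm.restrict ?_
  filter_upwards [ae_restrict_of_ae (hG.tendsto_corr l)] with x hx
  exact le_of_tendsto' hx.norm fun n => hG.grad_corr_le n l x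

lemma CorrectorApprox.memLp_sum (hG : CorrectorApprox B Â K ε G P s)
    (hp : MemLp p 2 (volume.restrict U)) :
    MemLp (fun x => ∑ l, p x l • G l x) 2 (volume.restrict U) := by
  simp only [Fin.sum_univ_two]
  exact memLp_fun_add (hG.memLp hp 0) (hG.memLp hp 1)

lemma CorrectorApprox.norm_le (hG : CorrectorApprox B Â K ε G P s) (l : Fin 2) :
    ∀ᵐ x, ‖G l x‖ ≤ K := by
  filter_upwards [hG.tendsto_corr l] with x hx
  exact le_of_tendsto' hx.norm fun n => hG.grad_corr_le n l x

/-- Purely algebraic: the flux defect is the combination of the cell flux defects with weights `q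
l`, minus `b` applied to the deviation of `Z` from the exact corrector term. -/
lemma flux_expansion (b : Matrix (Fin 2) (Fin 2) ℝ) (q Z : Plane) (g : Fin 2 → Plane) :
    mv Â q - mv b (q + Z) = ∑ l, q l • (mv Â (EuclideanSpace.single l 1)
      - mv b (EuclideanSpace.single l 1 + g l)) - mv b (Z - ∑ l, q l • g l) := by
  apply plane_ext <;> simp [Fin.sum_univ_two] <;> ring

/-- The two-scale expansion: `p + Z`, with `Z` the gradient of a function vanishing on the boundary,
is close to `p + ∑ p_l G_l`, and its flux is weakly close to the homogenized flux. -/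
theorem exists_two_scale (hU : Bornology.IsBounded U) (hUm : MeasurableSet U)
    (hL : MeasurableSet L) (hLU : L ⊆ U) (hε : 0 < ε) (hc : 0 ≤ c) (hK : 0 ≤ K)
    (hη : IsCutoff U L c ε η) (hB : BddCoeff K B) (hG : CorrectorApprox B Â K ε G P s)
    (hp : MemLp p 2 (volume.restrict U)) (hD : ∀ l, MemLp (D l) 2 (volume.restrict U))
    (hprod : ∀ l χ, IsTestFun U χ →
      MemH10 U (fun x => χ x * p x l) (fun x => p x l • ∇ χ x + χ x • D l x))
    {τ : ℝ} (hτ : 0 < τ) :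
    ∃ z Z, MemH10 U z Z ∧ MemLp z 2 (volume.restrict U) ∧ MemLp Z 2 (volume.restrict U) ∧
      l2 (volume.restrict U) (fun x => Z x - ∑ l, p x l • G l x)
        ≤ expansionError U L K c ε p D + τ ∧
      ∀ v g, WG U v g → |∫ x in U, inner ℝ (mv Â (p x) - mv (B x) (p x + Z x)) (g x)|
        ≤ (4 * K + 1) * (expansionError U L K c ε p D + τ) * l2 (volume.restrict U) g := by
  set μ := (volume : Measure Plane).restrict U with hμ
  have hpl := fun l => memLp_coord' hp l
  have hGm : ∀ l, AEStronglyMeasurable (G l) μ := fun l =>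
    (aestronglyMeasurable_of_tendsto_ae _
      (fun n => (continuous_gradient (hG.smooth_corr n l)).aestronglyMeasurable)
      (hG.tendsto_corr l)).restrict
  set b : Fin 2 → Plane → Plane := fun l x => mv Â (EuclideanSpace.single l 1)
    - mv (B x) (EuclideanSpace.single l 1 + G l x) with hb
  have t1 : ∀ l, Tendsto (fun n => l2 μ fun x => p x l • (∇ (P n l) x - G l x)) atTop (𝓝 0) :=
    fun l => tendsto_l2_smul_of_ae (hpl l)
      (fun n => (continuous_gradient (hG.smooth_corr n l)).aestronglyMeasurable)
      (fun n x => hG.grad_corr_le n l x) (ae_restrict_of_ae (hG.tendsto_corr l))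
  have hrm : ∀ n l, AEStronglyMeasurable (fun x => rot (∇ (s n l) x)) μ := fun n l =>
    (continuous_rot.comp (continuous_gradient (hG.smooth_stream n l))).aestronglyMeasurable
  have t2 : ∀ l, Tendsto (fun n => l2 μ fun x => p x l • (rot (∇ (s n l) x) - b l x)) atTop (𝓝 0) :=
    fun l => tendsto_l2_smul_of_ae (K := K) (hpl l) (fun n => hrm n l)
      (fun n x => by rw [norm_rot]; exact hG.grad_stream_le n l x)
      (ae_restrict_of_ae (hG.tendsto_stream l))
  have t3 := ((t1 0).add (t1 1))
  have t4 := ((t2 0).add (t2 1))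
  rw [add_zero] at t3 t4
  -- One index of the approximating sequence is fixed, with both the corrector and the stream
  -- function error below `τ`.
  obtain ⟨n, hn1, hn2⟩ := ((t3.eventually (gt_mem_nhds hτ)).and
    (t4.eventually (gt_mem_nhds hτ))).exists
  have hbm : ∀ l, AEStronglyMeasurable (b l) μ := fun l =>
    aestronglyMeasurable_of_tendsto_ae _ (fun n => hrm n l)
      (ae_restrict_of_ae (hG.tendsto_stream l))
  have hbb : ∀ l, ∀ᵐ x ∂μ, ‖b l x‖ ≤ K := fun l => by
    filter_upwards [ae_restrict_of_ae (hG.tendsto_stream l)] with x hx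
    exact le_of_tendsto' hx.norm fun n => by rw [norm_rot]; exact hG.grad_stream_le n l x
  have mb : ∀ l, MemLp (fun x => p x l • b l x) 2 μ := fun l =>
    memLp_mul_of_bound' (hpl l) (hbm l) (hbb l)
  have mG : ∀ l, MemLp (fun x => p x l • G l x) 2 μ := hG.memLp hp
  have mP : ∀ l, MemLp (fun x => p x l • ∇ (P n l) x) 2 μ := fun l =>
    memLp_mul_of_bound' (K := K) (hpl l)
      (continuous_gradient (hG.smooth_corr n l)).aestronglyMeasurable
      (ae_of_all _ fun x => hG.grad_corr_le n l x)
  have ms : ∀ l, MemLp (fun x => p x l • ∇ (s n l) x) 2 μ := fun l =>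
    memLp_mul_of_bound' (K := K) (hpl l)
      (continuous_gradient (hG.smooth_stream n l)).aestronglyMeasurable
      (ae_of_all _ fun x => hG.grad_stream_le n l x)
  -- `W l` is the gradient of `η P_l p_l` and `S l` that of `η s_l p_l`. The sum of the `W l` is the
  -- corrector field `Z`; the `S l` serve only to remove the divergence free part of the flux.
  set W : Fin 2 → Plane → Plane := fun l => prodGrad η (P n l) (fun x => p x l) (D l) with hW
  set S : Fin 2 → Plane → Plane := fun l => prodGrad η (s n l) (fun x => p x l) (D l) with hS
  have mW : ∀ l, MemLp (W l) 2 μ := fun l =>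
    memLp_prodGrad hU hη.test.1 (hG.smooth_corr n l) (hpl l) (hD l) hUm
  have mS : ∀ l, MemLp (S l) 2 μ := fun l =>
    memLp_prodGrad hU hη.test.1 (hG.smooth_stream n l) (hpl l) (hD l) hUm
  have bW := fun l => hη.l2_prodGrad_le hUm hL hLU hε hc hK (hG.smooth_corr n l)
    (hG.corr_le n l) (hG.grad_corr_le n l) (hpl l) (hD l)
  have bS := fun l => hη.l2_prodGrad_le hUm hL hLU hε hc hK (hG.smooth_stream n l)
    (hG.stream_le n l) (hG.grad_stream_le n l) (hpl l) (hD l)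
  have hW0 := fun l => memH10_prod hη.test (hG.smooth_corr n l) (hprod l)
  have hS0 := fun l => memH10_prod hη.test (hG.smooth_stream n l) (hprod l)
  have mz : ∀ l, MemLp (fun x => η x * P n l x * p x l) 2 μ := fun l => by
    have cc : Continuous fun x => η x * P n l x :=
      hη.test.1.continuous.mul (hG.smooth_corr n l).continuous
    obtain ⟨C, -, hC⟩ := exists_bound_on hU cc
    refine memLp_mul_of_bound cc.aestronglyMeasurable (K := C) ?_ (hpl l)
    filter_upwards [ae_restrict_mem hUm] with x hx using hC x hx
  have hzZ := (hW0 0).add hU (hW0 1) (mz 0) (mz 1) (mW 0) (mW 1)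
  have hZ1 : l2 μ (fun x => W 0 x + W 1 x - ∑ l, p x l • G l x)
      ≤ expansionError U L K c ε p D + τ := by
    have mm : ∀ l, MemLp (fun x => p x l • (∇ (P n l) x - G l x)) 2 μ := fun l => by
      simp only [smul_sub]
      exact (mP l).sub (mG l)
    have e : (fun x => W 0 x + W 1 x - ∑ l, p x l • G l x) = fun x =>
        (p x 0 • (∇ (P n 0) x - G 0 x) - (p x 0 • ∇ (P n 0) x - W 0 x)) +
        (p x 1 • (∇ (P n 1) x - G 1 x) - (p x 1 • ∇ (P n 1) x - W 1 x)) := by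
      funext x
      rw [Fin.sum_univ_two]
      module
    rw [e, expansionError, Fin.sum_univ_two]
    refine (l2_add_le (memLp_fun_sub (mm 0) (memLp_fun_sub (mP 0) (mW 0)))
      (memLp_fun_sub (mm 1) (memLp_fun_sub (mP 1) (mW 1)))).trans ?_
    have h0 := l2_sub_le (mm 0) (memLp_fun_sub (mP 0) (mW 0))
    have h1 := l2_sub_le (mm 1) (memLp_fun_sub (mP 1) (mW 1))
    have h2 := bW 0
    have h3 := bW 1
    linarith
  refine ⟨_, _, hzZ, (mz 0).add (mz 1), (mW 0).add (mW 1), hZ1, fun v g hv => ?_⟩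
  have mR : MemLp (fun x => W 0 x + W 1 x - ∑ l, p x l • G l x) 2 μ :=
    (memLp_fun_add (mW 0) (mW 1)).sub (hG.memLp_sum hp)
  have mBR := hB.memLp mR
  have bBR := hB.l2_le hK mR
  have z0 := (hS0 0).integral_rot hU (mS 0) hv
  have z1 := (hS0 1).integral_rot hU (mS 1) hv
  set Q : Fin 2 → Plane → Plane := fun l x =>
    rot (p x l • ∇ (s n l) x - S l x) - p x l • (rot (∇ (s n l) x) - b l x) with hQ
  have mr : ∀ l, MemLp (fun x => rot (p x l • ∇ (s n l) x - S l x)) 2 μ := fun l =>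
    memLp_rot ((ms l).sub (mS l))
  have mr' : ∀ l, MemLp (fun x => p x l • (rot (∇ (s n l) x) - b l x)) 2 μ := fun l => by
    simp only [smul_sub, ← rot_smul]
    exact (memLp_rot (ms l)).sub (mb l)
  have mQ : ∀ l, MemLp (Q l) 2 μ := fun l => (mr l).sub (mr' l)
  -- The flux defect is split into the rotated gradients `rot (S l)`, which integrate to zero
  -- against `g`, and remainders that are small in `L²`.
  have e : ∀ x, inner ℝ (mv Â (p x) - mv (B x) (p x + (W 0 x + W 1 x))) (g x)
      = inner ℝ (Q 0 x + Q 1 x - mv (B x) (W 0 x + W 1 x - ∑ l, p x l • G l x)) (g x)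
        + (inner ℝ (rot (S 0 x)) (g x) + inner ℝ (rot (S 1 x)) (g x)) := by
    intro x
    rw [flux_expansion (B x) (p x) (W 0 x + W 1 x) (fun l => G l x), ← inner_add_left,
      ← inner_add_left]
    congr 1
    simp only [hQ, Fin.sum_univ_two, rot_sub, rot_smul, hb]
    module
  have mT : MemLp (fun x => Q 0 x + Q 1 x - mv (B x) (W 0 x + W 1 x - ∑ l, p x l • G l x)) 2 μ :=
    memLp_fun_sub (memLp_fun_add (mQ 0) (mQ 1)) mBR
  have i0 := integrable_inner (memLp_rot (mS 0)) hv.grad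
  have i1 := integrable_inner (memLp_rot (mS 1)) hv.grad
  have eI : ∫ x in U, inner ℝ (mv Â (p x) - mv (B x) (p x + (W 0 x + W 1 x))) (g x)
      = ∫ x in U, inner ℝ (Q 0 x + Q 1 x
        - mv (B x) (W 0 x + W 1 x - ∑ l, p x l • G l x)) (g x) := by
    simp only [e]
    rw [integral_add (integrable_inner mT hv.grad) (i0.fun_add i1), integral_add i0 i1, z0, z1]
    ring
  rw [eI]
  -- The `1` in `4 * K + 1` comes from the stream function remainders `Q`, and `4 * K` is the norm
  -- bound of `B` acting on the corrector remainder.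
  refine (abs_integral_inner_le mT hv.grad).trans (mul_le_mul_of_nonneg_right ?_ l2_nonneg)
  refine (l2_sub_le (memLp_fun_add (mQ 0) (mQ 1)) mBR).trans ?_
  have h1 := l2_add_le (mQ 0) (mQ 1)
  have h2 := l2_sub_le (mr 0) (mr' 0)
  have h3 := l2_sub_le (mr 1) (mr' 1)
  rw [l2_rot (fun x => p x 0 • ∇ (s n 0) x - S 0 x)] at h2
  rw [l2_rot (fun x => p x 1 • ∇ (s n 1) x - S 1 x)] at h3
  have h4 := bS 0
  have h5 := bS 1
  have h6 : l2 μ (fun x => Q 0 x + Q 1 x) ≤ expansionError U L K c ε p D + τ := by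
    rw [expansionError, Fin.sum_univ_two]
    linarith
  have h7 := mul_le_mul_of_nonneg_left hZ1 (show 0 ≤ 4 * K by positivity)
  linarith

/-- A field `g` whose flux agrees weakly with the homogenized flux of `p` is close to
`p + ∑ p_l G_l`. -/
theorem two_scale_estimate (hU : Bornology.IsBounded U) (hUm : MeasurableSet U)
    (hL : MeasurableSet L) (hLU : L ⊆ U) (hε : 0 < ε) (hc : 0 ≤ c) (hK : 0 ≤ K)
    (hη : IsCutoff U L c ε η) (hB : BddCoeff K B) (hG : CorrectorApprox B Â K ε G P s)
    (hp : MemLp p 2 (volume.restrict U)) (hD : ∀ l, MemLp (D l) 2 (volume.restrict U))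
    (hprod : ∀ l χ, IsTestFun U χ →
      MemH10 U (fun x => χ x * p x l) (fun x => p x l • ∇ χ x + χ x • D l x))
    {κ : ℝ} (hκ : 0 < κ) (hell : ∀ᵐ y, ∀ ξ : Plane, κ * ‖ξ‖ ^ 2 ≤ inner ℝ (mv (B y) ξ) ξ)
    {g : Plane → Plane} (hg : MemLp g 2 (volume.restrict U)) {b : ℝ} (hb : 0 ≤ b)
    (hw : ∀ z Z, MemH10 U z Z → MemLp z 2 (volume.restrict U) → MemLp Z 2 (volume.restrict U) →
      (∃ v, WG U v fun x => g x - (p x + Z x)) ∧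
      ∫ x in U, inner ℝ (mv (B x) (g x) - mv Â (p x)) (g x - (p x + Z x)) = -b) :
    l2 (volume.restrict U) (fun x => g x - (p x + ∑ l, p x l • G l x))
      ≤ ((4 * K + 1) / κ + 1) * expansionError U L K c ε p D ∧
    b ≤ ((4 * K + 1) * expansionError U L K c ε p D) ^ 2 / κ := by
  set μ := (volume : Measure Plane).restrict U with hμ
  set E := expansionError U L K c ε p D with hE
  have hÂ : ∀ {F : Plane → Plane}, MemLp F 2 μ → MemLp (fun x => mv Â (F x)) 2 μ := by
    intro F hF
    refine BddCoeff.memLp (K := ∑ i, ∑ j, |Â i j|) (B := fun _ => Â)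
      ⟨fun i j => aemeasurable_const, ae_of_all _ fun _ i j => ?_⟩ hF
    exact (Finset.single_le_sum (f := fun j => |Â i j|) (fun _ _ => abs_nonneg _)
      (Finset.mem_univ j)).trans (Finset.single_le_sum (f := fun i => ∑ j, |Â i j|)
      (fun _ _ => Finset.sum_nonneg fun _ _ => abs_nonneg _) (Finset.mem_univ i))
  have key : ∀ τ : ℝ, 0 < τ →
      l2 μ (fun x => g x - (p x + ∑ l, p x l • G l x)) ≤ ((4 * K + 1) / κ + 1) * (E + τ) ∧
      b ≤ ((4 * K + 1) * (E + τ)) ^ 2 / κ := by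
    intro τ hτ
    obtain ⟨z, Z, hzZ, mz, mZ, h1, h2⟩ :=
      exists_two_scale hU hUm hL hLU hε hc hK hη hB hG hp hD hprod hτ
    obtain ⟨⟨v, hv⟩, h3⟩ := hw z Z hzZ mz mZ
    set V : Plane → Plane := fun x => g x - (p x + Z x) with hV
    have mV : MemLp V 2 μ := hv.grad
    have h4 := h2 v V hv
    have h5 : κ * l2 μ V ^ 2 ≤ ∫ x in U, inner ℝ (mv (B x) (V x)) (V x) := by
      rw [l2_sq mV.1, ← integral_const_mul]
      refine integral_mono_ae ((mV.integrable_norm_pow (by norm_num)).const_mul κ)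
        (integrable_inner (hB.memLp mV) mV) ?_
      filter_upwards [ae_restrict_of_ae hell] with x hx using hx (V x)
    have h6 : ∫ x in U, inner ℝ (mv (B x) (V x)) (V x)
        = (∫ x in U, inner ℝ (mv (B x) (g x) - mv Â (p x)) (V x))
          + ∫ x in U, inner ℝ (mv Â (p x) - mv (B x) (p x + Z x)) (V x) := by
      rw [← integral_add (integrable_inner (memLp_fun_sub (hB.memLp hg) (hÂ hp)) mV)
        (integrable_inner (memLp_fun_sub (hÂ hp) (hB.memLp (memLp_fun_add hp mZ))) mV)]
      refine integral_congr_ae (ae_of_all _ fun x => ?_)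
      beta_reduce
      rw [← inner_add_left, sub_add_sub_cancel]
      rw [← mv_sub]
    -- With `V = g - (p + Z)`, coercivity, the flux identity and the consistency bound give `κ ‖V‖²
    -- + b ≤ F ‖V‖`. Since `b ≥ 0` this bounds `‖V‖` by `F / κ`, and completing the square bounds
    -- `b`.
    rw [h6, h3] at h5
    set F := (4 * K + 1) * (E + τ) with hF
    have h7 := (abs_le.1 h4).2
    have hx0 : 0 ≤ l2 μ V := l2_nonneg
    have hxF : κ * l2 μ V ^ 2 + b ≤ F * l2 μ V := by linarith
    have hF0 : l2 μ V ≤ F / κ := by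
      rw [le_div_iff₀ hκ]
      rcases hx0.eq_or_lt with h0 | h0
      · have : 0 ≤ E + τ := l2_nonneg.trans h1
        rw [← h0, zero_mul]
        exact mul_nonneg (by linarith) this
      · by_contra hlt
        push Not at hlt
        nlinarith
    constructor
    · have e : (fun x => g x - (p x + ∑ l, p x l • G l x))
          = fun x => V x + (Z x - ∑ l, p x l • G l x) := by
        funext x
        simp only [hV]
        module
      rw [e]
      have mR : MemLp (fun x => Z x - ∑ l, p x l • G l x) 2 μ :=
        mZ.sub (hG.memLp_sum hp)
      refine (l2_add_le mV mR).trans ?_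
      rw [add_mul, one_mul, div_mul_eq_mul_div]
      exact add_le_add hF0 h1
    · rw [le_div_iff₀ hκ]
      nlinarith [sq_nonneg (F - 2 * κ * l2 μ V), sq_nonneg F]
  -- The field `Z` depends on `τ` but the two conclusions do not mention it, so `τ` may tend to
  -- zero.
  have lim : Tendsto (fun τ : ℝ => E + τ) (𝓝[>] 0) (𝓝 E) := by
    have : Tendsto (fun τ : ℝ => E + τ) (𝓝 0) (𝓝 (E + 0)) := tendsto_const_nhds.add tendsto_id
    rw [add_zero] at this
    exact this.mono_left nhdsWithin_le_nhds
  constructor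
  · refine ge_of_tendsto (lim.const_mul _) ?_
    filter_upwards [self_mem_nhdsWithin] with τ hτ using (key τ hτ).1
  · refine ge_of_tendsto (((lim.const_mul (4 * K + 1)).pow 2).div_const κ) ?_
    filter_upwards [self_mem_nhdsWithin] with τ hτ using (key τ hτ).2

end TwoScale

/-! ### Triangles -/

/-- Nondegenerate triangles in the plane. -/
abbrev Tri : Type := Affine.Simplex ℝ Plane 2

namespace Tri

/-- The vertices as an affine basis of the plane. -/
def basis (T : Tri) : AffineBasis (Fin 3) ℝ Plane :=
  ⟨T.points, T.independent, by
    rw [T.independent.affineSpan_eq_top_iff_card_eq_finrank_add_one]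
    simp⟩

/-- The barycentric coordinates. -/
def bary (T : Tri) (i : Fin 3) : Plane →ᵃ[ℝ] ℝ := T.basis.coord i

variable (T : Tri)

lemma sum_bary (x : Plane) : ∑ i, T.bary i x = 1 := T.basis.sum_coord_apply_eq_one x

lemma bary_self (i : Fin 3) : T.bary i (T.points i) = 1 := T.basis.coord_apply_eq i

lemma bary_ne {i j : Fin 3} (h : i ≠ j) : T.bary i (T.points j) = 0 := T.basis.coord_apply_ne h

lemma affineCombination_bary (x : Plane) :
    Finset.univ.affineCombination ℝ T.points (fun i => T.bary i x) = x :=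
  T.basis.affineCombination_coord_eq_self x

lemma sum_bary_smul (x : Plane) : ∑ i, T.bary i x • T.points i = x :=
  T.basis.linear_combination_coord_eq_self x

lemma affine_eq_sum (a : Plane →ᵃ[ℝ] ℝ) (x : Plane) : a x = ∑ i, T.bary i x * a (T.points i) := by
  conv_lhs => rw [← T.affineCombination_bary x]
  rw [Finset.map_affineCombination _ _ _ (T.sum_bary x),
    Finset.affineCombination_eq_linear_combination _ _ _ (T.sum_bary x)]
  rfl

lemma mem_closedInterior {x : Plane} : x ∈ T.closedInterior ↔ ∀ i, 0 ≤ T.bary i x := by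
  conv_lhs => rw [← T.affineCombination_bary x]
  rw [Affine.Simplex.affineCombination_mem_closedInterior_iff (T.sum_bary x)]
  refine ⟨fun h i => (h i).1, fun h i => ⟨h i, ?_⟩⟩
  rw [← T.sum_bary x]
  exact Finset.single_le_sum (f := fun i => T.bary i x) (fun j _ => h j) (Finset.mem_univ i)

lemma mem_interior {x : Plane} : x ∈ T.interior ↔ ∀ i, 0 < T.bary i x := by
  conv_lhs => rw [← T.affineCombination_bary x]
  rw [Affine.Simplex.affineCombination_mem_interior_iff (T.sum_bary x)]
  refine ⟨fun h i => (h i).1, fun h i => ⟨h i, ?_⟩⟩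
  rw [← T.sum_bary x]
  obtain ⟨j, hj⟩ := exists_ne i
  exact Finset.single_lt_sum hj (Finset.mem_univ i) (Finset.mem_univ j) (h j) fun k _ _ => (h k).le

lemma closedInterior_eq : T.closedInterior = convexHull ℝ (Set.range T.points) := by
  ext x
  rw [mem_closedInterior, show Set.range T.points = Set.range T.basis from rfl,
    T.basis.convexHull_eq_nonneg_coord]
  rfl

lemma interior_eq : T.interior = _root_.interior T.closedInterior := by
  rw [closedInterior_eq, show Set.range T.points = Set.range T.basis from rfl,
    T.basis.interior_convexHull]
  ext x
  rw [mem_interior]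
  rfl

lemma isOpen_interior : IsOpen T.interior := by
  rw [interior_eq]; exact _root_.isOpen_interior

lemma convex_closedInterior : Convex ℝ T.closedInterior := by
  rw [closedInterior_eq]; exact convex_convexHull _ _

lemma isCompact_closedInterior : IsCompact T.closedInterior := by
  rw [closedInterior_eq]; exact (Set.finite_range _).isCompact_convexHull ℝ

lemma points_mem (i : Fin 3) : T.points i ∈ T.closedInterior := T.point_mem_closedInterior i

lemma continuous_bary (i : Fin 3) : Continuous (T.bary i) :=
  (T.bary i).continuous_of_finiteDimensional

lemma nonempty_interior : T.interior.Nonempty := ⟨_, T.incenter_mem_interior⟩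

lemma closure_interior : closure T.interior = T.closedInterior := by
  rw [interior_eq, T.convex_closedInterior.closure_interior_eq_closure_of_nonempty_interior,
    T.isCompact_closedInterior.isClosed.closure_eq]
  rw [← interior_eq]
  exact T.nonempty_interior

lemma volume_diff : volume (T.closedInterior \ T.interior) = 0 := by
  have := T.convex_closedInterior.addHaar_frontier (volume : Measure Plane)
  rwa [T.isCompact_closedInterior.isClosed.frontier_eq, ← interior_eq] at this

/-- The heights of the triangle. -/
def height (i : Fin 3) : ℝ := T.signedInfDist i (T.points i)

lemma signedInfDist_eq (i : Fin 3) (x : Plane) : T.signedInfDist i x = T.bary i x * T.height i := by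
  have h := T.signedInfDist_affineCombination i (T.sum_bary x)
  rw [T.affineCombination_bary] at h
  rw [h, height, T.signedInfDist_apply_self]

lemma abs_signedInfDist_sub_le (i : Fin 3) (x y : Plane) :
    |T.signedInfDist i x - T.signedInfDist i y| ≤ dist x y := by
  rw [Affine.Simplex.signedInfDist, AffineSubspace.signedInfDist_def, signedDist_triangle_left,
    dist_comm]
  exact abs_signedDist_le_dist _ _ _

lemma bary_incenter (i : Fin 3) : T.bary i T.incenter * T.height i = T.inradius := by
  rw [← signedInfDist_eq, Affine.Simplex.signedInfDist_incenter]

lemma bary_le_one {x : Plane} (hx : x ∈ T.closedInterior) (i : Fin 3) : T.bary i x ≤ 1 := by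
  rw [mem_closedInterior] at hx
  rw [← T.sum_bary x]
  exact Finset.single_le_sum (f := fun i => T.bary i x) (fun j _ => hx j) (Finset.mem_univ i)

/-- The incenter has distance `inradius` to each side, which is its barycentric coordinate, at most
one, times the height. -/
lemma inradius_le_height (i : Fin 3) : T.inradius ≤ T.height i := by
  have h1 := T.bary_incenter i
  have h2 := T.bary_le_one (T.interior_subset_closedInterior T.incenter_mem_interior) i
  have h3 := (T.mem_interior.1 T.incenter_mem_interior) i
  have h4 := T.inradius_pos
  have h5 : 0 < T.height i := by
    by_contra h
    push Not at h
    nlinarith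
  nlinarith

lemma height_pos (i : Fin 3) : 0 < T.height i := T.inradius_pos.trans_le (T.inradius_le_height i)

/-- The gradients of the barycentric coordinates. -/
def baryGrad (i : Fin 3) : Plane :=
  (InnerProductSpace.toDual ℝ Plane).symm (LinearMap.toContinuousLinearMap (T.bary i).linear)

lemma inner_baryGrad (i : Fin 3) (v : Plane) :
    inner ℝ (T.baryGrad i) v = (T.bary i).linear v := by
  rw [baryGrad, InnerProductSpace.toDual_symm_apply]
  rfl

lemma bary_sub (i : Fin 3) (x y : Plane) :
    T.bary i y - T.bary i x = inner ℝ (T.baryGrad i) (y - x) := by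
  rw [inner_baryGrad]
  have := (T.bary i).linearMap_vsub y x
  simpa using this.symm

/-- A barycentric coordinate times its height is the signed distance to a side, which is
1-Lipschitz. Evaluating along its own gradient gives the bound `1 / height`. -/
lemma norm_baryGrad_le (i : Fin 3) : ‖T.baryGrad i‖ ≤ 1 / T.inradius := by
  have hr := T.inradius_pos
  have hh := T.height_pos i
  have h1 : ‖T.baryGrad i‖ * ‖T.baryGrad i‖ * T.height i ≤ ‖T.baryGrad i‖ := by
    have := T.abs_signedInfDist_sub_le i (T.baryGrad i) 0
    rw [signedInfDist_eq, signedInfDist_eq, ← sub_mul, bary_sub, sub_zero, dist_zero_right,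
      real_inner_self_eq_norm_mul_norm, abs_mul, abs_of_pos hh,
      abs_of_nonneg (mul_self_nonneg _)] at this
    exact this
  have h2 : ‖T.baryGrad i‖ * T.height i ≤ 1 := by
    rcases (norm_nonneg (T.baryGrad i)).eq_or_lt with h | h
    · rw [← h]; simp
    · by_contra hlt
      push Not at hlt
      nlinarith
  rw [le_div_iff₀ hr]
  exact (mul_le_mul_of_nonneg_left (T.inradius_le_height i) (norm_nonneg _)).trans h2

lemma dist_le {x y : Plane} (hx : x ∈ T.closedInterior) (hy : y ∈ T.closedInterior) :
    dist x y ≤ 2 * T.circumradius := by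
  have h : T.closedInterior ⊆ Metric.closedBall T.circumcenter T.circumradius := by
    rw [closedInterior_eq]
    refine convexHull_min ?_ (convex_closedBall _ _)
    rintro _ ⟨i, rfl⟩
    exact (T.dist_circumcenter_eq_circumradius i).le
  have h1 := h hx
  have h2 := h hy
  rw [Metric.mem_closedBall] at h1 h2
  linarith [dist_triangle_right x y T.circumcenter]

/-- The area of the boundary layer of a triangle. -/
lemma volume_layer_le {s : ℝ} (hs : 0 ≤ s) :
    volume (layer T.interior s) ≤ ENNReal.ofReal (2 * s / T.inradius) * volume T.interior := by
  have hr := T.inradius_pos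
  set r := T.inradius with hrdef
  have hfin : volume T.interior ≠ ⊤ :=
    ((T.isCompact_closedInterior.isBounded.subset
      T.interior_subset_closedInterior).measure_lt_top).ne
  rcases le_or_gt r s with hle | hlt
  · calc volume (layer T.interior s) ≤ 1 * volume T.interior := by
          rw [one_mul]; exact measure_mono Set.inter_subset_left
      _ ≤ _ := by
          gcongr
          rw [ENNReal.one_le_ofReal, le_div_iff₀ hr]
          linarith
  -- The copy of the triangle shrunk towards the incenter by `t` has distance more than `s` to all
  -- sides, because `(1 - t) r = s`. The layer lies in what is left, of relative area `1 - t² ≤ 2 s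
  -- / r`.
  · set t := 1 - s / r with ht
    have hsr : s / r < 1 := (div_lt_one hr).2 hlt
    have hsr0 : 0 ≤ s / r := by positivity
    set H := AffineMap.homothety T.incenter t '' T.interior with hH
    have hHopen : IsOpen H := (AffineMap.homothety_isOpenMap T.incenter t (by linarith)) _
      T.isOpen_interior
    have hcoord : ∀ y ∈ H, ∀ i, s < T.bary i y * T.height i := by
      rintro _ ⟨x, hx, rfl⟩ i
      have hx' := (T.mem_interior.1 hx) i
      have e : T.bary i (AffineMap.homothety T.incenter t x)
          = (1 - t) * T.bary i T.incenter + t * T.bary i x := by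
        rw [AffineMap.homothety_eq_lineMap, AffineMap.apply_lineMap, AffineMap.lineMap_apply_ring]
      rw [e, add_mul, mul_assoc, T.bary_incenter i, ← hrdef]
      have h1 : (1 - t) * r = s := by rw [ht]; field_simp; ring
      have h2 := mul_pos hx' (T.height_pos i)
      have h3 : 0 < t := by linarith
      nlinarith [mul_pos h3 h2]
    have hHsub : H ⊆ T.interior := by
      intro y hy
      rw [mem_interior]
      intro i
      have := hcoord y hy i
      by_contra h
      push Not at h
      nlinarith [T.height_pos i]
    have hdisj : layer T.interior s ⊆ T.interior \ H := by
      rintro y ⟨hy, z, hz, hyz⟩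
      refine ⟨hy, fun hyH => hz ?_⟩
      rw [mem_interior]
      intro i
      have h1 := hcoord y hyH i
      have h2 := (abs_le.1 (T.abs_signedInfDist_sub_le i y z)).2
      rw [signedInfDist_eq, signedInfDist_eq] at h2
      by_contra h
      push Not at h
      nlinarith [T.height_pos i]
    have hvH : volume H = ENNReal.ofReal (t ^ 2) * volume T.interior := by
      rw [hH, Measure.addHaar_image_homothety]
      simp
    calc volume (layer T.interior s) ≤ volume (T.interior \ H) := measure_mono hdisj
      _ = volume T.interior - volume H := by
          refine measure_sdiff hHsub hHopen.measurableSet.nullMeasurableSet ?_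
          exact ((measure_mono hHsub).trans_lt (lt_top_iff_ne_top.2 hfin)).ne
      _ = ENNReal.ofReal (1 - t ^ 2) * volume T.interior := by
          rw [hvH, ENNReal.ofReal_sub _ (by positivity), ENNReal.ofReal_one,
            ENNReal.sub_mul (fun _ _ => hfin), one_mul]
      _ ≤ _ := by
          gcongr
          rw [mul_div_assoc, ht]
          nlinarith

end Tri

/-! ### Triangulations -/

namespace Triangulation

variable (𝒯 : Triangulation Ω)

/-- The union of the open triangles. -/
def mesh : Set Plane := ⋃ T ∈ 𝒯.elems, T.interior

lemma isOpen_mesh : IsOpen 𝒯.mesh := isOpen_biUnion fun T _ => Tri.isOpen_interior T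

variable {𝒯}

lemma interior_subset_mesh {T : Tri} (hT : T ∈ 𝒯.elems) : T.interior ⊆ 𝒯.mesh :=
  Set.subset_biUnion_of_mem (u := fun T : Tri => T.interior) hT

lemma closedInterior_subset {T : Tri} (hT : T ∈ 𝒯.elems) : T.closedInterior ⊆ closure Ω := by
  rw [← 𝒯.cover]
  exact Set.subset_biUnion_of_mem (u := fun T : Tri => T.closedInterior) hT

lemma exists_mem {x : Plane} (hx : x ∈ closure Ω) : ∃ T ∈ 𝒯.elems, x ∈ T.closedInterior := by
  rw [← 𝒯.cover] at hx
  simpa using hx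

lemma mem_mesh {x : Plane} : x ∈ 𝒯.mesh ↔ ∃ T ∈ 𝒯.elems, x ∈ T.interior := by
  simp [mesh]

lemma mesh_subset (hΩ : IsLipschitzDomain Ω) : 𝒯.mesh ⊆ Ω := by
  refine Set.Subset.trans (Set.iUnion₂_subset fun T hT => ?_) hΩ.interior_closure.subset
  exact interior_maximal ((T.interior_subset_closedInterior).trans (closedInterior_subset hT))
    (Tri.isOpen_interior T)

lemma volume_diff_mesh : volume (closure Ω \ 𝒯.mesh) = 0 := by
  refine measure_mono_null (t := ⋃ T ∈ 𝒯.elems, T.closedInterior \ T.interior) ?_ ?_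
  · rintro x ⟨hx, hxm⟩
    obtain ⟨T, hT, hxT⟩ := exists_mem (𝒯 := 𝒯) hx
    exact Set.mem_biUnion hT ⟨hxT, fun h => hxm (interior_subset_mesh hT h)⟩
  · exact (measure_biUnion_null_iff 𝒯.finite.countable).2 fun T _ => Tri.volume_diff T

/-- Edges have measure zero, so integrals over the mesh and over `Ω` coincide. Only the spaces of
test functions distinguish the two sets. -/
lemma restrict_mesh (hΩ : IsLipschitzDomain Ω) :
    (volume : Measure Plane).restrict 𝒯.mesh = volume.restrict Ω := by
  refine Measure.restrict_congr_set ?_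
  refine (mesh_subset hΩ).eventuallyLE.antisymm ?_
  rw [ae_le_set]
  exact measure_mono_null (Set.sdiff_subset_sdiff_left subset_closure) volume_diff_mesh

lemma ae_mem_mesh (hΩ : IsLipschitzDomain Ω) : ∀ᵐ x ∂volume.restrict Ω, x ∈ 𝒯.mesh := by
  rw [← restrict_mesh (𝒯 := 𝒯) hΩ]
  exact ae_restrict_mem 𝒯.isOpen_mesh.measurableSet

lemma isBounded_mesh (hΩ : IsLipschitzDomain Ω) : Bornology.IsBounded 𝒯.mesh :=
  hΩ.1.subset (mesh_subset hΩ)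

lemma disjoint_interior_closedInterior {T T' : Tri} (hT : T ∈ 𝒯.elems) (hT' : T' ∈ 𝒯.elems)
    (hne : T ≠ T') : Disjoint T.interior T'.closedInterior := by
  rw [← Tri.closure_interior T']
  exact (𝒯.disjoint T hT T' hT' hne).closure_right (Tri.isOpen_interior T)

lemma mesh_inter_closedInterior {T : Tri} (hT : T ∈ 𝒯.elems) {x : Plane} (hx : x ∈ 𝒯.mesh)
    (hxT : x ∈ T.closedInterior) : x ∈ T.interior := by
  obtain ⟨T', hT', hxT'⟩ := mem_mesh.1 hx
  by_cases h : T' = T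
  · exact h ▸ hxT'
  · exact absurd hxT (Set.disjoint_left.1 (disjoint_interior_closedInterior hT' hT h) hxT')

/-- Test functions on the mesh restrict to test functions on each triangle. -/
lemma isTestFun_indicator {T : Tri} (hT : T ∈ 𝒯.elems) {φ : Plane → ℝ}
    (hφ : IsTestFun 𝒯.mesh φ) : IsTestFun T.interior (T.interior.indicator φ) := by
  have hts : tsupport (T.interior.indicator φ) ⊆ T.interior := by
    intro x hx
    have h1 : x ∈ tsupport φ := by
      refine closure_mono ?_ hx
      intro y hy
      rw [Function.mem_support] at hy ⊢
      intro h0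
      apply hy
      by_cases hyT : y ∈ T.interior <;> simp [hyT, h0]
    have h2 : x ∈ T.closedInterior := by
      rw [← Tri.closure_interior T]
      exact closure_mono Set.support_indicator_subset hx
    exact mesh_inter_closedInterior hT (hφ.2.2 h1) h2
  refine ⟨?_, ?_, hts⟩
  · rw [contDiff_iff_contDiffAt]
    intro x
    by_cases hx : x ∈ T.interior
    · refine hφ.1.contDiffAt.congr_of_eventuallyEq ?_
      filter_upwards [(Tri.isOpen_interior T).mem_nhds hx] with y hy
      simp [hy]
    · refine ContDiffAt.congr_of_eventuallyEq (f := fun _ => (0 : ℝ)) contDiffAt_const ?_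
      have : (tsupport (T.interior.indicator φ))ᶜ ∈ 𝓝 x :=
        (isClosed_tsupport _).isOpen_compl.mem_nhds fun h => hx (hts h)
      filter_upwards [this] with y hy
      exact image_eq_zero_of_notMem_tsupport hy
  · refine HasCompactSupport.of_support_subset_isCompact hφ.2.1 ?_
    intro y hy
    refine subset_tsupport _ ?_
    rw [Function.mem_support] at hy ⊢
    intro h0
    apply hy
    by_cases hyT : y ∈ T.interior <;> simp [hyT, h0]

variable (𝒯)

open Classical in
/-- The piecewise affine function with given values at the nodes. -/
def interp (c : Plane → ℝ) (x : Plane) : ℝ :=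
  if h : ∃ T ∈ 𝒯.elems, x ∈ T.closedInterior then
    ∑ i, Tri.bary h.choose i x * c (h.choose.points i) else 0

/-- The affine function on the plane with given values at the vertices of a triangle. -/
def affineOn (T : Tri) (c : Plane → ℝ) : Plane →ᵃ[ℝ] ℝ :=
  c (T.points 0) • Tri.bary T 0 + c (T.points 1) • Tri.bary T 1 + c (T.points 2) • Tri.bary T 2

lemma affineOn_apply (T : Tri) (c : Plane → ℝ) (x : Plane) :
    affineOn T c x = ∑ i, Tri.bary T i x * c (T.points i) := by
  simp only [affineOn, Fin.sum_univ_three, AffineMap.coe_add, Pi.add_apply, AffineMap.coe_smul,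
    Pi.smul_apply, smul_eq_mul]
  ring

lemma affineOn_points (T : Tri) (c : Plane → ℝ) (i : Fin 3) :
    affineOn T c (T.points i) = c (T.points i) := by
  rw [affineOn_apply, Finset.sum_eq_single i]
  · rw [Tri.bary_self, one_mul]
  · intro j _ hj
    rw [Tri.bary_ne T hj, zero_mul]
  · simp

variable {𝒯}

/-- The definition picks some triangle containing `x`. By conformity `x` is in the hull of the
vertices common to both triangles, where the two affine functions agree, so the choice is
irrelevant. -/
lemma interp_eq (c : Plane → ℝ) {T : Tri} (hT : T ∈ 𝒯.elems) {x : Plane}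
    (hx : x ∈ T.closedInterior) : 𝒯.interp c x = affineOn T c x := by
  have h : ∃ T ∈ 𝒯.elems, x ∈ T.closedInterior := ⟨T, hT, hx⟩
  rw [interp, dif_pos h, ← affineOn_apply]
  obtain ⟨hT', hx'⟩ := h.choose_spec
  set T' := h.choose
  have hmem : x ∈ convexHull ℝ (Set.range T'.points ∩ Set.range T.points) := by
    rw [← 𝒯.conforming T' hT' T hT]
    exact ⟨hx', hx⟩
  have hconv : Convex ℝ {y | affineOn T' c y = affineOn T c y} := by
    have : {y | affineOn T' c y = affineOn T c y} = (affineOn T' c - affineOn T c) ⁻¹' {0} := by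
      ext y
      simp [sub_eq_zero]
    rw [this]
    exact (convex_singleton 0).affine_preimage _
  refine convexHull_min ?_ hconv hmem
  rintro _ ⟨⟨i, rfl⟩, j, hj⟩
  change affineOn T' c _ = affineOn T c _
  rw [affineOn_points, ← hj, affineOn_points]

/-- The gradient of the affine function on a triangle. -/
def gradOn (T : Tri) (c : Plane → ℝ) : Plane := ∑ i, c (T.points i) • Tri.baryGrad T i

lemma affineOn_sub (T : Tri) (c : Plane → ℝ) (x y : Plane) :
    affineOn T c y - affineOn T c x = inner ℝ (gradOn T c) (y - x) := by
  rw [affineOn_apply, affineOn_apply, ← Finset.sum_sub_distrib, gradOn, sum_inner]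
  refine Finset.sum_congr rfl fun i _ => ?_
  rw [← sub_mul, Tri.bary_sub, real_inner_smul_left, mul_comm]

lemma hasFDerivAt_affineOn (T : Tri) (c : Plane → ℝ) (x : Plane) :
    HasFDerivAt (affineOn T c) (innerSL ℝ (gradOn T c)) x := by
  have e : (affineOn T c : Plane → ℝ) = fun y => affineOn T c x + innerSL ℝ (gradOn T c) (y - x) := by
    funext y
    have := affineOn_sub T c x y
    simp only [innerSL_apply_apply]
    linarith
  rw [e]
  exact (((innerSL ℝ (gradOn T c)).hasFDerivAt).comp x ((hasFDerivAt_id x).sub_const x)).const_add _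

lemma hasFDerivAt_interp (c : Plane → ℝ) {T : Tri} (hT : T ∈ 𝒯.elems) {x : Plane}
    (hx : x ∈ T.interior) : HasFDerivAt (𝒯.interp c) (innerSL ℝ (gradOn T c)) x := by
  refine (hasFDerivAt_affineOn T c x).congr_of_eventuallyEq ?_
  filter_upwards [(Tri.isOpen_interior T).mem_nhds hx] with y hy
  exact interp_eq c hT (T.interior_subset_closedInterior hy)

lemma gradient_interp (c : Plane → ℝ) {T : Tri} (hT : T ∈ 𝒯.elems) {x : Plane}
    (hx : x ∈ T.interior) : ∇ (𝒯.interp c) x = gradOn T c := by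
  rw [gradient, (hasFDerivAt_interp c hT hx).fderiv]
  exact (InnerProductSpace.toDual ℝ Plane).symm_apply_apply _

lemma continuousOn_interp (c : Plane → ℝ) : ContinuousOn (𝒯.interp c) (closure Ω) := by
  rw [← 𝒯.cover, Set.biUnion_eq_iUnion]
  have : Finite 𝒯.elems := 𝒯.finite
  refine LocallyFinite.continuousOn_iUnion (locallyFinite_of_finite _)
    (fun T => (Tri.isCompact_closedInterior T.1).isClosed) fun T => ?_
  refine ((affineOn T.1 c).continuous_of_finiteDimensional.continuousOn).congr fun x hx => ?_
  exact interp_eq c T.2 hx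

lemma isLagrange_interp (c : Plane → ℝ) : 𝒯.IsLagrange (𝒯.interp c) :=
  ⟨continuousOn_interp c, fun T hT => ⟨affineOn T c, fun _ hx => interp_eq c hT hx⟩⟩

lemma interp_node (c : Plane → ℝ) {p : Plane} (hp : p ∈ 𝒯.nodes) : 𝒯.interp c p = c p := by
  obtain ⟨T, hT, i, rfl⟩ := hp
  rw [interp_eq c hT (Tri.points_mem T i), affineOn_points]

lemma finite_nodes : 𝒯.nodes.Finite := by
  have : 𝒯.nodes = ⋃ T ∈ 𝒯.elems, Set.range T.points := by
    ext p; simp [nodes]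
  rw [this]
  exact 𝒯.finite.biUnion fun T _ => Set.finite_range _

lemma interp_of_notMem (c : Plane → ℝ) {x : Plane} (hx : x ∉ closure Ω) : 𝒯.interp c x = 0 := by
  rw [interp, dif_neg]
  rintro ⟨T, hT, hxT⟩
  exact hx (closedInterior_subset hT hxT)

lemma measurable_interp (c : Plane → ℝ) : Measurable (𝒯.interp c) := by
  classical
  have h := ContinuousOn.measurable_piecewise (continuousOn_interp (𝒯 := 𝒯) c)
    (g := fun _ => (0 : ℝ)) continuousOn_const isClosed_closure.measurableSet
  convert h using 1
  funext x
  by_cases hx : x ∈ closure Ω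
  · simp [hx]
  · simp [hx, interp_of_notMem]

lemma measurable_gradient_interp (c : Plane → ℝ) : Measurable (∇ (𝒯.interp c)) :=
  (InnerProductSpace.toDual ℝ Plane).symm.continuous.measurable.comp (measurable_fderiv ℝ _)

lemma exists_gradOn_bound (c : Plane → ℝ) : ∃ K : ℝ, 0 ≤ K ∧ ∀ T ∈ 𝒯.elems, ‖gradOn T c‖ ≤ K := by
  obtain ⟨K, hK⟩ := (𝒯.finite.image fun T => ‖gradOn T c‖).bddAbove
  exact ⟨max K 0, le_max_right _ _, fun T hT => (hK ⟨T, hT, rfl⟩).trans (le_max_left _ _)⟩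

/-- Piecewise affine functions are Lipschitz along segments in the domain. -/
lemma abs_interp_sub_le {c : Plane → ℝ} {K : ℝ} (hK : ∀ T ∈ 𝒯.elems, ‖gradOn T c‖ ≤ K)
    {x y : Plane} (hxy : segment ℝ x y ⊆ closure Ω) :
    |𝒯.interp c y - 𝒯.interp c x| ≤ K * dist x y := by
  set P : ℝ → Plane := fun t => x + t • (y - x) with hP
  have hPc : Continuous P := by fun_prop
  have hPmem : ∀ t ∈ Set.Icc (0 : ℝ) 1, P t ∈ closure Ω := by
    intro t ht
    apply hxy
    rw [segment_eq_image']
    exact ⟨t, ht, rfl⟩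
  set g : ℝ → ℝ := fun t => 𝒯.interp c (P t) with hg
  have hgc : ContinuousOn g (Set.Icc 0 1) :=
    (continuousOn_interp c).comp hPc.continuousOn hPmem
  have hex : ∀ t ∈ Set.Ico (0 : ℝ) 1, ∃ d : ℝ, HasDerivWithinAt g d (Set.Ici t) t ∧
      ‖d‖ ≤ K * dist x y := by
    intro t ht
    -- As there are finitely many closed triangles, one of them contains `P t` and a later point `P
    -- s`, hence the segment between them. So `g` is affine immediately to the right of `t`, and the
    -- mean value inequality for right derivatives applies.
    obtain ⟨T, hT, hPt, s, hs, hPs⟩ : ∃ T ∈ 𝒯.elems, P t ∈ T.closedInterior ∧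
        ∃ s ∈ Set.Ioo t 1, P s ∈ T.closedInterior := by
      by_contra hcon
      push Not at hcon
      have hev : ∀ᶠ s in 𝓝[>] t, ∀ T ∈ 𝒯.elems, P s ∉ T.closedInterior := by
        rw [eventually_all_finite 𝒯.finite]
        intro T hT
        by_cases hPt : P t ∈ T.closedInterior
        · filter_upwards [Ioo_mem_nhdsGT ht.2] with s hs using hcon T hT hPt s hs
        · have : ∀ᶠ s in 𝓝 t, P s ∉ T.closedInterior :=
            hPc.continuousAt.eventually
              ((Tri.isCompact_closedInterior T).isClosed.isOpen_compl.mem_nhds hPt)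
          exact this.filter_mono nhdsWithin_le_nhds
      obtain ⟨s, hs1, hs2⟩ := (hev.and (Ioo_mem_nhdsGT ht.2)).exists
      obtain ⟨T, hT, hsT⟩ := exists_mem (𝒯 := 𝒯) (hPmem s ⟨ht.1.trans hs2.1.le, hs2.2.le⟩)
      exact hs1 T hT hsT
    refine ⟨inner ℝ (gradOn T c) (y - x), ?_, ?_⟩
    · have h1 : HasDerivAt P (y - x) t := by
        have := ((hasDerivAt_id t).smul_const (y - x)).const_add x
        rwa [one_smul] at this
      have h2 : HasDerivAt (fun t => affineOn T c (P t)) (inner ℝ (gradOn T c) (y - x)) t := by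
        have := (hasFDerivAt_affineOn T c (P t)).comp_hasDerivAt t h1
        exact this
      have hconv : Convex ℝ (P ⁻¹' T.closedInterior) := by
        have : P = AffineMap.lineMap x y := by
          funext t
          simp [hP, AffineMap.lineMap_apply, add_comm]
        rw [this]
        exact (Tri.convex_closedInterior T).affine_preimage _
      have hseg : ∀ r ∈ Set.Icc t s, g r = affineOn T c (P r) := by
        intro r hr
        refine interp_eq c hT ?_
        have : r ∈ P ⁻¹' T.closedInterior := by
          refine hconv.segment_subset hPt hPs ?_
          rw [segment_eq_Icc hs.1.le]
          exact hr
        exact this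
      refine h2.hasDerivWithinAt.congr_of_eventuallyEq ?_ (hseg t ⟨le_rfl, hs.1.le⟩)
      filter_upwards [Icc_mem_nhdsGE hs.1] with r hr using hseg r hr
    · refine (norm_inner_le_norm _ _).trans ?_
      rw [dist_comm, dist_eq_norm]
      exact mul_le_mul_of_nonneg_right (hK T hT) (norm_nonneg _)
  choose! d hd1 hd2 using hex
  have := norm_image_sub_le_of_norm_deriv_right_le_segment hgc hd1 hd2 1 (by simp)
  simpa [hg, hP] using this

/-- Piecewise affine functions belong to `H¹(Ω)`. -/
theorem wg_interp (hΩ : IsLipschitzDomain Ω) (c : Plane → ℝ) :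
    WG Ω (𝒯.interp c) (∇ (𝒯.interp c)) := by
  obtain ⟨K, hK0, hK⟩ := exists_gradOn_bound (𝒯 := 𝒯) c
  obtain ⟨S, hS⟩ := hΩ.1.isCompact_closure.exists_bound_of_continuousOn
    (continuousOn_interp (𝒯 := 𝒯) c)
  have hS' : ∀ x, |𝒯.interp c x| ≤ |S| := by
    intro x
    by_cases hx : x ∈ closure Ω
    · exact (hS x hx).trans (le_abs_self S)
    · rw [interp_of_notMem c hx]; simp
  have hfin : IsFiniteMeasure ((volume : Measure Plane).restrict Ω) :=
    ⟨by simpa using hΩ.1.measure_lt_top⟩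
  have hgb : ∀ᵐ x ∂volume.restrict Ω, ‖∇ (𝒯.interp c) x‖ ≤ K := by
    filter_upwards [ae_mem_mesh (𝒯 := 𝒯) hΩ] with x hx
    obtain ⟨T, hT, hxT⟩ := mem_mesh.1 hx
    rw [gradient_interp c hT hxT]
    exact hK T hT
  have m1 : MemLp (𝒯.interp c) 2 (volume.restrict Ω) :=
    MemLp.of_bound (measurable_interp c).aestronglyMeasurable |S| (ae_of_all _ hS')
  have m2 : MemLp (∇ (𝒯.interp c)) 2 (volume.restrict Ω) :=
    MemLp.of_bound (measurable_gradient_interp c).aestronglyMeasurable K hgb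
  refine ⟨m1, m2, fun φ hφ i => ?_⟩
  set ψ := 𝒯.interp c with hψ
  obtain ⟨δ, hδ, hδΩ⟩ := IsCompact.exists_thickening_subset_open hφ.2.1 hΩ.2.1 hφ.2.2
  obtain ⟨L, hL⟩ := (hφ.1.of_le (by simp)).lipschitzWith_of_hasCompactSupport hφ.2.1 one_ne_zero
  obtain ⟨M, hM⟩ := hφ.2.1.exists_bound_of_continuous hφ.1.continuous
  have hM0 : 0 ≤ M := (norm_nonneg _).trans (hM 0)
  have hloc : ∀ x y, x ∈ tsupport φ → dist x y < δ →
      |ψ x * φ x - ψ y * φ y| ≤ (|S| * L + M * K) * dist x y := by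
    intro x y hx hxy
    have hball : Metric.ball x δ ⊆ Ω := fun z hz =>
      hδΩ (Metric.mem_thickening_iff.2 ⟨x, hx, hz⟩)
    have hseg : segment ℝ x y ⊆ closure Ω :=
      ((convex_ball x δ).segment_subset (Metric.mem_ball_self hδ)
        (by rwa [Metric.mem_ball, dist_comm])).trans (hball.trans subset_closure)
    have h1 := abs_interp_sub_le hK hseg
    have h2 := hL.dist_le_mul x y
    rw [Real.dist_eq] at h2
    have e : ψ x * φ x - ψ y * φ y = ψ x * (φ x - φ y) - φ y * (ψ y - ψ x) := by ring
    rw [e]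
    refine (abs_sub _ _).trans ?_
    rw [abs_mul, abs_mul, add_mul, mul_assoc, mul_assoc]
    exact add_le_add (mul_le_mul (hS' x) h2 (abs_nonneg _) (abs_nonneg _))
      (mul_le_mul (hM y) h1 (abs_nonneg _) hM0)
  -- Nearby pairs are joined by a segment in `Ω`, where `ψ` is Lipschitz, and the product rule bound
  -- holds. Pairs at distance at least `δ` are covered by the sup bound divided by `δ`.
  set C := max (|S| * L + M * K) (2 * (|S| * M) / δ) with hC
  have hC0 : 0 ≤ C := le_trans (by positivity) (le_max_left _ _)
  have hlip : LipschitzWith C.toNNReal fun x => ψ x * φ x := by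
    refine LipschitzWith.of_dist_le_mul fun x y => ?_
    rw [Real.coe_toNNReal _ hC0, Real.dist_eq]
    rcases lt_or_ge (dist x y) δ with h | h
    · by_cases hx : x ∈ tsupport φ
      · exact (hloc x y hx h).trans (mul_le_mul_of_nonneg_right (le_max_left _ _) dist_nonneg)
      · by_cases hy : y ∈ tsupport φ
        · rw [abs_sub_comm, dist_comm]
          rw [dist_comm] at h
          exact (hloc y x hy h).trans (mul_le_mul_of_nonneg_right (le_max_left _ _) dist_nonneg)
        · rw [image_eq_zero_of_notMem_tsupport hx, image_eq_zero_of_notMem_tsupport hy]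
          simp
          positivity
    · have hb : ∀ z, |ψ z * φ z| ≤ |S| * M := fun z => by
        rw [abs_mul]
        exact mul_le_mul (hS' z) (hM z) (abs_nonneg _) (abs_nonneg _)
      calc |ψ x * φ x - ψ y * φ y| ≤ 2 * (|S| * M) := by
            refine (abs_sub _ _).trans ?_
            linarith [hb x, hb y]
        _ = 2 * (|S| * M) / δ * δ := by field_simp
        _ ≤ C * dist x y := mul_le_mul (le_max_right _ _) h hδ.le hC0
  set e : Plane := EuclideanSpace.single i 1 with he
  have hcs : HasCompactSupport fun x => ψ x * φ x := hφ.2.1.mul_left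
  -- The product `ψ φ` is Lipschitz with compact support, so its directional derivative integrates
  -- to zero: integration by parts against the constant one. Jumps of `∇ψ` across edges thus play no
  -- role.
  have hintg := (LipschitzWith.const (α := Plane) (1 : ℝ)).integral_lineDeriv_mul_eq (μ := volume)
    hlip hcs (-e)
  simp only [neg_neg, mul_one] at hintg
  have hl0 : ∀ x : Plane, lineDeriv ℝ (fun _ : Plane => (1 : ℝ)) x (-e) = 0 := fun x => by
    simp [lineDeriv]
  simp only [hl0, zero_mul, integral_zero] at hintg
  have hset : ∫ x in Ω, lineDeriv ℝ (fun x => ψ x * φ x) x e = 0 := by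
    rw [hintg]
    refine setIntegral_eq_integral_of_forall_compl_eq_zero fun x hx => ?_
    have hx' : x ∉ tsupport φ := fun h => hx (hφ.2.2 h)
    have hev : (fun x => ψ x * φ x) =ᶠ[𝓝 x] fun _ => (0 : ℝ) := by
      filter_upwards [(isClosed_tsupport φ).isOpen_compl.mem_nhds hx'] with y hy
      rw [image_eq_zero_of_notMem_tsupport hy, mul_zero]
    rw [hev.lineDeriv_eq]
    simp [lineDeriv]
  have hsum : ∫ x in Ω, (ψ x * ∇ φ x i + ∇ ψ x i * φ x) = 0 := by
    rw [← hset]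
    refine integral_congr_ae ?_
    filter_upwards [ae_mem_mesh (𝒯 := 𝒯) hΩ] with x hx
    obtain ⟨T, hT, hxT⟩ := mem_mesh.1 hx
    have d1 := (hasFDerivAt_interp c hT hxT).differentiableAt
    have d2 := hφ.1.differentiable (by simp) x
    rw [(d1.fun_mul d2).lineDeriv_eq_fderiv, fderiv_fun_mul d1 d2, gradient_apply, gradient_apply]
    simp [he, hψ, mul_comm]
  rw [integral_add (integrable_mul' m1 (hφ.memLp_partial _ i))
    (integrable_mul' (memLp_coord' m2 i) (hφ.memLp _))] at hsum
  linarith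

end Triangulation

/-- A weak equation for test functions extends to their closure by continuity of the pairing. -/
lemma MemH10.integral_inner_eq_zero {F : Plane → Plane} (hF : MemLp F 2 (volume.restrict U))
    (h0 : ∀ θ, IsTestFun U θ → ∫ x in U, inner ℝ (F x) (∇ θ x) = 0) {z : Plane → ℝ}
    {Z : Plane → Plane} (hz : MemH10 U z Z) (hZ : MemLp Z 2 (volume.restrict U)) :
    ∫ x in U, inner ℝ (F x) (Z x) = 0 := by
  obtain ⟨φ, hφ, -, ht⟩ := hz
  have mφ : ∀ n, MemLp (∇ (φ n)) 2 (volume.restrict U) := fun n =>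
    memLp_of_coord fun i => (hφ n).memLp_partial _ i
  have mt : ∀ n, MemLp (fun x => ∇ (φ n) x - Z x) 2 (volume.restrict U) := fun n =>
    memLp_fun_sub (mφ n) hZ
  rw [tendsto_l2_iff mt] at ht
  have hle : ∀ n, |∫ x in U, inner ℝ (F x) (Z x)|
      ≤ l2 (volume.restrict U) F * l2 (volume.restrict U) (fun x => ∇ (φ n) x - Z x) := by
    intro n
    have := abs_integral_inner_le hF (mt n)
    have e : ∫ x in U, inner ℝ (F x) (∇ (φ n) x - Z x) = -∫ x in U, inner ℝ (F x) (Z x) := by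
      simp only [inner_sub_right]
      rw [integral_sub (integrable_inner hF (mφ n)) (integrable_inner hF hZ), h0 _ (hφ n), zero_sub]
    rwa [e, abs_neg] at this
  have := ge_of_tendsto' (ht.const_mul (l2 (volume.restrict U) F)) hle
  rw [mul_zero] at this
  exact abs_eq_zero.1 (le_antisymm this (abs_nonneg _))

lemma IsTestFun.integral_gradient_eq_zero (hU : Bornology.IsBounded U) {θ : Plane → ℝ}
    (hθ : IsTestFun U θ) (i : Fin 2) : ∫ x in U, ∇ θ x i = 0 := by
  have h := (WG.of_contDiff hU (f := fun _ => (1 : ℝ)) contDiff_const).weak θ hθ i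
  have e : ∇ (fun _ : Plane => (1 : ℝ)) = fun _ => 0 := by
    funext x
    simp [gradient]
  simpa [e] using h

/-! ### Piecewise constant gradients on the mesh -/

namespace Triangulation

variable {𝒯 : Triangulation Ω}

/-- Squared `L²` norms add over the disjoint open triangles, so a bound valid on each of them is
global. -/
lemma eLpNorm_mesh_le {E E' : Type*} [NormedAddCommGroup E] [NormedAddCommGroup E'] {S : Set Plane}
    (hS : MeasurableSet S) {K : ℝ≥0∞} {F : Plane → E} {F' : Plane → E'}
    (h : ∀ T ∈ 𝒯.elems, eLpNorm F 2 (volume.restrict (S ∩ T.interior))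
      ≤ K * eLpNorm F' 2 (volume.restrict T.interior)) :
    eLpNorm F 2 (volume.restrict (S ∩ 𝒯.mesh)) ≤ K * eLpNorm F' 2 (volume.restrict 𝒯.mesh) := by
  have hd : ∀ S : Set Plane, MeasurableSet S → ∀ f : Plane → ℝ≥0∞, ∫⁻ x in S ∩ 𝒯.mesh, f x
      = ∑ T ∈ 𝒯.finite.toFinset, ∫⁻ x in S ∩ T.interior, f x := by
    intro S hS f
    rw [← lintegral_biUnion_finset]
    · congr 2
      simp only [mesh, Set.inter_iUnion₂, Set.Finite.mem_toFinset]
    · intro T hT T' hT' hne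
      rw [Finset.mem_coe, Set.Finite.mem_toFinset] at hT hT'
      exact (𝒯.disjoint T hT T' hT' hne).mono Set.inter_subset_right Set.inter_subset_right
    · exact fun T _ => hS.inter (Tri.isOpen_interior T).measurableSet
  have h2 := hd Set.univ MeasurableSet.univ
  simp only [Set.univ_inter] at h2
  rw [← ENNReal.pow_le_pow_left_iff two_ne_zero, mul_pow, eLpNorm_two_sq, eLpNorm_two_sq, hd S hS, h2,
    Finset.mul_sum]
  refine Finset.sum_le_sum fun T hT => ?_
  rw [← eLpNorm_two_sq, ← eLpNorm_two_sq, ← mul_pow]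
  exact pow_le_pow_left' (h T (𝒯.finite.mem_toFinset.1 hT)) 2

lemma layer_mesh_inter_subset {T : Tri} (hT : T ∈ 𝒯.elems) (d : ℝ) :
    layer 𝒯.mesh d ∩ T.interior ⊆ layer T.interior d := by
  rintro y ⟨⟨-, z, hz, hd⟩, hy⟩
  exact ⟨hy, z, fun h => hz (interior_subset_mesh hT h), hd⟩

/-- The gradient of a piecewise affine function carries little mass near the edges. -/
lemma l2_layer_mesh_le (hΩ : IsLipschitzDomain Ω) (c : Plane → ℝ) {r d : ℝ} (hr : 0 < r)
    (hd : 0 ≤ d) (hT : ∀ T ∈ 𝒯.elems, r ≤ T.inradius) (l : Fin 2) :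
    l2 (volume.restrict (layer 𝒯.mesh d)) (fun x => ∇ (𝒯.interp c) x l)
      ≤ √(2 * d / r) * l2 (volume.restrict Ω) (fun x => ∇ (𝒯.interp c) x l) := by
  have hm : MeasurableSet (layer 𝒯.mesh d) := (isOpen_layer 𝒯.isOpen_mesh d).measurableSet
  have h := eLpNorm_mesh_le (𝒯 := 𝒯) hm (K := ENNReal.ofReal √(2 * d / r))
    (F := fun x => ∇ (𝒯.interp c) x l) (F' := fun x => ∇ (𝒯.interp c) x l) ?_
  · rw [Set.inter_eq_left.2 (fun x hx => hx.1), restrict_mesh hΩ] at h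
    have hfin := (memLp_coord' (wg_interp (𝒯 := 𝒯) hΩ c).grad l).2.ne
    have := ENNReal.toReal_mono (ENNReal.mul_ne_top ENNReal.ofReal_ne_top hfin) h
    rwa [ENNReal.toReal_mul, ENNReal.toReal_ofReal (Real.sqrt_nonneg _)] at this
  · intro T hTm
    have hTi : MeasurableSet T.interior := (Tri.isOpen_interior T).measurableSet
    -- The gradient is constant on the triangle, so its squared mass on a subset is proportional to
    -- the area, and the area bound for the layer finishes the proof.
    have hc : ∀ S ⊆ T.interior, MeasurableSet S →
        eLpNorm (fun x => ∇ (𝒯.interp c) x l) 2 (volume.restrict S) ^ 2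
          = ‖gradOn T c l‖ₑ ^ 2 * volume S := by
      intro S hS hSm
      rw [eLpNorm_two_sq, setLIntegral_congr_fun hSm (g := fun _ => ‖gradOn T c l‖ₑ ^ 2)]
      · simp
      · intro x hx
        simp only [gradient_interp c hTm (hS hx)]
    rw [← ENNReal.pow_le_pow_left_iff two_ne_zero, mul_pow, hc _ Set.inter_subset_right (hm.inter hTi),
      hc _ subset_rfl hTi, ← ENNReal.ofReal_pow (Real.sqrt_nonneg _), Real.sq_sqrt (by positivity),
      mul_left_comm]
    gcongr
    refine (measure_mono (layer_mesh_inter_subset hTm d)).trans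
      ((Tri.volume_layer_le T hd).trans ?_)
    gcongr
    exact hT T hTm

/-- The gradient is locally constant on the mesh and test functions on the mesh vanish near the
edges, so products stay smooth and only `χ` is differentiated. This supplies the vanishing
derivative of `p` in the two-scale expansion on triangles. -/
lemma isTestFun_mul_gradient_interp (c : Plane → ℝ) (l : Fin 2) {χ : Plane → ℝ}
    (hχ : IsTestFun 𝒯.mesh χ) : IsTestFun 𝒯.mesh (fun x => χ x * ∇ (𝒯.interp c) x l) ∧
      ∀ x, ∇ (fun x => χ x * ∇ (𝒯.interp c) x l) x = ∇ (𝒯.interp c) x l • ∇ χ x := by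
  have hloc : ∀ T ∈ 𝒯.elems, ∀ x ∈ T.interior,
      (fun x => χ x * ∇ (𝒯.interp c) x l) =ᶠ[𝓝 x] fun x => gradOn T c l * χ x := by
    intro T hT x hx
    filter_upwards [(Tri.isOpen_interior T).mem_nhds hx] with y hy
    rw [gradient_interp c hT hy, mul_comm]
  have hloc0 : ∀ x ∉ 𝒯.mesh, (fun x => χ x * ∇ (𝒯.interp c) x l) =ᶠ[𝓝 x] fun _ => (0 : ℝ) := by
    intro x hx
    filter_upwards [(isClosed_tsupport χ).isOpen_compl.mem_nhds fun h => hx (hχ.2.2 h)] with y hy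
    rw [image_eq_zero_of_notMem_tsupport hy, zero_mul]
  refine ⟨⟨?_, hχ.2.1.mul_right, (tsupport_mul_subset_left).trans hχ.2.2⟩, fun x => ?_⟩
  · rw [contDiff_iff_contDiffAt]
    intro x
    by_cases hx : x ∈ 𝒯.mesh
    · obtain ⟨T, hT, hxT⟩ := mem_mesh.1 hx
      exact (contDiffAt_const.mul hχ.1.contDiffAt).congr_of_eventuallyEq (hloc T hT x hxT)
    · exact contDiffAt_const.congr_of_eventuallyEq (hloc0 x hx)
  · by_cases hx : x ∈ 𝒯.mesh
    · obtain ⟨T, hT, hxT⟩ := mem_mesh.1 hx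
      rw [gradient, (hloc T hT x hxT).fderiv_eq, gradient_interp c hT hxT,
        ← gradient_const_mul' hχ.1]
      rfl
    · rw [gradient, (hloc0 x hx).fderiv_eq, hχ.gradient_eq_zero hx]
      simp

lemma memH10_mul_gradient_interp (c : Plane → ℝ) (l : Fin 2) {χ : Plane → ℝ}
    (hχ : IsTestFun 𝒯.mesh χ) : MemH10 𝒯.mesh (fun x => χ x * ∇ (𝒯.interp c) x l)
      (fun x => ∇ (𝒯.interp c) x l • ∇ χ x + χ x • (0 : Plane)) := by
  obtain ⟨h1, h2⟩ := isTestFun_mul_gradient_interp (𝒯 := 𝒯) c l hχ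
  refine ⟨fun _ x => χ x * ∇ (𝒯.interp c) x l, fun _ => h1, ?_, ?_⟩
  · simp
  · simp [h2]

/-- The flux of a piecewise affine function for a constant matrix is divergence free in the
triangles. -/
lemma integral_mv_gradient_interp (hΩ : IsLipschitzDomain Ω) (Â : Matrix (Fin 2) (Fin 2) ℝ)
    (c : Plane → ℝ) {θ : Plane → ℝ} (hθ : IsTestFun 𝒯.mesh θ) :
    ∫ x in 𝒯.mesh, inner ℝ (mv Â (∇ (𝒯.interp c) x)) (∇ θ x) = 0 := by
  have hg := (wg_interp (𝒯 := 𝒯) hΩ c).grad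
  rw [← restrict_mesh (𝒯 := 𝒯) hΩ] at hg
  have h0 : ∀ l i, ∫ x in 𝒯.mesh, ∇ (𝒯.interp c) x l * ∇ θ x i = 0 := by
    intro l i
    obtain ⟨h1, h2⟩ := isTestFun_mul_gradient_interp (𝒯 := 𝒯) c l hθ
    rw [← h1.integral_gradient_eq_zero (isBounded_mesh hΩ) i]
    simp [h2]
  have hi : ∀ l i, Integrable (fun x => ∇ (𝒯.interp c) x l * ∇ θ x i) (volume.restrict 𝒯.mesh) :=
    fun l i => integrable_mul' (memLp_coord' hg l) (hθ.memLp_partial _ i)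
  simp only [inner_mv, mul_assoc]
  refine (integral_finsetSum _ fun i _ => integrable_finsetSum _ fun j _ =>
    (hi j i).const_mul (Â i j)).trans (Finset.sum_eq_zero fun i _ => ?_)
  refine (integral_finsetSum _ fun j _ => (hi j i).const_mul (Â i j)).trans
    (Finset.sum_eq_zero fun j _ => ?_)
  rw [integral_const_mul, h0, mul_zero]

end Triangulation

/-! ### Boundary edges -/

lemma fin_three_cases {i j k : Fin 3} (hij : i ≠ j) (hik : i ≠ k) (hjk : j ≠ k) (m : Fin 3) :
    m = i ∨ m = j ∨ m = k := by
  omega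

lemma sum_fin_three {i j k : Fin 3} (hij : i ≠ j) (hik : i ≠ k) (hjk : j ≠ k) {E : Type*}
    [AddCommMonoid E] (f : Fin 3 → E) : ∑ m, f m = f i + f j + f k := by
  have : (Finset.univ : Finset (Fin 3)) = {i, j, k} := by
    ext m
    simpa using fin_three_cases hij hik hjk m
  rw [this, Finset.sum_insert (by simp [hij, hik]), Finset.sum_insert (by simp [hjk]),
    Finset.sum_singleton, add_assoc]

lemma Tri.mem_openSegment (T : Tri) {i j k : Fin 3} (hij : i ≠ j) (hik : i ≠ k) (hjk : j ≠ k)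
    {x : Plane} : x ∈ openSegment ℝ (T.points i) (T.points j) ↔
      0 < Tri.bary T i x ∧ 0 < Tri.bary T j x ∧ Tri.bary T k x = 0 := by
  constructor
  · rintro ⟨a, b, ha, hb, hab, rfl⟩
    rw [Convex.combo_affine_apply hab, Convex.combo_affine_apply hab, Convex.combo_affine_apply hab,
      Tri.bary_self T, Tri.bary_self T, Tri.bary_ne T hij, Tri.bary_ne T hij.symm, Tri.bary_ne T hik.symm,
      Tri.bary_ne T hjk.symm]
    simp [ha, hb]
  · rintro ⟨hi, hj, hk⟩
    have h1 := Tri.sum_bary T x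
    have h2 := Tri.sum_bary_smul T x
    rw [sum_fin_three hij hik hjk, hk] at h1 h2
    rw [zero_smul, add_zero] at h2
    rw [add_zero] at h1
    exact ⟨_, _, hi, hj, h1, h2⟩

namespace Triangulation

variable {𝒯 : Triangulation Ω}

lemma openSegment_subset_closure {T : Tri} (hT : T ∈ 𝒯.elems) (i j : Fin 3) :
    openSegment ℝ (T.points i) (T.points j) ⊆ closure Ω :=
  ((openSegment_subset_segment ℝ _ _).trans ((Tri.convex_closedInterior T).segment_subset
    (Tri.points_mem T i) (Tri.points_mem T j))).trans (closedInterior_subset hT)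

/-- An edge containing an inner point in its interior has a triangle on its other side. -/
lemma exists_neighbour {T : Tri} (hT : T ∈ 𝒯.elems) {i j k : Fin 3} (hij : i ≠ j) (hik : i ≠ k)
    (hjk : j ≠ k) (hΩ : IsOpen Ω) {z : Plane}
    (hz : z ∈ openSegment ℝ (T.points i) (T.points j)) (hzΩ : z ∈ Ω) :
    ∃ T' ∈ 𝒯.elems, ∃ i' j' k', i' ≠ j' ∧ i' ≠ k' ∧ j' ≠ k' ∧ T'.points i' = T.points i ∧
      T'.points j' = T.points j ∧ Tri.bary T k (T'.points k') < 0 := by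
  obtain ⟨hzi, hzj, hzk⟩ := (Tri.mem_openSegment T hij hik hjk).1 hz
  set P : ℝ → Plane := ⇑(AffineMap.lineMap (k := ℝ) z (T.points k)) with hP
  have hPc : Continuous P := AffineMap.lineMap_continuous
  have hP0 : P 0 = z := AffineMap.lineMap_apply_zero _ _
  have hPk : ∀ t, Tri.bary T k (P t) = t := by
    intro t
    rw [hP, AffineMap.apply_lineMap, hzk, Tri.bary_self T]
    simp [AffineMap.lineMap_apply]
  -- Points of `Ω` just across the edge, `P t` with small `t < 0`, must be covered. By finiteness
  -- and closedness one covering triangle also contains `z`.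
  obtain ⟨T', hT', hzT', y, hyT', hy⟩ : ∃ T' ∈ 𝒯.elems, z ∈ T'.closedInterior ∧
      ∃ y ∈ T'.closedInterior, Tri.bary T k y < 0 := by
    by_contra hcon
    push Not at hcon
    have hev : ∀ᶠ t in 𝓝[<] (0 : ℝ), ∀ T' ∈ 𝒯.elems, P t ∉ T'.closedInterior := by
      rw [eventually_all_finite 𝒯.finite]
      intro T' hT'
      by_cases hzT : z ∈ T'.closedInterior
      · filter_upwards [self_mem_nhdsWithin] with t ht hmem
        have := hcon T' hT' hzT _ hmem
        rw [hPk] at this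
        exact absurd ht (not_lt.2 this)
      · have : ∀ᶠ t in 𝓝 (0 : ℝ), P t ∉ T'.closedInterior :=
          hPc.continuousAt.eventually
            ((Tri.isCompact_closedInterior T').isClosed.isOpen_compl.mem_nhds (by rwa [hP0]))
        exact this.filter_mono nhdsWithin_le_nhds
    have hev2 : ∀ᶠ t in 𝓝[<] (0 : ℝ), P t ∈ Ω :=
      (hPc.continuousAt.eventually (hΩ.mem_nhds (by rwa [hP0]))).filter_mono nhdsWithin_le_nhds
    obtain ⟨t, ht1, ht2⟩ := (hev.and hev2).exists
    obtain ⟨T', hT', hmem⟩ := exists_mem (𝒯 := 𝒯) (subset_closure ht2)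
    exact ht1 T' hT' hmem
  -- By conformity `z` is in the hull of the common vertices. A vertex at which `z` has positive
  -- barycentric coordinate cannot be missing from them.
  have hcommon : ∀ m, 0 < Tri.bary T m z → ∃ m', T'.points m' = T.points m := by
    intro m hm
    by_contra hne
    push Not at hne
    have hmem : z ∈ convexHull ℝ (Set.range T.points ∩ Set.range T'.points) := by
      rw [← 𝒯.conforming T hT T' hT']
      exact ⟨(Tri.mem_closedInterior T).2 fun n => by
        rcases fin_three_cases hij hik hjk n with rfl | rfl | rfl
        exacts [hzi.le, hzj.le, hzk.ge], hzT'⟩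
    have : convexHull ℝ (Set.range T.points ∩ Set.range T'.points) ⊆ Tri.bary T m ⁻¹' {0} := by
      refine convexHull_min ?_ ((convex_singleton 0).affine_preimage _)
      rintro _ ⟨⟨n, rfl⟩, n', hn'⟩
      refine Tri.bary_ne T ?_
      rintro rfl
      exact hne n' hn'
    exact hm.ne' (this hmem)
  obtain ⟨i', hi'⟩ := hcommon i hzi
  obtain ⟨j', hj'⟩ := hcommon j hzj
  have hij' : i' ≠ j' := by
    rintro rfl
    exact hij (T.independent.injective (hi'.symm.trans hj'))
  obtain ⟨k', hik', hjk'⟩ : ∃ k', i' ≠ k' ∧ j' ≠ k' := by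
    exact (by decide : ∀ a b : Fin 3, ∃ c, a ≠ c ∧ b ≠ c) i' j'
  refine ⟨T', hT', i', j', k', hij', hik', hjk', hi', hj', ?_⟩
  rw [Tri.affine_eq_sum T', sum_fin_three hij' hik' hjk', hi', hj', Tri.bary_ne T hik.symm,
    Tri.bary_ne T hjk.symm] at hy
  have h0 := (Tri.mem_closedInterior T').1 hyT' k'
  by_contra hcon
  push Not at hcon
  have := mul_nonneg h0 hcon
  linarith

/-- An edge with an inner point of `Ω` does not touch the boundary apart from its end points. -/
lemma openSegment_subset_frontier (hΩ : IsLipschitzDomain Ω) {T : Tri} (hT : T ∈ 𝒯.elems)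
    {i j k : Fin 3} (hij : i ≠ j) (hik : i ≠ k) (hjk : j ≠ k) {x : Plane}
    (hx : x ∈ openSegment ℝ (T.points i) (T.points j)) (hxf : x ∈ frontier Ω) :
    openSegment ℝ (T.points i) (T.points j) ⊆ frontier Ω := by
  intro z hz
  rw [hΩ.2.1.frontier_eq]
  refine ⟨openSegment_subset_closure hT i j hz, fun hzΩ => ?_⟩
  obtain ⟨T', hT', i', j', k', hij', hik', hjk', hi', hj', hneg⟩ :=
    exists_neighbour hT hij hik hjk hΩ.2.1 hz hzΩ
  obtain ⟨hxi, hxj, hxk⟩ := (Tri.mem_openSegment T hij hik hjk).1 hx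
  rw [← hi', ← hj'] at hx
  obtain ⟨hxi', hxj', hxk'⟩ := (Tri.mem_openSegment T' hij' hik' hjk').1 hx
  have hpos : ∀ (S : Tri) (m : Fin 3), 0 < S.bary m x → ∀ᶠ y in 𝓝 x, 0 < S.bary m y :=
    fun S m h => (S.continuous_bary m).continuousAt.eventually (lt_mem_nhds h)
  -- The triangles on the two sides share the whole edge, so together they fill a neighbourhood of
  -- any of its relatively interior points. Such a point belongs to the interior of `closure Ω`,
  -- which is `Ω`, and not to the frontier.
  have hev : ∀ᶠ y in 𝓝 x, y ∈ closure Ω := by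
    filter_upwards [hpos T i hxi, hpos T j hxj, hpos T' i' hxi', hpos T' j' hxj'] with y h1 h2 h3 h4
    rcases le_or_gt 0 (Tri.bary T k y) with h | h
    · refine closedInterior_subset hT ((Tri.mem_closedInterior T).2 fun n => ?_)
      rcases fin_three_cases hij hik hjk n with rfl | rfl | rfl
      exacts [h1.le, h2.le, h]
    · refine closedInterior_subset hT' ((Tri.mem_closedInterior T').2 fun n => ?_)
      rcases fin_three_cases hij' hik' hjk' n with rfl | rfl | rfl
      · exact h3.le
      · exact h4.le
      · rw [Tri.affine_eq_sum T', sum_fin_three hij' hik' hjk', hi', hj', Tri.bary_ne T hik.symm,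
          Tri.bary_ne T hjk.symm] at h
        nlinarith
  have : x ∈ interior (closure Ω) := mem_interior_iff_mem_nhds.2 hev
  rw [hΩ.interior_closure] at this
  rw [hΩ.2.1.frontier_eq] at hxf
  exact hxf.2 this

/-- Boundary points other than nodes lie in a boundary edge. -/
lemma exists_edge (hΩ : IsLipschitzDomain Ω) {x : Plane} (hx : x ∈ frontier Ω)
    (hxn : x ∉ 𝒯.nodes) : ∃ T ∈ 𝒯.elems, ∃ i j k, i ≠ j ∧ i ≠ k ∧ j ≠ k ∧
      x ∈ openSegment ℝ (T.points i) (T.points j) := by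
  have hx' := hx
  rw [hΩ.2.1.frontier_eq] at hx'
  obtain ⟨T, hT, hxT⟩ := exists_mem (𝒯 := 𝒯) hx'.1
  have hxi : x ∉ T.interior := fun h => hx'.2 (mesh_subset hΩ (interior_subset_mesh hT h))
  rw [Tri.mem_interior T] at hxi
  push Not at hxi
  obtain ⟨k, hk⟩ := hxi
  have h0 := (Tri.mem_closedInterior T).1 hxT
  have hk0 : Tri.bary T k x = 0 := le_antisymm hk (h0 k)
  obtain ⟨i, j, hij, hik, hjk⟩ : ∃ i j, i ≠ j ∧ i ≠ k ∧ j ≠ k  :=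
    (by decide : ∀ c : Fin 3, ∃ a b : Fin 3, a ≠ b ∧ a ≠ c ∧ b ≠ c) k
  have hne : ∀ m n, m ≠ n → m ≠ k → n ≠ k → Tri.bary T m x ≠ 0 := by
    intro m n hmn hmk hnk h
    have h2 := Tri.sum_bary_smul T x
    have h1 := Tri.sum_bary T x
    rw [sum_fin_three hmn hmk hnk, hk0, h] at h1 h2
    simp only [zero_add, add_zero] at h1
    simp only [zero_smul, zero_add, add_zero, h1, one_smul] at h2
    exact hxn ⟨T, hT, n, h2⟩
  refine ⟨T, hT, i, j, k, hij, hik, hjk, (Tri.mem_openSegment T hij hik hjk).2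
    ⟨(h0 i).lt_of_ne' (hne i j hij hik hjk), (h0 j).lt_of_ne' (hne j i hij.symm hjk hik), hk0⟩⟩

end Triangulation

/-- A continuous function vanishing almost everywhere on a set vanishes on the segments
contained in it. -/
lemma eq_zero_on_segment {Γ : Set Plane} {a b : Plane} (hne : a ≠ b) {w : Plane → ℝ}
    (hab : openSegment ℝ a b ⊆ Γ) (hw : ContinuousOn w (segment ℝ a b)) (h0 : w =ᵐ[arc Γ] 0) :
    ∀ x ∈ segment ℝ a b, w x = 0 := by
  set P : ℝ → Plane := ⇑(AffineMap.lineMap (k := ℝ) a b) with hP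
  have hPc : Continuous P := AffineMap.lineMap_continuous
  have hopen : ∀ t ∈ Set.Ioo (0 : ℝ) 1, w (P t) = 0 := by
    intro t ht
    by_contra hwt
    have hPo : ∀ s ∈ Set.Ioo (0 : ℝ) 1, P s ∈ openSegment ℝ a b := by
      intro s hs
      rw [openSegment_eq_image_lineMap]
      exact ⟨s, hs, rfl⟩
    have hcont : ContinuousOn (fun t => w (P t)) (Set.Ioo 0 1) :=
      hw.comp hPc.continuousOn fun s hs => openSegment_subset_segment _ _ _ (hPo s hs)
    have hev : ∀ᶠ s in 𝓝 t, w (P s) ≠ 0 ∧ s ∈ Set.Ioo (0 : ℝ) 1 :=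
      ((hcont.continuousAt (isOpen_Ioo.mem_nhds ht)).eventually_ne hwt).and (isOpen_Ioo.mem_nhds ht)
    obtain ⟨δ, hδ, hball⟩ := Metric.eventually_nhds_iff_ball.1 hev
    have hsub : segment ℝ (P t) (P (t + δ / 2)) ⊆ {x | ¬ w x = (0 : Plane → ℝ) x} ∩ Γ := by
      rw [hP, ← image_segment]
      rintro _ ⟨s, hs, rfl⟩
      have hs' : s ∈ Metric.ball t δ := by
        refine (convex_ball t δ).segment_subset (Metric.mem_ball_self hδ) ?_ hs
        rw [Metric.mem_ball, Real.dist_eq, add_sub_cancel_left, abs_of_pos (by positivity)]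
        linarith
      exact ⟨(hball s hs').1, hab (hPo s (hball s hs').2)⟩
    -- A short segment on which `w` does not vanish would be null for arc length, but its measure is
    -- its positive length.
    have hpos : (Measure.hausdorffMeasure 1 : Measure Plane) (segment ℝ (P t) (P (t + δ / 2))) = 0 :=
      measure_mono_null hsub (le_antisymm ((Measure.le_restrict_apply _ _).trans
        (ae_iff.1 h0).le) zero_le)
    rw [hausdorffMeasure_segment, edist_eq_zero] at hpos
    have := AffineMap.lineMap_injective ℝ hne hpos
    linarith
  intro x hx
  rw [segment_eq_image_lineMap] at hx
  obtain ⟨t, ht, rfl⟩ := hx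
  have hcont : ContinuousOn (fun t => w (P t)) (Set.Icc 0 1) :=
    hw.comp hPc.continuousOn fun s hs => by
      rw [segment_eq_image_lineMap]
      exact ⟨s, hs, rfl⟩
  rw [← closure_Ioo zero_ne_one] at hcont ht
  have heq : Set.EqOn (fun t => w (P t)) (fun _ => 0) (Set.Ioo 0 1) := hopen
  exact heq.of_subset_closure hcont continuousOn_const subset_closure subset_rfl ht

namespace Triangulation

variable {𝒯 : Triangulation Ω}

/-- Piecewise affine interpolation preserves homogeneous Dirichlet conditions. -/
theorem interp_vanishesOn (hΩ : IsLipschitzDomain Ω) {ΓD ΓN : Set Plane} (hd : Disjoint ΓD ΓN)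
    (hu : ΓD ∪ ΓN = frontier Ω) (hres : 𝒯.Resolves ΓD ΓN) {w : Plane → ℝ}
    (hw : ContinuousOn w (closure Ω)) (h0 : w =ᵐ[arc ΓD] 0) : 𝒯.interp w =ᵐ[arc ΓD] 0 := by
  have key : ∀ x ∈ ΓD, x ∉ 𝒯.nodes → 𝒯.interp w x = 0 := by
    intro x hx hxn
    have hxf : x ∈ frontier Ω := hu ▸ Or.inl hx
    obtain ⟨T, hT, i, j, k, hij, hik, hjk, hxs⟩ := exists_edge hΩ hxf hxn
    have hsub := openSegment_subset_frontier hΩ hT hij hik hjk hxs hxf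
    have hD : openSegment ℝ (T.points i) (T.points j) ⊆ ΓD := by
      rcases hres T hT i j hij hsub with h | h
      · exact h
      · exact absurd (h hxs) (Set.disjoint_left.1 hd hx)
    have hseg : segment ℝ (T.points i) (T.points j) ⊆ T.closedInterior :=
      (Tri.convex_closedInterior T).segment_subset (Tri.points_mem T i) (Tri.points_mem T j)
    -- By continuity `w` vanishes also at the end points of the edge, which need not lie in `ΓD`.
    -- Only these two nodal values enter the interpolant on the edge.
    have hz := eq_zero_on_segment (T.independent.injective.ne hij) hD (hw.mono (hseg.trans (closedInterior_subset hT))) h0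
    rw [interp_eq w hT (hseg (openSegment_subset_segment _ _ _ hxs)), affineOn_apply,
      sum_fin_three hij hik hjk, hz _ (left_mem_segment _ _ _), hz _ (right_mem_segment _ _ _),
      ((Tri.mem_openSegment T hij hik hjk).1 hxs).2.2]
    simp
  have hm : MeasurableSet {x | ¬ 𝒯.interp w x = (0 : Plane → ℝ) x} :=
    ((measurable_interp w) (measurableSet_singleton 0)).compl
  refine ae_iff.2 ?_
  rw [arc, Measure.restrict_apply hm]
  have := Measure.nullSingletonClass_hausdorff (X := Plane) one_pos
  refine measure_mono_null ?_ ((finite_nodes (𝒯 := 𝒯)).measure_zero _)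
  rintro x ⟨h1, h2⟩
  by_contra hxn
  exact h1 (key x h2 hxn)

end Triangulation

/-! ### Taylor remainders and interpolation -/

/-- The remainder of the first order Taylor expansion at `x`, evaluated at `a`. -/
def taylorRem (f : Plane → ℝ) (a x : Plane) : ℝ := f a - f x - inner ℝ (∇ f x) (a - x)

/-- A bound for the second derivatives. -/
def hess (f : Plane → ℝ) (z : Plane) : ℝ := ∑ l : Fin 2, ‖∇ (fun y => ∇ f y l) z‖

lemma hess_nonneg (f : Plane → ℝ) (z : Plane) : 0 ≤ hess f z :=
  Finset.sum_nonneg fun _ _ => norm_nonneg _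

lemma continuous_hess {f : Plane → ℝ} (hf : ContDiff ℝ ∞ f) : Continuous (hess f) :=
  continuous_finsetSum _ fun l _ => (continuous_gradient (contDiff_partial hf l)).norm

lemma continuous_taylorRem {f : Plane → ℝ} (hf : ContDiff ℝ ∞ f) (a : Plane) :
    Continuous (taylorRem f a) :=
  (continuous_const.sub hf.continuous).sub
    ((continuous_gradient hf).inner (continuous_const.sub continuous_id))

lemma hasDerivAt_comp_line {g : Plane → ℝ} (hg : ContDiff ℝ ∞ g) (x v : Plane) (τ : ℝ) :
    HasDerivAt (fun τ : ℝ => g (x + τ • v)) (inner ℝ (∇ g (x + τ • v)) v) τ := by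
  have h1 : HasDerivAt (fun τ : ℝ => x + τ • v) v τ := by
    have := ((hasDerivAt_id τ).smul_const v).const_add x
    rwa [one_smul] at this
  have h2 := ((hg.differentiable (by simp)) (x + τ • v)).hasFDerivAt.comp_hasDerivAt τ h1
  rwa [← inner_gradient_left] at h2

lemma inner_eq_sum (v w : Plane) : inner ℝ v w = ∑ l, v l * w l := by
  simp [PiLp.inner_apply, mul_comm]

lemma sq_integral_le {g : ℝ → ℝ} (hg : Continuous g) :
    (∫ τ in (0 : ℝ)..1, g τ) ^ 2 ≤ ∫ τ in (0 : ℝ)..1, g τ ^ 2 := by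
  set m := ∫ τ in (0 : ℝ)..1, g τ with hm
  have h0 : 0 ≤ ∫ τ in (0 : ℝ)..1, (g τ - m) ^ 2 :=
    intervalIntegral.integral_nonneg zero_le_one fun τ _ => sq_nonneg _
  have e : ∀ τ, (g τ - m) ^ 2 = g τ ^ 2 - 2 * m * g τ + m ^ 2 := fun τ => by ring
  simp only [e] at h0
  rw [intervalIntegral.integral_add ((by fun_prop : Continuous fun τ =>
      g τ ^ 2 - 2 * m * g τ).intervalIntegrable _ _) (by simp),
    intervalIntegral.integral_sub ((by fun_prop : Continuous fun τ => g τ ^ 2).intervalIntegrable _ _)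
      ((hg.const_mul _).intervalIntegrable _ _), intervalIntegral.integral_const_mul, ← hm] at h0
  simp only [intervalIntegral.integral_const, sub_zero, one_smul] at h0
  nlinarith

/-- Integral form of the remainder and Cauchy–Schwarz on the unit interval. The weight `1 - τ` stays
inside the square, because `(1 - τ)²` is the Jacobian of the contraction towards `a` in the plane.
-/
lemma sq_taylorRem_le {f : Plane → ℝ} (hf : ContDiff ℝ ∞ f) (a x : Plane) :
    taylorRem f a x ^ 2 ≤ (‖a - x‖ ^ 2) ^ 2 *
      ∫ τ in (0 : ℝ)..1, ((1 - τ) * hess f (x + τ • (a - x))) ^ 2 := by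
  set v := a - x with hv
  have hline : Continuous fun τ : ℝ => x + τ • v := by fun_prop
  set q : ℝ → ℝ := fun τ => ∑ l, inner ℝ (∇ (fun y => ∇ f y l) (x + τ • v)) v * v l with hq
  have hqc : Continuous q := continuous_finsetSum _ fun l _ =>
    (((continuous_gradient (contDiff_partial hf l)).comp hline).inner continuous_const).mul
      continuous_const
  have hH : Continuous fun τ : ℝ => (1 - τ) * hess f (x + τ • v) :=
    (continuous_const.sub continuous_id).mul ((continuous_hess hf).comp hline)
  have hder : ∀ τ, HasDerivAt (fun τ => f (x + τ • v) + (1 - τ) * inner ℝ (∇ f (x + τ • v)) v)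
      ((1 - τ) * q τ) τ := by
    intro τ
    have h1 := hasDerivAt_comp_line hf x v τ
    have h2 : HasDerivAt (fun τ => inner ℝ (∇ f (x + τ • v)) v) (q τ) τ := by
      simp only [inner_eq_sum (∇ f _)]
      exact HasDerivAt.fun_sum fun l _ =>
        (hasDerivAt_comp_line (contDiff_partial hf l) x v τ).mul_const (v l)
    refine (h1.fun_add (((hasDerivAt_id' τ).const_sub 1).fun_mul h2)).congr_deriv ?_
    ring
  have hintg := intervalIntegral.integral_eq_sub_of_hasDerivAt (a := 0) (b := 1)
    (fun τ _ => hder τ) (((continuous_const.sub continuous_id).mul hqc).intervalIntegrable _ _)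
  have hR : taylorRem f a x = ∫ τ in (0 : ℝ)..1, (1 - τ) * q τ := by
    rw [hintg, taylorRem]
    simp [hv]
    ring
  have hqb : ∀ τ, |q τ| ≤ ‖v‖ ^ 2 * hess f (x + τ • v) := by
    intro τ
    rw [hess, Finset.mul_sum]
    refine (Finset.abs_sum_le_sum_abs _ _).trans (Finset.sum_le_sum fun l _ => ?_)
    rw [abs_mul]
    have h1 := abs_real_inner_le_norm (∇ (fun y => ∇ f y l) (x + τ • v)) v
    have h2 := abs_coord_le v l
    calc _ ≤ ‖∇ (fun y => ∇ f y l) (x + τ • v)‖ * ‖v‖ * ‖v‖ :=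
          mul_le_mul h1 h2 (abs_nonneg _) (by positivity)
      _ = _ := by ring
  have hle : |taylorRem f a x| ≤ ‖v‖ ^ 2 * ∫ τ in (0 : ℝ)..1, (1 - τ) * hess f (x + τ • v) := by
    rw [hR, ← intervalIntegral.integral_const_mul]
    refine (intervalIntegral.abs_integral_le_integral_abs zero_le_one).trans ?_
    refine intervalIntegral.integral_mono_on zero_le_one
      ((((continuous_const.sub continuous_id).mul hqc).abs).intervalIntegrable _ _)
      ((hH.const_mul _).intervalIntegrable _ _) fun τ hτ => ?_
    rw [abs_mul, abs_of_nonneg (sub_nonneg.2 hτ.2)]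
    have := mul_le_mul_of_nonneg_left (hqb τ) (sub_nonneg.2 hτ.2)
    linarith
  calc taylorRem f a x ^ 2 = |taylorRem f a x| ^ 2 := (sq_abs _).symm
    _ ≤ (‖v‖ ^ 2 * ∫ τ in (0 : ℝ)..1, (1 - τ) * hess f (x + τ • v)) ^ 2 :=
        pow_le_pow_left₀ (abs_nonneg _) hle 2
    _ ≤ _ := by
        rw [mul_pow]
        exact mul_le_mul_of_nonneg_left (sq_integral_le hH) (by positivity)

/-- Contraction of a star-shaped set towards its centre. -/
lemma lintegral_contraction_le {S : Set Plane} (hS : MeasurableSet S) {a : Plane} {τ : ℝ}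
    (hτ : τ < 1) (hstar : ∀ x ∈ S, x + τ • (a - x) ∈ S) {F : Plane → ℝ≥0∞} (hF : Measurable F) :
    ∫⁻ x in S, ENNReal.ofReal ((1 - τ) ^ 2) * F (x + τ • (a - x)) ≤ ∫⁻ z in S, F z := by
  have hr : (1 - τ) ≠ 0 := by linarith
  have hF' : Measurable (S.indicator F) := hF.indicator hS
  have e : ∀ x : Plane, x + τ • (a - x) = (1 - τ) • x + τ • a := by
    intro x
    module
  calc ∫⁻ x in S, ENNReal.ofReal ((1 - τ) ^ 2) * F (x + τ • (a - x))
      = ∫⁻ x in S, ENNReal.ofReal ((1 - τ) ^ 2) * S.indicator F ((1 - τ) • x + τ • a) := by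
        refine setLIntegral_congr_fun hS fun x hx => ?_
        simp only [← e]
        rw [Set.indicator_of_mem (hstar x hx)]
    _ ≤ ∫⁻ x, ENNReal.ofReal ((1 - τ) ^ 2) * S.indicator F ((1 - τ) • x + τ • a) :=
        setLIntegral_le_lintegral _ _
    _ = ENNReal.ofReal ((1 - τ) ^ 2) * ∫⁻ x, S.indicator F ((1 - τ) • x + τ • a) :=
        lintegral_const_mul _ (hF'.comp (by fun_prop))
    _ = ∫⁻ z, S.indicator F z := by
        have h1 := lintegral_map (μ := (volume : Measure Plane))
          (f := fun z => S.indicator F (z + τ • a)) (g := fun x : Plane => (1 - τ) • x)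
          (hF'.comp (by fun_prop)) (by fun_prop)
        rw [← h1, Measure.map_addHaar_smul _ hr, lintegral_smul_measure, smul_eq_mul, ← mul_assoc,
          ← ENNReal.ofReal_mul (by positivity)]
        rw [lintegral_add_right_eq_self (μ := (volume : Measure Plane)) (S.indicator F)]
        simp only [finrank_euclideanSpace, Fintype.card_fin]
        rw [abs_of_nonneg (by positivity), mul_inv_cancel₀ (by positivity)]
        simp
    _ = ∫⁻ z in S, F z := lintegral_indicator hS _

lemma Tri.contraction_mem (T : Tri) {a x : Plane} (ha : a ∈ T.closedInterior)
    (hx : x ∈ T.interior) {τ : ℝ} (h0 : 0 ≤ τ) (h1 : τ < 1) : x + τ • (a - x) ∈ T.interior := by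
  rw [T.mem_interior] at hx ⊢
  rw [T.mem_closedInterior] at ha
  intro i
  have e : x + τ • (a - x) = (1 - τ) • x + τ • a := by module
  rw [e, Convex.combo_affine_apply (by ring)]
  have := mul_pos (sub_pos.2 h1) (hx i)
  have := mul_nonneg h0 (ha i)
  simp only [smul_eq_mul]
  linarith

/-- After exchanging the integrals, the substitution `z = x + τ (a - x)` maps the triangle into
itself and absorbs the weight `(1 - τ)²` exactly, so no singularity appears at `τ = 1`. -/
lemma Tri.eLpNorm_taylorRem_le (T : Tri) {f : Plane → ℝ} (hf : ContDiff ℝ ∞ f) {a : Plane}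
    (ha : a ∈ T.closedInterior) :
    eLpNorm (taylorRem f a) 2 (volume.restrict T.interior)
      ≤ ENNReal.ofReal ((2 * T.circumradius) ^ 2) *
        eLpNorm (hess f) 2 (volume.restrict T.interior) := by
  set d := 2 * T.circumradius with hd
  have hTm := (Tri.isOpen_interior T).measurableSet
  have hC : Continuous fun p : Plane × ℝ => ((1 - p.2) * hess f (p.1 + p.2 • (a - p.1))) ^ 2 := by
    have := continuous_hess hf
    fun_prop
  have key : ∫⁻ x in T.interior, ENNReal.ofReal (taylorRem f a x ^ 2)
      ≤ ENNReal.ofReal ((d ^ 2) ^ 2) * eLpNorm (hess f) 2 (volume.restrict T.interior) ^ 2 := by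
    calc ∫⁻ x in T.interior, ENNReal.ofReal (taylorRem f a x ^ 2)
        ≤ ∫⁻ x in T.interior, ENNReal.ofReal ((d ^ 2) ^ 2) *
          ∫⁻ τ in Set.Ioc (0 : ℝ) 1, ENNReal.ofReal (((1 - τ) * hess f (x + τ • (a - x))) ^ 2) := by
          refine setLIntegral_mono' hTm fun x hx => ?_
          have hcx : Continuous fun τ : ℝ => ((1 - τ) * hess f (x + τ • (a - x))) ^ 2 :=
            hC.comp (by fun_prop : Continuous fun τ : ℝ => (x, τ))
          have h := sq_taylorRem_le hf a x
          rw [intervalIntegral.integral_of_le zero_le_one] at h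
          rw [← ofReal_integral_eq_lintegral_ofReal, ← ENNReal.ofReal_mul (by positivity)]
          · refine ENNReal.ofReal_le_ofReal (h.trans ?_)
            refine mul_le_mul_of_nonneg_right ?_ (integral_nonneg fun τ => sq_nonneg _)
            have := T.dist_le ha (T.interior_subset_closedInterior hx)
            rw [dist_eq_norm] at this
            gcongr
          · exact (hcx.intervalIntegrable 0 1).1
          · exact ae_of_all _ fun τ => sq_nonneg _
      _ = ENNReal.ofReal ((d ^ 2) ^ 2) * ∫⁻ τ in Set.Ioc (0 : ℝ) 1, ∫⁻ x in T.interior,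
            ENNReal.ofReal (((1 - τ) * hess f (x + τ • (a - x))) ^ 2) := by
          rw [lintegral_const_mul' _ _ ENNReal.ofReal_ne_top, lintegral_lintegral_swap]
          exact (ENNReal.continuous_ofReal.comp hC).measurable.aemeasurable
      _ ≤ ENNReal.ofReal ((d ^ 2) ^ 2) * ∫⁻ τ in Set.Ioc (0 : ℝ) 1,
            eLpNorm (hess f) 2 (volume.restrict T.interior) ^ 2 := by
          refine mul_le_mul_right (setLIntegral_mono' measurableSet_Ioc fun τ hτ => ?_) _
          rcases hτ.2.lt_or_eq with hlt | rfl
          · rw [eLpNorm_two_sq]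
            refine le_trans (le_of_eq ?_) (lintegral_contraction_le hTm hlt
              (fun x hx => T.contraction_mem ha hx hτ.1.le hlt)
              (F := fun z => ‖hess f z‖ₑ ^ 2) ((continuous_hess hf).measurable.enorm.pow_const 2))
            refine lintegral_congr fun x => ?_
            rw [mul_pow, ENNReal.ofReal_mul (sq_nonneg _), Real.enorm_of_nonneg (hess_nonneg _ _),
              ENNReal.ofReal_pow (hess_nonneg _ _)]
          · simp
      _ = _ := by simp
  have := eLpNorm_le_of_lintegral (by positivity) key
  rwa [Real.sqrt_sq (by positivity)] at this

namespace Triangulation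

variable {𝒯 : Triangulation Ω}

/-- The linear Taylor terms drop out because barycentric coordinates reproduce the point: `∑ λ_i
(a_i - x) = 0`. -/
lemma affineOn_sub_eq (T : Tri) (f : Plane → ℝ) (x : Plane) :
    affineOn T f x - f x = ∑ i, Tri.bary T i x * taylorRem f (T.points i) x := by
  have h := Tri.affine_eq_sum T (affineOn T f) x
  have h1 : ∑ i, Tri.bary T i x * inner ℝ (∇ f x) (T.points i - x) = 0 := by
    have : ∑ i, Tri.bary T i x • (T.points i - x) = 0 := by
      simp only [smul_sub, Finset.sum_sub_distrib, ← Finset.sum_smul, Tri.sum_bary_smul,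
        Tri.sum_bary, one_smul, sub_self]
    rw [← inner_zero_right (𝕜 := ℝ) (∇ f x), ← this, inner_sum]
    simp
  simp only [taylorRem, mul_sub, Finset.sum_sub_distrib, h1, ← Finset.sum_mul, Tri.sum_bary,
    affineOn_apply]
  simp

/-- Since `∑ ⟨∇λ_i, v⟩ (a_i - x) = v`, the linear Taylor terms reproduce `∇f` exactly and only
remainders are left. -/
lemma gradOn_sub_eq (T : Tri) (f : Plane → ℝ) (x : Plane) :
    gradOn T f - ∇ f x = ∑ i, taylorRem f (T.points i) x • Tri.baryGrad T i := by
  refine ext_inner_right ℝ fun v => ?_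
  have h0 : ∑ i, inner ℝ (Tri.baryGrad T i) v = 0 := by
    have : ∀ i, inner ℝ (Tri.baryGrad T i) v = Tri.bary T i (x + v) - Tri.bary T i x := by
      intro i
      rw [Tri.bary_sub, add_sub_cancel_left]
    simp only [this, Finset.sum_sub_distrib, Tri.sum_bary, sub_self]
  have h1 : ∑ i, inner ℝ (∇ f x) (T.points i - x) * inner ℝ (Tri.baryGrad T i) v
      = inner ℝ (∇ f x) v := by
    have : ∑ i, inner ℝ (Tri.baryGrad T i) v • (T.points i - x) = v := by
      have e : ∀ i, inner ℝ (Tri.baryGrad T i) v = Tri.bary T i (x + v) - Tri.bary T i x := by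
        intro i
        rw [Tri.bary_sub, add_sub_cancel_left]
      simp only [smul_sub, Finset.sum_sub_distrib, ← Finset.sum_smul, h0, zero_smul, sub_zero]
      simp only [e, sub_smul, Finset.sum_sub_distrib, Tri.sum_bary_smul, add_sub_cancel_left]
    conv_rhs => rw [← this, inner_sum]
    simp [mul_comm]
  rw [inner_sub_left, gradOn, sum_inner, sum_inner, ← h1]
  simp only [real_inner_smul_left, taylorRem, sub_mul, Finset.sum_sub_distrib, ← Finset.mul_sum, h0]
  simp

/-- The factor `12` counts three vertices, each contributing the squared diameter bound `(2 h)²`. -/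
lemma eLpNorm_sum_taylorRem_le {h : ℝ} {T : Tri} (hh : T.circumradius ≤ h) {f : Plane → ℝ}
    (hf : ContDiff ℝ ∞ f) :
    eLpNorm (fun x => ∑ i, |taylorRem f (T.points i) x|) 2 (volume.restrict T.interior)
      ≤ ENNReal.ofReal (12 * h ^ 2) * eLpNorm (hess f) 2 (volume.restrict T.interior) := by
  have hc : ∀ i, Continuous fun x => |taylorRem f (T.points i) x| := fun i =>
    (continuous_taylorRem hf _).abs
  have e : (fun x => ∑ i, |taylorRem f (T.points i) x|)
      = ∑ i, fun x => |taylorRem f (T.points i) x| := by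
    funext x
    simp
  have h0 := T.circumradius_pos.le
  rw [e]
  refine (eLpNorm_sum_le (fun i _ => (hc i).aestronglyMeasurable) (by norm_num)).trans ?_
  have : ∀ i ∈ (Finset.univ : Finset (Fin 3)),
      eLpNorm (fun x => |taylorRem f (T.points i) x|) 2 (volume.restrict T.interior)
        ≤ ENNReal.ofReal (4 * h ^ 2) * eLpNorm (hess f) 2 (volume.restrict T.interior) := by
    intro i _
    have := Tri.eLpNorm_taylorRem_le T hf (Tri.points_mem T i)
    have e2 : eLpNorm (fun x => |taylorRem f (T.points i) x|) 2 (volume.restrict T.interior)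
        = eLpNorm (taylorRem f (T.points i)) 2 (volume.restrict T.interior) :=
      eLpNorm_norm (taylorRem f (T.points i))
    rw [e2]
    refine this.trans ?_
    gcongr
    nlinarith
  refine (Finset.sum_le_sum this).trans (le_of_eq ?_)
  rw [Finset.sum_const, Finset.card_univ, Fintype.card_fin, ← smul_mul_assoc]
  congr 1
  rw [show (12 : ℝ) * h ^ 2 = 3 * (4 * h ^ 2) by ring, ENNReal.ofReal_mul (by norm_num)]
  simp

lemma eLpNorm_hess_le {f : Plane → ℝ} (hf : ContDiff ℝ ∞ f) (hΩ : Bornology.IsBounded Ω) :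
    l2 (volume.restrict Ω) (hess f) ≤ ∑ l, l2 (volume.restrict Ω) (∇ fun y => ∇ f y l) := by
  have hg : ∀ l, Continuous (∇ fun y => ∇ f y l) := fun l =>
    continuous_gradient (contDiff_partial hf l)
  refine (l2_sum_le Finset.univ fun l _ =>
    memLp_of_continuous hΩ (hg l).norm 2).trans (le_of_eq ?_)
  refine Finset.sum_congr rfl fun l _ => ?_
  rw [l2, l2, eLpNorm_norm]

/-- Interpolation estimates for smooth functions. -/
lemma interp_smooth_estimate (hΩ : IsLipschitzDomain Ω) {h r : ℝ} (hr : 0 < r)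
    (hT : ∀ T ∈ 𝒯.elems, T.circumradius ≤ h ∧ r ≤ T.inradius) {f : Plane → ℝ}
    (hf : ContDiff ℝ ∞ f) :
    l2 (volume.restrict Ω) (fun x => 𝒯.interp f x - f x)
      ≤ 12 * h ^ 2 * ∑ l, l2 (volume.restrict Ω) (∇ fun y => ∇ f y l) ∧
    l2 (volume.restrict Ω) (fun x => ∇ (𝒯.interp f) x - ∇ f x)
      ≤ 12 * h ^ 2 / r * ∑ l, l2 (volume.restrict Ω) (∇ fun y => ∇ f y l) := by
  have hess_fin : eLpNorm (hess f) 2 (volume.restrict Ω) ≠ ⊤ :=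
    (memLp_of_continuous hΩ.1 (continuous_hess hf) 2).2.ne
  have glob : ∀ {E : Type} [NormedAddCommGroup E] (F : Plane → E) (c : ℝ), 0 ≤ c →
      (∀ T ∈ 𝒯.elems, ∀ x ∈ T.interior, ‖F x‖ ≤ c * ∑ i, |taylorRem f (T.points i) x|) →
      l2 (volume.restrict Ω) F
        ≤ c * (12 * h ^ 2) * ∑ l, l2 (volume.restrict Ω) (∇ fun y => ∇ f y l) := by
    intro E _ F c hc hF
    have h1 := eLpNorm_mesh_le (𝒯 := 𝒯) MeasurableSet.univ
      (K := ENNReal.ofReal (c * (12 * h ^ 2))) (F := F) (F' := hess f) ?_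
    · rw [Set.univ_inter, restrict_mesh hΩ] at h1
      have h2 := ENNReal.toReal_mono (ENNReal.mul_ne_top ENNReal.ofReal_ne_top hess_fin) h1
      rw [ENNReal.toReal_mul, ENNReal.toReal_ofReal (by positivity)] at h2
      exact h2.trans (mul_le_mul_of_nonneg_left (eLpNorm_hess_le hf hΩ.1) (by positivity))
    · intro T hTm
      rw [Set.univ_inter, ENNReal.ofReal_mul hc, mul_assoc]
      refine le_trans ?_ (mul_le_mul_right (eLpNorm_sum_taylorRem_le (hT T hTm).1 hf) _)
      refine eLpNorm_le_mul_eLpNorm_of_ae_le_mul ?_ 2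
      filter_upwards [ae_restrict_mem (Tri.isOpen_interior T).measurableSet] with x hx
      refine (hF T hTm x hx).trans_eq ?_
      rw [Real.norm_of_nonneg (Finset.sum_nonneg fun _ _ => abs_nonneg _)]
  constructor
  · have := glob (fun x => 𝒯.interp f x - f x) 1 zero_le_one fun T hTm x hx => ?_
    · rwa [one_mul] at this
    · have hx' := T.interior_subset_closedInterior hx
      rw [interp_eq f hTm hx', affineOn_sub_eq, one_mul]
      refine (norm_sum_le _ _).trans (Finset.sum_le_sum fun i _ => ?_)
      rw [norm_mul, Real.norm_of_nonneg ((Tri.mem_closedInterior T).1 hx' i)]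
      exact mul_le_of_le_one_left (norm_nonneg _) (Tri.bary_le_one T hx' i)
  · have := glob (fun x => ∇ (𝒯.interp f) x - ∇ f x) (1 / r) (by positivity) fun T hTm x hx => ?_
    · rwa [show 1 / r * (12 * h ^ 2) = 12 * h ^ 2 / r by ring] at this
    · rw [gradient_interp f hTm hx, gradOn_sub_eq, Finset.mul_sum]
      refine (norm_sum_le _ _).trans (Finset.sum_le_sum fun i _ => ?_)
      rw [norm_smul, mul_comm, Real.norm_eq_abs]
      refine mul_le_mul_of_nonneg_right ((Tri.norm_baryGrad_le T i).trans ?_) (abs_nonneg _)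
      exact one_div_le_one_div_of_le hr (hT T hTm).2

/-- Pointwise values of smooth functions are controlled by their `H²` norms. -/
lemma abs_le_of_smooth (𝒯 : Triangulation Ω) (hΩ : IsLipschitzDomain Ω) : ∃ K : ℝ, 0 ≤ K ∧ ∀ f : Plane → ℝ,
    ContDiff ℝ ∞ f → ∀ a ∈ closure Ω, |f a| ≤ K * (l2 (volume.restrict Ω) f +
      l2 (volume.restrict Ω) (∇ f) + ∑ l, l2 (volume.restrict Ω) (∇ fun y => ∇ f y l)) := by
  have loc : ∀ T ∈ 𝒯.elems, ∃ K : ℝ, 0 ≤ K ∧ ∀ f : Plane → ℝ,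
      ContDiff ℝ ∞ f → ∀ a ∈ T.closedInterior, |f a| ≤ K * (l2 (volume.restrict Ω) f +
      l2 (volume.restrict Ω) (∇ f) + ∑ l, l2 (volume.restrict Ω) (∇ fun y => ∇ f y l)) := by
    intro T hT
    set μ := (volume : Measure Plane).restrict T.interior with hμ
    have hTb : Bornology.IsBounded T.interior :=
      (Tri.isCompact_closedInterior T).isBounded.subset T.interior_subset_closedInterior
    have hle : μ ≤ volume.restrict Ω :=
      Measure.restrict_mono ((interior_subset_mesh hT).trans (mesh_subset hΩ)) le_rfl
    set V := l2 μ fun _ => (1 : ℝ) with hV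
    have hVpos : 0 < V := by
      have h0 : volume T.interior ≠ 0 :=
        ((Tri.isOpen_interior T).measure_pos volume (Tri.nonempty_interior T)).ne'
      have h1 : 0 < V ^ 2 := by
        rw [hV, l2_sq aestronglyMeasurable_const]
        simp only [norm_one, one_pow, integral_const, smul_eq_mul, mul_one, hμ]
        simp only [measureReal_def, Measure.restrict_apply_univ]
        exact ENNReal.toReal_pos h0 hTb.measure_lt_top.ne
      exact lt_of_le_of_ne l2_nonneg fun h => by rw [← h] at h1; norm_num at h1
    set d := 2 * T.circumradius with hd
    have hd0 : 0 ≤ d := by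
      have := T.circumradius_pos
      positivity
    refine ⟨(1 + d + d ^ 2) / V, by positivity, fun f hf a ha => ?_⟩
    have m1 : MemLp f 2 μ := memLp_of_continuous hTb hf.continuous 2
    have m2 : MemLp (∇ f) 2 μ := memLp_of_continuous hTb (continuous_gradient hf) 2
    have m3 : MemLp (taylorRem f a) 2 μ := memLp_of_continuous hTb (continuous_taylorRem hf a) 2
    have m4 : MemLp (fun x => inner ℝ (∇ f x) (a - x)) 2 μ := memLp_of_continuous hTb
      ((continuous_gradient hf).inner (continuous_const.sub continuous_id)) 2
    have m5 : MemLp (hess f) 2 μ := memLp_of_continuous hTb (continuous_hess hf) 2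
    have b1 : l2 μ f ≤ l2 (volume.restrict Ω) f :=
      l2_mono_measure hle (memLp_of_continuous hΩ.1 hf.continuous 2)
    have b2 : l2 μ (fun x => inner ℝ (∇ f x) (a - x)) ≤ d * l2 (volume.restrict Ω) (∇ f) := by
      refine le_trans (l2_le_of_ae hd0 m2 ?_) (mul_le_mul_of_nonneg_left (l2_mono_measure hle
        (memLp_of_continuous hΩ.1 (continuous_gradient hf) 2)) hd0)
      filter_upwards [ae_restrict_mem (Tri.isOpen_interior T).measurableSet] with x hx
      refine (norm_inner_le_norm _ _).trans ?_
      rw [mul_comm, ← dist_eq_norm]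
      exact mul_le_mul_of_nonneg_right
        (Tri.dist_le T ha (T.interior_subset_closedInterior hx)) (norm_nonneg _)
    have b3 : l2 μ (taylorRem f a)
        ≤ d ^ 2 * ∑ l, l2 (volume.restrict Ω) (∇ fun y => ∇ f y l) := by
      have h1 := ENNReal.toReal_mono (ENNReal.mul_ne_top ENNReal.ofReal_ne_top m5.2.ne)
        (Tri.eLpNorm_taylorRem_le T hf ha)
      rw [ENNReal.toReal_mul, ENNReal.toReal_ofReal (by positivity)] at h1
      refine h1.trans (mul_le_mul_of_nonneg_left ?_ (by positivity))
      exact (l2_mono_measure hle (memLp_of_continuous hΩ.1 (continuous_hess hf) 2)).trans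
        (eLpNorm_hess_le hf hΩ.1)
    -- The value `f a` is a constant function on the triangle, equal to the Taylor polynomial at `x`
    -- plus the remainder. Taking `L²` norms in `x` and dividing by `V`, the norm of the constant
    -- one, bounds it. The dependence on the triangulation is harmless, as the bound serves only to
    -- show convergence.
    have b4 : V * |f a| ≤ l2 μ f + l2 μ (fun x => inner ℝ (∇ f x) (a - x))
        + l2 μ (taylorRem f a) := by
      have e : (fun _ : Plane => f a)
          = fun x => (f x + inner ℝ (∇ f x) (a - x)) + taylorRem f a x := by
        funext x
        simp only [taylorRem]
        ring
      have h1 : l2 μ (fun _ => f a) = V * |f a| := by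
        have : l2 μ (fun _ => f a) = |f a| * V := by
          have e1 : eLpNorm (fun _ : Plane => f a) 2 μ
              = ‖f a‖ₑ * eLpNorm (fun _ : Plane => (1 : ℝ)) 2 μ := by
            rw [← eLpNorm_const_smul]
            congr 1
            funext x
            simp
          rw [l2, e1, ENNReal.toReal_mul]
          simp [hV, l2]
        rw [this, mul_comm]
      rw [← h1, e]
      exact (l2_add_le (memLp_fun_add m1 m4) m3).trans
        (add_le_add_left (l2_add_le m1 m4) _)
    have hs : 0 ≤ ∑ l, l2 (volume.restrict Ω) (∇ fun y => ∇ f y l) :=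
      Finset.sum_nonneg fun _ _ => l2_nonneg
    rw [div_mul_eq_mul_div, le_div_iff₀ hVpos, mul_comm]
    have p1 : 0 ≤ l2 (volume.restrict Ω) f := l2_nonneg
    have p2 : 0 ≤ l2 (volume.restrict Ω) (∇ f) := l2_nonneg
    refine (b4.trans (add_le_add (add_le_add b1 b2) b3)).trans ?_
    nlinarith [mul_nonneg hd0 p1, mul_nonneg hd0 hs, mul_nonneg (sq_nonneg d) p1,
      mul_nonneg (sq_nonneg d) p2]
  choose! K hK0 hK using loc
  refine ⟨∑ T ∈ 𝒯.finite.toFinset, K T, Finset.sum_nonneg fun T hT =>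
    hK0 T (𝒯.finite.mem_toFinset.1 hT), fun f hf a ha => ?_⟩
  obtain ⟨T, hT, haT⟩ := exists_mem (𝒯 := 𝒯) ha
  refine (hK T hT f hf a haT).trans (mul_le_mul_of_nonneg_right ?_ ?_)
  · exact Finset.single_le_sum (f := K) (fun T hT => hK0 T (𝒯.finite.mem_toFinset.1 hT))
      (𝒯.finite.mem_toFinset.2 hT)
  · exact add_nonneg (add_nonneg l2_nonneg l2_nonneg) (Finset.sum_nonneg fun _ _ => l2_nonneg)

end Triangulation

/-! ### Interpolation of `H²` functions -/

lemma H2.seminorm_le_norm (u : H2 Ω) (l : Fin 2) : (u.deriv l).seminorm ≤ u.norm := by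
  refine Real.le_sqrt_of_sq_le ?_
  have := Finset.single_le_sum (f := fun l => (u.deriv l).seminorm ^ 2) (fun _ _ => sq_nonneg _)
    (Finset.mem_univ l)
  have h2 := sq_nonneg ‖u.toH1‖
  linarith

lemma H2.norm_toH1_le (u : H2 Ω) : ‖u.toH1‖ ≤ u.norm := by
  refine Real.le_sqrt_of_sq_le (le_add_of_nonneg_right ?_)
  exact Finset.sum_nonneg fun _ _ => sq_nonneg _

lemma H2.norm_nonneg (u : H2 Ω) : 0 ≤ u.norm := Real.sqrt_nonneg _

lemma H2.wg_deriv (u : H2 Ω) (l : Fin 2) :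
    WG Ω (fun x => u.toH1.grad x l) (u.deriv l).grad :=
  (u.deriv l).wg.congr (u.deriv_eq l) (ae_eq_refl _)

namespace Triangulation

variable {𝒯 : Triangulation Ω}

lemma abs_interp_sub_le_sum (c c' : Plane → ℝ) {x : Plane} (hx : x ∈ closure Ω) :
    |𝒯.interp c x - 𝒯.interp c' x| ≤ ∑ p ∈ (finite_nodes (𝒯 := 𝒯)).toFinset, |c p - c' p| := by
  obtain ⟨T, hT, hxT⟩ := exists_mem (𝒯 := 𝒯) hx
  rw [interp_eq c hT hxT, interp_eq c' hT hxT, affineOn_apply, affineOn_apply,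
    ← Finset.sum_sub_distrib]
  have hle : ∀ i, |c (T.points i) - c' (T.points i)|
      ≤ ∑ p ∈ (finite_nodes (𝒯 := 𝒯)).toFinset, |c p - c' p| := fun i =>
    Finset.single_le_sum (f := fun p => |c p - c' p|) (fun _ _ => abs_nonneg _)
      ((finite_nodes (𝒯 := 𝒯)).mem_toFinset.2 ⟨T, hT, i, rfl⟩)
  refine (Finset.abs_sum_le_sum_abs _ _).trans ?_
  calc _ ≤ ∑ i, Tri.bary T i x * ∑ p ∈ (finite_nodes (𝒯 := 𝒯)).toFinset, |c p - c' p| := by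
        refine Finset.sum_le_sum fun i _ => ?_
        rw [← mul_sub, abs_mul, abs_of_nonneg ((Tri.mem_closedInterior T).1 hxT i)]
        exact mul_le_mul_of_nonneg_left (hle i) ((Tri.mem_closedInterior T).1 hxT i)
    _ = _ := by rw [← Finset.sum_mul, Tri.sum_bary, one_mul]

/-- Nodal convergence implies convergence of the interpolants. -/
lemma tendsto_interp (hΩ : IsLipschitzDomain Ω) {c : ℕ → Plane → ℝ} {w : Plane → ℝ}
    (hc : ∀ x ∈ closure Ω, Tendsto (fun n => c n x) atTop (𝓝 (w x))) :
    Tendsto (fun n => l2 (volume.restrict Ω) fun x => 𝒯.interp w x - 𝒯.interp (c n) x)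
      atTop (𝓝 0) ∧
    Tendsto (fun n => l2 (volume.restrict Ω) fun x => ∇ (𝒯.interp w) x - ∇ (𝒯.interp (c n)) x)
      atTop (𝓝 0) := by
  have m1 : MemLp (fun _ : Plane => (1 : ℝ)) 2 (volume.restrict Ω) :=
    memLp_of_continuous hΩ.1 continuous_const 2
  have hnode : ∀ p ∈ 𝒯.nodes, p ∈ closure Ω := by
    rintro _ ⟨T, hT, i, rfl⟩
    exact closedInterior_subset hT (Tri.points_mem T i)
  constructor
  · have hlim : Tendsto (fun n => (∑ p ∈ (finite_nodes (𝒯 := 𝒯)).toFinset, |w p - c n p|) *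
        l2 (volume.restrict Ω) fun _ : Plane => (1 : ℝ)) atTop (𝓝 0) := by
      have : Tendsto (fun n => ∑ p ∈ (finite_nodes (𝒯 := 𝒯)).toFinset, |w p - c n p|) atTop
          (𝓝 (∑ p ∈ (finite_nodes (𝒯 := 𝒯)).toFinset, |w p - w p|)) :=
        tendsto_finsetSum _ fun p hp => ((hc p (hnode p
          ((finite_nodes (𝒯 := 𝒯)).mem_toFinset.1 hp))).const_sub (w p)).abs
      simpa using this.mul_const (l2 (volume.restrict Ω) fun _ : Plane => (1 : ℝ))
    refine squeeze_zero (fun _ => l2_nonneg) (fun n => ?_) hlim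
    refine l2_le_of_ae (Finset.sum_nonneg fun _ _ => abs_nonneg _) m1 ?_
    filter_upwards [ae_restrict_mem hΩ.2.1.measurableSet] with x hx
    rw [norm_one, mul_one]
    exact abs_interp_sub_le_sum _ _ (subset_closure hx)
  · have hlim : Tendsto (fun n => (∑ T ∈ 𝒯.finite.toFinset, ‖gradOn T w - gradOn T (c n)‖) *
        l2 (volume.restrict Ω) fun _ : Plane => (1 : ℝ)) atTop (𝓝 0) := by
      have : Tendsto (fun n => ∑ T ∈ 𝒯.finite.toFinset, ‖gradOn T w - gradOn T (c n)‖) atTop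
          (𝓝 (∑ T ∈ 𝒯.finite.toFinset, ‖gradOn T w - gradOn T w‖)) := by
        refine tendsto_finsetSum _ fun T hT => (Tendsto.const_sub _ ?_).norm
        refine tendsto_finsetSum _ fun i _ => Tendsto.smul_const (hc _ (hnode _ ?_)) _
        exact ⟨T, 𝒯.finite.mem_toFinset.1 hT, i, rfl⟩
      simpa using this.mul_const (l2 (volume.restrict Ω) fun _ : Plane => (1 : ℝ))
    refine squeeze_zero (fun _ => l2_nonneg) (fun n => ?_) hlim
    refine l2_le_of_ae (Finset.sum_nonneg fun _ _ => norm_nonneg _) m1 ?_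
    filter_upwards [ae_mem_mesh (𝒯 := 𝒯) hΩ] with x hx
    obtain ⟨T, hT, hxT⟩ := mem_mesh.1 hx
    rw [norm_one, mul_one, gradient_interp _ hT hxT, gradient_interp _ hT hxT]
    exact Finset.single_le_sum (f := fun T => ‖gradOn T w - gradOn T (c n)‖)
      (fun _ _ => norm_nonneg _) (𝒯.finite.mem_toFinset.2 hT)

/-- Interpolation of `H²` functions through their continuous representatives. -/
theorem exists_interpolation (hΩ : IsLipschitzDomain Ω) {h r : ℝ} (hr : 0 < r)
    (hT : ∀ T ∈ 𝒯.elems, T.circumradius ≤ h ∧ r ≤ T.inradius) (u : H2 Ω) :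
    ∃ w : Plane → ℝ, ContinuousOn w (closure Ω) ∧
      u.toH1.trace =ᵐ[arc (frontier Ω)] w ∧
      l2 (volume.restrict Ω) (fun x => 𝒯.interp w x - u.toH1.fn x) ≤ 24 * h ^ 2 * u.norm ∧
      l2 (volume.restrict Ω) (fun x => ∇ (𝒯.interp w) x - u.toH1.grad x)
        ≤ 24 * h ^ 2 / r * u.norm := by
  obtain ⟨φ, hφ, ht, -, htl⟩ := hΩ.exists_smooth_approx u.toH1.wg u.toH1.measurable_fn
    u.toH1.measurable_grad
  replace htl := htl (fun l => (u.deriv l).grad) (fun l => (u.deriv l).measurable_grad) u.wg_deriv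
  set μ := (volume : Measure Plane).restrict Ω with hμ
  have mf : ∀ n, MemLp (φ n) 2 μ := fun n => memLp_of_continuous hΩ.1 (hφ n).continuous 2
  have mg : ∀ n, MemLp (∇ (φ n)) 2 μ := fun n =>
    memLp_of_continuous hΩ.1 (continuous_gradient (hφ n)) 2
  have mh : ∀ n l, MemLp (∇ fun y => ∇ (φ n) y l) 2 μ := fun n l =>
    memLp_of_continuous hΩ.1 (continuous_gradient (contDiff_partial (hφ n) l)) 2
  have t1 := (tendsto_l2_iff fun n => memLp_fun_sub (mf n) u.toH1.wg.fn).1 ht.1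
  have t2 := (tendsto_l2_iff fun n => memLp_fun_sub (mg n) u.toH1.wg.grad).1 ht.2
  have t3 := fun l => (tendsto_l2_iff fun n => memLp_fun_sub (mh n l) (u.deriv l).wg.grad).1
    (htl l).2
  have t4 := fun l => tendsto_l2_of_tendsto (fun n => mh n l) (u.deriv l).wg.grad (htl l).2
  obtain ⟨K, hK0, hK⟩ := abs_le_of_smooth 𝒯 hΩ
  -- The sup bound applied to differences turns convergence in `H²` into uniform convergence; its
  -- limit is the continuous representative `w`, which has nodal values.
  have hcauchy : UniformCauchySeqOn φ atTop (closure Ω) := by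
    set δ : ℕ → ℝ := fun n => l2 μ (fun x => φ n x - u.toH1.fn x)
      + l2 μ (fun x => ∇ (φ n) x - u.toH1.grad x)
      + ∑ l, l2 μ (fun x => ∇ (fun y => ∇ (φ n) y l) x - (u.deriv l).grad x) with hδ
    have hδ0 : Tendsto δ atTop (𝓝 0) := by
      have := (t1.add t2).add (tendsto_finsetSum Finset.univ fun l _ => t3 l)
      rwa [Finset.sum_const_zero, add_zero, add_zero] at this
    have hb : ∀ m n, ∀ a ∈ closure Ω, |φ m a - φ n a| ≤ K * (δ m + δ n) := by
      intro m n a ha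
      refine (hK _ ((hφ m).sub (hφ n)) a ha).trans (mul_le_mul_of_nonneg_left ?_ hK0)
      have e1 : ∇ (fun x => φ m x - φ n x) = fun x => ∇ (φ m) x - ∇ (φ n) x :=
        funext fun x => gradient_sub' (hφ m) (hφ n) x
      have e2 : ∀ l, ∇ (fun y => ∇ (fun x => φ m x - φ n x) y l)
          = fun x => ∇ (fun y => ∇ (φ m) y l) x - ∇ (fun y => ∇ (φ n) y l) x := by
        intro l
        rw [e1]
        exact funext fun x => gradient_sub' (contDiff_partial (hφ m) l) (contDiff_partial (hφ n) l) x
      have tri : ∀ {E : Type} [NormedAddCommGroup E] (F G H : Plane → E), MemLp F 2 μ → MemLp G 2 μ →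
          MemLp H 2 μ → l2 μ (fun x => F x - G x)
            ≤ l2 μ (fun x => F x - H x) + l2 μ (fun x => G x - H x) := by
        intro E _ F G H hF hG hH
        refine (l2_triangle hF hH hG).trans (le_of_eq ?_)
        rw [l2_sub_comm (F := H)]
      have i1 := tri _ _ _ (mf m) (mf n) u.toH1.wg.fn
      have i2 := tri _ _ _ (mg m) (mg n) u.toH1.wg.grad
      have i3 : ∑ l, l2 μ (∇ fun y => ∇ (fun x => φ m x - φ n x) y l)
          ≤ ∑ l, l2 μ (fun x => ∇ (fun y => ∇ (φ m) y l) x - (u.deriv l).grad x)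
            + ∑ l, l2 μ (fun x => ∇ (fun y => ∇ (φ n) y l) x - (u.deriv l).grad x) := by
        rw [← Finset.sum_add_distrib]
        refine Finset.sum_le_sum fun l _ => ?_
        rw [e2]
        exact tri _ _ _ (mh m l) (mh n l) (u.deriv l).wg.grad
      rw [e1]
      simp only [e1] at i3
      simp only [hδ]
      linarith
    rw [Metric.uniformCauchySeqOn_iff]
    intro τ hτ
    have hev : ∀ᶠ n in atTop, K * δ n < τ / 2 := by
      have := hδ0.const_mul K
      rw [mul_zero] at this
      exact this.eventually_lt_const (by linarith)
    obtain ⟨N, hN⟩ := eventually_atTop.1 hev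
    refine ⟨N, fun m hm n hn x hx => ?_⟩
    rw [Real.dist_eq]
    have := hb m n x hx
    have h1 := hN m hm
    have h2 := hN n hn
    rw [mul_add] at this
    linarith
  have hlim : ∀ x ∈ closure Ω, ∃ y, Tendsto (fun n => φ n x) atTop (𝓝 y) := fun x hx =>
    cauchySeq_tendsto_of_complete (hcauchy.cauchySeq hx)
  choose! w hw using hlim
  have hunif := hcauchy.tendstoUniformlyOn_of_tendsto hw
  obtain ⟨j1, j2⟩ := tendsto_interp (𝒯 := 𝒯) hΩ hw
  have hS : Tendsto (fun n => ∑ l, l2 μ (∇ fun y => ∇ (φ n) y l)) atTop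
      (𝓝 (∑ l, (u.deriv l).seminorm)) := tendsto_finsetSum _ fun l _ => t4 l
  -- The two second-derivative norms turn the constant `12` for smooth functions into `24`.
  have hSle : ∑ l, (u.deriv l).seminorm ≤ 2 * u.norm := by
    rw [Fin.sum_univ_two]
    linarith [u.seminorm_le_norm 0, u.seminorm_le_norm 1]
  refine ⟨w, hunif.continuousOn (Frequently.of_forall fun n => (hφ n).continuous.continuousOn),
    u.toH1.trace_eq_of_tendsto hΩ hφ ht fun x hx => hw x (frontier_subset_closure hx), ?_, ?_⟩
  · have hb : ∀ n, l2 μ (fun x => 𝒯.interp w x - u.toH1.fn x)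
        ≤ l2 μ (fun x => 𝒯.interp w x - 𝒯.interp (φ n) x)
          + (12 * h ^ 2 * ∑ l, l2 μ (∇ fun y => ∇ (φ n) y l)
          + l2 μ (fun x => φ n x - u.toH1.fn x)) := fun n =>
      (l2_triangle (wg_interp hΩ w).fn (wg_interp hΩ (φ n)).fn u.toH1.wg.fn).trans
        (add_le_add_right ((l2_triangle (wg_interp hΩ (φ n)).fn (mf n) u.toH1.wg.fn).trans
          (add_le_add_left (interp_smooth_estimate hΩ hr hT (hφ n)).1 _)) _)
    have := ge_of_tendsto' (j1.add ((hS.const_mul (12 * h ^ 2)).add t1)) hb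
    nlinarith [mul_le_mul_of_nonneg_left hSle (sq_nonneg h)]
  · have hb : ∀ n, l2 μ (fun x => ∇ (𝒯.interp w) x - u.toH1.grad x)
        ≤ l2 μ (fun x => ∇ (𝒯.interp w) x - ∇ (𝒯.interp (φ n)) x)
          + (12 * h ^ 2 / r * ∑ l, l2 μ (∇ fun y => ∇ (φ n) y l)
          + l2 μ (fun x => ∇ (φ n) x - u.toH1.grad x)) := fun n =>
      (l2_triangle (wg_interp hΩ w).grad (wg_interp hΩ (φ n)).grad u.toH1.wg.grad).trans
        (add_le_add_right ((l2_triangle (wg_interp hΩ (φ n)).grad (mg n) u.toH1.wg.grad).trans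
          (add_le_add_left (interp_smooth_estimate hΩ hr hT (hφ n)).2 _)) _)
    have := ge_of_tendsto' (j2.add ((hS.const_mul (12 * h ^ 2 / r)).add t2)) hb
    have h2 := mul_le_mul_of_nonneg_left hSle (by positivity : 0 ≤ 12 * h ^ 2 / r)
    have e : 12 * h ^ 2 / r * (2 * u.norm) = 24 * h ^ 2 / r * u.norm := by ring
    linarith

end Triangulation

/-! ### Solvability in `H¹₀` -/

lemma IsTestFun.zero : IsTestFun U (fun _ => 0) :=
  ⟨contDiff_const, HasCompactSupport.zero, by simp [tsupport]⟩

lemma IsTestFun.add {φ ψ : Plane → ℝ} (hφ : IsTestFun U φ) (hψ : IsTestFun U ψ) :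
    IsTestFun U fun x => φ x + ψ x :=
  ⟨hφ.1.add hψ.1, hφ.2.1.add hψ.2.1, (tsupport_add _ _).trans (Set.union_subset hφ.2.2 hψ.2.2)⟩

lemma IsTestFun.const_mul {φ : Plane → ℝ} (hφ : IsTestFun U φ) (c : ℝ) :
    IsTestFun U fun x => c * φ x :=
  ⟨contDiff_const.mul hφ.1, hφ.2.1.mul_left, (tsupport_mul_subset_right).trans hφ.2.2⟩

lemma IsTestFun.sub {φ ψ : Plane → ℝ} (hφ : IsTestFun U φ) (hψ : IsTestFun U ψ) :
    IsTestFun U fun x => φ x - ψ x := by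
  have := hφ.add (hψ.const_mul (-1))
  convert this using 2
  ring

lemma IsTestFun.memLp_gradient {φ : Plane → ℝ} (hφ : IsTestFun U φ) (μ : Measure Plane)
    [IsFiniteMeasureOnCompacts μ] : MemLp (∇ φ) 2 μ :=
  memLp_of_coord fun i => hφ.memLp_partial μ i

/-- The Poincaré inequality for test functions on a bounded set. -/
lemma exists_poincare (hU : Bornology.IsBounded U) (hUm : MeasurableSet U) :
    ∃ C : ℝ, 0 ≤ C ∧ ∀ φ, IsTestFun U φ →
      l2 (volume.restrict U) φ ≤ C * l2 (volume.restrict U) (∇ φ) := by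
  -- The Sobolev embedding of `W^{1,1}` into `L²` in the plane, followed by Hölder's inequality for
  -- the gradient on a set of finite measure.
  set C₁ := eLpNormLESNormFDerivOfLeConst ℝ (volume : Measure Plane) U 1 2
  set c := (volume.restrict U : Measure Plane) Set.univ ^ (1 / (1 : ℝ≥0∞).toReal - 1 / (2 : ℝ≥0∞).toReal)
    with hc
  have hcfin : c ≠ ⊤ := by
    refine ENNReal.rpow_ne_top_of_nonneg (by norm_num) ?_
    simpa using hU.measure_lt_top.ne
  refine ⟨C₁ * c.toReal, by positivity, fun φ hφ => ?_⟩
  have hsupp : φ.support ⊆ U := (subset_tsupport φ).trans hφ.2.2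
  have h1 := eLpNorm_le_eLpNorm_fderiv_of_le (volume : Measure Plane) (hφ.1.of_le (by simp)) hsupp
    (p := 1) (q := 2) le_rfl (by simp) (by simp; norm_num) hU
  have h2 : eLpNorm (fderiv ℝ φ) 1 volume = eLpNorm (∇ φ) 1 (volume.restrict U) := by
    have e : eLpNorm (fderiv ℝ φ) 1 (volume : Measure Plane) = eLpNorm (∇ φ) 1 volume :=
      eLpNorm_congr_norm_ae (ae_of_all _ fun x => (norm_gradient φ x).symm)
    rw [e, ← eLpNorm_indicator_eq_eLpNorm_restrict hUm]
    congr 1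
    rw [Set.indicator_eq_self.2]
    intro x hx
    by_contra hxU
    exact hx (hφ.gradient_eq_zero hxU)
  have h3 : eLpNorm φ 2 (volume.restrict U) ≤ C₁ * (eLpNorm (∇ φ) 2 (volume.restrict U) * c) := by
    refine (eLpNorm_mono_measure φ Measure.restrict_le_self).trans (h1.trans ?_)
    rw [ENNReal.coe_one, h2]
    gcongr
    exact eLpNorm_le_eLpNorm_mul_rpow_measure_univ (by norm_num)
      (hφ.memLp_gradient _).1
  have h4 := ENNReal.toReal_mono (ENNReal.mul_ne_top ENNReal.coe_ne_top
    (ENNReal.mul_ne_top (hφ.memLp_gradient _).2.ne hcfin)) h3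
  rw [ENNReal.toReal_mul, ENNReal.toReal_mul] at h4
  refine h4.trans_eq ?_
  simp only [ENNReal.coe_toReal, l2]
  ring

/-- Gradients of test functions, as a subspace of `L²(U)`. -/
def testGrad (U : Set Plane) : Submodule ℝ (Lp Plane 2 (volume.restrict U : Measure Plane)) where
  carrier := {g | ∃ φ, IsTestFun U φ ∧ g =ᵐ[volume.restrict U] ∇ φ}
  zero_mem' := by
    refine ⟨_, IsTestFun.zero, ?_⟩
    filter_upwards [Lp.coeFn_zero Plane 2 (volume.restrict U : Measure Plane)] with x hx
    rw [hx]
    simp [gradient]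
  add_mem' := by
    rintro g g' ⟨φ, hφ, h⟩ ⟨ψ, hψ, h'⟩
    refine ⟨_, hφ.add hψ, ?_⟩
    filter_upwards [Lp.coeFn_add g g', h, h'] with x h1 h2 h3
    rw [h1, Pi.add_apply, h2, h3, gradient_add' hφ.1 hψ.1]
  smul_mem' := by
    rintro c g ⟨φ, hφ, h⟩
    refine ⟨_, hφ.const_mul c, ?_⟩
    filter_upwards [Lp.coeFn_smul c g, h] with x h1 h2
    rw [h1, Pi.smul_apply, h2, gradient_const_mul' hφ.1]

/-- By the Poincaré inequality the functions converge together with their gradients, so a limit of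
gradients of test functions is the gradient of an element of `H¹₀`. Lax–Milgram can then be used in
the space of gradients alone. -/
lemma exists_of_mem_closure (hU : Bornology.IsBounded U) (hUm : MeasurableSet U)
    {W : Lp Plane 2 (volume.restrict U : Measure Plane)}
    (hW : W ∈ (testGrad U).topologicalClosure) :
    ∃ w : Plane → ℝ, MemLp w 2 (volume.restrict U) ∧ MemH10 U w W := by
  obtain ⟨g, hg, hgt⟩ := mem_closure_iff_seq_limit.1 hW
  choose φ hφ hgφ using hg
  have mφ : ∀ n, MemLp (φ n) 2 (volume.restrict U) := fun n => (hφ n).memLp _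
  have mg : ∀ n, MemLp (∇ (φ n)) 2 (volume.restrict U) := fun n => (hφ n).memLp_gradient _
  obtain ⟨C, hC0, hC⟩ := exists_poincare hU hUm
  have hdist : ∀ m n, dist ((mφ m).toLp (φ m)) ((mφ n).toLp (φ n)) ≤ C * dist (g m) (g n) := by
    intro m n
    have h1 := hC _ ((hφ m).sub (hφ n))
    have e1 : dist ((mφ m).toLp (φ m)) ((mφ n).toLp (φ n)) = l2 (volume.restrict U) fun x => φ m x - φ n x := by
      rw [dist_eq_norm, ← MemLp.toLp_sub, l2_toLp]
      rfl
    have e2 : dist (g m) (g n) = l2 (volume.restrict U) (∇ fun x => φ m x - φ n x) := by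
      rw [dist_eq_norm, ← l2_Lp]
      refine l2_congr ?_
      filter_upwards [Lp.coeFn_sub (g m) (g n), hgφ m, hgφ n] with x h1 h2 h3
      rw [h1, Pi.sub_apply, h2, h3, gradient_sub' (hφ m).1 (hφ n).1]
    rw [e1, e2]
    exact h1
  have hcau : CauchySeq fun n => (mφ n).toLp (φ n) := by
    rw [Metric.cauchySeq_iff]
    intro ε hε
    have hgc := Metric.cauchySeq_iff.1 hgt.cauchySeq (ε / (C + 1)) (by positivity)
    obtain ⟨N, hN⟩ := hgc
    refine ⟨N, fun m hm n hn => (hdist m n).trans_lt ?_⟩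
    have h1 := hN m hm n hn
    rw [lt_div_iff₀ (by positivity)] at h1
    nlinarith [dist_nonneg (x := g m) (y := g n)]
  obtain ⟨w, hw⟩ := cauchySeq_tendsto_of_complete hcau
  refine ⟨w, Lp.memLp w, φ, hφ, ?_, ?_⟩
  · rw [tendsto_l2_iff fun n => memLp_fun_sub (mφ n) (Lp.memLp w)]
    refine (tendsto_iff_dist_tendsto_zero.1 hw).congr fun n => ?_
    rw [dist_eq_norm, ← l2_Lp]
    refine l2_congr ?_
    filter_upwards [Lp.coeFn_sub ((mφ n).toLp (φ n)) w, (mφ n).coeFn_toLp] with x h1 h2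
    rw [h1, Pi.sub_apply, h2]
  · rw [tendsto_l2_iff fun n => memLp_fun_sub (mg n) (Lp.memLp W)]
    refine (tendsto_iff_dist_tendsto_zero.1 hgt).congr fun n => ?_
    rw [dist_eq_norm, ← l2_Lp]
    refine l2_congr ?_
    filter_upwards [Lp.coeFn_sub (g n) W, hgφ n] with x h1 h2
    rw [h1, Pi.sub_apply, h2]

lemma BddCoeff.exists_clm {K : ℝ} {B : Plane → Matrix (Fin 2) (Fin 2) ℝ} (hB : BddCoeff K B)
    (hK : 0 ≤ K) (U : Set Plane) :
    ∃ L : Lp Plane 2 (volume.restrict U : Measure Plane) →L[ℝ]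
        Lp Plane 2 (volume.restrict U : Measure Plane),
      ∀ g, L g =ᵐ[volume.restrict U] fun x => mv (B x) (g x) := by
  have m : ∀ g : Lp Plane 2 (volume.restrict U : Measure Plane),
      MemLp (fun x => mv (B x) (g x)) 2 (volume.restrict U) := fun g => hB.memLp (Lp.memLp g)
  refine ⟨LinearMap.mkContinuous
    { toFun := fun g => (m g).toLp _
      map_add' := fun g g' => ?_
      map_smul' := fun c g => ?_ } (4 * K) fun g => ?_, fun g => (m g).coeFn_toLp⟩
  · refine Lp.ext ?_
    filter_upwards [(m (g + g')).coeFn_toLp, Lp.coeFn_add ((m g).toLp _) ((m g').toLp _),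
      (m g).coeFn_toLp, (m g').coeFn_toLp, Lp.coeFn_add g g'] with x h1 h2 h3 h4 h5
    rw [h1, h2, Pi.add_apply, h3, h4, h5, Pi.add_apply, mv_add]
  · refine Lp.ext ?_
    filter_upwards [(m (c • g)).coeFn_toLp, Lp.coeFn_smul c ((m g).toLp _),
      (m g).coeFn_toLp, Lp.coeFn_smul c g] with x h1 h2 h3 h4
    rw [h1, RingHom.id_apply, h2, Pi.smul_apply, h3, h4, Pi.smul_apply, mv_smul]
  · change ‖(m g).toLp _‖ ≤ _
    rw [l2_toLp, ← l2_Lp]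
    exact hB.l2_le hK (Lp.memLp g)

lemma inner_Lp_eq {μ : Measure Plane} {f g : Lp Plane 2 μ} {F G : Plane → Plane}
    (hf : f =ᵐ[μ] F) (hg : g =ᵐ[μ] G) : inner ℝ f g = ∫ x, inner ℝ (F x) (G x) ∂μ := by
  rw [MeasureTheory.L2.inner_def]
  refine integral_congr_ae ?_
  filter_upwards [hf, hg] with x h1 h2
  rw [h1, h2]

/-- The Lax–Milgram lemma on a closed subspace. -/
lemma exists_galerkin {X : Type*} [NormedAddCommGroup X] [InnerProductSpace ℝ X] [CompleteSpace X]
    {S : Submodule ℝ X} (hS : IsClosed (S : Set X)) (L : X →L[ℝ] X) {κ : ℝ} (hκ : 0 < κ)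
    (hL : ∀ g ∈ S, κ * ‖g‖ ^ 2 ≤ inner ℝ (L g) g) (F : X) :
    ∃ W ∈ S, ∀ k ∈ S, inner ℝ (L W) k = -inner ℝ (L F) k := by
  have : CompleteSpace S := hS.completeSpace_coe
  set b : S →L[ℝ] S →L[ℝ] ℝ := (innerSL ℝ).bilinearComp (L ∘L S.subtypeL) S.subtypeL with hb
  have hbapp : ∀ g k : S, b g k = inner ℝ (L g) (k : X) := fun g k => rfl
  have hco : IsCoercive b := by
    refine ⟨κ, hκ, fun g => ?_⟩
    rw [hbapp, mul_assoc, ← sq]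
    exact hL g g.2
  set ℓ : S →L[ℝ] ℝ := -((innerSL ℝ (L F)) ∘L S.subtypeL) with hℓ
  refine ⟨hco.continuousLinearEquivOfBilin.symm ((InnerProductSpace.toDual ℝ S).symm ℓ),
    Submodule.coe_mem _, fun k hk => ?_⟩
  rw [← hbapp _ ⟨k, hk⟩, ← hco.continuousLinearEquivOfBilin_apply,
    ContinuousLinearEquiv.apply_symm_apply, InnerProductSpace.toDual_symm_apply]
  rfl

/-- Solvability of the Dirichlet problem with right hand side `div (B F)`. -/
theorem exists_dirichlet_solution (hU : Bornology.IsBounded U) (hUm : MeasurableSet U)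
    {K κ : ℝ} {B : Plane → Matrix (Fin 2) (Fin 2) ℝ} (hB : BddCoeff K B) (hK : 0 ≤ K) (hκ : 0 < κ)
    (hell : ∀ᵐ y, ∀ ξ : Plane, κ * ‖ξ‖ ^ 2 ≤ inner ℝ (mv (B y) ξ) ξ) {F : Plane → Plane}
    (hF : MemLp F 2 (volume.restrict U)) :
    ∃ w W, MemH10 U w W ∧ MemLp w 2 (volume.restrict U) ∧ MemLp W 2 (volume.restrict U) ∧
      ∀ φ, IsTestFun U φ → ∫ x in U, inner ℝ (mv (B x) (F x + W x)) (∇ φ x) = 0 := by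
  obtain ⟨L, hL⟩ := hB.exists_clm hK U
  obtain ⟨W, hWS, hsol⟩ := exists_galerkin (S := (testGrad U).topologicalClosure)
    (Submodule.isClosed_topologicalClosure _) L hκ (fun g _ => by
      rw [inner_Lp_eq (hL g) (ae_eq_refl _), ← l2_Lp, l2_sq (Lp.memLp g).1, ← integral_const_mul]
      refine integral_mono_ae (((Lp.memLp g).integrable_norm_pow (by norm_num)).const_mul κ)
        (integrable_inner (hB.memLp (Lp.memLp g)) (Lp.memLp g)) ?_
      filter_upwards [ae_restrict_of_ae hell] with x hx using hx _) (hF.toLp F)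
  obtain ⟨w, mw, hwW⟩ := exists_of_mem_closure hU hUm hWS
  refine ⟨w, W, hwW, mw, Lp.memLp _, fun φ hφ => ?_⟩
  have mφ : MemLp (∇ φ) 2 (volume.restrict U) := hφ.memLp_gradient _
  have h := hsol (mφ.toLp (∇ φ))
    ((testGrad U).le_topologicalClosure ⟨φ, hφ, mφ.coeFn_toLp⟩)
  have hLF : L (hF.toLp F) =ᵐ[volume.restrict U] fun x => mv (B x) (F x) := by
    filter_upwards [hL (hF.toLp F), hF.coeFn_toLp] with x h1 h2
    rw [h1, h2]
  rw [inner_Lp_eq (hL _) mφ.coeFn_toLp, inner_Lp_eq hLF mφ.coeFn_toLp] at h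
  simp only [mv_add, inner_add_left]
  rw [integral_add (integrable_inner (hB.memLp hF) mφ)
    (integrable_inner (hB.memLp (Lp.memLp _)) mφ), h, add_neg_cancel]

lemma MemH10.congr {u v : Plane → ℝ} {F G : Plane → Plane} (h : MemH10 U u F)
    (hu : u =ᵐ[volume.restrict U] v) (hF : F =ᵐ[volume.restrict U] G) : MemH10 U v G := by
  obtain ⟨φ, hφ, h1, h2⟩ := h
  refine ⟨φ, hφ, h1.congr fun n => eLpNorm_congr_ae ?_, h2.congr fun n => eLpNorm_congr_ae ?_⟩
  · filter_upwards [hu] with x hx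
    rw [hx]
  · filter_upwards [hF] with x hx
    rw [hx]

lemma MemH10.const_mul {u : Plane → ℝ} {F : Plane → Plane} (h : MemH10 U u F) (c : ℝ) :
    MemH10 U (fun x => c * u x) (fun x => c • F x) := by
  obtain ⟨φ, hφ, h1, h2⟩ := h
  refine ⟨fun n x => c * φ n x, fun n => (hφ n).const_mul c, ?_, ?_⟩
  · have e : ∀ n, eLpNorm (fun x => c * φ n x - c * u x) 2 (volume.restrict U)
        = ‖c‖ₑ * eLpNorm (fun x => φ n x - u x) 2 (volume.restrict U) := by
      intro n
      rw [← eLpNorm_const_smul]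
      congr 1
      funext x
      simp [mul_sub]
    simp only [e]
    have := ENNReal.Tendsto.const_mul (a := ‖c‖ₑ) h1 (Or.inr enorm_ne_top)
    rwa [mul_zero] at this
  · have e : ∀ n, eLpNorm (fun x => ∇ (fun y => c * φ n y) x - c • F x) 2 (volume.restrict U)
        = ‖c‖ₑ * eLpNorm (fun x => ∇ (φ n) x - F x) 2 (volume.restrict U) := by
      intro n
      rw [← eLpNorm_const_smul]
      congr 1
      funext x
      rw [gradient_const_mul' (hφ n).1]
      simp [smul_sub]
    simp only [e]
    have := ENNReal.Tendsto.const_mul (a := ‖c‖ₑ) h2 (Or.inr enorm_ne_top)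
    rwa [mul_zero] at this

lemma IsTestFun.mono {V : Set Plane} (h : U ⊆ V) {φ : Plane → ℝ} (hφ : IsTestFun U φ) :
    IsTestFun V φ := ⟨hφ.1, hφ.2.1, hφ.2.2.trans h⟩

namespace Triangulation

variable {𝒯 : Triangulation Ω}

/-! ### The multiscale space -/

lemma interp_add_mul (c d : Plane → ℝ) (a : ℝ) (x : Plane) :
    𝒯.interp (fun y => c y + a * d y) x = 𝒯.interp c x + a * 𝒯.interp d x := by
  by_cases hx : x ∈ closure Ω
  · obtain ⟨T, hT, hxT⟩ := exists_mem (𝒯 := 𝒯) hx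
    simp only [interp_eq _ hT hxT, affineOn_apply, Finset.mul_sum, ← Finset.sum_add_distrib]
    exact Finset.sum_congr rfl fun i _ => by ring
  · simp [interp_of_notMem, hx]

lemma gradient_interp_add_mul (c d : Plane → ℝ) (a : ℝ) {x : Plane} (hx : x ∈ 𝒯.mesh) :
    ∇ (𝒯.interp fun y => c y + a * d y) x = ∇ (𝒯.interp c) x + a • ∇ (𝒯.interp d) x := by
  obtain ⟨T, hT, hxT⟩ := mem_mesh.1 hx
  simp only [gradient_interp _ hT hxT, gradOn, Finset.smul_sum, ← Finset.sum_add_distrib]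
  exact Finset.sum_congr rfl fun i _ => by rw [add_smul, mul_smul]

lemma interp_congr {c d : Plane → ℝ} (h : ∀ p ∈ 𝒯.nodes, c p = d p) : 𝒯.interp c = 𝒯.interp d := by
  funext x
  by_cases hx : x ∈ closure Ω
  · obtain ⟨T, hT, hxT⟩ := exists_mem (𝒯 := 𝒯) hx
    simp only [interp_eq _ hT hxT, affineOn_apply]
    exact Finset.sum_congr rfl fun i _ => by rw [h _ ⟨T, hT, i, rfl⟩]
  · simp [interp_of_notMem, hx]

/-- `v` is the multiscale function with nodal values `c`. -/
structure IsMs (𝒯 : Triangulation Ω) (B : Plane → Matrix (Fin 2) (Fin 2) ℝ) (c : Plane → ℝ)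
    (v : H1 Ω) : Prop where
  mem : v ∈ 𝒯.msSpace B
  memH10 : MemH10 𝒯.mesh (fun x => v.fn x - 𝒯.interp c x) (fun x => v.grad x - ∇ (𝒯.interp c) x)
  weak : ∀ φ, IsTestFun 𝒯.mesh φ → ∫ x in 𝒯.mesh, inner ℝ (mv (B x) (v.grad x)) (∇ φ x) = 0

/-- Test functions on the mesh may be cut at the edges without losing smoothness, so a statement on
the mesh localizes to each triangle. -/
lemma memH10_interior {T : Tri} (hT : T ∈ 𝒯.elems) {u : Plane → ℝ} {G : Plane → Plane}
    (h : MemH10 𝒯.mesh u G) : MemH10 T.interior u G := by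
  obtain ⟨φ, hφ, h1, h2⟩ := h
  have hTo := Tri.isOpen_interior T
  have hle : (volume : Measure Plane).restrict T.interior ≤ volume.restrict 𝒯.mesh :=
    Measure.restrict_mono (interior_subset_mesh hT) le_rfl
  refine ⟨fun n => T.interior.indicator (φ n), fun n => isTestFun_indicator hT (hφ n), ?_, ?_⟩
  · refine tendsto_of_tendsto_of_tendsto_of_le_of_le tendsto_const_nhds h1 (fun _ => zero_le)
      fun n => ?_
    refine (le_of_eq (eLpNorm_congr_ae ?_)).trans (eLpNorm_mono_measure _ hle)
    filter_upwards [ae_restrict_mem hTo.measurableSet] with x hx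
    rw [Set.indicator_of_mem hx]
  · refine tendsto_of_tendsto_of_tendsto_of_le_of_le tendsto_const_nhds h2 (fun _ => zero_le)
      fun n => ?_
    refine (le_of_eq (eLpNorm_congr_ae ?_)).trans (eLpNorm_mono_measure _ hle)
    filter_upwards [ae_restrict_mem hTo.measurableSet] with x hx
    rw [gradient_congr_of_eqOn hTo (Set.eqOn_indicator) hx]

variable {K κ : ℝ} {B : Plane → Matrix (Fin 2) (Fin 2) ℝ}

-- The hat function is corrected by the solution of one Dirichlet problem on the whole mesh. As the
-- mesh is a disjoint union of open triangles, the problem decouples and the result is a multiscale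
-- basis function.
open Classical in
lemma exists_isMs_node (hΩ : IsLipschitzDomain Ω) (hB : BddCoeff K B) (hK : 0 ≤ K) (hκ : 0 < κ)
    (hell : ∀ᵐ y, ∀ ξ : Plane, κ * ‖ξ‖ ^ 2 ≤ inner ℝ (mv (B y) ξ) ξ) {p : Plane}
    (hp : p ∈ 𝒯.nodes) : ∃ v, 𝒯.IsMs B (fun y => if y = p then 1 else 0) v := by
  set δ : Plane → ℝ := fun y => if y = p then 1 else 0 with hδ
  have hI := wg_interp (𝒯 := 𝒯) hΩ δ
  have hb := isBounded_mesh (𝒯 := 𝒯) hΩ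
  have hgm : MemLp (∇ (𝒯.interp δ)) 2 (volume.restrict 𝒯.mesh) := by
    rw [restrict_mesh hΩ]
    exact hI.grad
  obtain ⟨w, W, hwW, mw, mW, hsol⟩ := exists_dirichlet_solution hb 𝒯.isOpen_mesh.measurableSet
    hB hK hκ hell hgm
  have hwΩ : MemH10 Ω w W := by
    obtain ⟨φ, hφ, h1, h2⟩ := hwW
    rw [restrict_mesh hΩ] at h1 h2
    exact ⟨φ, fun n => (hφ n).mono (mesh_subset hΩ), h1, h2⟩
  rw [restrict_mesh hΩ] at mw mW
  have hwg : WG Ω w W := hwΩ.wg hΩ.1 mw mW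
  set v : H1 Ω := (hI.add hwg).toH1 with hv
  have e1 : v.fn =ᵐ[volume.restrict Ω] fun x => 𝒯.interp δ x + w x := WG.fn_toH1 _
  have e2 : v.grad =ᵐ[volume.restrict Ω] fun x => ∇ (𝒯.interp δ) x + W x := WG.grad_toH1 _
  have h10 : MemH10 𝒯.mesh (fun x => v.fn x - 𝒯.interp δ x)
      (fun x => v.grad x - ∇ (𝒯.interp δ) x) := by
    refine hwW.congr ?_ ?_ <;> rw [restrict_mesh hΩ]
    · filter_upwards [e1] with x hx
      rw [hx, add_sub_cancel_left]
    · filter_upwards [e2] with x hx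
      rw [hx, add_sub_cancel_left]
  have hweak : ∀ φ, IsTestFun 𝒯.mesh φ →
      ∫ x in 𝒯.mesh, inner ℝ (mv (B x) (v.grad x)) (∇ φ x) = 0 := by
    intro φ hφ
    rw [← hsol φ hφ, restrict_mesh hΩ]
    refine integral_congr_ae ?_
    filter_upwards [e2] with x hx
    rw [hx]
  refine ⟨v, ?_, h10, hweak⟩
  refine Submodule.subset_span ⟨p, hp, 𝒯.interp δ, ⟨isLagrange_interp δ, ?_, ?_⟩, ?_⟩
  · rw [interp_node δ hp]
    simp [hδ]
  · intro q hq hqp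
    rw [interp_node δ hq]
    simp [hδ, hqp]
  · intro T hT
    refine ⟨memH10_interior hT h10, fun φ hφ => ?_⟩
    rw [form_eq, ← hweak φ (hφ.mono (interior_subset_mesh hT))]
    refine (setIntegral_eq_of_subset_of_forall_sdiff_eq_zero 𝒯.isOpen_mesh.measurableSet
      (interior_subset_mesh hT) fun x hx => ?_).symm
    rw [hφ.gradient_eq_zero hx.2, inner_zero_right]

lemma IsMs.add_smul (hΩ : IsLipschitzDomain Ω) (hB : BddCoeff K B) {c d : Plane → ℝ} {v v' : H1 Ω}
    (hv : 𝒯.IsMs B c v) (hv' : 𝒯.IsMs B d v') (a : ℝ) :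
    𝒯.IsMs B (fun y => c y + a * d y) (v + a • v') := by
  have e1 : (v + a • v').fn =ᵐ[volume.restrict Ω] fun x => v.fn x + a * v'.fn x := by
    filter_upwards [H1.fn_add v (a • v'), H1.fn_smul a v'] with x h1 h2
    rw [h1, h2]
  have e2 : (v + a • v').grad =ᵐ[volume.restrict Ω] fun x => v.grad x + a • v'.grad x := by
    filter_upwards [H1.grad_add v (a • v'), H1.grad_smul a v'] with x h1 h2
    rw [h1, h2]
  have hr := restrict_mesh (𝒯 := 𝒯) hΩ
  have m1 : ∀ (v : H1 Ω) (c : Plane → ℝ),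
      MemLp (fun x => v.fn x - 𝒯.interp c x) 2 (volume.restrict 𝒯.mesh) := fun v c => by
    rw [hr]
    exact memLp_fun_sub v.wg.fn (wg_interp hΩ c).fn
  have m2 : ∀ (v : H1 Ω) (c : Plane → ℝ),
      MemLp (fun x => v.grad x - ∇ (𝒯.interp c) x) 2 (volume.restrict 𝒯.mesh) := fun v c => by
    rw [hr]
    exact memLp_fun_sub v.wg.grad (wg_interp hΩ c).grad
  refine ⟨Submodule.add_mem _ hv.mem (Submodule.smul_mem _ a hv'.mem), ?_, fun φ hφ => ?_⟩
  · refine (hv.memH10.add (isBounded_mesh hΩ) (hv'.memH10.const_mul a) (m1 _ _)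
      ((m1 v' d).const_mul a) (m2 _ _) ((m2 v' d).const_smul a)).congr ?_ ?_
    · rw [hr]
      filter_upwards [e1] with x hx
      rw [hx, interp_add_mul]
      ring
    · rw [hr]
      filter_upwards [e2, ae_mem_mesh (𝒯 := 𝒯) hΩ] with x hx hxm
      rw [hx, gradient_interp_add_mul _ _ _ hxm]
      module
  · have h1 := hv.weak φ hφ
    have h2 := hv'.weak φ hφ
    rw [hr] at h1 h2 ⊢
    have mφ := hφ.memLp_gradient (volume.restrict Ω)
    have : ∫ x in Ω, inner ℝ (mv (B x) ((v + a • v').grad x)) (∇ φ x)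
        = ∫ x in Ω, (inner ℝ (mv (B x) (v.grad x)) (∇ φ x)
          + a * inner ℝ (mv (B x) (v'.grad x)) (∇ φ x)) := by
      refine integral_congr_ae ?_
      filter_upwards [e2] with x hx
      rw [hx, mv_add, mv_smul, inner_add_left, real_inner_smul_left]
    rw [this, integral_add (integrable_inner (hB.memLp v.wg.grad) mφ)
      ((integrable_inner (hB.memLp v'.wg.grad) mφ).const_mul a), integral_const_mul, h1, h2]
    simp

/-- For all nodal values there is a function in the multiscale space. -/
theorem exists_isMs (hΩ : IsLipschitzDomain Ω) (hB : BddCoeff K B) (hK : 0 ≤ K) (hκ : 0 < κ)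
    (hell : ∀ᵐ y, ∀ ξ : Plane, κ * ‖ξ‖ ^ 2 ≤ inner ℝ (mv (B y) ξ) ξ) (c : Plane → ℝ) :
    ∃ v, 𝒯.IsMs B c v := by
  classical
  -- Nodal values are switched on one node at a time; linearity adds a multiple of the corresponding
  -- basis function.
  have key : ∀ s : Finset Plane, (∀ p ∈ s, p ∈ 𝒯.nodes) →
      ∃ v, 𝒯.IsMs B (fun y => if y ∈ s then c y else 0) v := by
    intro s
    induction s using Finset.induction_on with
    | empty =>
      intro _
      have hz : 𝒯.interp (fun _ => 0) = fun _ => 0 := by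
        funext x
        by_cases hx : x ∈ closure Ω
        · obtain ⟨T, hT, hxT⟩ := exists_mem (𝒯 := 𝒯) hx
          simp [interp_eq _ hT hxT, affineOn_apply]
        · simp [interp_of_notMem, hx]
      have hr := restrict_mesh (𝒯 := 𝒯) hΩ
      have z1 : (0 : H1 Ω).fn =ᵐ[volume.restrict Ω] fun _ => 0 := Lp.coeFn_zero _ _ _
      have z2 : (0 : H1 Ω).grad =ᵐ[volume.restrict Ω] fun _ => 0 := Lp.coeFn_zero _ _ _
      have hg0 : ∇ (fun _ : Plane => (0 : ℝ)) = fun _ => 0 := by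
        funext x
        simp [gradient]
      refine ⟨0, Submodule.zero_mem _, ?_, fun φ hφ => ?_⟩
      · simp only [Finset.notMem_empty, if_false, hz, hg0]
        refine ⟨fun _ _ => 0, fun _ => IsTestFun.zero, ?_, ?_⟩
        · rw [hr]
          refine tendsto_const_nhds.congr fun n => ?_
          rw [eLpNorm_congr_ae (g := 0), eLpNorm_zero]
          filter_upwards [z1] with x hx
          simp [hx]
        · rw [hr]
          refine tendsto_const_nhds.congr fun n => ?_
          rw [eLpNorm_congr_ae (g := 0), eLpNorm_zero]
          filter_upwards [z2] with x hx
          simp [hx, hg0]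
      · rw [hr]
        refine integral_eq_zero_of_ae ?_
        filter_upwards [z2] with x hx
        rw [hx, ← zero_smul ℝ (0 : Plane), mv_smul, zero_smul, inner_zero_left]
        rfl
    | insert p s hps ih =>
      intro hs
      obtain ⟨v, hv⟩ := ih fun q hq => hs q (Finset.mem_insert_of_mem hq)
      obtain ⟨v', hv'⟩ := exists_isMs_node hΩ hB hK hκ hell (hs p (Finset.mem_insert_self p s))
      refine ⟨v + c p • v', ?_⟩
      convert hv.add_smul hΩ hB hv' (c p) using 2 with y
      by_cases hy : y = p
      · subst hy
        simp [hps]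
      · simp [hy]
  obtain ⟨v, hv⟩ := key (finite_nodes (𝒯 := 𝒯)).toFinset fun p hp =>
    (finite_nodes (𝒯 := 𝒯)).mem_toFinset.1 hp
  have e : 𝒯.interp (fun y => if y ∈ (finite_nodes (𝒯 := 𝒯)).toFinset then c y else 0)
      = 𝒯.interp c := interp_congr fun p hp => by simp [hp]
  refine ⟨v, hv.mem, ?_, hv.weak⟩
  have := hv.memH10
  rwa [e] at this

/-- Multiscale functions have the traces of their piecewise affine interpolants. -/
lemma IsMs.trace_eq (hΩ : IsLipschitzDomain Ω) {c : Plane → ℝ} {v : H1 Ω} (hv : 𝒯.IsMs B c v) :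
    v.trace =ᵐ[arc (frontier Ω)] 𝒯.interp c := by
  have hI := wg_interp (𝒯 := 𝒯) hΩ c
  set I : H1 Ω := hI.toH1 with hIdef
  have e1 : I.fn =ᵐ[volume.restrict Ω] 𝒯.interp c := hI.fn_toH1
  have e2 : I.grad =ᵐ[volume.restrict Ω] ∇ (𝒯.interp c) := hI.grad_toH1
  have h10 : MemH10 Ω (v - I).fn (v - I).grad := by
    obtain ⟨φ, hφ, h1, h2⟩ := hv.memH10
    rw [restrict_mesh hΩ] at h1 h2
    have : MemH10 Ω (fun x => v.fn x - 𝒯.interp c x) (fun x => v.grad x - ∇ (𝒯.interp c) x) :=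
      ⟨φ, fun n => (hφ n).mono (mesh_subset hΩ), h1, h2⟩
    refine this.congr ?_ ?_
    · filter_upwards [H1.fn_sub v I, e1] with x h1 h2
      rw [h1, h2]
    · filter_upwards [H1.grad_sub v I, e2] with x h1 h2
      rw [h1, h2]
  filter_upwards [H1.trace_of_memH10 hΩ _ h10, H1.trace_sub hΩ v I,
    H1.trace_of_continuousOn hΩ I (measurable_interp c) (continuousOn_interp c) e1] with x h1 h2 h3
  rw [h1, Pi.zero_apply, h3] at h2
  linarith

end Triangulation

/-! ### Error estimates -/

/-- An oscillating coefficient `B`, its homogenized matrix and rescaled correctors. -/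
structure Medium (κ K ε : ℝ) (B : Plane → Matrix (Fin 2) (Fin 2) ℝ) (Â : Matrix (Fin 2) (Fin 2) ℝ)
    (G : Fin 2 → Plane → Plane) (P s : ℕ → Fin 2 → Plane → ℝ) : Prop where
  κ_pos : 0 < κ
  K_nonneg : 0 ≤ K
  ε_pos : 0 < ε
  bdd : BddCoeff K B
  bdd_hom : BddCoeff K fun _ => Â
  ell : ∀ᵐ y, ∀ ξ : Plane, κ * ‖ξ‖ ^ 2 ≤ inner ℝ (mv (B y) ξ) ξ
  approx : CorrectorApprox B Â K ε G P s

lemma BddCoeff.mono {K K' : ℝ} {B : Plane → Matrix (Fin 2) (Fin 2) ℝ} (hB : BddCoeff K B)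
    (h : K ≤ K') : BddCoeff K' B :=
  ⟨hB.meas, hB.bdd.mono fun _ hy i j => (hy i j).trans h⟩

/-- The absolute value of `κ₂` makes the constant nonnegative before any coefficient is given. Once
a coefficient exists, its bounded entries force `κ₂ ≥ 0`. -/
lemma exists_medium {κ₁ κ₂ ε : ℝ} {A : Plane → Matrix (Fin 2) (Fin 2) ℝ} {N : Fin 2 → H1 cell}
    {M : ℝ≥0} (hA : IsCoeff κ₁ κ₂ A) (hκ : 0 < κ₁) (hN : ∀ l, IsCorrector A l (N l))
    (h : ∀ l, w1infNorm (N l) ≤ M) (hε : 0 < ε) :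
    ∃ G P s, Medium κ₁ (2 * M + 8 * (|κ₂| * (M + 1))) ε (scaled A ε) (homogenized A N) G P s := by
  obtain ⟨G, P, s, hG⟩ := exists_correctorApprox hA hκ.le hN h
  obtain ⟨y, hy⟩ := (hA.abs_le hκ.le).exists
  have hκ₂ : 0 ≤ κ₂ := (abs_nonneg _).trans (hy 0 0)
  rw [abs_of_nonneg hκ₂]
  have hM : (0 : ℝ) ≤ M := M.2
  have h1 : κ₂ ≤ κ₂ * (M + 1) := le_mul_of_one_le_right hκ₂ (by linarith)
  refine ⟨_, _, _, hκ, by positivity, hε, (hA.bddCoeff_scaled hκ.le hε).mono (by linarith),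
    ⟨fun i j => aemeasurable_const, ae_of_all _ fun _ i j => ?_⟩, hA.elliptic_scaled hε,
    hG.scale hε⟩
  have := abs_homogenized_le hA hκ.le h i j
  linarith

lemma exists_isCutoff (hU : IsOpen U) (hb : Bornology.IsBounded U) {ε : ℝ} (hε : 0 < ε) :
    ∃ η, IsCutoff U (layer U ε) 4 ε η := by
  obtain ⟨η, h1, h2, h3, h4⟩ := exists_cutoff hU hb hε
  exact ⟨η, h1, fun x => (h2 x).1, fun x => (h2 x).2, h3, fun x hx hxl => (h4 x hx hxl).1,
    fun x hx hxl => (h4 x hx hxl).2⟩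

/-- With smooth `φ n` tending to `q` in `H¹(Ω)`, the products `χ φ n` are test functions and
converge to `χ q`. -/
lemma memH10_mul_of_wg (hΩ : IsLipschitzDomain Ω) {q : Plane → ℝ} {D : Plane → Plane}
    (h : WG Ω q D) (hq : Measurable q) (hD : Measurable D) {χ : Plane → ℝ} (hχ : IsTestFun Ω χ) :
    MemH10 Ω (fun x => χ x * q x) (fun x => q x • ∇ χ x + χ x • D x) := by
  obtain ⟨φ, hφ, ⟨h1, h2⟩, -⟩ := hΩ.exists_smooth_approx h hq hD
  have mφ : ∀ n, MemLp (φ n) 2 (volume.restrict Ω) := fun n =>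
    memLp_of_continuous hΩ.1 (hφ n).continuous 2
  have mg : ∀ n, MemLp (∇ (φ n)) 2 (volume.restrict Ω) := fun n =>
    memLp_of_continuous hΩ.1 (continuous_gradient (hφ n)) 2
  obtain ⟨a, ha0, ha⟩ := exists_bound_on (U := Ω) hΩ.1 hχ.1.continuous
  obtain ⟨b, hb0, hb⟩ := exists_bound_on (U := Ω) hΩ.1 (continuous_gradient hχ.1)
  have hmem := ae_restrict_mem (μ := (volume : Measure Plane)) hΩ.2.1.measurableSet
  have t1 := (tendsto_l2_iff fun n => memLp_fun_sub (mφ n) h.fn).1 h1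
  have t2 := (tendsto_l2_iff fun n => memLp_fun_sub (mg n) h.grad).1 h2
  have n1 : ∀ n, MemLp (fun x => χ x • (φ n x - q x)) 2 (volume.restrict Ω) := fun n =>
    memLp_mul_of_bound hχ.1.continuous.aestronglyMeasurable (K := a)
      (hmem.mono fun x hx => ha x hx) (memLp_fun_sub (mφ n) h.fn)
  have n2 : ∀ n, MemLp (fun x => χ x • (∇ (φ n) x - D x)) 2 (volume.restrict Ω) := fun n =>
    memLp_mul_of_bound hχ.1.continuous.aestronglyMeasurable (K := a)
      (hmem.mono fun x hx => ha x hx) (memLp_fun_sub (mg n) h.grad)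
  have n3 : ∀ n, MemLp (fun x => (φ n x - q x) • ∇ χ x) 2 (volume.restrict Ω) := fun n =>
    memLp_mul_of_bound' (K := b) (memLp_fun_sub (mφ n) h.fn)
      (continuous_gradient hχ.1).aestronglyMeasurable (hmem.mono fun x hx => hb x hx)
  refine ⟨fun n x => χ x * φ n x, fun n => ⟨hχ.1.mul (hφ n), hχ.2.1.mul_right,
    tsupport_mul_subset_left.trans hχ.2.2⟩, ?_, ?_⟩
  · have e : ∀ n, (fun x => χ x * φ n x - χ x * q x) = fun x => χ x • (φ n x - q x) := fun n => by
      funext x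
      rw [smul_eq_mul, mul_sub]
    simp only [e]
    rw [tendsto_l2_iff n1]
    refine squeeze_zero (fun _ => l2_nonneg) (fun n => l2_le_of_ae ha0
      (memLp_fun_sub (mφ n) h.fn) (hmem.mono fun x hx => ?_)) (by simpa using t1.const_mul a)
    rw [norm_smul]
    exact mul_le_mul_of_nonneg_right (ha x hx) (norm_nonneg _)
  · have e : ∀ n, (fun x => ∇ (fun y => χ y * φ n y) x - (q x • ∇ χ x + χ x • D x))
        = fun x => χ x • (∇ (φ n) x - D x) + (φ n x - q x) • ∇ χ x := fun n => by
      funext x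
      rw [gradient_mul hχ.1 (hφ n)]
      module
    simp only [e]
    rw [tendsto_l2_iff fun n => memLp_fun_add (n2 n) (n3 n)]
    refine squeeze_zero (fun _ => l2_nonneg) (fun n => (l2_add_le (n2 n) (n3 n)).trans
      (add_le_add (l2_le_of_ae ha0 (memLp_fun_sub (mg n) h.grad) (hmem.mono fun x hx => ?_))
      (l2_le_of_ae hb0 (memLp_fun_sub (mφ n) h.fn) (hmem.mono fun x hx => ?_))))
      (by simpa using (t2.const_mul a).add (t1.const_mul b))
    · rw [norm_smul]
      exact mul_le_mul_of_nonneg_right (ha x hx) (norm_nonneg _)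
    · rw [norm_smul, mul_comm]
      exact mul_le_mul_of_nonneg_right (hb x hx) (norm_nonneg _)

section Estimates

variable {κ K ε : ℝ} {B : Plane → Matrix (Fin 2) (Fin 2) ℝ} {Â : Matrix (Fin 2) (Fin 2) ℝ}
  {G : Fin 2 → Plane → Plane} {P s : ℕ → Fin 2 → Plane → ℝ}

/-- The difference of the fluxes of `u` and `u₀`, tested with functions having the boundary values
of `u - u₀`, equals `-b`. -/
def FluxIdentity (B : Plane → Matrix (Fin 2) (Fin 2) ℝ) (Â : Matrix (Fin 2) (Fin 2) ℝ)
    (u u₀ : H1 Ω) (b : ℝ) : Prop :=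
  ∀ v : H1 Ω, MemH10 Ω (v - (u - u₀)).fn (v - (u - u₀)).grad →
    form B Ω u.grad v.grad - form (fun _ => Â) Ω u₀.grad v.grad = -b

/-- The function `u - u₀ - z` differs from `u - u₀` by an element of `H¹₀`, hence is admissible.
This brings the identity into the form required by `two_scale_estimate`. -/
lemma FluxIdentity.apply (hΩ : IsLipschitzDomain Ω) {u u₀ : H1 Ω} {b : ℝ}
    (h : FluxIdentity B Â u u₀ b) (hB : BddCoeff K B) (hÂ : BddCoeff K fun _ => Â)
    {z : Plane → ℝ} {Z : Plane → Plane} (hz : MemH10 Ω z Z) (mz : MemLp z 2 (volume.restrict Ω))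
    (mZ : MemLp Z 2 (volume.restrict Ω)) :
    (∃ v, WG Ω v fun x => u.grad x - (u₀.grad x + Z x)) ∧
      ∫ x in Ω, inner ℝ (mv (B x) (u.grad x) - mv Â (u₀.grad x))
        (u.grad x - (u₀.grad x + Z x)) = -b := by
  set ζ : H1 Ω := (hz.wg hΩ.1 mz mZ).toH1 with hζ
  have f1 : ζ.fn =ᵐ[volume.restrict Ω] z := WG.fn_toH1 _
  have f2 : ζ.grad =ᵐ[volume.restrict Ω] Z := WG.grad_toH1 _
  set v : H1 Ω := u - u₀ - ζ with hv
  have e : v - (u - u₀) = (-1 : ℝ) • ζ := by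
    rw [hv, neg_one_smul]
    abel
  have g1 : v.grad =ᵐ[volume.restrict Ω] fun x => u.grad x - (u₀.grad x + Z x) := by
    filter_upwards [H1.grad_sub (u - u₀) ζ, H1.grad_sub u u₀, f2] with x h1 h2 h3
    rw [h1, h2, h3, sub_sub]
  refine ⟨⟨v.fn, v.wg.congr (ae_eq_refl _) g1⟩, ?_⟩
  have h10 : MemH10 Ω (v - (u - u₀)).fn (v - (u - u₀)).grad := by
    rw [e]
    refine (hz.const_mul (-1)).congr ?_ ?_
    · filter_upwards [H1.fn_smul (-1) ζ, f1] with x h1 h2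
      rw [h1, h2]
    · filter_upwards [H1.grad_smul (-1) ζ, f2] with x h1 h2
      rw [h1, h2]
  rw [← h v h10, form_eq, form_eq, ← integral_sub
    (integrable_inner (hB.memLp u.wg.grad) v.wg.grad)
    (integrable_inner (hÂ.memLp u₀.wg.grad) v.wg.grad)]
  refine integral_congr_ae ?_
  filter_upwards [g1] with x hx
  rw [hx, inner_sub_left]

/-- The first order expansion of an oscillating solution. -/
theorem IsLipschitzDomain.homogenization_estimate (hΩ : IsLipschitzDomain Ω) :
    ∃ C : ℝ, 0 ≤ C ∧ ∀ (κ K ε : ℝ) (B : Plane → Matrix (Fin 2) (Fin 2) ℝ)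
      (Â : Matrix (Fin 2) (Fin 2) ℝ) (G : Fin 2 → Plane → Plane) (P s : ℕ → Fin 2 → Plane → ℝ),
      Medium κ K ε B Â G P s → ε ≤ 1 → ∀ (u : H1 Ω) (u₀ : H2 Ω) (b : ℝ), 0 ≤ b →
      FluxIdentity B Â u u₀.toH1 b →
      l2 (volume.restrict Ω) (fun x => u.grad x -
        (u₀.toH1.grad x + ∑ l, u₀.toH1.grad x l • G l x))
        ≤ ((4 * K + 1) / κ + 1) * (C * K * (√ε * u₀.norm)) ∧
      b ≤ ((4 * K + 1) * (C * K * (√ε * u₀.norm))) ^ 2 / κ := by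
  obtain ⟨C, hC0, hC⟩ := hΩ.layer_estimate
  -- Each of the two directions contributes `5 K` times a layer norm of at most `2 C √ε ‖u₀‖₂`, plus
  -- `K ε ‖u₀‖₂`, and `ε ≤ √ε` because `ε ≤ 1`.
  refine ⟨20 * C + 2, by positivity, ?_⟩
  intro κ K ε B Â G P s hm hε1 u u₀ b hb hflux
  obtain ⟨η, hη⟩ := exists_isCutoff hΩ.2.1 hΩ.1 hm.ε_pos
  have hε := hm.ε_pos
  have hK := hm.K_nonneg
  have hκ := hm.κ_pos
  have hn := u₀.norm_nonneg
  obtain ⟨h1, h2⟩ := two_scale_estimate hΩ.1 hΩ.2.1.measurableSet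
    (isOpen_layer hΩ.2.1 ε).measurableSet (fun x hx => hx.1) hε (by norm_num : (0 : ℝ) ≤ 4) hK hη
    hm.bdd hm.approx u₀.toH1.wg.grad (fun l => (u₀.deriv l).wg.grad)
    (fun l χ hχ => memH10_mul_of_wg hΩ (u₀.wg_deriv l)
      (measurable_coord u₀.toH1.measurable_grad l) (u₀.deriv l).measurable_grad hχ)
    hκ hm.ell u.wg.grad hb (fun z Z hz mz mZ => hflux.apply hΩ hm.bdd hm.bdd_hom hz mz mZ)
  have hE : expansionError Ω (layer Ω ε) K 4 ε u₀.toH1.grad (fun l => (u₀.deriv l).grad)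
      ≤ (20 * C + 2) * K * (√ε * u₀.norm) := by
    have hle : ∀ l ∈ (Finset.univ : Finset (Fin 2)),
        (K + K * 4) * l2 (volume.restrict (layer Ω ε)) (fun x => u₀.toH1.grad x l)
          + K * ε * l2 (volume.restrict Ω) (u₀.deriv l).grad
        ≤ (10 * C + 1) * K * (√ε * u₀.norm) := by
      intro l _
      have d1 : l2 (volume.restrict (layer Ω ε)) (fun x => u₀.toH1.grad x l)
          ≤ C * √ε * (2 * u₀.norm) := by
        have hle : (volume : Measure Plane).restrict (layer Ω ε) ≤ volume.restrict Ω :=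
          Measure.restrict_mono (fun x hx => hx.1) le_rfl
        rw [← l2_congr ((Measure.absolutelyContinuous_of_le hle).ae_eq (u₀.deriv_eq l))]
        refine (hC (u₀.deriv l) ε hε).trans (mul_le_mul_of_nonneg_left ?_ (by positivity))
        refine (u₀.deriv l).norm_le.trans ?_
        rw [l2_congr (u₀.deriv_eq l), ← H1.seminorm_eq]
        have := (l2_coord_le u₀.toH1.wg.grad l).trans (u₀.toH1.l2_grad_le.trans u₀.norm_toH1_le)
        linarith [u₀.seminorm_le_norm l]
      have d2 : l2 (volume.restrict Ω) (u₀.deriv l).grad ≤ u₀.norm := u₀.seminorm_le_norm l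
      have d3 : ε ≤ √ε := Real.le_sqrt_of_sq_le (by nlinarith)
      calc _ ≤ (K + K * 4) * (C * √ε * (2 * u₀.norm)) + K * √ε * u₀.norm :=
            add_le_add (mul_le_mul_of_nonneg_left d1 (by positivity))
              (mul_le_mul (mul_le_mul_of_nonneg_left d3 hK) d2 l2_nonneg (by positivity))
        _ = _ := by ring
    refine (Finset.sum_le_sum hle).trans_eq ?_
    rw [Fin.sum_univ_two]
    ring
  have hE0 : 0 ≤ expansionError Ω (layer Ω ε) K 4 ε u₀.toH1.grad (fun l => (u₀.deriv l).grad) :=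
    Finset.sum_nonneg fun l _ => add_nonneg (mul_nonneg (by positivity) l2_nonneg)
      (mul_nonneg (by positivity) l2_nonneg)
  refine ⟨h1.trans (mul_le_mul_of_nonneg_left hE (by positivity)), h2.trans ?_⟩
  gcongr

variable {𝒯 : Triangulation Ω}

/-- The first order expansion of multiscale functions. -/
theorem Triangulation.IsMs.expansion_estimate (hΩ : IsLipschitzDomain Ω)
    (hm : Medium κ K ε B Â G P s) {r : ℝ} (hr : 0 < r) (hT : ∀ T ∈ 𝒯.elems, r ≤ T.inradius)
    {c : Plane → ℝ} {v : H1 Ω} (hv : 𝒯.IsMs B c v) :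
    l2 (volume.restrict Ω) (fun x => v.grad x -
        (∇ (𝒯.interp c) x + ∑ l, ∇ (𝒯.interp c) x l • G l x))
      ≤ ((4 * K + 1) / κ + 1) *
        (10 * K * (√(2 * ε / r) * l2 (volume.restrict Ω) (∇ (𝒯.interp c)))) := by
  have hε := hm.ε_pos
  have hK := hm.K_nonneg
  have hκ := hm.κ_pos
  have hr' := restrict_mesh (𝒯 := 𝒯) hΩ
  have hI := wg_interp (𝒯 := 𝒯) hΩ c
  have hbm := isBounded_mesh (𝒯 := 𝒯) hΩ
  obtain ⟨η, hη⟩ := exists_isCutoff 𝒯.isOpen_mesh hbm hε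
  have mp : MemLp (∇ (𝒯.interp c)) 2 (volume.restrict 𝒯.mesh) := by
    rw [hr']
    exact hI.grad
  have mg : MemLp v.grad 2 (volume.restrict 𝒯.mesh) := by
    rw [hr']
    exact v.wg.grad
  have mgp := memLp_fun_sub mg mp
  have mfp : MemLp (fun x => v.fn x - 𝒯.interp c x) 2 (volume.restrict 𝒯.mesh) := by
    rw [hr']
    exact memLp_fun_sub v.wg.fn hI.fn
  -- The field `p` is piecewise constant, so its derivative `D` is zero and only the layer term
  -- survives. There is no boundary term, so `b = 0`.
  have key := two_scale_estimate hbm 𝒯.isOpen_mesh.measurableSet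
    (isOpen_layer 𝒯.isOpen_mesh ε).measurableSet (fun x hx => hx.1) hε (by norm_num : (0 : ℝ) ≤ 4)
    hK hη hm.bdd hm.approx mp (D := fun _ _ => 0) (fun l => MemLp.zero)
    (fun l χ hχ => memH10_mul_gradient_interp c l hχ) hκ hm.ell mg le_rfl ?_
  · have h1 := key.1
    rw [hr'] at h1
    refine h1.trans (mul_le_mul_of_nonneg_left ?_ (by positivity))
    have hle : ∀ l ∈ (Finset.univ : Finset (Fin 2)),
        (K + K * 4) * l2 (volume.restrict (layer 𝒯.mesh ε)) (fun x => ∇ (𝒯.interp c) x l)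
          + K * ε * l2 (volume.restrict 𝒯.mesh) (fun _ => (0 : Plane))
        ≤ 5 * K * (√(2 * ε / r) * l2 (volume.restrict Ω) (∇ (𝒯.interp c))) := by
      intro l _
      have z : l2 (volume.restrict 𝒯.mesh) (fun _ => (0 : Plane)) = 0 := by simp [l2]
      rw [z, mul_zero, add_zero, show K + K * 4 = 5 * K by ring]
      refine mul_le_mul_of_nonneg_left ((l2_layer_mesh_le hΩ c hr hε.le hT l).trans ?_)
        (by positivity)
      exact mul_le_mul_of_nonneg_left (l2_coord_le hI.grad l) (Real.sqrt_nonneg _)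
    refine (Finset.sum_le_sum hle).trans_eq ?_
    rw [Fin.sum_univ_two]
    ring
  · intro z Z hz mz mZ
    -- The test function vanishes on all edges. Both fluxes are orthogonal to its gradient: that of
    -- `v` by the multiscale equation, the homogenized one because it is constant on each triangle.
    have h10 : MemH10 𝒯.mesh (fun x => (v.fn x - 𝒯.interp c x) + -1 * z x)
        (fun x => v.grad x - (∇ (𝒯.interp c) x + Z x)) := by
      refine (hv.memH10.add hbm (hz.const_mul (-1)) mfp (mz.const_mul _) mgp
        (mZ.const_smul (-1 : ℝ))).congr (ae_eq_refl _) (ae_of_all _ fun x => ?_)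
      module
    have mW : MemLp (fun x => v.grad x - (∇ (𝒯.interp c) x + Z x)) 2 (volume.restrict 𝒯.mesh) :=
      memLp_fun_sub mg (memLp_fun_add mp mZ)
    refine ⟨⟨_, h10.wg hbm (memLp_fun_add mfp (mz.const_mul _)) mW⟩, ?_⟩
    have mBg := hm.bdd.memLp mg
    have mÂp := hm.bdd_hom.memLp mp
    simp only [inner_sub_left]
    rw [integral_sub (integrable_inner mBg mW) (integrable_inner mÂp mW),
      h10.integral_inner_eq_zero mBg hv.weak mW,
      h10.integral_inner_eq_zero mÂp (fun θ hθ => integral_mv_gradient_interp hΩ Â c hθ) mW]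
    simp

end Estimates

/-! ### Approximation by the multiscale interpolant -/

lemma Triangulation.IsRegular.le_inradius {𝒯 : Triangulation Ω} {ρ σ h : ℝ} (hρ : 0 < ρ)
    (h𝒯 : 𝒯.IsRegular ρ σ h) {T : Affine.Simplex ℝ Plane 2} (hT : T ∈ 𝒯.elems) :
    ρ * σ * h ≤ T.inradius := by
  obtain ⟨-, h2, h3⟩ := h𝒯 T hT
  rw [le_div_iff₀ T.circumradius_pos] at h3
  nlinarith

/-- The convergence rate. -/
def rate (ε h : ℝ) : ℝ := √ε + h + √(ε / h)

lemma l2_corrected_le {κ K ε : ℝ} {B : Plane → Matrix (Fin 2) (Fin 2) ℝ}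
    {Â : Matrix (Fin 2) (Fin 2) ℝ} {G : Fin 2 → Plane → Plane} {P s : ℕ → Fin 2 → Plane → ℝ}
    (hm : Medium κ K ε B Â G P s) {q : Plane → Plane} (hq : MemLp q 2 (volume.restrict Ω)) :
    l2 (volume.restrict Ω) (fun x => q x + ∑ l, q x l • G l x)
      ≤ (1 + 2 * K) * l2 (volume.restrict Ω) q := by
  have hK := hm.K_nonneg
  refine l2_le_of_ae (by positivity) hq ?_
  filter_upwards [ae_restrict_of_ae (hm.approx.norm_le 0), ae_restrict_of_ae (hm.approx.norm_le 1)]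
    with x h0 h1
  have hl : ∀ l, ‖G l x‖ ≤ K → ‖q x l • G l x‖ ≤ K * ‖q x‖ := by
    intro l hl
    rw [norm_smul, mul_comm]
    exact mul_le_mul hl (abs_coord_le _ _) (norm_nonneg _) hK
  rw [Fin.sum_univ_two]
  have := norm_add_le (q x) (q x 0 • G 0 x + q x 1 • G 1 x)
  have := norm_add_le (q x 0 • G 0 x) (q x 1 • G 1 x)
  linarith [hl 0 h0, hl 1 h1]

/-- The map `p ↦ p + ∑ p_l G_l` is linear and bounded by `1 + 2 K`, so two functions with expansions
over `p` and `q` differ by the expansion errors and a multiple of `p - q`. -/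
lemma l2_sub_le_of_expansions {κ K ε : ℝ} {B : Plane → Matrix (Fin 2) (Fin 2) ℝ}
    {Â : Matrix (Fin 2) (Fin 2) ℝ} {G : Fin 2 → Plane → Plane} {P s : ℕ → Fin 2 → Plane → ℝ}
    (hm : Medium κ K ε B Â G P s) {u v p q : Plane → Plane} (hu : MemLp u 2 (volume.restrict Ω))
    (hv : MemLp v 2 (volume.restrict Ω)) (hp : MemLp p 2 (volume.restrict Ω))
    (hq : MemLp q 2 (volume.restrict Ω)) :
    l2 (volume.restrict Ω) (fun x => u x - v x)
      ≤ l2 (volume.restrict Ω) (fun x => u x - (p x + ∑ l, p x l • G l x))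
        + l2 (volume.restrict Ω) (fun x => v x - (q x + ∑ l, q x l • G l x))
        + (1 + 2 * K) * l2 (volume.restrict Ω) (fun x => q x - p x) := by
  have mE : ∀ {p : Plane → Plane}, MemLp p 2 (volume.restrict Ω) →
      MemLp (fun x => p x + ∑ l, p x l • G l x) 2 (volume.restrict Ω) := fun hp =>
    memLp_fun_add hp (hm.approx.memLp_sum hp)
  have m1 := memLp_fun_sub hu (mE hp)
  have m2 := memLp_fun_sub hv (mE hq)
  have md := memLp_fun_sub hp hq
  have e : (fun x => u x - v x) = fun x =>
      ((u x - (p x + ∑ l, p x l • G l x)) - (v x - (q x + ∑ l, q x l • G l x)))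
      + ((p x - q x) + ∑ l, (p x - q x) l • G l x) := by
    funext x
    simp only [Fin.sum_univ_two, PiLp.sub_apply, sub_smul]
    abel
  have i3 := l2_corrected_le hm md
  have i4 := l2_add_le (memLp_fun_sub m1 m2) (mE md)
  have i5 := l2_sub_le m1 m2
  rw [l2_sub_comm (F := q), e]
  linarith

set_option maxHeartbeats 800000 in
/-- The multiscale interpolant of the homogenized solution approximates the oscillating one. -/
theorem IsLipschitzDomain.exists_ms_approximation (hΩ : IsLipschitzDomain Ω) {κ K ρ σ : ℝ}
    (hκ : 0 < κ) (hK : 0 ≤ K) (hρ : 0 < ρ) (hσ : 0 < σ) :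
    ∃ C : ℝ, 0 ≤ C ∧ ∀ (ε h : ℝ) (B : Plane → Matrix (Fin 2) (Fin 2) ℝ)
      (Â : Matrix (Fin 2) (Fin 2) ℝ) (G : Fin 2 → Plane → Plane) (P s : ℕ → Fin 2 → Plane → ℝ),
      Medium κ K ε B Â G P s → ε ≤ 1 → 0 < h → h ≤ 1 → ∀ 𝒯 : Triangulation Ω,
      𝒯.IsRegular ρ σ h → ∀ (u : H1 Ω) (u₀ : H2 Ω) (b : ℝ), 0 ≤ b →
      FluxIdentity B Â u u₀.toH1 b → ∃ (w : Plane → ℝ) (v : H1 Ω),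
        ContinuousOn w (closure Ω) ∧ u₀.toH1.trace =ᵐ[arc (frontier Ω)] w ∧ 𝒯.IsMs B w v ∧
        l2 (volume.restrict Ω) (fun x => u.grad x - v.grad x) ≤ C * rate ε h * u₀.norm ∧
        √b ≤ C * rate ε h * u₀.norm ∧
        l2 (arc (frontier Ω)) (fun x => u₀.toH1.trace x - 𝒯.interp w x)
          ≤ C * rate ε h * u₀.norm := by
  obtain ⟨C₁, hC₁, hhom⟩ := hΩ.homogenization_estimate
  obtain ⟨C₂, hC₂, htr⟩ := hΩ.trace_estimate
  set q := 1 / (ρ * σ) with hq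
  have hq0 : 0 < q := by positivity
  set a := (4 * K + 1) / κ + 1 with ha
  have ha0 : 0 ≤ a := by positivity
  -- `D₁` stems from the expansion of `u`, `D₂` from interpolation of the gradient, `D₃` from the
  -- expansion of `v`, `D₄` from the boundary term `√b`, and `D₅` from the trace of the
  -- interpolation error.
  set D₁ := a * (C₁ * K) with hD₁
  set D₂ := (1 + 2 * K) * (24 * q) with hD₂
  set D₃ := a * (10 * K * (√(2 * q) * (24 * q + 1))) with hD₃
  set D₄ := (4 * K + 1) * (C₁ * K) / √κ with hD₄
  set D₅ := C₂ * (24 + 24 * q) with hD₅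
  have p1 : 0 ≤ D₁ := by positivity
  have p2 : 0 ≤ D₂ := by positivity
  have p3 : 0 ≤ D₃ := by positivity
  have p4 : 0 ≤ D₄ := by positivity
  have p5 : 0 ≤ D₅ := by positivity
  refine ⟨D₁ + D₂ + D₃ + D₄ + D₅, by positivity, ?_⟩
  intro ε h B Â G P s hm hε1 hh hh1 𝒯 h𝒯 u u₀ b hb hflux
  have hε := hm.ε_pos
  set n := u₀.norm with hn
  have hn0 : 0 ≤ n := u₀.norm_nonneg
  set r := ρ * σ * h with hr
  have hr0 : 0 < r := by positivity
  have hT : ∀ T ∈ 𝒯.elems, T.circumradius ≤ h ∧ r ≤ T.inradius := fun T hT =>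
    ⟨(h𝒯 T hT).1, h𝒯.le_inradius hρ hT⟩
  have hqr : h ^ 2 / r = q * h := by
    rw [hr, hq]
    field_simp
  have hsq : √(2 * ε / r) = √(2 * q) * √(ε / h) := by
    rw [← Real.sqrt_mul (by positivity)]
    congr 1
    rw [hr, hq]
    field_simp
  obtain ⟨w, hw, hwtr, i1, i2⟩ := Triangulation.exists_interpolation (𝒯 := 𝒯) hΩ hr0 hT u₀
  rw [← hn, mul_div_assoc, hqr] at i2
  obtain ⟨v, hv⟩ := Triangulation.exists_isMs (𝒯 := 𝒯) hΩ hm.bdd hK hκ hm.ell w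
  have hI := Triangulation.wg_interp (𝒯 := 𝒯) hΩ w
  obtain ⟨e1, e2⟩ := hhom κ K ε B Â G P s hm hε1 u u₀ b hb hflux
  have e3 := hv.expansion_estimate hΩ hm hr0 fun T hT' => (hT T hT').2
  have hR1 : √ε ≤ rate ε h := by
    have := Real.sqrt_nonneg (ε / h)
    simp only [rate]
    linarith
  have hR2 : h ≤ rate ε h := by
    have := Real.sqrt_nonneg (ε / h)
    have := Real.sqrt_nonneg ε
    simp only [rate]
    linarith
  have hR3 : √(ε / h) ≤ rate ε h := by
    have := Real.sqrt_nonneg ε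
    simp only [rate]
    linarith
  have hR0 : 0 ≤ rate ε h := hh.le.trans hR2
  have key : ∀ D t, 0 ≤ D → t ≤ rate ε h → D * (t * n) ≤ D * (rate ε h * n) := fun D t hD ht =>
    mul_le_mul_of_nonneg_left (mul_le_mul_of_nonneg_right ht hn0) hD
  have hRn : 0 ≤ rate ε h * n := mul_nonneg hR0 hn0
  have q1 := mul_nonneg p1 hRn
  have q2 := mul_nonneg p2 hRn
  have q3 := mul_nonneg p3 hRn
  have q4 := mul_nonneg p4 hRn
  have q5 := mul_nonneg p5 hRn
  have hsplit : (D₁ + D₂ + D₃ + D₄ + D₅) * rate ε h * n = D₁ * (rate ε h * n) + D₂ * (rate ε h * n)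
      + D₃ * (rate ε h * n) + D₄ * (rate ε h * n) + D₅ * (rate ε h * n) := by ring
  refine ⟨w, v, hw, hwtr, hv, ?_, ?_, ?_⟩
  · have mp := u₀.toH1.wg.grad
    have hgrad : l2 (volume.restrict Ω) (∇ (𝒯.interp w)) ≤ (24 * q + 1) * n := by
      have e4 : (∇ (𝒯.interp w))
          = fun x => (∇ (𝒯.interp w) x - u₀.toH1.grad x) + u₀.toH1.grad x := by
        funext x
        simp
      rw [e4]
      refine (l2_add_le (memLp_fun_sub hI.grad mp) mp).trans ?_
      have := u₀.toH1.l2_grad_le.trans u₀.norm_toH1_le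
      have h2 : 24 * (q * h) * n ≤ 24 * q * n := by
        refine mul_le_mul_of_nonneg_right ?_ hn0
        nlinarith
      linarith
    have t1 : D₁ * (√ε * n) = a * (C₁ * K * (√ε * n)) := by rw [hD₁]; ring
    have t2 : (1 + 2 * K) * (24 * (q * h) * n) = D₂ * (h * n) := by rw [hD₂]; ring
    have t3 : a * (10 * K * (√(2 * ε / r) * ((24 * q + 1) * n))) = D₃ * (√(ε / h) * n) := by
      rw [hD₃, hsq]; ring
    have e3' := e3.trans (mul_le_mul_of_nonneg_left (mul_le_mul_of_nonneg_left
      (mul_le_mul_of_nonneg_left hgrad (Real.sqrt_nonneg _)) (by positivity : 0 ≤ 10 * K)) ha0)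
    have i3 := l2_sub_le_of_expansions hm u.wg.grad v.wg.grad mp hI.grad
    have i4 := mul_le_mul_of_nonneg_left i2 (by positivity : 0 ≤ 1 + 2 * K)
    have k1 := key D₁ _ p1 hR1
    have k2 := key D₂ _ p2 hR2
    have k3 := key D₃ _ p3 hR3
    linarith
  · have h1 : √b ≤ (4 * K + 1) * (C₁ * K * (√ε * n)) / √κ := by
      rw [← Real.sqrt_sq (by positivity : 0 ≤ (4 * K + 1) * (C₁ * K * (√ε * n))),
        ← Real.sqrt_div (sq_nonneg _)]
      exact Real.sqrt_le_sqrt e2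
    have t1 : (4 * K + 1) * (C₁ * K * (√ε * n)) / √κ = D₄ * (√ε * n) := by rw [hD₄]; ring
    have k1 := key D₄ _ p4 hR1
    linarith
  · set I : H1 Ω := hI.toH1 with hIdef
    have f1 : I.fn =ᵐ[volume.restrict Ω] 𝒯.interp w := hI.fn_toH1
    have f2 : I.grad =ᵐ[volume.restrict Ω] ∇ (𝒯.interp w) := hI.grad_toH1
    have h1 : l2 (arc (frontier Ω)) (fun x => u₀.toH1.trace x - 𝒯.interp w x)
        = l2 (arc (frontier Ω)) (u₀.toH1 - I).trace := by
      refine l2_congr ?_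
      filter_upwards [H1.trace_sub hΩ u₀.toH1 I, H1.trace_of_continuousOn hΩ I
        (Triangulation.measurable_interp w) (Triangulation.continuousOn_interp w) f1] with x h1 h2
      rw [h1, h2]
    have h2 : l2 (volume.restrict Ω) (u₀.toH1 - I).fn ≤ 24 * h ^ 2 * n := by
      rw [l2_congr (G := fun x => u₀.toH1.fn x - 𝒯.interp w x), l2_sub_comm]
      · exact i1
      · filter_upwards [H1.fn_sub u₀.toH1 I, f1] with x h1 h2
        rw [h1, h2]
    have h3 : l2 (volume.restrict Ω) (u₀.toH1 - I).grad ≤ 24 * (q * h) * n := by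
      rw [l2_congr (G := fun x => u₀.toH1.grad x - ∇ (𝒯.interp w) x), l2_sub_comm]
      · exact i2
      · filter_upwards [H1.grad_sub u₀.toH1 I, f2] with x h1 h2
        rw [h1, h2]
    have h4 : ‖u₀.toH1 - I‖ ≤ (24 + 24 * q) * (h * n) := by
      refine (H1.norm_le _).trans ?_
      have : h ^ 2 * n ≤ h * n := mul_le_mul_of_nonneg_right (by nlinarith) hn0
      linarith
    rw [h1]
    have h5 := (htr (u₀.toH1 - I)).trans (mul_le_mul_of_nonneg_left h4 hC₂)
    have k5 := key D₅ _ p5 hR2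
    have t5 : C₂ * ((24 + 24 * q) * (h * n)) = D₅ * (h * n) := by rw [hD₅]; ring
    linarith

lemma one_le_rate {ε h : ℝ} (hh : 0 < h) (h1 : 1 < ε ∨ 1 < h) : 1 ≤ rate ε h := by
  have h3 := Real.sqrt_nonneg (ε / h)
  have h2 := Real.sqrt_nonneg ε
  simp only [rate]
  rcases h1 with h1 | h1
  · have := Real.one_le_sqrt.2 h1.le
    linarith
  · linarith

lemma H1.trace_of_sub_memH10 (hΩ : IsLipschitzDomain Ω) {u v w : H1 Ω}
    (h : MemH10 Ω (v - (u - w)).fn (v - (u - w)).grad) :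
    v.trace =ᵐ[arc (frontier Ω)] (u - w).trace := by
  filter_upwards [H1.trace_of_memH10 hΩ _ h, H1.trace_sub hΩ v (u - w)] with x h1 h2
  rw [h1, Pi.zero_apply] at h2
  linarith

lemma H1.trace_zero (hΩ : IsLipschitzDomain Ω) : (0 : H1 Ω).trace =ᵐ[arc (frontier Ω)] 0 := by
  have h := H1.trace_sub hΩ (0 : H1 Ω) 0
  rw [sub_zero] at h
  filter_upwards [h] with x hx
  rw [hx, sub_self]
  rfl

lemma ae_arc_of_subset {Γ : Set Plane} (hΓ : Γ ⊆ frontier Ω) {p : Plane → Prop}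
    (h : ∀ᵐ x ∂arc (frontier Ω), p x) : ∀ᵐ x ∂arc Γ, p x :=
  ae_restrict_of_ae_restrict_of_subset hΓ h

lemma VanishesOn.sub (hΩ : IsLipschitzDomain Ω) {Γ : Set Plane} (hΓ : Γ ⊆ frontier Ω) {u v : H1 Ω}
    (hu : VanishesOn Γ u) (hv : VanishesOn Γ v) : VanishesOn Γ (u - v) := by
  filter_upwards [hu, hv, ae_arc_of_subset hΓ (H1.trace_sub hΩ u v)] with x h1 h2 h3
  rw [h3, h1, h2]
  simp

/-! ### Energy forms and quasi-optimality -/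

/-- The bilinear form of the Robin problem. -/
def rform (B : Plane → Matrix (Fin 2) (Fin 2) ℝ) (α : Plane → ℝ) (u v : H1 Ω) : ℝ :=
  form B Ω u.grad v.grad + ∫ x, α x * u.trace x * v.trace x ∂arc (frontier Ω)

section Rform

variable {K a : ℝ} {B : Plane → Matrix (Fin 2) (Fin 2) ℝ} {α : Plane → ℝ}

lemma memLp_coeff_trace (hΩ : IsLipschitzDomain Ω)
    (hα : AEStronglyMeasurable α (arc (frontier Ω)))
    (ha : ∀ᵐ x ∂arc (frontier Ω), |α x| ≤ a) (u : H1 Ω) :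
    MemLp (fun x => α x * u.trace x) 2 (arc (frontier Ω)) :=
  memLp_mul_of_bound hα ha (u.memLp_trace hΩ)

lemma rform_sub_left (hΩ : IsLipschitzDomain Ω) (hB : BddCoeff K B)
    (hα : AEStronglyMeasurable α (arc (frontier Ω))) (ha : ∀ᵐ x ∂arc (frontier Ω), |α x| ≤ a)
    (u u' v : H1 Ω) : rform B α (u - u') v = rform B α u v - rform B α u' v := by
  have h1 : form B Ω (u - u').grad v.grad = form B Ω u.grad v.grad - form B Ω u'.grad v.grad := by
    rw [form_congr (H1.grad_sub u u') (ae_eq_refl _),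
      hB.form_sub_left u.wg.grad u'.wg.grad v.wg.grad]
  have h2 : ∫ x, α x * (u - u').trace x * v.trace x ∂arc (frontier Ω)
      = (∫ x, α x * u.trace x * v.trace x ∂arc (frontier Ω))
        - ∫ x, α x * u'.trace x * v.trace x ∂arc (frontier Ω) := by
    rw [← integral_sub (integrable_mul' (memLp_coeff_trace hΩ hα ha u) (v.memLp_trace hΩ))
      (integrable_mul' (memLp_coeff_trace hΩ hα ha u') (v.memLp_trace hΩ))]
    refine integral_congr_ae ?_
    filter_upwards [H1.trace_sub hΩ u u'] with x hx
    rw [hx]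
    ring
  rw [rform, rform, rform, h1, h2]
  ring

lemma rform_sub_right (hΩ : IsLipschitzDomain Ω) (hB : BddCoeff K B)
    (hα : AEStronglyMeasurable α (arc (frontier Ω))) (ha : ∀ᵐ x ∂arc (frontier Ω), |α x| ≤ a)
    (u v v' : H1 Ω) : rform B α u (v - v') = rform B α u v - rform B α u v' := by
  have h1 : form B Ω u.grad (v - v').grad = form B Ω u.grad v.grad - form B Ω u.grad v'.grad := by
    rw [form_congr (ae_eq_refl _) (H1.grad_sub v v'),
      hB.form_sub_right u.wg.grad v.wg.grad v'.wg.grad]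
  have h2 : ∫ x, α x * u.trace x * (v - v').trace x ∂arc (frontier Ω)
      = (∫ x, α x * u.trace x * v.trace x ∂arc (frontier Ω))
        - ∫ x, α x * u.trace x * v'.trace x ∂arc (frontier Ω) := by
    rw [← integral_sub (integrable_mul' (memLp_coeff_trace hΩ hα ha u) (v.memLp_trace hΩ))
      (integrable_mul' (memLp_coeff_trace hΩ hα ha u) (v'.memLp_trace hΩ))]
    refine integral_congr_ae ?_
    filter_upwards [H1.trace_sub hΩ v v'] with x hx
    rw [hx]
    ring
  rw [rform, rform, rform, h1, h2]
  ring

lemma rform_le (hΩ : IsLipschitzDomain Ω) (hB : BddCoeff K B) (hK : 0 ≤ K)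
    (hα : AEStronglyMeasurable α (arc (frontier Ω))) (ha : ∀ᵐ x ∂arc (frontier Ω), |α x| ≤ a)
    (ha0 : 0 ≤ a) (u v : H1 Ω) : rform B α u v
      ≤ 4 * K * l2 (volume.restrict Ω) u.grad * l2 (volume.restrict Ω) v.grad
        + a * l2 (arc (frontier Ω)) u.trace * l2 (arc (frontier Ω)) v.trace := by
  refine add_le_add ((le_abs_self _).trans (hB.abs_form_le hK u.wg.grad v.wg.grad)) ?_
  refine (le_abs_self _).trans ((abs_integral_mul_le (memLp_coeff_trace hΩ hα ha u)
    (v.memLp_trace hΩ)).trans (mul_le_mul_of_nonneg_right ?_ l2_nonneg))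
  refine l2_le_of_ae ha0 (u.memLp_trace hΩ) ?_
  filter_upwards [ha] with x hx
  rw [norm_mul]
  exact mul_le_mul_of_nonneg_right hx (norm_nonneg _)

/-- The Galerkin error, tested with the difference to an element of the discrete space. -/
lemma rform_galerkin (hΩ : IsLipschitzDomain Ω) (hB : BddCoeff K B)
    (hα : AEStronglyMeasurable α (arc (frontier Ω))) (ha : ∀ᵐ x ∂arc (frontier Ω), |α x| ≤ a)
    {u w v : H1 Ω} (h : rform B α u (w - v) = rform B α w (w - v)) :
    rform B α (u - w) (u - w) = rform B α (u - w) (u - v) := by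
  have e : u - w = (u - v) - (w - v) := by abel
  have h1 := rform_sub_right hΩ hB hα ha (u - w) (u - v) (w - v)
  rw [← e, rform_sub_left hΩ hB hα ha u w (w - v), h, sub_self, sub_zero] at h1
  exact h1

end Rform

lemma Medium.le_form {κ K ε : ℝ} {B : Plane → Matrix (Fin 2) (Fin 2) ℝ}
    {Â : Matrix (Fin 2) (Fin 2) ℝ} {G : Fin 2 → Plane → Plane} {P s : ℕ → Fin 2 → Plane → ℝ}
    (hm : Medium κ K ε B Â G P s) {F : Plane → Plane} (hF : MemLp F 2 (volume.restrict U)) :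
    κ * l2 (volume.restrict U) F ^ 2 ≤ form B U F F := by
  rw [form_eq, l2_sq hF.1, ← integral_const_mul]
  refine integral_mono_ae ((hF.integrable_norm_pow (by norm_num)).const_mul κ)
    (integrable_inner (hm.bdd.memLp hF) hF) ?_
  filter_upwards [ae_restrict_of_ae hm.ell] with x hx using hx _

/-- Both `x` and `t` are at most multiples of `√X`, so the linear bound on `X` may be divided by
`√X`. -/
lemma le_of_energy_le {κ α X P Q x t : ℝ} (hκ : 0 < κ) (hα : 0 < α) (hP : 0 ≤ P) (hQ : 0 ≤ Q)
    (hx : κ * x ^ 2 ≤ X) (ht : α * t ^ 2 ≤ X) (h : X ≤ P * x + Q * t) :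
    √X ≤ P / √κ + Q / √α ∧ x ≤ √X / √κ ∧ t ≤ √X / √α := by
  have hκ' := Real.sqrt_pos.2 hκ
  have hα' := Real.sqrt_pos.2 hα
  have hX0 : 0 ≤ X := le_trans (by positivity) hx
  have hX := Real.sqrt_nonneg X
  have x1 : x ≤ √X / √κ := by
    rw [le_div_iff₀ hκ']
    refine Real.le_sqrt_of_sq_le ?_
    rw [mul_pow, Real.sq_sqrt hκ.le]
    linarith
  have t1 : t ≤ √X / √α := by
    rw [le_div_iff₀ hα']
    refine Real.le_sqrt_of_sq_le ?_
    rw [mul_pow, Real.sq_sqrt hα.le]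
    linarith
  refine ⟨?_, x1, t1⟩
  rcases hX.eq_or_lt with h0 | h0
  · rw [← h0]
    positivity
  · refine le_of_mul_le_mul_left ?_ h0
    rw [Real.mul_self_sqrt hX0]
    have := mul_le_mul_of_nonneg_left x1 hP
    have := mul_le_mul_of_nonneg_left t1 hQ
    have e : √X * (P / √κ + Q / √α) = P * (√X / √κ) + Q * (√X / √α) := by ring
    linarith

lemma le_div_of_mul_sq_le {κ P x : ℝ} (hκ : 0 < κ) (hx0 : 0 ≤ x) (hP : 0 ≤ P)
    (h : κ * x ^ 2 ≤ P * x) : x ≤ P / κ := by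
  rw [le_div_iff₀ hκ]
  rcases hx0.eq_or_lt with h0 | h0
  · rw [← h0]
    simpa using hP
  · refine le_of_mul_le_mul_right ?_ h0
    nlinarith

/-! ### The mixed problem -/

section Mixed

variable {κ K ε : ℝ} {B : Plane → Matrix (Fin 2) (Fin 2) ℝ} {Â : Matrix (Fin 2) (Fin 2) ℝ}
  {G : Fin 2 → Plane → Plane} {P s : ℕ → Fin 2 → Plane → ℝ} {ΓD ΓN : Set Plane} {f g : Plane → ℝ}
  {u u₀ w v : H1 Ω} {V : Submodule ℝ (H1 Ω)}

/-- A function with the trace of `u - u₀` vanishes on `ΓD`, so it is a test function for both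
problems, and their right-hand sides coincide. -/
lemma fluxIdentity_mixed (hΩ : IsLipschitzDomain Ω) (hΓ : ΓD ⊆ frontier Ω)
    (hu : SolvesMixed B ΓD ΓN f g ⊤ u) (hu₀ : SolvesMixed (fun _ => Â) ΓD ΓN f g ⊤ u₀) :
    FluxIdentity B Â u u₀ 0 := by
  intro v hv
  have hvan : VanishesOn ΓD v := by
    filter_upwards [hu.2.1.sub hΩ hΓ hu₀.2.1, ae_arc_of_subset hΓ (H1.trace_of_sub_memH10 hΩ hv)]
      with x h1 h2
    rw [h2, h1]
  rw [hu.2.2 v trivial hvan, hu₀.2.2 v trivial hvan]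
  ring

/-- Quasi-optimality of the Galerkin solution. -/
lemma mixed_quasi_optimal (hΩ : IsLipschitzDomain Ω) (hm : Medium κ K ε B Â G P s)
    (hΓ : ΓD ⊆ frontier Ω) (hu : SolvesMixed B ΓD ΓN f g ⊤ u) (hw : SolvesMixed B ΓD ΓN f g V w)
    (hv : v ∈ V) (hvan : VanishesOn ΓD v) :
    (u - w).seminorm ≤ 4 * K / κ * l2 (volume.restrict Ω) (u - v).grad := by
  have hr : ∀ x y : H1 Ω, rform B (fun _ => 0) x y = form B Ω x.grad y.grad := fun x y => by
    simp [rform]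
  have hα : AEStronglyMeasurable (fun _ : Plane => (0 : ℝ)) (arc (frontier Ω)) :=
    aestronglyMeasurable_const
  have ha : ∀ᵐ x ∂arc (frontier Ω), |(fun _ : Plane => (0 : ℝ)) x| ≤ 0 := ae_of_all _ fun x => by
    simp
  have hsub := hw.2.1.sub hΩ hΓ hvan
  have h := rform_galerkin (v := v) hΩ hm.bdd hα ha (u := u) (w := w) (by
    rw [hr, hr, hu.2.2 _ trivial hsub, hw.2.2 _ (V.sub_mem hw.1 hv) hsub])
  have h1 := rform_le hΩ hm.bdd hm.K_nonneg hα ha le_rfl (u - w) (u - v)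
  rw [← h, hr] at h1
  have h2 := hm.le_form (u - w).wg.grad
  rw [H1.seminorm_eq]
  have hK := hm.K_nonneg
  have h3 : 0 ≤ l2 (volume.restrict Ω) (u - v).grad := l2_nonneg
  refine (le_div_of_mul_sq_le hm.κ_pos l2_nonneg
    (P := 4 * K * l2 (volume.restrict Ω) (u - v).grad) (by positivity) ?_).trans_eq (by ring)
  linarith

/-- Since `u` is admissible in both problems, its energy equals the homogenized form of `u₀` and
`u`. This suffices when `ε` or `h` exceeds one, where the zero function is the competitor. -/
lemma mixed_energy_bound (hm : Medium κ K ε B Â G P s)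
    (hu : SolvesMixed B ΓD ΓN f g ⊤ u) (hu₀ : SolvesMixed (fun _ => Â) ΓD ΓN f g ⊤ u₀) :
    l2 (volume.restrict Ω) u.grad ≤ 4 * K / κ * ‖u₀‖ := by
  have h1 := hm.le_form u.wg.grad
  rw [hu.2.2 u trivial hu.2.1, ← hu₀.2.2 u trivial hu.2.1] at h1
  have h2 := (le_abs_self _).trans
    (hm.bdd_hom.abs_form_le hm.K_nonneg u₀.wg.grad u.wg.grad)
  have hK := hm.K_nonneg
  have h3 : 4 * K * l2 (volume.restrict Ω) u₀.grad * l2 (volume.restrict Ω) u.grad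
      ≤ 4 * K * ‖u₀‖ * l2 (volume.restrict Ω) u.grad :=
    mul_le_mul_of_nonneg_right (mul_le_mul_of_nonneg_left u₀.l2_grad_le (by positivity)) l2_nonneg
  refine (le_div_of_mul_sq_le hm.κ_pos l2_nonneg (P := 4 * K * ‖u₀‖) (by positivity) ?_).trans_eq
    (by ring)
  linarith

end Mixed

/-! ### The Robin problem -/

section Robin

variable {κ K ε α₁ α₂ : ℝ} {B : Plane → Matrix (Fin 2) (Fin 2) ℝ} {Â : Matrix (Fin 2) (Fin 2) ℝ}
  {G : Fin 2 → Plane → Plane} {P s : ℕ → Fin 2 → Plane → ℝ} {α f g : Plane → ℝ}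
  {u u₀ w v : H1 Ω} {V : Submodule ℝ (H1 Ω)}

lemma abs_le_of_robin (hα₁ : 0 < α₁) (hα : ∀ᵐ x ∂arc (frontier Ω), α₁ ≤ α x ∧ α x ≤ α₂) :
    ∀ᵐ x ∂arc (frontier Ω), |α x| ≤ |α₂| := by
  filter_upwards [hα] with x hx
  rw [abs_of_pos (hα₁.trans_le hx.1)]
  exact hx.2.trans (le_abs_self _)

lemma le_integral_trace (hΩ : IsLipschitzDomain Ω) (hα₁ : 0 < α₁)
    (hαm : AEMeasurable α (arc (frontier Ω)))
    (hα : ∀ᵐ x ∂arc (frontier Ω), α₁ ≤ α x ∧ α x ≤ α₂) (u : H1 Ω) :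
    α₁ * l2 (arc (frontier Ω)) u.trace ^ 2
      ≤ ∫ x, α x * u.trace x * u.trace x ∂arc (frontier Ω) := by
  have mt := u.memLp_trace hΩ
  rw [l2_sq mt.1, ← integral_const_mul]
  refine integral_mono_ae ((mt.integrable_norm_pow (by norm_num)).const_mul α₁)
    (integrable_mul' (memLp_coeff_trace hΩ hαm.aestronglyMeasurable (abs_le_of_robin hα₁ hα) u) mt)
    ?_
  filter_upwards [hα] with x hx
  simp only [Real.norm_eq_abs, sq_abs, mul_assoc, ← sq]
  exact mul_le_mul_of_nonneg_right hx.1 (sq_nonneg _)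

/-- The data cancel and the boundary terms leave `-∫ α (u - u₀) v`. As `v` has the trace of `u -
u₀`, this is minus a square, which `two_scale_estimate` can bound. -/
lemma fluxIdentity_robin (hΩ : IsLipschitzDomain Ω) (hα₁ : 0 < α₁)
    (hαm : AEMeasurable α (arc (frontier Ω)))
    (hα : ∀ᵐ x ∂arc (frontier Ω), α₁ ≤ α x ∧ α x ≤ α₂)
    (hu : SolvesRobin B α f g ⊤ u) (hu₀ : SolvesRobin (fun _ => Â) α f g ⊤ u₀) :
    FluxIdentity B Â u u₀ (∫ x, α x * (u - u₀).trace x * (u - u₀).trace x ∂arc (frontier Ω)) := by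
  intro v hv
  have h1 := hu.2 v trivial
  have h2 := hu₀.2 v trivial
  have hm := fun z : H1 Ω =>
    memLp_coeff_trace hΩ hαm.aestronglyMeasurable (abs_le_of_robin hα₁ hα) z
  have h3 : ∫ x, α x * (u - u₀).trace x * (u - u₀).trace x ∂arc (frontier Ω)
      = (∫ x, α x * u.trace x * v.trace x ∂arc (frontier Ω))
        - ∫ x, α x * u₀.trace x * v.trace x ∂arc (frontier Ω) := by
    rw [← integral_sub (integrable_mul' (hm u) (v.memLp_trace hΩ))
      (integrable_mul' (hm u₀) (v.memLp_trace hΩ))]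
    refine integral_congr_ae ?_
    filter_upwards [H1.trace_sub hΩ u u₀, H1.trace_of_sub_memH10 hΩ hv] with x h1 h2
    rw [h2, h1]
    ring
  rw [h3]
  linarith

lemma energyNorm_eq (B : Plane → Matrix (Fin 2) (Fin 2) ℝ) (α : Plane → ℝ) (u : H1 Ω) :
    energyNorm B α u = √(rform B α u u) := by
  simp only [energyNorm, rform, sq, mul_assoc]

/-- Bounds on a function whose energy is controlled linearly. -/
lemma robin_energy_le (hΩ : IsLipschitzDomain Ω) (hm : Medium κ K ε B Â G P s) (hα₁ : 0 < α₁)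
    (hαm : AEMeasurable α (arc (frontier Ω)))
    (hα : ∀ᵐ x ∂arc (frontier Ω), α₁ ≤ α x ∧ α x ≤ α₂) {p q : ℝ} (hp : 0 ≤ p) (hq : 0 ≤ q)
    (h : rform B α u u ≤ 4 * K * p * l2 (volume.restrict Ω) u.grad
      + |α₂| * q * l2 (arc (frontier Ω)) u.trace) :
    √(rform B α u u) ≤ 4 * K / √κ * p + |α₂| / √α₁ * q ∧
      l2 (volume.restrict Ω) u.grad ≤ √(rform B α u u) / √κ ∧
      l2 (arc (frontier Ω)) u.trace ≤ √(rform B α u u) / √α₁ := by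
  have h1 := hm.le_form u.wg.grad
  have h2 := le_integral_trace hΩ hα₁ hαm hα u
  have hK := hm.K_nonneg
  have hκ := hm.κ_pos
  have n1 : 0 ≤ κ * l2 (volume.restrict Ω) u.grad ^ 2 := by positivity
  have n2 : 0 ≤ α₁ * l2 (arc (frontier Ω)) u.trace ^ 2 := by positivity
  obtain ⟨r1, r2, r3⟩ := le_of_energy_le (X := rform B α u u) hκ hα₁
    (by positivity : 0 ≤ 4 * K * p) (by positivity : 0 ≤ |α₂| * q)
    (by simp only [rform]; linarith) (by simp only [rform]; linarith) h
  exact ⟨r1.trans_eq (by ring), r2, r3⟩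

/-- Quasi-optimality of the Galerkin solution of the Robin problem. -/
lemma robin_quasi_optimal (hΩ : IsLipschitzDomain Ω) (hm : Medium κ K ε B Â G P s) (hα₁ : 0 < α₁)
    (hαm : AEMeasurable α (arc (frontier Ω)))
    (hα : ∀ᵐ x ∂arc (frontier Ω), α₁ ≤ α x ∧ α x ≤ α₂)
    (hu : SolvesRobin B α f g ⊤ u) (hw : SolvesRobin B α f g V w) (hv : v ∈ V) :
    energyNorm B α (u - w) ≤ 4 * K / √κ * l2 (volume.restrict Ω) (u - v).grad
      + |α₂| / √α₁ * l2 (arc (frontier Ω)) (u - v).trace := by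
  have ha := abs_le_of_robin hα₁ hα
  have h := rform_galerkin (v := v) hΩ hm.bdd hαm.aestronglyMeasurable ha (u := u) (w := w)
    ((hu.2 _ trivial).trans (hw.2 _ (V.sub_mem hw.1 hv)).symm)
  have h1 := rform_le hΩ hm.bdd hm.K_nonneg hαm.aestronglyMeasurable ha (abs_nonneg _)
    (u - w) (u - v)
  rw [← h] at h1
  rw [energyNorm_eq]
  exact (robin_energy_le hΩ hm hα₁ hαm hα l2_nonneg l2_nonneg (h1.trans_eq (by ring))).1

end Robin

/-! ### Error estimates for both problems -/

/-- Error estimate for the mixed problem. -/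
theorem IsLipschitzDomain.mixed_estimate (hΩ : IsLipschitzDomain Ω) {κ K ρ σ : ℝ} (hκ : 0 < κ)
    (hK : 0 ≤ K) (hρ : 0 < ρ) (hσ : 0 < σ) :
    ∃ C : ℝ, ∀ (ε h : ℝ) (B : Plane → Matrix (Fin 2) (Fin 2) ℝ)
      (Â : Matrix (Fin 2) (Fin 2) ℝ) (G : Fin 2 → Plane → Plane) (P s : ℕ → Fin 2 → Plane → ℝ),
      Medium κ K ε B Â G P s → 0 < h → ∀ 𝒯 : Triangulation Ω, 𝒯.IsRegular ρ σ h →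
      ∀ ΓD ΓN : Set Plane, Disjoint ΓD ΓN → ΓD ∪ ΓN = frontier Ω → 𝒯.Resolves ΓD ΓN →
      ∀ (f g : Plane → ℝ) (u : H1 Ω) (u₀ : H2 Ω) (w : H1 Ω),
        SolvesMixed B ΓD ΓN f g ⊤ u → SolvesMixed (fun _ => Â) ΓD ΓN f g ⊤ u₀.toH1 →
        SolvesMixed B ΓD ΓN f g (𝒯.msSpace B) w →
        (u - w).seminorm ≤ C * rate ε h * u₀.norm := by
  obtain ⟨C, hC0, hC⟩ := hΩ.exists_ms_approximation hκ hK hρ hσ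
  set q := 4 * K / κ with hq
  have hq0 : 0 ≤ q := by positivity
  refine ⟨q * (C + q), ?_⟩
  intro ε h B Â G P s hm hh 𝒯 h𝒯 ΓD ΓN hd hun hres f g u u₀ w hu hu₀ hw
  have hΓ : ΓD ⊆ frontier Ω := hun ▸ Set.subset_union_left
  have hn := u₀.norm_nonneg
  -- By quasi-optimality a single admissible competitor suffices; the constant `C + q` covers both
  -- the multiscale interpolant and the zero function.
  suffices hex : ∃ v ∈ 𝒯.msSpace B, VanishesOn ΓD v ∧
      l2 (volume.restrict Ω) (u - v).grad ≤ (C + q) * rate ε h * u₀.norm by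
    obtain ⟨v, hv, hvan, hle⟩ := hex
    refine (mixed_quasi_optimal hΩ hm hΓ hu hw hv hvan).trans
      ((mul_le_mul_of_nonneg_left hle hq0).trans_eq (by ring))
  have hR0 : 0 ≤ rate ε h := by
    simp only [rate]
    positivity
  by_cases hcase : ε ≤ 1 ∧ h ≤ 1
  · obtain ⟨c, v, hc, hctr, hv, hle, -, -⟩ := hC ε h B Â G P s hm hcase.1 hh hcase.2 𝒯 h𝒯 u u₀ 0
      le_rfl (fluxIdentity_mixed hΩ hΓ hu hu₀)
    have h0 : c =ᵐ[arc ΓD] 0 := by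
      filter_upwards [hu₀.2.1, ae_arc_of_subset hΓ hctr] with x h1 h2
      rw [← h2, h1]
    refine ⟨v, hv.mem, ?_, ?_⟩
    · filter_upwards [Triangulation.interp_vanishesOn (𝒯 := 𝒯) hΩ hd hun hres hc h0,
        ae_arc_of_subset hΓ (hv.trace_eq hΩ)] with x h1 h2
      rw [h2, h1]
    · rw [l2_congr (H1.grad_sub u v)]
      refine hle.trans ?_
      gcongr
      linarith
  -- Here `ε > 1` or `h > 1`, the rate is at least one, and the energy bound on `u` is already of
  -- the required size.
  · refine ⟨0, Submodule.zero_mem _, ae_arc_of_subset hΓ (H1.trace_zero hΩ), ?_⟩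
    have hR : 1 ≤ rate ε h := one_le_rate hh (by
      by_contra hcon
      push Not at hcon
      exact hcase hcon)
    rw [sub_zero]
    refine (mixed_energy_bound hm hu hu₀).trans ?_
    calc q * ‖u₀.toH1‖ ≤ (C + q) * 1 * u₀.norm := by
          rw [mul_one]
          exact mul_le_mul (by linarith) u₀.norm_toH1_le (norm_nonneg _) (by positivity)
      _ ≤ (C + q) * rate ε h * u₀.norm := by gcongr

set_option maxHeartbeats 1000000 in
/-- Error estimate for the Robin problem. -/
theorem IsLipschitzDomain.robin_estimate (hΩ : IsLipschitzDomain Ω) {κ K ρ σ α₁ : ℝ} (hκ : 0 < κ)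
    (hK : 0 ≤ K) (hρ : 0 < ρ) (hσ : 0 < σ) (hα₁ : 0 < α₁) (α₂ : ℝ) :
    ∃ C : ℝ, ∀ (ε h : ℝ) (B : Plane → Matrix (Fin 2) (Fin 2) ℝ)
      (Â : Matrix (Fin 2) (Fin 2) ℝ) (G : Fin 2 → Plane → Plane) (P s : ℕ → Fin 2 → Plane → ℝ),
      Medium κ K ε B Â G P s → 0 < h → ∀ 𝒯 : Triangulation Ω, 𝒯.IsRegular ρ σ h →
      ∀ α : Plane → ℝ, AEMeasurable α (arc (frontier Ω)) →
        (∀ᵐ x ∂arc (frontier Ω), α₁ ≤ α x ∧ α x ≤ α₂) →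
      ∀ (f g : Plane → ℝ) (u : H1 Ω) (u₀ : H2 Ω) (w : H1 Ω),
        SolvesRobin B α f g ⊤ u → SolvesRobin (fun _ => Â) α f g ⊤ u₀.toH1 →
        SolvesRobin B α f g (𝒯.msSpace B) w →
        energyNorm B α (u - w) ≤ C * rate ε h * u₀.norm := by
  obtain ⟨C, hC0, hC⟩ := hΩ.exists_ms_approximation hκ hK hρ hσ
  obtain ⟨C₂, hC₂, htr⟩ := hΩ.trace_estimate
  set q := 4 * K / √κ with hq
  set t := |α₂| / √α₁ with ht
  -- `Y` bounds the energy of `u` by the norm of `u₀`, for use with the zero competitor. `E₁` and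
  -- `E₂` add this to the constants of the multiscale competitor, for gradient and trace
  -- respectively.
  set Y := q + t * C₂ with hY
  have hq0 : 0 ≤ q := by positivity
  have ht0 : 0 ≤ t := by positivity
  have hY0 : 0 ≤ Y := by positivity
  set E₁ := C + Y / √κ with hE₁
  set E₂ := C / √α₁ + C + Y / √α₁ with hE₂
  have hE₁0 : 0 ≤ E₁ := by positivity
  have hE₂0 : 0 ≤ E₂ := by positivity
  refine ⟨q * E₁ + t * E₂, ?_⟩
  intro ε h B Â G P s hm hh 𝒯 h𝒯 α hαm hα f g u u₀ w hu hu₀ hw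
  have hn := u₀.norm_nonneg
  have hR0 : 0 ≤ rate ε h := by
    simp only [rate]
    positivity
  suffices hex : ∃ v ∈ 𝒯.msSpace B,
      l2 (volume.restrict Ω) (u - v).grad ≤ E₁ * rate ε h * u₀.norm ∧
      l2 (arc (frontier Ω)) (u - v).trace ≤ E₂ * rate ε h * u₀.norm by
    obtain ⟨v, hv, h1, h2⟩ := hex
    refine (robin_quasi_optimal hΩ hm hα₁ hαm hα hu hw hv).trans ((add_le_add
      (mul_le_mul_of_nonneg_left h1 hq0) (mul_le_mul_of_nonneg_left h2 ht0)).trans_eq (by ring))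
  by_cases hcase : ε ≤ 1 ∧ h ≤ 1
  · set b := ∫ x, α x * (u - u₀.toH1).trace x * (u - u₀.toH1).trace x ∂arc (frontier Ω) with hb
    have hbt := le_integral_trace hΩ hα₁ hαm hα (u - u₀.toH1)
    rw [← hb] at hbt
    have hb0 : 0 ≤ b := le_trans (by positivity) hbt
    obtain ⟨c, v, hc, hctr, hv, hle, hsb, hI⟩ := hC ε h B Â G P s hm hcase.1 hh hcase.2 𝒯 h𝒯 u u₀ b
      hb0 (fluxIdentity_robin hΩ hα₁ hαm hα hu hu₀)
    refine ⟨v, hv.mem, ?_, ?_⟩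
    · rw [l2_congr (H1.grad_sub u v)]
      refine hle.trans ?_
      have : 0 ≤ Y / √κ := by positivity
      gcongr
      linarith
    · have e : (u - v).trace =ᵐ[arc (frontier Ω)]
          fun x => (u - u₀.toH1).trace x + (u₀.toH1.trace x - 𝒯.interp c x) := by
        filter_upwards [H1.trace_sub hΩ u v, H1.trace_sub hΩ u u₀.toH1, hv.trace_eq hΩ]
          with x h1 h2 h3
        rw [h1, h2, h3]
        ring
      have mI : MemLp (fun x => u₀.toH1.trace x - 𝒯.interp c x) 2 (arc (frontier Ω)) := by
        refine MemLp.ae_eq ?_ ((u₀.toH1 - v).memLp_trace hΩ)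
        filter_upwards [H1.trace_sub hΩ u₀.toH1 v, hv.trace_eq hΩ] with x h1 h2
        rw [h1, h2]
      rw [l2_congr e]
      refine (l2_add_le ((u - u₀.toH1).memLp_trace hΩ) mI).trans ?_
      -- The trace of `u - u₀` is controlled by the boundary term `b`, thanks to `α ≥ α₁`.
      have h1 : l2 (arc (frontier Ω)) (u - u₀.toH1).trace ≤ √b / √α₁ := by
        rw [le_div_iff₀ (Real.sqrt_pos.2 hα₁)]
        refine Real.le_sqrt_of_sq_le ?_
        rw [mul_pow, Real.sq_sqrt hα₁.le]
        linarith
      have h2 : √b / √α₁ ≤ C * rate ε h * u₀.norm / √α₁ := by gcongr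
      have h3 : 0 ≤ Y / √α₁ * (rate ε h * u₀.norm) := by positivity
      calc _ ≤ C * rate ε h * u₀.norm / √α₁ + C * rate ε h * u₀.norm
            + Y / √α₁ * (rate ε h * u₀.norm) := by linarith
        _ = _ := by rw [hE₂]; ring
  · have hR : 1 ≤ rate ε h := one_le_rate hh (by
      by_contra hcon
      push Not at hcon
      exact hcase hcon)
    have h1 : rform B α u u = rform (fun _ => Â) α u₀.toH1 u :=
      (hu.2 u trivial).trans (hu₀.2 u trivial).symm
    have h2 := rform_le hΩ hm.bdd_hom hK hαm.aestronglyMeasurable (abs_le_of_robin hα₁ hα)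
      (abs_nonneg α₂) u₀.toH1 u
    rw [← h1] at h2
    obtain ⟨r1, r2, r3⟩ := robin_energy_le hΩ hm hα₁ hαm hα l2_nonneg l2_nonneg h2
    have h3 : √(rform B α u u) ≤ Y * u₀.norm := by
      refine r1.trans ?_
      have a1 := mul_le_mul_of_nonneg_left (u₀.toH1.l2_grad_le.trans u₀.norm_toH1_le) hq0
      have a2 := mul_le_mul_of_nonneg_left ((htr u₀.toH1).trans
        (mul_le_mul_of_nonneg_left u₀.norm_toH1_le hC₂)) ht0
      calc _ ≤ q * u₀.norm + t * (C₂ * u₀.norm) := add_le_add a1 a2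
        _ = _ := by rw [hY]; ring
    have up : ∀ D E : ℝ, 0 ≤ E → D ≤ E → D * u₀.norm ≤ E * rate ε h * u₀.norm := by
      intro D E hE hDE
      refine mul_le_mul_of_nonneg_right (hDE.trans ?_) hn
      exact le_mul_of_one_le_right hE hR
    refine ⟨0, Submodule.zero_mem _, ?_, ?_⟩ <;> rw [sub_zero]
    · refine r2.trans (le_trans ?_ (up (Y / √κ) E₁ hE₁0 (by linarith)))
      rw [div_mul_eq_mul_div]
      gcongr
    · have : 0 ≤ C / √α₁ := by positivity
      refine r3.trans (le_trans ?_ (up (Y / √α₁) E₂ hE₂0 (by linarith)))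
      rw [div_mul_eq_mul_div]
      gcongr

end

end MsFEM

open MsFEM in
theorem mainTheorem1 (Ω : Set Plane) (hΩ : IsLipschitzDomain Ω)
    (κ₁ κ₂ ρ σ : ℝ) (M : ℝ≥0) (hκ₁ : 0 < κ₁) (hρ : 0 < ρ) (hσ : 0 < σ) :
    -- mixed Dirichlet–Neumann problem
    (∃ C : ℝ, ∀ (A : Plane → Matrix (Fin 2) (Fin 2) ℝ) (N : Fin 2 → H1 cell),
      IsCoeff κ₁ κ₂ A → (∀ l, IsCorrector A l (N l)) → (∀ l, w1infNorm (N l) ≤ M) →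
      ∀ (ε h : ℝ), 0 < ε → 0 < h →
      ∀ 𝒯 : Triangulation Ω, 𝒯.IsRegular ρ σ h →
      ∀ ΓD ΓN : Set Plane, Disjoint ΓD ΓN → ΓD ∪ ΓN = frontier Ω → 𝒯.Resolves ΓD ΓN →
      ∀ f g : Plane → ℝ, MemLp f 2 (volume.restrict Ω) → MemLp g 2 (arc ΓN) →
      ∀ (uε : H1 Ω) (u₀ : H2 Ω) (ums : H1 Ω),
        SolvesMixed (scaled A ε) ΓD ΓN f g ⊤ uε →
        SolvesMixed (fun _ => homogenized A N) ΓD ΓN f g ⊤ u₀.toH1 →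
        SolvesMixed (scaled A ε) ΓD ΓN f g (𝒯.msSpace (scaled A ε)) ums →
        (uε - ums).seminorm ≤ C * (√ε + h + √(ε / h)) * u₀.norm) ∧
    -- Robin problem
    (∀ α₁ α₂ : ℝ, 0 < α₁ →
      ∃ C : ℝ, ∀ (A : Plane → Matrix (Fin 2) (Fin 2) ℝ) (N : Fin 2 → H1 cell),
      IsCoeff κ₁ κ₂ A → (∀ l, IsCorrector A l (N l)) → (∀ l, w1infNorm (N l) ≤ M) →
      ∀ (ε h : ℝ), 0 < ε → 0 < h →
      ∀ 𝒯 : Triangulation Ω, 𝒯.IsRegular ρ σ h →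
      ∀ α : Plane → ℝ, AEMeasurable α (arc (frontier Ω)) →
        (∀ᵐ x ∂arc (frontier Ω), α₁ ≤ α x ∧ α x ≤ α₂) →
      ∀ f g : Plane → ℝ, MemLp f 2 (volume.restrict Ω) → MemLp g 2 (arc (frontier Ω)) →
      ∀ (uε : H1 Ω) (u₀ : H2 Ω) (ums : H1 Ω),
        SolvesRobin (scaled A ε) α f g ⊤ uε →
        SolvesRobin (fun _ => homogenized A N) α f g ⊤ u₀.toH1 →
        SolvesRobin (scaled A ε) α f g (𝒯.msSpace (scaled A ε)) ums →
        energyNorm (scaled A ε) α (uε - ums) ≤ C * (√ε + h + √(ε / h)) * u₀.norm) := by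
  -- The constant of the medium depends only on `κ₂` and `M`, so `C` can be fixed before the
  -- coefficient, the scales and the mesh.
  have hK : (0 : ℝ) ≤ 2 * M + 8 * (|κ₂| * (M + 1)) := by positivity
  refine ⟨?_, fun α₁ α₂ hα₁ => ?_⟩
  · obtain ⟨C, hC⟩ := hΩ.mixed_estimate hκ₁ hK hρ hσ
    refine ⟨C, fun A N hA hN hM ε h hε hh 𝒯 h𝒯 ΓD ΓN hd hun hres f g _ _ uε u₀ ums hu hu₀ hw => ?_⟩
    obtain ⟨G, P, s, hm⟩ := exists_medium hA hκ₁ hN hM hε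
    exact hC ε h _ _ G P s hm hh 𝒯 h𝒯 ΓD ΓN hd hun hres f g uε u₀ ums hu hu₀ hw
  · obtain ⟨C, hC⟩ := hΩ.robin_estimate hκ₁ hK hρ hσ hα₁ α₂
    refine ⟨C, fun A N hA hN hM ε h hε hh 𝒯 h𝒯 α hαm hα f g _ _ uε u₀ ums hu hu₀ hw => ?_⟩
    obtain ⟨G, P, s, hm⟩ := exists_medium hA hκ₁ hN hM hε
    exact hC ε h _ _ G P s hm hh 𝒯 h𝒯 α hαm hα f g uε u₀ ums hu hu₀ hw
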